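/- **Setting.** Let $p,q,r\ge 1$ be pairwise relatively prime integers with $p,q$ odd, let $a,c$ be integers with $a\,r(p+q)+c\,pq=1$, and let $\Sigma=\Sigma(p,q,r)=\{(x,y,z)\in\mathbb C^3 : x^p+y^q+z^r=0\}\cap S^5$ be the Brieskorn homology sphere. Fix the standard presentation $$\pi_1(\Sigma)=\langle x,y,z,h \mid x^p=y^q=h^a,\ z^r=h^c,\ xyz=1,\ h \text{ is central}\rangle .$$ Let $R(\Sigma,SU(3))=\operatorname{Hom}(\pi_1(\Sigma),SU(3))/\text{conjugation}$, with the quotient of the topology of pointwise convergence. For $\alpha\colon\pi_1(\Sigma)\to SU(3)$ let $H^1(\Sigma;su(3)_\alpha)=H^1(\pi_1(\Sigma);su(3)_\alpha)$ be the cohomology with coefficients in $su(3)$ twisted by the adjoint action. A representation is reducible if $\mathbb C^3$ has a proper nonzero invariant subspace. Every reducible representation $\beta$ is conjugate to one with image in $SU(2)\times\{1\}$; $H^1(\Sigma;\mathbb C^2_\beta)$ denotes the cohomology of $\pi_1(\Sigma)$ with coefficients in $\mathbb C^2$, acted on through the defining representation of $SU(2)$. All cohomology groups are regarded as real vector spaces.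 A class $[\alpha]$ is a smooth point if it has a neighbourhood in $R(\Sigma,SU(3))$ homeomorphic to $H^1(\Sigma;su(3)_\alpha)$, and a singular point otherwise. A smooth 2-sphere is a component homeomorphic to $S^2$ all of whose points are smooth points. **Theorem.** Every path component of $R(\Sigma,SU(3))$ is of exactly one of the following four types. Along each path component the conjugacy classes of the images of $x,y,z$ and $h$ are constant (and in types Ia, IIa and IIb the image of $h$ is central, hence itself constant). 1. **Type Ia:** one isolated conjugacy class $[\alpha]$ of irreducible representations, with exactly one of $\alpha(x),\alpha(y),\alpha(z)$ having a repeated eigenvalue, $\alpha(h)$ central, and $H^1(\Sigma;su(3)_\alpha)=0$. 2. **Type IIa:** a smooth 2-sphere of conjugacy classes of irreducible representations $\alpha$ such that $\alpha(x),\alpha(y),\alpha(z)$ each have three distinct eigenvalues; every such $\alpha$ sends $h$ to a central element and has $H^1(\Sigma;su(3)_\alpha)\cong\mathbb R^2$. 3. **Type Ib:** one isolated conjugacy class $[\beta]$ of reducible representations. The only isolated conjugacy class of reducible representations with $\beta(h)=I$ is the (isolated) class of the trivial representation. If $[\beta]$ is isolated, reducible and nontrivial, then $\operatorname{tr}\beta(h)=-1$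 (i.e. $\beta(h)=-I$ as an element of $SU(2)$) and $H^1(\Sigma;\mathbb C^2_\beta)=0$. 4. **Type IIb:** a topological 2-sphere containing exactly one conjugacy class $[\beta]$ of reducible representations. One has $H^1(\Sigma;su(3)_\beta)=H^1(\Sigma;\mathbb C^2_\beta)\cong\mathbb R^4$, where the equality is induced by the inclusion of the summand $\mathbb C^2$ in $su(3)=su(2)\oplus\mathbb C^2\oplus\mathbb R$. Every other class $[\alpha]$ in the component is a smooth point with $\alpha$ irreducible and $H^1(\Sigma;su(3)_\alpha)\cong\mathbb R^2$, and $[\beta]$ is the only singular point. Every representation in the component sends $h$ to $I$ and sends $x,y,z$ to elements with three distinct eigenvalues. -/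

import Mathlib

noncomputable section

open CategoryTheory

/-! ### The special unitary groups and the modules `su(3)` and `ℂ²` -/

/-- The special unitary group `SU(n)`, with the topology induced from complex matrices. -/
abbrev SU (n : ℕ) := ↥(Matrix.specialUnitaryGroup (Fin n) ℂ)

lemma SU_coe_inv {n : ℕ} (g : SU n) :
    ((g⁻¹ : SU n) : Matrix (Fin n) (Fin n) ℂ) = (g : Matrix (Fin n) (Fin n) ℂ).conjTranspose := rfl

lemma SU_conjTranspose_mul {n : ℕ} (g : SU n) :
    (g : Matrix (Fin n) (Fin n) ℂ).conjTranspose * (g : Matrix (Fin n) (Fin n) ℂ) = 1 := by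
  rw [← SU_coe_inv, ← Submonoid.coe_mul, inv_mul_cancel, Submonoid.coe_one]

lemma SU_mul_conjTranspose {n : ℕ} (g : SU n) :
    (g : Matrix (Fin n) (Fin n) ℂ) * (g : Matrix (Fin n) (Fin n) ℂ).conjTranspose = 1 := by
  rw [← SU_coe_inv, ← Submonoid.coe_mul, mul_inv_cancel, Submonoid.coe_one]

/-- The Lie algebra `su(3)`: skew-Hermitian `3 × 3` matrices of trace zero, as a real vector
space. -/
def su3 : Submodule ℝ (Matrix (Fin 3) (Fin 3) ℂ) where
  carrier := {X | X.conjTranspose = -X ∧ X.trace = 0}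
  zero_mem' := by simp
  add_mem' := by
    rintro X Y ⟨hX, hX'⟩ ⟨hY, hY'⟩
    refine ⟨?_, ?_⟩
    · rw [Matrix.conjTranspose_add, hX, hY]; abel
    · rw [Matrix.trace_add, hX', hY', add_zero]
  smul_mem' := by
    rintro t X ⟨hX, hX'⟩
    refine ⟨?_, ?_⟩
    · rw [Matrix.conjTranspose_smul, hX]; simp
    · rw [Matrix.trace_smul, hX', smul_zero]

lemma conj_mem_su3 (g : SU 3) {X : Matrix (Fin 3) (Fin 3) ℂ} (hX : X ∈ su3) :
    (g : Matrix (Fin 3) (Fin 3) ℂ) * X * (g : Matrix (Fin 3) (Fin 3) ℂ).conjTranspose ∈ su3 := by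
  obtain ⟨h1, h2⟩ := hX
  refine ⟨?_, ?_⟩
  · simp only [Matrix.conjTranspose_mul, Matrix.conjTranspose_conjTranspose, h1]
    simp [Matrix.mul_assoc]
  · rw [Matrix.trace_mul_comm, ← Matrix.mul_assoc, SU_conjTranspose_mul, Matrix.one_mul, h2]

/-- The adjoint representation of `SU(3)` on `su(3)`, `g • X = g X g⁻¹`. -/
def Ad3 : Representation ℝ (SU 3) su3 where
  toFun g :=
    { toFun := fun X => ⟨_, conj_mem_su3 g X.2⟩
      map_add' := fun X Y => by
        ext1; simp [Matrix.mul_add, Matrix.add_mul]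
      map_smul' := fun t X => by
        ext1; simp }
  map_one' := by
    ext1 X; ext1; simp
  map_mul' g h := by
    ext1 X; ext1; simp [Matrix.conjTranspose_mul, Matrix.mul_assoc]

/-- The defining complex representation of `SU(n)` on `ℂⁿ`. -/
def stdRep (n : ℕ) : Representation ℂ (SU n) (Fin n → ℂ) where
  toFun g := Matrix.toLin' (g : Matrix (Fin n) (Fin n) ℂ)
  map_one' := by simp; rfl
  map_mul' g h := by simp [Matrix.toLin'_mul]; rfl

/-- The defining representation of `SU(n)` on `ℂⁿ`, regarded as a real vector space. -/
def stdRepReal (n : ℕ) : Representation ℝ (SU n) (Fin n → ℂ) where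
  toFun g := (stdRep n g).restrictScalars ℝ
  map_one' := by rw [map_one]; rfl
  map_mul' g h := by rw [map_mul]; rfl

/-- The matrix with diagonal blocks `A` (of size `2`) and `1`. -/
def blockOne (A : Matrix (Fin 2) (Fin 2) ℂ) : Matrix (Fin 3) (Fin 3) ℂ :=
  !![A 0 0, A 0 1, 0; A 1 0, A 1 1, 0; 0, 0, 1]

lemma blockOne_mul (A B : Matrix (Fin 2) (Fin 2) ℂ) :
    blockOne (A * B) = blockOne A * blockOne B := by
  ext i j
  fin_cases i <;> fin_cases j <;>
    simp [blockOne, Matrix.mul_apply, Fin.sum_univ_succ]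

lemma blockOne_one : blockOne 1 = 1 := by
  ext i j
  fin_cases i <;> fin_cases j <;> simp [blockOne]

lemma blockOne_conjTranspose (A : Matrix (Fin 2) (Fin 2) ℂ) :
    blockOne A.conjTranspose = (blockOne A).conjTranspose := by
  ext i j
  fin_cases i <;> fin_cases j <;> simp [blockOne]

lemma blockOne_mem (A : SU 2) :
    blockOne (A : Matrix (Fin 2) (Fin 2) ℂ) ∈ Matrix.specialUnitaryGroup (Fin 3) ℂ := by
  rw [Matrix.mem_specialUnitaryGroup_iff, Matrix.mem_unitaryGroup_iff]
  refine ⟨?_, ?_⟩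
  · rw [Matrix.star_eq_conjTranspose, ← blockOne_conjTranspose, ← blockOne_mul,
      SU_mul_conjTranspose, blockOne_one]
  · have h := (Matrix.mem_specialUnitaryGroup_iff.1 A.2).2
    rw [Matrix.det_fin_two] at h
    rw [← h, Matrix.det_fin_three]
    simp [blockOne]

/-- The inclusion `SU(2) ≅ SU(2) × {1} ⊂ SU(3)`. -/
def inclSU2 : SU 2 →* SU 3 where
  toFun A := ⟨blockOne A, blockOne_mem A⟩
  map_one' := Subtype.ext blockOne_one
  map_mul' A B := Subtype.ext (blockOne_mul A B)

/-- The skew-Hermitian matrix with off-diagonal column `v` and off-diagonal row `-v*`. -/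
def offDiag (v : Fin 2 → ℂ) : Matrix (Fin 3) (Fin 3) ℂ :=
  !![0, 0, v 0; 0, 0, v 1; -star (v 0), -star (v 1), 0]

lemma offDiag_mem (v : Fin 2 → ℂ) : offDiag v ∈ su3 := by
  refine ⟨?_, ?_⟩
  · ext i j
    fin_cases i <;> fin_cases j <;> simp [offDiag]
  · simp [offDiag, Matrix.trace, Fin.sum_univ_succ]

lemma offDiag_add (v w : Fin 2 → ℂ) : offDiag (v + w) = offDiag v + offDiag w := by
  ext i j
  fin_cases i <;> fin_cases j <;> simp [offDiag, add_comm]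

lemma offDiag_smul (t : ℝ) (v : Fin 2 → ℂ) : offDiag (t • v) = t • offDiag v := by
  ext i j
  fin_cases i <;> fin_cases j <;> simp [offDiag]

lemma offDiag_equivariant (A : Matrix (Fin 2) (Fin 2) ℂ) (v : Fin 2 → ℂ) :
    offDiag (A.mulVec v) = blockOne A * offDiag v * (blockOne A).conjTranspose := by
  rw [← blockOne_conjTranspose]
  ext i j
  fin_cases i <;> fin_cases j <;>
    simp [offDiag, blockOne, Matrix.mul_apply, Fin.sum_univ_succ, Matrix.mulVec,
      dotProduct] <;> ring

/-- The inclusion of the summand `ℂ²` of `su(3) = su(2) ⊕ ℂ² ⊕ ℝ`. -/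
def inclC2 : (Fin 2 → ℂ) →ₗ[ℝ] su3 where
  toFun v := ⟨offDiag v, offDiag_mem v⟩
  map_add' v w := Subtype.ext (offDiag_add v w)
  map_smul' t v := Subtype.ext (offDiag_smul t v)

lemma inclC2_equivariant (A : SU 2) (v : Fin 2 → ℂ) :
    inclC2 (stdRepReal 2 A v) = Ad3 (inclSU2 A) (inclC2 v) :=
  Subtype.ext (offDiag_equivariant (A : Matrix (Fin 2) (Fin 2) ℂ) v)

/-! ### Representation varieties -/

section RepresentationVariety

variable (π : Type) [Group π]

/-- `Hom(π, SU(3))` carries the topology of pointwise convergence. -/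
instance homSU3Topology : TopologicalSpace (π →* SU 3) :=
  TopologicalSpace.induced (fun (α : π →* SU 3) (γ : π) => α γ) inferInstance

/-- Conjugacy of representations. -/
def repSetoid : Setoid (π →* SU 3) where
  r α β := ∃ g : SU 3, ∀ γ, β γ = g * α γ * g⁻¹
  iseqv :=
    { refl := fun α => ⟨1, by simp⟩
      symm := by
        rintro α β ⟨g, hg⟩
        exact ⟨g⁻¹, fun γ => by rw [hg]; group⟩
      trans := by
        rintro α β δ ⟨g, hg⟩ ⟨k, hk⟩
        exact ⟨k * g, fun γ => by rw [hk, hg]; group⟩ }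

/-- The representation variety `R(π, SU(3)) = Hom(π, SU(3)) / conjugation`. -/
def RepVariety : Type := Quotient (repSetoid π)

/-- The representation variety carries the quotient topology. -/
instance repVarietyTopology : TopologicalSpace (RepVariety π) :=
  inferInstanceAs (TopologicalSpace (Quotient (repSetoid π)))

variable {π}

/-- The conjugacy class `[α]`. -/
def repClass (α : π →* SU 3) : RepVariety π := Quotient.mk (repSetoid π) α

/-- `α` is irreducible: `ℂ³` has no proper nonzero subspace invariant under its image. -/
def IsIrred (α : π →* SU 3) : Prop := Representation.IsIrreducible ((stdRep 3).comp α)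

/-- `su(3)_α`: the `π`-module `su(3)`, with `π` acting by the adjoint action through `α`. -/
abbrev su3Module (α : π →* SU 3) : Rep ℝ π := Rep.of (Ad3.comp α)

/-- `ℂ²_ρ`: the `π`-module `ℂ²`, with `π` acting by the defining representation through
`ρ : π → SU(2)`. -/
abbrev C2Module (ρ : π →* SU 2) : Rep ℝ π := Rep.of ((stdRepReal 2).comp ρ)

/-- `H¹(π; su(3)_α)`, a real vector space. -/
abbrev H1su3 (α : π →* SU 3) : ModuleCat ℝ := groupCohomology.H1 (su3Module α)

/-- `H¹(π; ℂ²_ρ)`, a real vector space. -/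
abbrev H1C2 (ρ : π →* SU 2) : ModuleCat ℝ := groupCohomology.H1 (C2Module ρ)

/-- The inclusion of coefficients `ℂ²_ρ → su(3)_{ρ ⊕ 1}`. -/
def inclC2Module (ρ : π →* SU 2) : C2Module ρ ⟶ su3Module (inclSU2.comp ρ) :=
  Rep.ofHom (LinearMap.intertwiningMap_of_isIntertwiningMap
    ((stdRepReal 2).comp ρ) (Ad3.comp (inclSU2.comp ρ)) inclC2
    (fun g v => inclC2_equivariant (ρ g) v))

/-- The map `H¹(π; ℂ²_ρ) → H¹(π; su(3)_{ρ ⊕ 1})` induced by the inclusion of coefficients. -/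
def inclH1 (ρ : π →* SU 2) : H1C2 ρ ⟶ H1su3 (inclSU2.comp ρ) :=
  groupCohomology.map (MonoidHom.id π) (inclC2Module ρ) 1

/-- `[α]` is a smooth point: some neighbourhood of `[α]` in the representation variety is
homeomorphic to the vector space `H¹(π; su(3)_α)` (which is finite dimensional). -/
def IsSmoothPoint (α : π →* SU 3) : Prop :=
  ∃ n : ℕ, Nonempty (H1su3 α ≃ₗ[ℝ] (Fin n → ℝ)) ∧
    ∃ U : Set (RepVariety π), IsOpen U ∧ repClass α ∈ U ∧ Nonempty (U ≃ₜ (Fin n → ℝ))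

end RepresentationVariety

/-- `A` has a repeated eigenvalue. -/
def HasRepeatedEigenvalue (A : SU 3) : Prop :=
  ∃ μ : ℂ, 2 ≤ (A : Matrix (Fin 3) (Fin 3) ℂ).charpoly.roots.count μ

/-- `A` has three distinct eigenvalues. -/
def HasThreeDistinctEigenvalues (A : SU 3) : Prop :=
  {μ : ℂ | Module.End.HasEigenvalue
    (Matrix.toLin' (A : Matrix (Fin 3) (Fin 3) ℂ)) μ}.ncard = 3

/-- A space homeomorphic to the unit sphere in `ℝ³`. -/
def IsTwoSphere (X : Type) [TopologicalSpace X] : Prop :=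
  Nonempty (X ≃ₜ Metric.sphere (0 : EuclideanSpace ℝ (Fin 3)) 1)

/-! ### The four types of components -/

section Types

variable {π : Type} [Group π] (x y z h : π)

/-- Type Ia: one isolated class of irreducible representations. -/
def IsTypeIa (C : Set (RepVariety π)) : Prop :=
  ∃ α : π →* SU 3, C = {repClass α} ∧ IsOpen C ∧
    IsIrred α ∧
    (∃! i : Fin 3, HasRepeatedEigenvalue (α (![x, y, z] i))) ∧
    α h ∈ Subgroup.center (SU 3) ∧
    Subsingleton (H1su3 α)

/-- Type IIa: a smooth 2-sphere of classes of irreducible representations. -/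
def IsTypeIIa (C : Set (RepVariety π)) : Prop :=
  IsTwoSphere C ∧
  (∀ α : π →* SU 3, repClass α ∈ C →
    IsSmoothPoint α ∧
    IsIrred α ∧
    HasThreeDistinctEigenvalues (α x) ∧
    HasThreeDistinctEigenvalues (α y) ∧
    HasThreeDistinctEigenvalues (α z) ∧
    Nonempty (H1su3 α ≃ₗ[ℝ] (Fin 2 → ℝ))) ∧
  ∃ ζ ∈ Subgroup.center (SU 3), ∀ α : π →* SU 3, repClass α ∈ C → α h = ζ

/-- Type Ib: one isolated class of reducible representations. A reducible representation is
conjugate to one with values in `SU(2) × {1}`; the assertions about `β(h)` as an element of `SU(2)`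
and about `H¹(ℂ²)` are made for every such conjugate. -/
def IsTypeIb (C : Set (RepVariety π)) : Prop :=
  ∃ β : π →* SU 3, C = {repClass β} ∧ IsOpen C ∧
    ¬ IsIrred β ∧
    (∃ ρ : π →* SU 2, repClass (inclSU2.comp ρ) = repClass β) ∧
    (β h = 1 → β = 1) ∧
    (β ≠ 1 →
      (β h : Matrix (Fin 3) (Fin 3) ℂ).trace = -1 ∧
      ∀ ρ : π →* SU 2, repClass (inclSU2.comp ρ) = repClass β →
        (ρ h : Matrix (Fin 2) (Fin 2) ℂ) = -1 ∧ Subsingleton (H1C2 ρ))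

/-- Type IIb: a pointed 2-sphere, that is, a topological 2-sphere containing exactly one class
`[β]` of reducible representations, which is its only singular point. The equality
`H¹(su(3)_β) = H¹(ℂ²_β)` is that of the splitting `su(3) = su(2) ⊕ ℂ² ⊕ ℝ`: the inclusion of
coefficients induces an isomorphism. -/
def IsTypeIIb (C : Set (RepVariety π)) : Prop :=
  IsTwoSphere C ∧
  (∃ β : π →* SU 3, repClass β ∈ C ∧
    ¬ IsIrred β ∧
    (∀ α : π →* SU 3, repClass α ∈ C → ¬ IsIrred α → repClass α = repClass β) ∧
    ¬ IsSmoothPoint β ∧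
    Nonempty (H1su3 β ≃ₗ[ℝ] (Fin 4 → ℝ)) ∧
    (∃ ρ : π →* SU 2, repClass (inclSU2.comp ρ) = repClass β) ∧
    (∀ ρ : π →* SU 2, repClass (inclSU2.comp ρ) = repClass β →
      Function.Bijective (inclH1 ρ) ∧ Nonempty (H1C2 ρ ≃ₗ[ℝ] (Fin 4 → ℝ))) ∧
    ∀ α : π →* SU 3, repClass α ∈ C → repClass α ≠ repClass β →
      IsIrred α ∧ IsSmoothPoint α ∧ Nonempty (H1su3 α ≃ₗ[ℝ] (Fin 2 → ℝ))) ∧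
  ∀ α : π →* SU 3, repClass α ∈ C →
    α h = 1 ∧
    HasThreeDistinctEigenvalues (α x) ∧
    HasThreeDistinctEigenvalues (α y) ∧
    HasThreeDistinctEigenvalues (α z)

/-- The four names. -/
inductive ComponentType
  | Ia
  | IIa
  | Ib
  | IIb

/-- `C` is a component of the given type. -/
def HasType (C : Set (RepVariety π)) : ComponentType → Prop
  | .Ia => IsTypeIa x y z h C
  | .IIa => IsTypeIIa x y z h C
  | .Ib => IsTypeIb h C
  | .IIb => IsTypeIIb x y z h C

/-- The classification of the path components of `R(π, SU(3))`, with respect to the elements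
`x, y, z, h` of `π`. -/
structure ComponentClassification : Prop where
  /-- Every path component is of exactly one of the four types. -/
  exactly_one_type : ∀ c : RepVariety π, ∃! t : ComponentType, HasType x y z h (pathComponent c) t
  /-- The classes of the images of `x, y, z, h` are constant along a path component (so the image
  of `h` itself is constant whenever it is central). -/
  constant : ∀ α β : π →* SU 3, Joined (repClass α) (repClass β) →
    IsConj (α x) (β x) ∧ IsConj (α y) (β y) ∧ IsConj (α z) (β z) ∧ IsConj (α h) (β h)
  /-- The only isolated class of reducible representations sending `h` to the identity is the
  trivial one. -/
  isolated_reducible : ∀ β : π →* SU 3,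
    (IsOpen {repClass β} ∧ ¬ IsIrred β ∧ β h = 1) ↔ β = 1

end Types

/-! ### Brieskorn spheres and their fundamental groups -/

/-- The Brieskorn sphere `Σ(p,q,r)`, the intersection of `x ^ p + y ^ q + z ^ r = 0` with the unit
sphere `S⁵` of `ℂ³`. -/
def BrieskornSphere (p q r : ℕ) : Set (EuclideanSpace ℂ (Fin 3)) :=
  {v | v 0 ^ p + v 1 ^ q + v 2 ^ r = 0 ∧ ‖v‖ = 1}

/-- Generators of the fundamental group of a Brieskorn sphere. -/
inductive BrieskornGen
  | x
  | y
  | z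
  | h

/-- The relators of the fundamental group of a Brieskorn sphere:
`x ^ p = h ^ a`, `y ^ q = h ^ a`, `z ^ r = h ^ c`, `x y z = 1`, and `h` is central. -/
def brieskornRels (p q r : ℕ) (a c : ℤ) : Set (FreeGroup BrieskornGen) :=
  let x := FreeGroup.of BrieskornGen.x
  let y := FreeGroup.of BrieskornGen.y
  let z := FreeGroup.of BrieskornGen.z
  let h := FreeGroup.of BrieskornGen.h
  {x ^ p * (h ^ a)⁻¹, y ^ q * (h ^ a)⁻¹, z ^ r * (h ^ c)⁻¹, x * y * z,
    h * x * h⁻¹ * x⁻¹, h * y * h⁻¹ * y⁻¹, h * z * h⁻¹ * z⁻¹}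

/-- The group `⟨x, y, z, h | x^p = y^q = h^a, z^r = h^c, xyz = 1, h central⟩`. When
`a r (p + q) + c p q = 1` it is the fundamental group of `Σ(p,q,r)`, with `x, y, z, h` the Wirtinger
generators of the surgery description. -/
abbrev BrieskornGroup (p q r : ℕ) (a c : ℤ) := PresentedGroup (brieskornRels p q r a c)

/-- The generators, as elements of the group. -/
def brieskornGen (p q r : ℕ) (a c : ℤ) (s : BrieskornGen) : BrieskornGroup p q r a c :=
  PresentedGroup.of s

end

/-!
# Path components of the `SU(3)` representation variety of a Brieskorn sphere

The argument only uses that the group is presented as in `IsBrieskornGroup`, so it applies to the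
presented group and to every group isomorphic to it.

**Discreteness of traces.** The image of `h` has order dividing `6`, so `x, y, z` go to matrices of
bounded order. The traces of the images of `x, y, z, h` therefore take finitely many values, and
their level sets are open and closed (`IsBrieskornGroup.isClopen_traceLevel`). As a trace determines
a conjugacy class in `SU(3)`, these conjugacy classes are constant along path components. It remains
to describe each level set.

**Reducible representations.** The group is perfect, so a common eigenvector is fixed and a reducible
representation lives in `SU(2) × {1}`. A nontrivial one sends `x, y, z` to matrices with three
distinct eigenvalues and `h` to `± 1` in `SU(2)`, and it is determined by its traces
(`repClass_eq_of_hasFixedVector`). Unless `tr α(h) = -1`, the image of `h` is a scalar. The level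
sets with `tr α(h) = -1` consist of one reducible class, and so does that of the trivial
representation.

**One multiple eigenvalue.** If two of `x, y, z` go to matrices with a multiple eigenvalue, two planes
of eigenvectors meet and the representation is reducible. If exactly one does, the pair of matrices
is determined by the traces (`repClass_eq_of_double`), and the level set is one point.

**Three distinct eigenvalues.** Diagonalize the image of `x`. The diagonal of the image `Y` of `y` then
varies on a complex line, because `tr Y` and `tr XY` are fixed. A vector is the diagonal of a matrix
in `SU(3)` if and only if it satisfies the polynomial inequalities `IsDiagonal`, and up to diagonal
conjugation the matrix is determined by its diagonal and by a square root, the chirality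
`|y₀₁|² - |y₁₀|²`, of the polynomial `disc` of the diagonal (`SU3.exists_of_isDiagonal`,
`SU3.exists_conj_of_diag_eq`). So the level set is the double of a compact region in the plane along
its boundary curve `disc = 0`. The boundary is smooth except at the reducible class, which lies at
the only point where two off-diagonal entries vanish: at any other critical point `Y` or `XY` would
have a multiple eigenvalue (`hasDoubleRoot_of_critical`). The polynomial `disc` has degree four on
each real line, with negative leading coefficient, so a line through a point with `disc ≥ 0` outside
the region meets the region in intervals; such a point exists by a winding number argument
(`IsRegularSlice.exists_pencilData`). Polar coordinates about it identify the double of each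
component of the region with the 2-sphere (`IsRadialRegion.double_bijOn_sphere`).

**Cohomology.** When `h` acts trivially on a module `V` with an invariant inner product, a cocycle
vanishes at `h`, and its values at `x, y, z` lie in the images of `1 - x, 1 - y, 1 - z`, subject to one
linear relation whose image is the orthogonal complement of the invariants. This gives
`dim H¹ = ∑ rank (1 - g) - 2 (dim V - dim V^π)`, the sum being over `g = x, y, z` (`finrank_H1`), and
so the dimensions `0`, `2` and `4` of the theorem. When `h` acts as `-1` the cohomology is zero.

**Singular points.** Irreducible classes on a sphere are smooth because `H¹` has dimension two. The
reducible one is singular because its `H¹` has dimension four, and a neighbourhood in a surface is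
not homeomorphic to `ℝ⁴`: a small 2-sphere around the point would embed in the plane
(`not_injective_sphere_plane`).
-/

open ComplexConjugate

/-! ### Continuous logarithms on the plane -/

lemma exists_continuous_log {H : ℂ → ℂ} (hc : Continuous H) (h0 : ∀ z, H z ≠ 0) :
    ∃ L : ℂ → ℂ, Continuous L ∧ ∀ z, Complex.exp (L z) = H z := by
  obtain ⟨f, hf, hf'⟩ := Complex.exists_continuousOn_eqOn_exp_comp (U := Set.univ) (g := H)
    ((Homeomorph.Set.univ ℂ).toHomotopyEquiv.simplyConnectedSpace_iff.2 inferInstance)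
    isOpen_univ hc.continuousOn
    (by simpa using h0)
  exact ⟨f, continuousOn_univ.1 hf, fun z => hf' (Set.mem_univ z)⟩

/-- A continuous function with constant exponential is constant on preconnected sets: its values
lie in a discrete set. -/
lemma eq_of_exp_eq_const {s : Set ℝ} (hs : IsPreconnected s) {f : ℝ → ℂ} (hf : ContinuousOn f s)
    {k : ℂ} (hk : ∀ t ∈ s, Complex.exp (f t) = k) {t t' : ℝ} (ht : t ∈ s) (ht' : t' ∈ s) :
    f t = f t' := by
  have him : IsPreconnected (f '' s) := hs.image f hf
  have hcount : (f '' s).Countable := by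
    have : f '' s ⊆ Set.range (fun n : ℤ => f t + n * (2 * Real.pi * Complex.I)) := by
      rintro _ ⟨x, hx, rfl⟩
      obtain ⟨n, hn⟩ := Complex.exp_eq_exp_iff_exists_int.1 ((hk x hx).trans (hk t ht).symm)
      exact ⟨n, hn.symm⟩
    exact (Set.countable_range _).mono this
  exact hcount.isTotallyDisconnected _ subset_rfl him ⟨t, ht, rfl⟩ ⟨t', ht', rfl⟩

/-- A nowhere vanishing continuous function on the plane cannot grow like a positive power: its
winding number along large circles would be both `0` and `n`. -/
lemma false_of_tendsto_div_pow {H : ℂ → ℂ} (hc : Continuous H) (h0 : ∀ z, H z ≠ 0) {n : ℕ}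
    (hn : n ≠ 0) {κ : ℂ} (hκ : κ ≠ 0)
    (hlim : Filter.Tendsto (fun z => H z / z ^ n) (Filter.cocompact ℂ) (nhds κ)) : False := by
  obtain ⟨L, hL, hexp⟩ := exists_continuous_log hc h0
  have hlim1 : Filter.Tendsto (fun z => H z / z ^ n / κ) (Filter.cocompact ℂ) (nhds 1) := by
    simpa [hκ] using hlim.div_const κ
  have hev : ∀ᶠ z in Filter.cocompact ℂ, H z / z ^ n / κ ∈ Complex.slitPlane :=
    hlim1.eventually (Complex.isOpen_slitPlane.mem_nhds (by simp [Complex.one_mem_slitPlane]))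
  obtain ⟨R, hR⟩ : ∃ R : ℝ, ∀ z : ℂ, R ≤ ‖z‖ → H z / z ^ n / κ ∈ Complex.slitPlane := by
    rw [← Metric.cobounded_eq_cocompact, ← comap_norm_atTop, Filter.eventually_comap] at hev
    obtain ⟨R, hR⟩ := Filter.eventually_atTop.1 hev
    exact ⟨R, fun z hz => hR _ hz z rfl⟩
  set ρ : ℝ := max R 1
  have hρ : 0 < ρ := lt_of_lt_of_le one_pos (le_max_right _ _)
  set c : ℝ → ℂ := fun θ => (ρ : ℂ) * Complex.exp (θ * Complex.I)
  have hcn : ∀ θ, ‖c θ‖ = ρ := by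
    intro θ; simp [c, Complex.norm_exp_ofReal_mul_I, abs_of_pos hρ]
  have hc0 : ∀ θ, c θ ≠ 0 := fun θ => norm_pos_iff.1 (by rw [hcn]; exact hρ)
  have hslit : ∀ θ, H (c θ) / c θ ^ n / κ ∈ Complex.slitPlane := fun θ =>
    hR _ (by rw [hcn]; exact le_max_left _ _)
  have hcc : Continuous c := by fun_prop
  set q : ℝ → ℂ := fun θ =>
    L (c θ) - n * (θ * Complex.I) - Complex.log (H (c θ) / c θ ^ n / κ)
  have hq : Continuous q := by
    refine ((hL.comp hcc).sub (by fun_prop)).sub ?_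
    refine Continuous.clog ?_ hslit
    exact ((hc.comp hcc).div (hcc.pow n) (fun θ => pow_ne_zero _ (hc0 θ))).div_const κ
  have hqe : ∀ θ ∈ (Set.univ : Set ℝ), Complex.exp (q θ) = κ * (ρ : ℂ) ^ n := by
    intro θ _
    have h1 : H (c θ) / c θ ^ n / κ ≠ 0 := Complex.slitPlane_ne_zero (hslit θ)
    simp only [q, Complex.exp_sub, hexp, Complex.exp_log h1]
    have h2 : Complex.exp (n * (θ * Complex.I)) = Complex.exp (θ * Complex.I) ^ n := by
      rw [← Complex.exp_nat_mul]
    have h3 : c θ ^ n = (ρ : ℂ) ^ n * Complex.exp (θ * Complex.I) ^ n := by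
      simp only [c, mul_pow]
    have h4 := Complex.exp_ne_zero (θ * Complex.I)
    have h5 := h0 (c θ)
    rw [h2, h3]
    field_simp
  have h := eq_of_exp_eq_const isPreconnected_univ hq.continuousOn hqe
    (Set.mem_univ (0 : ℝ)) (Set.mem_univ (2 * Real.pi))
  have hc2 : c (2 * Real.pi) = c 0 := by
    simp only [c]
    push_cast
    simp [Complex.exp_two_pi_mul_I]
  simp only [q, hc2] at h
  have h' : (n : ℂ) * ((2 * Real.pi : ℝ) * Complex.I) = 0 := by
    simp only [Complex.ofReal_zero, zero_mul, mul_zero, sub_zero] at h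
    linear_combination h
  simp [hn, Real.pi_ne_zero] at h'

/-- There is no continuous injection of the 2-sphere into the plane (a case of the Borsuk–Ulam
theorem): the odd map `f x - f (-x)` would have a continuous logarithm on the upper
hemisphere. -/
lemma not_injective_sphere_plane {f : EuclideanSpace ℝ (Fin 3) → ℂ}
    (hf : ContinuousOn f (Metric.sphere 0 1)) (hinj : Set.InjOn f (Metric.sphere 0 1)) : False := by
  -- the hemisphere over the unit disc, precomposed with the radial retraction to the disc
  set ret : ℂ → ℂ := fun z => z / ((max 1 ‖z‖ : ℝ) : ℂ)
  have hretc : Continuous ret := by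
    refine continuous_id.div ?_ ?_
    · exact Complex.continuous_ofReal.comp (continuous_const.max continuous_norm)
    · intro z
      exact_mod_cast (lt_of_lt_of_le one_pos (le_max_left 1 ‖z‖)).ne'
  have hretn : ∀ z, ‖ret z‖ ≤ 1 := by
    intro z
    simp only [ret, norm_div, Complex.norm_real]
    rw [Real.norm_of_nonneg (le_trans zero_le_one (le_max_left 1 ‖z‖))]
    exact div_le_one_of_le₀ (le_max_right _ _) (le_trans zero_le_one (le_max_left 1 ‖z‖))
  have hret1 : ∀ z, ‖z‖ = 1 → ret z = z := by
    intro z hz; simp [ret, hz]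
  set x : ℂ → EuclideanSpace ℝ (Fin 3) := fun z =>
    !₂[(ret z).re, (ret z).im, Real.sqrt (1 - ‖ret z‖ ^ 2)]
  have hx : Continuous x := by
    refine (PiLp.continuous_toLp 2 _).comp ?_
    refine continuous_pi fun i => ?_
    fin_cases i
    · exact Complex.continuous_re.comp hretc
    · exact Complex.continuous_im.comp hretc
    · exact Real.continuous_sqrt.comp (by fun_prop)
  have hxs : ∀ z, x z ∈ Metric.sphere (0 : EuclideanSpace ℝ (Fin 3)) 1 := by
    intro z
    rw [mem_sphere_zero_iff_norm, EuclideanSpace.norm_eq, Real.sqrt_eq_one]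
    have h1 : 0 ≤ 1 - ‖ret z‖ ^ 2 := by nlinarith [hretn z, norm_nonneg (ret z)]
    have h2 := Complex.normSq_apply (ret z)
    rw [Complex.normSq_eq_norm_sq] at h2
    simp only [x, Fin.sum_univ_three]
    simp [Real.sq_sqrt h1]
    nlinarith
  have hnxs : ∀ z, -x z ∈ Metric.sphere (0 : EuclideanSpace ℝ (Fin 3)) 1 := by
    intro z; simpa using hxs z
  have hne : ∀ z, f (x z) - f (-x z) ≠ 0 := by
    intro z h
    have := hinj (hxs z) (hnxs z) (sub_eq_zero.1 h)
    have h0 : x z = 0 := by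
      have h2 : (2 : ℝ) • x z = 0 := by rw [two_smul]; nth_rewrite 1 [this]; simp
      simpa using h2
    simpa [h0] using hxs z
  have hc : Continuous fun z => f (x z) - f (-x z) :=
    (hf.comp_continuous hx hxs).sub (hf.comp_continuous hx.neg hnxs)
  obtain ⟨L, hL, hexp⟩ := exists_continuous_log hc hne
  have hxneg : ∀ z, ‖z‖ = 1 → x (-z) = -x z := by
    intro z hz
    have hz' : ‖-z‖ = 1 := by simpa using hz
    ext i
    fin_cases i <;> simp [x, hret1 z hz, hret1 (-z) hz', hz]
  set c : ℝ → ℂ := fun θ => Complex.exp (θ * Complex.I)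
  have hcn : ∀ θ, ‖c θ‖ = 1 := fun θ => Complex.norm_exp_ofReal_mul_I θ
  have hcc : Continuous c := by fun_prop
  have hq : Continuous fun θ => L (-c θ) - L (c θ) :=
    (hL.comp hcc.neg).sub (hL.comp hcc)
  have hqe : ∀ θ ∈ (Set.univ : Set ℝ), Complex.exp (L (-c θ) - L (c θ)) = -1 := by
    intro θ _
    rw [Complex.exp_sub, hexp, hexp, hxneg _ (hcn θ), neg_neg,
      div_eq_iff (hne _)]
    ring
  have h := eq_of_exp_eq_const isPreconnected_univ hq.continuousOn hqe
    (Set.mem_univ (0 : ℝ)) (Set.mem_univ Real.pi)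
  have h0 : c 0 = 1 := by simp [c]
  have hpi : c Real.pi = -1 := by simp [c, Complex.exp_pi_mul_I]
  simp only [h0, hpi, neg_neg] at h
  have h1 := hqe 0 (Set.mem_univ _)
  rw [h0] at h1
  have h2 : L (-1) - L 1 = 0 := by linear_combination h / 2
  rw [h2, Complex.exp_zero] at h1
  norm_num at h1

/-! ### Plane regions with interval rays and their doubles -/

/-- A compact plane region `Ω`, normalised to contain `1` and not `0`, which meets each ray from
the origin in an interval and no two opposite rays, together with a function `G` that is
nonnegative on `Ω` and positive inside the intervals. The last field is a smoothness condition at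
the points where the ray meets `Ω` only once. -/
structure IsRadialRegion (G : ℂ → ℝ) (Ω : Set ℂ) : Prop where
  isCompact : IsCompact Ω
  contDiff : ContDiff ℝ 1 G
  one_mem : (1 : ℂ) ∈ Ω
  zero_notMem : (0 : ℂ) ∉ Ω
  nonneg : ∀ u ∈ Ω, 0 ≤ G u
  mem_nhds : ∀ u ∈ Ω, 0 < G u → Ω ∈ nhds u
  segment : ∀ u ∈ Ω, ∀ t : ℝ, (t : ℂ) * u ∈ Ω → ∀ s : ℝ, 1 < s → s < t →
    (s : ℂ) * u ∈ Ω ∧ 0 < G (s * u)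
  antipodal : ∀ u ∈ Ω, ∀ t : ℝ, 0 < t → -(t : ℂ) * u ∉ Ω
  regular : ∀ u ∈ Ω, (∃ t : ℝ, 0 < t ∧ t ≠ 1 ∧ (t : ℂ) * u ∈ Ω) ∨
    (fderiv ℝ G u ≠ 0 ∧ ∀ᶠ v in nhds u, 0 ≤ G v → v ∈ Ω)

/-- The unit complex number with argument `θ`. -/
noncomputable def cis (θ : ℝ) : ℂ := Complex.exp (θ * Complex.I)

lemma continuous_cis : Continuous cis := by unfold cis; fun_prop

lemma norm_cis (θ : ℝ) : ‖cis θ‖ = 1 := Complex.norm_exp_ofReal_mul_I θ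

lemma cis_ne_zero (θ : ℝ) : cis θ ≠ 0 := Complex.exp_ne_zero _

lemma norm_mul_cis_arg (u : ℂ) : (‖u‖ : ℂ) * cis u.arg = u := Complex.norm_mul_exp_arg_mul_I u

lemma arg_mul_cis {r θ : ℝ} (hr : 0 < r) (hθ : θ ∈ Set.Ioc (-Real.pi) Real.pi) :
    ((r : ℂ) * cis θ).arg = θ := by
  rw [cis, Complex.exp_mul_I, Complex.arg_mul_cos_add_sin_mul_I hr hθ]

lemma norm_mul_cis {r : ℝ} (hr : 0 ≤ r) (θ : ℝ) : ‖(r : ℂ) * cis θ‖ = r := by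
  rw [norm_mul, norm_cis, mul_one, Complex.norm_real, Real.norm_of_nonneg hr]

lemma hasDerivAt_cis (θ : ℝ) : HasDerivAt cis (Complex.I * cis θ) θ := by
  have h1 : HasDerivAt (fun t : ℝ => (t : ℂ) * Complex.I) Complex.I θ := by
    simpa using (Complex.ofRealCLM.hasDerivAt (x := θ)).mul_const Complex.I
  have := h1.cexp
  rwa [mul_comm] at this

lemma isCompact_connectedComponentIn {X : Type*} [TopologicalSpace X] {F : Set X}
    (hF : IsCompact F) (hFc : IsClosed F) (x : X) : IsCompact (connectedComponentIn F x) := by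
  by_cases hx : x ∈ F
  · rw [connectedComponentIn_eq_image hx]
    exact hF.of_isClosed_subset (hFc.isClosedEmbedding_subtypeVal.isClosedMap _
      isClosed_connectedComponent) (by rintro _ ⟨y, -, rfl⟩; exact y.2)
  · rw [connectedComponentIn_eq_empty hx]; exact isCompact_empty

namespace IsRadialRegion

variable {G : ℂ → ℝ} {Ω : Set ℂ}

lemma mem_slitPlane (h : IsRadialRegion G Ω) {u : ℂ} (hu : u ∈ Ω) : u ∈ Complex.slitPlane := by
  by_contra hs
  rw [Complex.mem_slitPlane_iff_not_le_zero, not_not] at hs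
  have h1 : u = (u.re : ℂ) := by
    apply Complex.ext <;> simp [(Complex.le_def.1 hs).2]
  have h2 : u.re ≤ 0 := (Complex.le_def.1 hs).1
  rcases h2.eq_or_lt with h3 | h3
  · rw [h3] at h1; exact h.zero_notMem (by simpa [h1] using hu)
  · refine h.antipodal 1 h.one_mem (-u.re) (by linarith) ?_
    rw [mul_one]; push_cast; rw [neg_neg, ← h1]; exact hu

/-- The component of `Ω` through the base point. -/
abbrev base (Ω : Set ℂ) : Set ℂ := connectedComponentIn Ω 1

lemma base_subset : base Ω ⊆ Ω := connectedComponentIn_subset _ _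

lemma subset_base {S : Set ℂ} (hS : IsPreconnected S) (hSΩ : S ⊆ Ω) {u : ℂ} (huS : u ∈ S)
    (hu : u ∈ base Ω) : S ⊆ base Ω := by
  rw [base, connectedComponentIn_eq hu]
  exact hS.subset_connectedComponentIn huS hSΩ

lemma arg_image_eq (h : IsRadialRegion G Ω) : ∃ θ₁ θ₂ : ℝ, Complex.arg '' base Ω = Set.Icc θ₁ θ₂ ∧ θ₁ ≤ θ₂ ∧
    -Real.pi < θ₁ ∧ θ₂ < Real.pi := by
  have hc : ContinuousOn Complex.arg (base Ω) := fun u hu =>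
    (Complex.continuousAt_arg (h.mem_slitPlane (base_subset hu))).continuousWithinAt
  have hI := eq_Icc_of_connected_compact
    ((isConnected_connectedComponentIn_iff.2 h.one_mem).image _ hc)
    ((isCompact_connectedComponentIn h.isCompact h.isCompact.isClosed 1).image_of_continuousOn hc)
  have hle : sInf (Complex.arg '' base Ω) ≤ sSup (Complex.arg '' base Ω) := by
    rw [← Set.nonempty_Icc, ← hI]
    exact ⟨_, 1, mem_connectedComponentIn h.one_mem, rfl⟩
  refine ⟨_, _, hI, hle, ?_, ?_⟩
  · have := Set.left_mem_Icc.2 hle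
    rw [← hI] at this
    obtain ⟨u, -, hu⟩ := this
    rw [← hu]; exact Complex.neg_pi_lt_arg u
  · have := Set.right_mem_Icc.2 hle
    rw [← hI] at this
    obtain ⟨u, hu, hu'⟩ := this
    rw [← hu']
    exact lt_of_le_of_ne (Complex.arg_le_pi u)
      (Complex.mem_slitPlane_iff_arg.1 (h.mem_slitPlane (base_subset hu))).1

/-- The ray of angle `θ` meets `Ω` in an interval of radii, with `G` positive inside. -/
lemma exists_radii (h : IsRadialRegion G Ω) : ∃ r₁ r₂ : ℝ → ℝ, ∀ θ ∈ Complex.arg '' base Ω,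
    0 < r₁ θ ∧ r₁ θ ≤ r₂ θ ∧
    (∀ r : ℝ, 0 < r → ((r : ℂ) * cis θ ∈ Ω ↔ r₁ θ ≤ r ∧ r ≤ r₂ θ)) ∧
    (∀ r : ℝ, r₁ θ < r → r < r₂ θ → 0 < G (r * cis θ)) := by
  suffices H : ∀ θ : ℝ, ∃ a b : ℝ, θ ∈ Complex.arg '' base Ω →
      0 < a ∧ a ≤ b ∧ (∀ r : ℝ, 0 < r → ((r : ℂ) * cis θ ∈ Ω ↔ a ≤ r ∧ r ≤ b)) ∧
      (∀ r : ℝ, a < r → r < b → 0 < G (r * cis θ)) by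
    choose r₁ r₂ hr using H
    exact ⟨r₁, r₂, hr⟩
  intro θ
  by_cases hθ : θ ∈ Complex.arg '' base Ω
  swap
  · exact ⟨0, 0, fun h => absurd h hθ⟩
  obtain ⟨u, hu, rfl⟩ := hθ
  set S : Set ℝ := {r | 0 ≤ r ∧ (r : ℂ) * cis u.arg ∈ Ω}
  have hSc : IsCompact S := by
    obtain ⟨B, hB⟩ := h.isCompact.isBounded.exists_norm_le
    refine (isCompact_Icc (a := 0) (b := B)).of_isClosed_subset ?_ ?_
    · exact (isClosed_Ici).inter (h.isCompact.isClosed.preimage (by fun_prop))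
    · rintro r ⟨h0, hr⟩
      have := hB _ hr
      rw [norm_mul_cis h0] at this
      exact ⟨h0, this⟩
  have hSn : S.Nonempty := ⟨‖u‖, norm_nonneg _, by
    rw [norm_mul_cis_arg]; exact base_subset hu⟩
  have ha := hSc.sInf_mem hSn
  have hb := hSc.sSup_mem hSn
  set a := sInf S
  set b := sSup S
  have hapos : 0 < a := lt_of_le_of_ne ha.1 (fun h0 => h.zero_notMem (by
    have := ha.2; rwa [← h0, Complex.ofReal_zero, zero_mul] at this))
  have hseg : ∀ r, a < r → r < b → (r : ℂ) * cis u.arg ∈ Ω ∧ 0 < G (r * cis u.arg) := by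
    intro r h1 h2
    have hane : (a : ℂ) ≠ 0 := by exact_mod_cast hapos.ne'
    have := h.segment _ ha.2 (b / a) (by
      push_cast; rw [← mul_assoc, div_mul_cancel₀ _ hane]; exact hb.2) (r / a)
      (by rwa [lt_div_iff₀ hapos, one_mul]) (by gcongr)
    push_cast at this
    rwa [← mul_assoc, div_mul_cancel₀ _ hane] at this
  refine ⟨a, b, fun _ => ⟨hapos, ?_, ?_, fun r h1 h2 => (hseg r h1 h2).2⟩⟩
  · exact csInf_le hSc.bddBelow hb
  · intro r hr
    constructor
    · intro hr'
      exact ⟨csInf_le hSc.bddBelow ⟨hr.le, hr'⟩, le_csSup hSc.bddAbove ⟨hr.le, hr'⟩⟩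
    · rintro ⟨h1, h2⟩
      rcases h1.eq_or_lt with h1 | h1
      · rw [← h1]; exact ha.2
      rcases h2.eq_or_lt with h2 | h2
      · rw [h2]; exact hb.2
      exact (hseg r h1 h2).1

/-- At a point where the ray meets `Ω` in more than one point, the nearby angles all occur. -/
lemma eventually_arg_mem_of_lt (h : IsRadialRegion G Ω) {θ r r' : ℝ} (hr : 0 < r) (hrr' : r < r')
    (h1 : (r : ℂ) * cis θ ∈ base Ω) (h2 : (r' : ℂ) * cis θ ∈ base Ω) :
    ∀ᶠ t in nhds θ, t ∈ Set.Ioc (-Real.pi) Real.pi → t ∈ Complex.arg '' base Ω := by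
  set m : ℝ := (r + r') / 2
  have hm : r < m := by simp only [m]; linarith
  have hm' : m < r' := by simp only [m]; linarith
  have hrc : (r : ℂ) ≠ 0 := by exact_mod_cast hr.ne'
  have hseg : ∀ x : ℝ, r < x → x < r' → (x : ℂ) * cis θ ∈ Ω ∧ 0 < G (x * cis θ) := by
    intro x hx hx'
    have := h.segment _ (base_subset h1) (r' / r) (by
      push_cast; rw [← mul_assoc, div_mul_cancel₀ _ hrc]; exact base_subset h2) (x / r)
      (by rwa [lt_div_iff₀ hr, one_mul]) (by gcongr)
    push_cast at this
    rwa [← mul_assoc, div_mul_cancel₀ _ hrc] at this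
  have hmb : (m : ℂ) * cis θ ∈ base Ω := by
    refine subset_base (S := (fun x : ℝ => (x : ℂ) * cis θ) '' Set.Icc r m)
      (isPreconnected_Icc.image _ (by fun_prop)) ?_ ⟨r, ⟨le_rfl, hm.le⟩, rfl⟩ h1
      ⟨m, ⟨hm.le, le_rfl⟩, rfl⟩
    rintro _ ⟨x, ⟨hx, hx'⟩, rfl⟩
    rcases hx.eq_or_lt with rfl | hx
    · exact base_subset h1
    · exact (hseg x hx (hx'.trans_lt hm')).1
  obtain ⟨ε, hε, hball⟩ := Metric.mem_nhds_iff.1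
    (h.mem_nhds _ (hseg m hm hm').1 (hseg m hm hm').2)
  have hball' : Metric.ball ((m : ℂ) * cis θ) ε ⊆ base Ω :=
    subset_base (convex_ball _ _).isPreconnected hball (Metric.mem_ball_self hε) hmb
  have hcont : Filter.Tendsto (fun t : ℝ => (m : ℂ) * cis t) (nhds θ) (nhds ((m : ℂ) * cis θ)) :=
    (continuous_const.mul continuous_cis).tendsto θ
  filter_upwards [hcont (Metric.ball_mem_nhds _ hε)] with t ht htI
  exact ⟨_, hball' ht, arg_mul_cis (hr.trans hm) htI⟩

/-- At a point where the ray meets `Ω` only once, `Ω` lies locally on one side of the ray and all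
nearby angles on that side occur. -/
lemma exists_side (h : IsRadialRegion G Ω) {r θ : ℝ} (hr : 0 < r) (hθ : θ ∈ Set.Ioo (-Real.pi) Real.pi)
    (hu : (r : ℂ) * cis θ ∈ base Ω)
    (huniq : ∀ r' : ℝ, 0 < r' → (r' : ℂ) * cis θ ∈ Ω → r' = r) :
    G (r * cis θ) = 0 ∧ ∃ σ : ℝ, (σ = 1 ∨ σ = -1) ∧ ∃ η > 0,
      (∀ t ∈ Set.Ioo 0 η, θ + σ * t ∈ Complex.arg '' base Ω) ∧
      ∀ᶠ v in nhds ((r : ℂ) * cis θ), v ∈ Ω → 0 ≤ σ * (v.arg - θ) := by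
  set u := (r : ℂ) * cis θ
  have huΩ : u ∈ Ω := base_subset hu
  have hrc : Continuous fun x : ℝ => (x : ℂ) * cis θ := by fun_prop
  obtain ⟨hD, hnear⟩ : fderiv ℝ G u ≠ 0 ∧ ∀ᶠ v in nhds u, 0 ≤ G v → v ∈ Ω := by
    rcases h.regular u huΩ with ⟨t, ht, ht1, htu⟩ | h'
    · refine absurd ?_ ht1
      have := huniq (t * r) (mul_pos ht hr) (by push_cast; rw [mul_assoc]; exact htu)
      exact mul_right_cancel₀ hr.ne' (by rw [this, one_mul])
    · exact h'
  have hG0 : G u = 0 := by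
    by_contra hne
    have hpos := lt_of_le_of_ne (h.nonneg u huΩ) (Ne.symm hne)
    have h1 : ∀ᶠ x : ℝ in nhds r, (x : ℂ) * cis θ ∈ Ω := hrc.tendsto r (h.mem_nhds u huΩ hpos)
    have h2 : ∀ᶠ x : ℝ in nhds r, x = r := by
      filter_upwards [h1, lt_mem_nhds hr] with x hx hx'
      exact huniq x hx' hx
    have h3 : ∀ᶠ x : ℝ in nhdsWithin r (Set.Ioi r), x = r := h2.filter_mono nhdsWithin_le_nhds
    obtain ⟨x, hx, hx'⟩ := (h3.and self_mem_nhdsWithin).exists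
    exact absurd hx (ne_of_gt hx')
  have hdiff : Differentiable ℝ G := h.contDiff.differentiable (by norm_num)
  -- along the ray `G` is nonpositive near the point
  have hray : ∀ᶠ x : ℝ in nhds r, G (x * cis θ) ≤ 0 := by
    filter_upwards [hrc.tendsto r hnear, lt_mem_nhds hr] with x hx hx'
    by_contra hlt
    push Not at hlt
    rw [huniq x hx' (hx hlt.le)] at hlt
    exact absurd hG0 hlt.ne'
  have hrad : fderiv ℝ G u (cis θ) = 0 := by
    have hd : HasDerivAt (fun x : ℝ => G (x * cis θ)) (fderiv ℝ G u (cis θ)) r := by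
      have h1 : HasDerivAt (fun x : ℝ => (x : ℂ) * cis θ) (cis θ) r := by
        simpa using (Complex.ofRealCLM.hasDerivAt (x := r)).mul_const (cis θ)
      exact (hdiff u).hasFDerivAt.comp_hasDerivAt r h1
    refine IsLocalMax.hasDerivAt_eq_zero (f := fun x : ℝ => G (x * cis θ)) (a := r) ?_ hd
    filter_upwards [hray] with x hx
    simpa [u] using hx.trans hG0.ge
  have hang : fderiv ℝ G u (Complex.I * u) ≠ 0 := by
    intro h0
    apply hD
    have h1 : fderiv ℝ G u (Complex.I * cis θ) = 0 := by
      have : Complex.I * u = r • (Complex.I * cis θ) := by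
        simp only [u, Complex.real_smul]; ring
      rw [this, map_smul, smul_eq_mul] at h0
      exact (mul_eq_zero.1 h0).resolve_left hr.ne'
    ext v
    have hv : v = (v / cis θ).re • cis θ + (v / cis θ).im • (Complex.I * cis θ) := by
      conv_lhs => rw [← div_mul_cancel₀ v (cis_ne_zero θ), ← Complex.re_add_im (v / cis θ)]
      simp only [Complex.real_smul]; ring
    rw [hv, map_add, map_smul, map_smul, hrad, h1]; simp
  obtain ⟨σ, hσ, hσpos⟩ : ∃ σ : ℝ, (σ = 1 ∨ σ = -1) ∧ 0 < σ * fderiv ℝ G u (Complex.I * u) := by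
    rcases lt_or_gt_of_ne hang with h1 | h1
    · exact ⟨-1, Or.inr rfl, by linarith⟩
    · exact ⟨1, Or.inl rfl, by linarith⟩
  have hσσ : σ * σ = 1 := by rcases hσ with rfl | rfl <;> norm_num
  refine ⟨hG0, σ, hσ, ?_⟩
  -- the angular derivative keeps its sign on a polar rectangle
  have hcontD : Continuous fun x : ℝ × ℝ =>
      σ * fderiv ℝ G (x.1 * cis x.2) (Complex.I * (x.1 * cis x.2)) := by
    have h1 : Continuous fun x : ℝ × ℝ => (x.1 : ℂ) * cis x.2 :=
      (Complex.continuous_ofReal.comp continuous_fst).mul (continuous_cis.comp continuous_snd)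
    have h2 : Continuous (fderiv ℝ G) := h.contDiff.continuous_fderiv (by norm_num)
    exact continuous_const.mul ((h2.comp h1).clm_apply (continuous_const.mul h1))
  have hrect : ∃ η > 0, ∀ x : ℝ, |x - r| < η → ∀ t : ℝ, |t - θ| < η →
      0 < σ * fderiv ℝ G (x * cis t) (Complex.I * (x * cis t)) := by
    have : ∀ᶠ x in nhds ((r, θ) : ℝ × ℝ),
        0 < σ * fderiv ℝ G (x.1 * cis x.2) (Complex.I * (x.1 * cis x.2)) :=
      hcontD.tendsto (r, θ) (lt_mem_nhds hσpos)
    obtain ⟨η, hη, hball⟩ := Metric.eventually_nhds_iff.1 this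
    refine ⟨η, hη, fun x hx t ht => @hball (x, t) ?_⟩
    rw [Prod.dist_eq, max_lt_iff, Real.dist_eq, Real.dist_eq]
    exact ⟨hx, ht⟩
  obtain ⟨η₁, hη₁, hrect⟩ := hrect
  have hmono : ∀ x : ℝ, |x - r| < η₁ →
      StrictMonoOn (fun t : ℝ => G (x * cis (θ + σ * t))) (Set.Ioo (-η₁) η₁) := by
    intro x hx
    have hder : ∀ t : ℝ, HasDerivAt (fun t : ℝ => G (x * cis (θ + σ * t)))
        (σ * fderiv ℝ G (x * cis (θ + σ * t)) (Complex.I * (x * cis (θ + σ * t)))) t := by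
      intro t
      have h1 : HasDerivAt (fun t : ℝ => θ + σ * t) σ t := by
        simpa using ((hasDerivAt_id t).const_mul σ).const_add θ
      have h2 := ((hasDerivAt_cis (θ + σ * t)).scomp t h1).const_mul (x : ℂ)
      have h3 := (hdiff (x * cis (θ + σ * t))).hasFDerivAt.comp_hasDerivAt t h2
      have h4 : (x : ℂ) * σ • (Complex.I * cis (θ + σ * t)) =
          σ • (Complex.I * (x * cis (θ + σ * t))) := by
        simp only [Complex.real_smul]; ring
      rw [h4, map_smul, smul_eq_mul] at h3
      exact h3
    refine strictMonoOn_of_deriv_pos (convex_Ioo _ _)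
      (fun t _ => (hder t).continuousAt.continuousWithinAt) ?_
    intro t ht
    rw [interior_Ioo] at ht
    rw [(hder t).deriv]
    refine hrect x hx _ ?_
    rw [add_sub_cancel_left, abs_mul]
    have : |σ| = 1 := by rcases hσ with rfl | rfl <;> norm_num
    rw [this, one_mul, abs_lt]; exact ht
  obtain ⟨η₂, hη₂, hnear₂⟩ : ∃ η₂ > 0, ∀ t : ℝ, |t| < η₂ →
      (0 ≤ G (r * cis (θ + σ * t)) → (r : ℂ) * cis (θ + σ * t) ∈ Ω) ∧
        θ + σ * t ∈ Set.Ioo (-Real.pi) Real.pi := by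
    have hc : Continuous fun t : ℝ => (r : ℂ) * cis (θ + σ * t) :=
      continuous_const.mul (continuous_cis.comp (by fun_prop))
    have hc0 : Filter.Tendsto (fun t : ℝ => (r : ℂ) * cis (θ + σ * t)) (nhds 0) (nhds u) := by
      simpa [u] using hc.tendsto 0
    have hc1 : Filter.Tendsto (fun t : ℝ => θ + σ * t) (nhds 0) (nhds θ) := by
      have : Continuous fun t : ℝ => θ + σ * t := by fun_prop
      simpa using this.tendsto 0
    obtain ⟨η, hη, hb⟩ := Metric.eventually_nhds_iff.1
      ((hc0.eventually hnear).and (hc1 (Ioo_mem_nhds hθ.1 hθ.2)))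
    exact ⟨η, hη, fun t ht => hb (by simpa using ht)⟩
  refine ⟨min η₁ η₂, lt_min hη₁ hη₂, ?_, ?_⟩
  · rintro t ⟨ht0, ht⟩
    have htη₁ := ht.trans_le (min_le_left _ _)
    have htη₂ := ht.trans_le (min_le_right _ _)
    have hpos : ∀ s ∈ Set.Icc 0 t, 0 ≤ G (r * cis (θ + σ * s)) := by
      rintro s ⟨hs0, hs⟩
      have := (hmono r (by simpa using hη₁)).monotoneOn (a := 0) ⟨by linarith, hη₁⟩ (b := s)
        ⟨by linarith, by linarith⟩ hs0
      simpa [hG0, u] using hG0.ge.trans (by simpa [u] using this)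
    have hsub : (fun s : ℝ => (r : ℂ) * cis (θ + σ * s)) '' Set.Icc 0 t ⊆ base Ω := by
      refine subset_base (isPreconnected_Icc.image _ ?_) ?_ (u := u) ⟨0, ⟨le_rfl, ht0.le⟩, ?_⟩ hu
      · exact (continuous_const.mul (continuous_cis.comp (by fun_prop))).continuousOn
      · rintro _ ⟨s, hs, rfl⟩
        exact (hnear₂ s (by rw [abs_lt]; constructor <;> linarith [hs.1, hs.2])).1 (hpos s hs)
      · simp [u]
    refine ⟨_, hsub ⟨t, ⟨ht0.le, le_rfl⟩, rfl⟩, arg_mul_cis hr ?_⟩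
    exact Set.Ioo_subset_Ioc_self (hnear₂ t (by rw [abs_lt]; constructor <;> linarith)).2
  · have harg : Filter.Tendsto Complex.arg (nhds u) (nhds θ) := by
      have := (Complex.continuousAt_arg (h.mem_slitPlane huΩ)).tendsto
      rwa [show u.arg = θ from arg_mul_cis hr (Set.Ioo_subset_Ioc_self hθ)] at this
    have hnorm : Filter.Tendsto (fun v : ℂ => ‖v‖) (nhds u) (nhds r) := by
      have := (continuous_norm (E := ℂ)).tendsto u
      rwa [show ‖u‖ = r from norm_mul_cis hr.le θ] at this
    filter_upwards [hnorm.eventually hray, hnorm (Metric.ball_mem_nhds r hη₁),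
      harg (Metric.ball_mem_nhds θ hη₁)] with v h1 h2 h3 hv
    by_contra hneg
    push Not at hneg
    simp only [Set.mem_preimage, Metric.mem_ball, Real.dist_eq] at h2 h3
    set t := σ * (v.arg - θ)
    have habs : |t| < η₁ := by
      rw [abs_mul]
      have : |σ| = 1 := by rcases hσ with rfl | rfl <;> norm_num
      rwa [this, one_mul]
    have hlt := hmono ‖v‖ h2 (a := t) (abs_lt.1 habs) (b := 0) ⟨by linarith, hη₁⟩ hneg
    have hθt : θ + σ * t = v.arg := by
      simp only [t]; linear_combination (v.arg - θ) * hσσ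
    simp only [hθt, norm_mul_cis_arg, mul_zero, add_zero] at hlt
    linarith [h.nonneg v hv]

end IsRadialRegion

namespace IsRadialRegion

variable {G : ℂ → ℝ} {Ω : Set ℂ}

/-- The double of the base component: two copies of it, the sheets `δ = ± √G`, glued along the
curve `G = 0`. -/
def double (G : ℂ → ℝ) (Ω : Set ℂ) : Set (ℂ × ℝ) := {x | x.1 ∈ base Ω ∧ x.2 ^ 2 = G x.1}

/-- Polar description of the base component: it lies between two continuous graphs over an interval
of angles, which meet exactly at the end points. -/
structure PolarData (G : ℂ → ℝ) (Ω : Set ℂ) (θ₁ θ₂ : ℝ) (r₁ r₂ : ℝ → ℝ) : Prop where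
  lt : θ₁ < θ₂
  neg_pi_lt : -Real.pi < θ₁
  lt_pi : θ₂ < Real.pi
  image : Complex.arg '' base Ω = Set.Icc θ₁ θ₂
  pos : ∀ θ ∈ Set.Icc θ₁ θ₂, 0 < r₁ θ
  le : ∀ θ ∈ Set.Icc θ₁ θ₂, r₁ θ ≤ r₂ θ
  mem_iff : ∀ θ ∈ Set.Icc θ₁ θ₂, ∀ r : ℝ, 0 < r → ((r : ℂ) * cis θ ∈ base Ω ↔ r₁ θ ≤ r ∧ r ≤ r₂ θ)
  pos_of_mem : ∀ θ ∈ Set.Icc θ₁ θ₂, ∀ r : ℝ, r₁ θ < r → r < r₂ θ → 0 < G (r * cis θ)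
  lt_iff : ∀ θ ∈ Set.Icc θ₁ θ₂, (r₁ θ < r₂ θ ↔ θ₁ < θ ∧ θ < θ₂)
  eq_zero : ∀ u ∈ base Ω, (‖u‖ = r₁ u.arg ∨ ‖u‖ = r₂ u.arg) → G u = 0
  eventually_mem : ∀ u ∈ base Ω, ∀ᶠ v in nhds u, v ∈ Ω → v ∈ base Ω
  continuousOn_left : ContinuousOn r₁ (Set.Icc θ₁ θ₂)
  continuousOn_right : ContinuousOn r₂ (Set.Icc θ₁ θ₂)

lemma exists_polarData (h : IsRadialRegion G Ω) :
    ∃ (θ₁ θ₂ : ℝ) (r₁ r₂ : ℝ → ℝ), PolarData G Ω θ₁ θ₂ r₁ r₂ := by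
  obtain ⟨θ₁, θ₂, hI, hle, hπ, hπ'⟩ := h.arg_image_eq
  obtain ⟨r₁, r₂, hr⟩ := h.exists_radii
  rw [hI] at hr
  have hIoc : ∀ θ ∈ Set.Icc θ₁ θ₂, θ ∈ Set.Ioc (-Real.pi) Real.pi := fun θ hθ =>
    ⟨by linarith [hθ.1], by linarith [hθ.2]⟩
  -- each ray meets `Ω` in a connected set, hence in a single component
  have hbase : ∀ θ ∈ Set.Icc θ₁ θ₂, ∀ r : ℝ, 0 < r →
      ((r : ℂ) * cis θ ∈ base Ω ↔ r₁ θ ≤ r ∧ r ≤ r₂ θ) := by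
    intro θ hθ r hr0
    obtain ⟨h0, h1, h2, -⟩ := hr θ hθ
    refine ⟨fun hb => (h2 r hr0).1 (base_subset hb), fun hrr => ?_⟩
    rw [← hI] at hθ
    obtain ⟨w, hw, rfl⟩ := hθ
    have hwn : 0 < ‖w‖ := norm_pos_iff.2 (fun h0 => h.zero_notMem (h0 ▸ base_subset hw))
    have hw' := (h2 ‖w‖ hwn).1 (by rw [norm_mul_cis_arg]; exact base_subset hw)
    refine subset_base (S := (fun x : ℝ => (x : ℂ) * cis w.arg) '' Set.Icc (r₁ w.arg) (r₂ w.arg))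
      (isPreconnected_Icc.image _ (by fun_prop)) ?_ (u := w) ⟨‖w‖, hw', norm_mul_cis_arg w⟩ hw
      ⟨r, hrr, rfl⟩
    rintro _ ⟨x, hx, rfl⟩
    exact (h2 x (h0.trans_le hx.1)).2 hx
  have hnorm_pos : ∀ u ∈ Ω, 0 < ‖u‖ := fun u hu =>
    norm_pos_iff.2 (fun h0 => h.zero_notMem (h0 ▸ hu))
  have harg : ∀ u ∈ base Ω, u.arg ∈ Set.Icc θ₁ θ₂ := fun u hu => hI ▸ ⟨u, hu, rfl⟩
  have hrange : ∀ u ∈ base Ω, r₁ u.arg ≤ ‖u‖ ∧ ‖u‖ ≤ r₂ u.arg := fun u hu =>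
    (hbase _ (harg u hu) _ (hnorm_pos u (base_subset hu))).1 (by rw [norm_mul_cis_arg]; exact hu)
  have hcompact : IsCompact (base Ω) := isCompact_connectedComponentIn h.isCompact
    h.isCompact.isClosed 1
  have hargc : ∀ K : Set ℂ, IsClosed K → IsClosed (Complex.arg '' (base Ω ∩ K)) := by
    intro K hK
    refine ((hcompact.inter_right hK).image_of_continuousOn fun u hu => ?_).isClosed
    exact (Complex.continuousAt_arg
      (h.mem_slitPlane (base_subset hu.1))).continuousWithinAt
  -- semicontinuity from compactness
  have husc : ∀ θ ∈ Set.Icc θ₁ θ₂, ∀ c, r₂ θ < c → ∀ᶠ t in nhdsWithin θ (Set.Icc θ₁ θ₂),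
      r₂ t < c := by
    intro θ hθ c hc
    have hcl := hargc {u | c ≤ ‖u‖} (isClosed_le continuous_const continuous_norm)
    have hn : θ ∉ Complex.arg '' (base Ω ∩ {u | c ≤ ‖u‖}) := by
      rintro ⟨u, ⟨hu, hcu⟩, rfl⟩
      exact absurd ((hcu.trans (hrange u hu).2)) (not_le.2 hc)
    filter_upwards [nhdsWithin_le_nhds (hcl.isOpen_compl.mem_nhds hn), self_mem_nhdsWithin]
      with t ht htI
    by_contra hge
    push Not at hge
    have h0 := (hr t htI).1.trans_le (hr t htI).2.1
    refine ht ⟨(r₂ t : ℂ) * cis t, ⟨(hbase t htI _ h0).2 ⟨(hr t htI).2.1, le_rfl⟩, ?_⟩,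
      arg_mul_cis h0 (hIoc t htI)⟩
    simpa only [Set.mem_ofPred_eq, norm_mul_cis h0.le] using hge
  have hlsc : ∀ θ ∈ Set.Icc θ₁ θ₂, ∀ c, c < r₁ θ → ∀ᶠ t in nhdsWithin θ (Set.Icc θ₁ θ₂),
      c < r₁ t := by
    intro θ hθ c hc
    have hcl := hargc {u | ‖u‖ ≤ c} (isClosed_le continuous_norm continuous_const)
    have hn : θ ∉ Complex.arg '' (base Ω ∩ {u | ‖u‖ ≤ c}) := by
      rintro ⟨u, ⟨hu, hcu⟩, rfl⟩
      exact absurd ((hrange u hu).1.trans hcu) (not_le.2 hc)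
    filter_upwards [nhdsWithin_le_nhds (hcl.isOpen_compl.mem_nhds hn), self_mem_nhdsWithin]
      with t ht htI
    by_contra hge
    push Not at hge
    have h0 := (hr t htI).1
    refine ht ⟨(r₁ t : ℂ) * cis t, ⟨(hbase t htI _ h0).2 ⟨le_rfl, (hr t htI).2.1⟩, ?_⟩,
      arg_mul_cis h0 (hIoc t htI)⟩
    simpa only [Set.mem_ofPred_eq, norm_mul_cis h0.le] using hge
  -- interior points of the rays are interior to `Ω`
  have hint : ∀ θ ∈ Set.Icc θ₁ θ₂, ∀ r, r₁ θ < r → r < r₂ θ →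
      ∀ᶠ t in nhdsWithin θ (Set.Icc θ₁ θ₂), r₁ t ≤ r ∧ r ≤ r₂ t := by
    intro θ hθ r h1 h2
    have h0 := (hr θ hθ).1.trans h1
    have hm := h.mem_nhds _ (((hr θ hθ).2.2.1 r h0).2 ⟨h1.le, h2.le⟩) ((hr θ hθ).2.2.2 r h1 h2)
    have hc : Continuous fun t => (r : ℂ) * cis t := continuous_const.mul continuous_cis
    filter_upwards [nhdsWithin_le_nhds (hc.tendsto θ hm), self_mem_nhdsWithin] with t ht htI
    exact ((hr t htI).2.2.1 r h0).1 ht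
  have hc₁ : ContinuousOn r₁ (Set.Icc θ₁ θ₂) := by
    intro θ hθ
    refine tendsto_order.2 ⟨hlsc θ hθ, fun c hc => ?_⟩
    rcases (hr θ hθ).2.1.eq_or_lt with heq | hlt
    · filter_upwards [husc θ hθ c (heq ▸ hc), self_mem_nhdsWithin] with t ht htI
      exact (hr t htI).2.1.trans_lt ht
    · obtain ⟨x, hx1, hx2⟩ := exists_between (lt_min hc hlt)
      filter_upwards [hint θ hθ x hx1 (hx2.trans_le (min_le_right _ _))] with t ht
      exact ht.1.trans_lt (hx2.trans_le (min_le_left _ _))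
  have hc₂ : ContinuousOn r₂ (Set.Icc θ₁ θ₂) := by
    intro θ hθ
    refine tendsto_order.2 ⟨fun c hc => ?_, husc θ hθ⟩
    rcases (hr θ hθ).2.1.eq_or_lt with heq | hlt
    · filter_upwards [hlsc θ hθ c (heq ▸ hc), self_mem_nhdsWithin] with t ht htI
      exact ht.trans_le (hr t htI).2.1
    · obtain ⟨x, hx1, hx2⟩ := exists_between (max_lt hc hlt)
      filter_upwards [hint θ hθ x ((le_max_right _ _).trans_lt hx1) hx2] with t ht
      exact ((le_max_left _ _).trans_lt hx1).trans_le ht.2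
  have hinner : ∀ θ ∈ Set.Icc θ₁ θ₂, r₁ θ < r₂ θ → θ₁ < θ ∧ θ < θ₂ := by
    intro θ hθ hlt
    have h0 := (hr θ hθ).1
    have hev := h.eventually_arg_mem_of_lt h0 hlt ((hbase θ hθ _ h0).2 ⟨le_rfl, hlt.le⟩)
      ((hbase θ hθ _ (h0.trans hlt)).2 ⟨hlt.le, le_rfl⟩)
    rw [hI] at hev
    have hev' : ∀ᶠ t in nhds θ, t ∈ Set.Icc θ₁ θ₂ := by
      filter_upwards [hev, Ioc_mem_nhds (show -Real.pi < θ by linarith [hθ.1])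
        (show θ < Real.pi by linarith [hθ.2])] with t ht ht'
      exact ht ht'
    have := mem_interior_iff_mem_nhds.2 (show Set.Icc θ₁ θ₂ ∈ nhds θ from hev')
    rwa [interior_Icc] at this
  have houter : ∀ θ ∈ Set.Icc θ₁ θ₂, r₁ θ = r₂ θ → G (r₁ θ * cis θ) = 0 ∧ θ₁ < θ₂ ∧
      (θ = θ₁ ∨ θ = θ₂) ∧
      ∀ᶠ v in nhds ((r₁ θ : ℂ) * cis θ), v ∈ Ω → v.arg ∈ Set.Icc θ₁ θ₂ := by
    intro θ hθ heq
    have h0 := (hr θ hθ).1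
    have hu := (hbase θ hθ _ h0).2 ⟨le_rfl, heq.le⟩
    obtain ⟨hG, σ, hσ, η, hη, hmem, hnear⟩ := h.exists_side h0
      ⟨by linarith [hθ.1], by linarith [hθ.2]⟩ hu (fun r' hr' hm => by
        have := ((hr θ hθ).2.2.1 r' hr').1 hm
        exact le_antisymm (heq ▸ this.2) this.1)
    rw [hI] at hmem
    refine ⟨hG, ?_⟩
    have hlim : Filter.Tendsto (fun t => (r₁ t : ℂ) * cis t) (nhdsWithin θ (Set.Icc θ₁ θ₂))
        (nhds ((r₁ θ : ℂ) * cis θ)) :=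
      ((Complex.continuous_ofReal.tendsto _).comp (hc₁ θ hθ)).mul
        (continuous_cis.continuousAt.mono_left nhdsWithin_le_nhds)
    have hside : ∀ᶠ t in nhdsWithin θ (Set.Icc θ₁ θ₂), 0 ≤ σ * (t - θ) := by
      filter_upwards [hlim.eventually hnear, self_mem_nhdsWithin] with t ht htI
      have h0' := (hr t htI).1
      have := ht (((hr t htI).2.2.1 _ h0').2 ⟨le_rfl, (hr t htI).2.1⟩)
      rwa [arg_mul_cis h0' (hIoc t htI)] at this
    have hargt : Filter.Tendsto Complex.arg (nhds ((r₁ θ : ℂ) * cis θ)) (nhds θ) := by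
      have := (Complex.continuousAt_arg (h.mem_slitPlane (base_subset hu))).tendsto
      rwa [arg_mul_cis h0 (hIoc θ hθ)] at this
    have hη2 := hmem (η / 2) ⟨by linarith, by linarith⟩
    rcases hσ with rfl | rfl
    · have hθ1 : θ = θ₁ := ?_
      · refine ⟨by linarith [hη2.2, hθ.1], Or.inl hθ1, ?_⟩
        filter_upwards [hnear, hargt (Iio_mem_nhds (show θ < θ₂ by linarith [hη2.2]))]
          with v hv hv' hvΩ
        have := hv hvΩ
        exact ⟨by linarith, hv'.le⟩
      by_contra hne
      have hlt := lt_of_le_of_ne hθ.1 (Ne.symm hne)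
      have hle' : nhdsWithin θ (Set.Ioo θ₁ θ) ≤ nhdsWithin θ (Set.Icc θ₁ θ₂) :=
        nhdsWithin_mono _ (fun t ht => ⟨ht.1.le, ht.2.le.trans hθ.2⟩)
      have : (nhdsWithin θ (Set.Ioo θ₁ θ)).NeBot := right_nhdsWithin_Ioo_neBot hlt
      obtain ⟨t, ht, ht'⟩ := ((hside.filter_mono hle').and self_mem_nhdsWithin).exists
      linarith [ht'.2]
    · have hθ2 : θ = θ₂ := ?_
      · refine ⟨by linarith [hη2.1, hθ.2], Or.inr hθ2, ?_⟩
        filter_upwards [hnear, hargt (Ioi_mem_nhds (show θ₁ < θ by linarith [hη2.1]))]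
          with v hv hv' hvΩ
        have := hv hvΩ
        exact ⟨hv'.le, by linarith⟩
      by_contra hne
      have hlt := lt_of_le_of_ne hθ.2 hne
      have hle' : nhdsWithin θ (Set.Ioo θ θ₂) ≤ nhdsWithin θ (Set.Icc θ₁ θ₂) :=
        nhdsWithin_mono _ (fun t ht => ⟨hθ.1.trans ht.1.le, ht.2.le⟩)
      have : (nhdsWithin θ (Set.Ioo θ θ₂)).NeBot := left_nhdsWithin_Ioo_neBot hlt
      obtain ⟨t, ht, ht'⟩ := ((hside.filter_mono hle').and self_mem_nhdsWithin).exists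
      linarith [ht'.1]
  have hθlt : θ₁ < θ₂ := by
    have h1 := Set.left_mem_Icc.2 hle
    rcases (hr θ₁ h1).2.1.eq_or_lt with heq | hlt
    · exact (houter θ₁ h1 heq).2.1
    · exact absurd (hinner θ₁ h1 hlt).1 (lt_irrefl _)
  refine ⟨θ₁, θ₂, r₁, r₂, hθlt, hπ, hπ', hI, fun θ hθ => (hr θ hθ).1, fun θ hθ => (hr θ hθ).2.1,
    hbase, fun θ hθ => (hr θ hθ).2.2.2, fun θ hθ => ⟨hinner θ hθ, fun hlt => ?_⟩, ?_, ?_, hc₁, hc₂⟩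
  · rcases (hr θ hθ).2.1.eq_or_lt with heq | hlt'
    · rcases (houter θ hθ heq).2.2.1 with rfl | rfl
      · exact absurd hlt.1 (lt_irrefl _)
      · exact absurd hlt.2 (lt_irrefl _)
    · exact hlt'
  · intro u hu hend
    have hI' := harg u hu
    rcases (hr _ hI').2.1.eq_or_lt with heq | hlt
    · have h2 := (houter _ hI' heq).1
      have h3 : ‖u‖ = r₁ u.arg := by rcases hend with h3 | h3 <;> linarith
      rwa [← h3, norm_mul_cis_arg] at h2
    -- a point with `G > 0` is interior, so it is not an end point of its ray
    by_contra hne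
    have hpos := lt_of_le_of_ne (h.nonneg u (base_subset hu)) (Ne.symm hne)
    have hm := h.mem_nhds u (base_subset hu) hpos
    have hc : Filter.Tendsto (fun x : ℝ => (x : ℂ) * cis u.arg) (nhds ‖u‖) (nhds u) := by
      have : Continuous fun x : ℝ => (x : ℂ) * cis u.arg := by fun_prop
      simpa [norm_mul_cis_arg] using this.tendsto ‖u‖
    have hev : ∀ᶠ x : ℝ in nhds ‖u‖, r₁ u.arg ≤ x ∧ x ≤ r₂ u.arg := by
      filter_upwards [hc hm, lt_mem_nhds (hnorm_pos u (base_subset hu))] with x hx hx0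
      exact ((hr _ hI').2.2.1 x hx0).1 hx
    have hmem := mem_interior_iff_mem_nhds.2 (show Set.Icc (r₁ u.arg) (r₂ u.arg) ∈ nhds ‖u‖ from hev)
    rw [interior_Icc] at hmem
    rcases hend with h3 | h3
    · exact absurd hmem.1 (by rw [h3]; exact lt_irrefl _)
    · exact absurd hmem.2 (by rw [h3]; exact lt_irrefl _)
  · intro u hu
    have hI' := harg u hu
    have hev : ∀ᶠ v in nhds u, v ∈ Ω → v.arg ∈ Set.Icc θ₁ θ₂ := by
      rcases (hr _ hI').2.1.eq_or_lt with heq | hlt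
      · have h3 : r₁ u.arg = ‖u‖ := le_antisymm (hrange u hu).1 (heq ▸ (hrange u hu).2)
        have := (houter _ hI' heq).2.2.2
        rwa [h3, norm_mul_cis_arg] at this
      · have hin := hinner _ hI' hlt
        filter_upwards [Complex.continuousAt_arg (h.mem_slitPlane (base_subset hu))
          (Ioo_mem_nhds hin.1 hin.2)] with v hv _
        exact Set.Ioo_subset_Icc_self hv
    filter_upwards [hev] with v hv hvΩ
    have := (hbase _ (hv hvΩ) ‖v‖ (hnorm_pos v hvΩ)).2
      (((hr _ (hv hvΩ)).2.2.1 ‖v‖ (hnorm_pos v hvΩ)).1 (by rwa [norm_mul_cis_arg]))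
    rwa [norm_mul_cis_arg] at this

namespace PolarData

variable {θ₁ θ₂ : ℝ} {r₁ r₂ : ℝ → ℝ}

/-- The height of a point of the sphere over the angle `θ`. -/
noncomputable def height (θ₁ θ₂ θ : ℝ) : ℝ := (2 * θ - θ₁ - θ₂) / (θ₂ - θ₁)

/-- The position of the radius `r` in the interval `[a, b]`, rescaled to `[-1, 1]`. -/
noncomputable def position (a b r : ℝ) : ℝ := (2 * r - a - b) / (b - a)

/-- The map from the double to the sphere: angles become heights, and the two sheets over a ray
become the two halves of a circle of latitude. -/
noncomputable def toSphere (θ₁ θ₂ : ℝ) (r₁ r₂ : ℝ → ℝ) (x : ℂ × ℝ) : EuclideanSpace ℝ (Fin 3) :=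
  !₂[height θ₁ θ₂ x.1.arg,
    Real.sqrt (1 - height θ₁ θ₂ x.1.arg ^ 2) * position (r₁ x.1.arg) (r₂ x.1.arg) ‖x.1‖,
    Real.sqrt (1 - height θ₁ θ₂ x.1.arg ^ 2) *
      (Real.sign x.2 * Real.sqrt (1 - position (r₁ x.1.arg) (r₂ x.1.arg) ‖x.1‖ ^ 2))]

lemma position_sq_le {a b r : ℝ} (ha : a ≤ r) (hb : r ≤ b) : position a b r ^ 2 ≤ 1 := by
  rcases (ha.trans hb).eq_or_lt with h | h
  · simp [position, h]
  · rw [position, div_pow, div_le_one (by have := sub_pos.2 h; positivity)]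
    nlinarith

lemma position_sq_eq_one {a b r : ℝ} (hab : a < b) :
    position a b r ^ 2 = 1 ↔ r = a ∨ r = b := by
  have h : b - a ≠ 0 := (sub_pos.2 hab).ne'
  rw [position, div_pow, div_eq_one_iff_eq (pow_ne_zero 2 h)]
  constructor
  · intro h1
    have : (r - a) * (r - b) = 0 := by nlinarith
    rcases mul_eq_zero.1 this with h2 | h2
    · left; linarith
    · right; linarith
  · rintro (rfl | rfl) <;> ring

lemma arg_mem (P : PolarData G Ω θ₁ θ₂ r₁ r₂) {u : ℂ} (hu : u ∈ base Ω) :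
    u.arg ∈ Set.Icc θ₁ θ₂ := P.image ▸ ⟨u, hu, rfl⟩

lemma norm_mem (P : PolarData G Ω θ₁ θ₂ r₁ r₂) {u : ℂ} (hu : u ∈ base Ω) (h0 : u ≠ 0) :
    r₁ u.arg ≤ ‖u‖ ∧ ‖u‖ ≤ r₂ u.arg :=
  (P.mem_iff _ (P.arg_mem hu) _ (norm_pos_iff.2 h0)).1 (by rwa [norm_mul_cis_arg])

lemma height_sq_le {θ : ℝ} (hθ : θ ∈ Set.Icc θ₁ θ₂) :
    height θ₁ θ₂ θ ^ 2 ≤ 1 := position_sq_le hθ.1 hθ.2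

lemma height_sq_eq_one (P : PolarData G Ω θ₁ θ₂ r₁ r₂) {θ : ℝ} :
    height θ₁ θ₂ θ ^ 2 = 1 ↔ θ = θ₁ ∨ θ = θ₂ := position_sq_eq_one P.lt

lemma height_injective (P : PolarData G Ω θ₁ θ₂ r₁ r₂) {θ θ' : ℝ}
    (h : height θ₁ θ₂ θ = height θ₁ θ₂ θ') : θ = θ' := by
  have h0 : θ₂ - θ₁ ≠ 0 := (sub_pos.2 P.lt).ne'
  rw [height, height, div_left_inj' h0] at h
  linarith

lemma toSphere_mem (P : PolarData G Ω θ₁ θ₂ r₁ r₂) (h0 : (0 : ℂ) ∉ Ω) {x : ℂ × ℝ}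
    (hx : x ∈ double G Ω) : toSphere θ₁ θ₂ r₁ r₂ x ∈ Metric.sphere (0 : EuclideanSpace ℝ (Fin 3)) 1 := by
  have hne : x.1 ≠ 0 := fun h => h0 (h ▸ base_subset hx.1)
  have hθ := P.arg_mem hx.1
  have hn := P.norm_mem hx.1 hne
  rw [mem_sphere_zero_iff_norm, EuclideanSpace.norm_eq, Real.sqrt_eq_one]
  have h1 := height_sq_le hθ
  have h2 := position_sq_le hn.1 hn.2
  simp only [toSphere, Fin.sum_univ_three, Real.norm_eq_abs, sq_abs]
  simp only [Matrix.cons_val_zero, Matrix.cons_val_one, Matrix.cons_val, mul_pow]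
  rw [Real.sq_sqrt (by linarith), Real.sq_sqrt (by linarith)]
  by_cases hδ : x.2 = 0
  · have hG : G x.1 = 0 := by rw [← hx.2, hδ]; norm_num
    rw [hδ, Real.sign_zero]
    rcases (P.le _ hθ).eq_or_lt with heq | hlt
    · have : ¬ (θ₁ < x.1.arg ∧ x.1.arg < θ₂) := fun h => absurd ((P.lt_iff _ hθ).2 h) (by rw [heq]; exact lt_irrefl _)
      have h3 : height θ₁ θ₂ x.1.arg ^ 2 = 1 := by
        rw [P.height_sq_eq_one]
        by_contra hcon
        push Not at hcon
        exact this ⟨lt_of_le_of_ne hθ.1 (Ne.symm hcon.1), lt_of_le_of_ne hθ.2 hcon.2⟩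
      rw [h3]; ring
    · have h3 : position (r₁ x.1.arg) (r₂ x.1.arg) ‖x.1‖ ^ 2 = 1 := by
        rw [position_sq_eq_one hlt]
        by_contra hcon
        push Not at hcon
        have := P.pos_of_mem _ hθ ‖x.1‖ (lt_of_le_of_ne hn.1 (Ne.symm hcon.1))
          (lt_of_le_of_ne hn.2 hcon.2)
        rw [norm_mul_cis_arg, hG] at this
        exact lt_irrefl _ this
      rw [h3]; ring
  · have h3 : Real.sign x.2 ^ 2 = 1 := by
      rcases Real.sign_apply_eq_of_ne_zero _ hδ with h | h <;> rw [h] <;> norm_num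
    rw [h3]; ring

lemma continuousOn_toSphere (P : PolarData G Ω θ₁ θ₂ r₁ r₂) (h : IsRadialRegion G Ω) :
    ContinuousOn (toSphere θ₁ θ₂ r₁ r₂) (double G Ω) := by
  have hne : ∀ x ∈ double G Ω, x.1 ≠ 0 := fun x hx h' => h.zero_notMem (h' ▸ base_subset hx.1)
  have harg : ContinuousOn (fun x : ℂ × ℝ => x.1.arg) (double G Ω) := fun x hx =>
    ((Complex.continuousAt_arg (h.mem_slitPlane (base_subset hx.1))).comp
      continuousAt_fst).continuousWithinAt
  have hmaps : Set.MapsTo (fun x : ℂ × ℝ => x.1.arg) (double G Ω) (Set.Icc θ₁ θ₂) :=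
    fun x hx => P.arg_mem hx.1
  have hheight : ContinuousOn (fun x : ℂ × ℝ => height θ₁ θ₂ x.1.arg) (double G Ω) := by
    have : Continuous (height θ₁ θ₂) := by unfold height; fun_prop
    exact this.comp_continuousOn harg
  have hρ : ContinuousOn (fun x : ℂ × ℝ => Real.sqrt (1 - height θ₁ θ₂ x.1.arg ^ 2))
      (double G Ω) := (continuousOn_const.sub (hheight.pow 2)).sqrt
  have hr₁ := P.continuousOn_left.comp harg hmaps
  have hr₂ := P.continuousOn_right.comp harg hmaps
  have hbd : ∀ x ∈ double G Ω, |position (r₁ x.1.arg) (r₂ x.1.arg) ‖x.1‖| ≤ 1 := fun x hx => by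
    have hn := P.norm_mem hx.1 (hne x hx)
    exact abs_le_one_iff_mul_self_le_one.2 (by rw [← sq]; exact position_sq_le hn.1 hn.2)
  have hsign : ∀ t : ℝ, |Real.sign t| ≤ 1 := fun t => by
    rcases Real.sign_apply_eq t with h | h | h <;> rw [h] <;> norm_num
  have hbd' : ∀ x : ℂ × ℝ, |Real.sign x.2 *
      Real.sqrt (1 - position (r₁ x.1.arg) (r₂ x.1.arg) ‖x.1‖ ^ 2)| ≤
      Real.sqrt (1 - position (r₁ x.1.arg) (r₂ x.1.arg) ‖x.1‖ ^ 2) := fun x => by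
    rw [abs_mul, abs_of_nonneg (Real.sqrt_nonneg _)]
    exact mul_le_of_le_one_left (Real.sqrt_nonneg _) (hsign _)
  have hsq1 : ∀ t : ℝ, Real.sqrt (1 - t ^ 2) ≤ 1 := fun t => by
    rw [Real.sqrt_le_one]; nlinarith [sq_nonneg t]
  -- at the end angles the latitude circle shrinks to a point
  have hend : ∀ (k : ℂ × ℝ → ℝ), (∀ x ∈ double G Ω, |k x| ≤ 1) → ∀ x ∈ double G Ω,
      Real.sqrt (1 - height θ₁ θ₂ x.1.arg ^ 2) = 0 → ContinuousWithinAt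
        (fun x : ℂ × ℝ => Real.sqrt (1 - height θ₁ θ₂ x.1.arg ^ 2) * k x) (double G Ω) x := by
    intro k hk x hx h0
    have h1 := hρ x hx
    unfold ContinuousWithinAt at h1 ⊢
    beta_reduce at h1 ⊢
    rw [h0] at h1 ⊢
    rw [zero_mul]
    refine squeeze_zero_norm' ?_ h1
    filter_upwards [self_mem_nhdsWithin] with y hy
    rw [norm_mul, Real.norm_eq_abs, abs_of_nonneg (Real.sqrt_nonneg _)]
    exact mul_le_of_le_one_right (Real.sqrt_nonneg _) (hk y hy)
  have hlt : ∀ x ∈ double G Ω, Real.sqrt (1 - height θ₁ θ₂ x.1.arg ^ 2) ≠ 0 →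
      r₁ x.1.arg < r₂ x.1.arg := by
    intro x hx h0
    have hθ := P.arg_mem hx.1
    refine (P.lt_iff _ hθ).2 ⟨lt_of_le_of_ne hθ.1 ?_, lt_of_le_of_ne hθ.2 ?_⟩ <;> intro heq <;>
      apply h0
    · rw [(P.height_sq_eq_one).2 (Or.inl heq.symm), sub_self, Real.sqrt_zero]
    · rw [(P.height_sq_eq_one).2 (Or.inr heq), sub_self, Real.sqrt_zero]
  have hpos : ∀ x ∈ double G Ω, r₁ x.1.arg < r₂ x.1.arg → ContinuousWithinAt
      (fun x : ℂ × ℝ => position (r₁ x.1.arg) (r₂ x.1.arg) ‖x.1‖) (double G Ω) x := by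
    intro x hx hx'
    refine ContinuousWithinAt.div ?_ ((hr₂ x hx).sub (hr₁ x hx)) (sub_pos.2 hx').ne'
    exact (((continuous_const.mul (continuous_norm.comp continuous_fst)).continuousWithinAt).sub
      (hr₁ x hx)).sub (hr₂ x hx)
  have h2 : ContinuousOn (fun x : ℂ × ℝ => Real.sqrt (1 - height θ₁ θ₂ x.1.arg ^ 2) *
      position (r₁ x.1.arg) (r₂ x.1.arg) ‖x.1‖) (double G Ω) := by
    intro x hx
    by_cases h0 : Real.sqrt (1 - height θ₁ θ₂ x.1.arg ^ 2) = 0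
    · exact hend _ hbd x hx h0
    · exact (hρ x hx).mul (hpos x hx (hlt x hx h0))
  have h3 : ContinuousOn (fun x : ℂ × ℝ => Real.sqrt (1 - height θ₁ θ₂ x.1.arg ^ 2) *
      (Real.sign x.2 * Real.sqrt (1 - position (r₁ x.1.arg) (r₂ x.1.arg) ‖x.1‖ ^ 2)))
      (double G Ω) := by
    intro x hx
    by_cases h0 : Real.sqrt (1 - height θ₁ θ₂ x.1.arg ^ 2) = 0
    · exact hend _ (fun y _ => (hbd' y).trans (hsq1 _)) x hx h0
    refine (hρ x hx).mul ?_
    have hpx := hpos x hx (hlt x hx h0)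
    have hs : ContinuousWithinAt (fun x : ℂ × ℝ =>
        Real.sqrt (1 - position (r₁ x.1.arg) (r₂ x.1.arg) ‖x.1‖ ^ 2)) (double G Ω) x :=
      (continuousWithinAt_const.sub (hpx.pow 2)).sqrt
    by_cases hδ : x.2 = 0
    · -- where the sheets are glued the last factor vanishes
      have hn := P.norm_mem hx.1 (hne x hx)
      have hs0 : Real.sqrt (1 - position (r₁ x.1.arg) (r₂ x.1.arg) ‖x.1‖ ^ 2) = 0 := by
        have : position (r₁ x.1.arg) (r₂ x.1.arg) ‖x.1‖ ^ 2 = 1 := by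
          rw [position_sq_eq_one (hlt x hx h0)]
          by_contra hcon
          push Not at hcon
          have := P.pos_of_mem _ (P.arg_mem hx.1) ‖x.1‖ (lt_of_le_of_ne hn.1 (Ne.symm hcon.1))
            (lt_of_le_of_ne hn.2 hcon.2)
          rw [norm_mul_cis_arg, ← hx.2, hδ] at this
          norm_num at this
        rw [this, sub_self, Real.sqrt_zero]
      unfold ContinuousWithinAt at hs ⊢
      beta_reduce at hs ⊢
      rw [hs0] at hs ⊢
      rw [mul_zero]
      exact squeeze_zero_norm' (Filter.Eventually.of_forall hbd') hs
    · refine ContinuousWithinAt.mul ?_ hs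
      have hc : ContinuousAt Real.sign x.2 := by
        rcases lt_or_gt_of_ne hδ with hδ | hδ
        · refine (continuousAt_const (y := (-1 : ℝ))).congr ?_
          filter_upwards [gt_mem_nhds hδ] with y hy
          exact (Real.sign_of_neg hy).symm
        · refine (continuousAt_const (y := (1 : ℝ))).congr ?_
          filter_upwards [lt_mem_nhds hδ] with y hy
          exact (Real.sign_of_pos hy).symm
      exact (hc.comp continuousAt_snd).continuousWithinAt
  refine (PiLp.continuous_toLp 2 _).comp_continuousOn (continuousOn_pi.2 fun i => ?_)
  fin_cases i
  · exact hheight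
  · exact h2
  · exact h3

lemma injOn_toSphere (P : PolarData G Ω θ₁ θ₂ r₁ r₂) (h : IsRadialRegion G Ω) :
    Set.InjOn (toSphere θ₁ θ₂ r₁ r₂) (double G Ω) := by
  rintro ⟨u, δ⟩ hx ⟨u', δ'⟩ hx' heq
  have h0 : u ≠ 0 := fun h' => h.zero_notMem (h' ▸ base_subset hx.1)
  have h0' : u' ≠ 0 := fun h' => h.zero_notMem (h' ▸ base_subset hx'.1)
  have e0 := congrArg (fun v : EuclideanSpace ℝ (Fin 3) => v 0) heq
  have e1 := congrArg (fun v : EuclideanSpace ℝ (Fin 3) => v 1) heq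
  have e2 := congrArg (fun v : EuclideanSpace ℝ (Fin 3) => v 2) heq
  simp only [toSphere, Matrix.cons_val_zero, Matrix.cons_val_one, Matrix.cons_val] at e0 e1 e2
  have hθ : u.arg = u'.arg := P.height_injective e0
  have hm := P.arg_mem hx.1
  have hn := P.norm_mem hx.1 h0
  have hn' := P.norm_mem hx'.1 h0'
  simp only at hm hn hn'
  rw [← hθ] at e1 e2 hn'
  have hx2 : δ ^ 2 = G u := hx.2
  have hx2' : δ' ^ 2 = G u' := hx'.2
  have hu : ‖u‖ = ‖u'‖ → u = u' := fun hnn => by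
    rw [← norm_mul_cis_arg u, ← norm_mul_cis_arg u', hnn, hθ]
  rcases (P.le _ hm).eq_or_lt with hr | hr
  · have hnn : ‖u‖ = ‖u'‖ := by linarith [hn.1, hn.2, hn'.1, hn'.2]
    have huu := hu hnn
    have hG := P.eq_zero u hx.1 (Or.inl (by linarith [hn.1, hn.2]))
    rw [← huu, hG] at hx2'
    rw [hG] at hx2
    rw [Prod.mk.injEq]
    exact ⟨huu, by rw [pow_eq_zero_iff two_ne_zero] at hx2 hx2'; rw [hx2, hx2']⟩
  · have hin := (P.lt_iff _ hm).1 hr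
    have hρ : Real.sqrt (1 - height θ₁ θ₂ u.arg ^ 2) ≠ 0 := by
      rw [Real.sqrt_ne_zero']
      have h1 := height_sq_le hm
      rcases h1.eq_or_lt with h2 | h2
      · rcases P.height_sq_eq_one.1 h2 with h3 | h3
        · exact absurd h3 hin.1.ne'
        · exact absurd h3 hin.2.ne
      · linarith
    have e1' := mul_left_cancel₀ hρ e1
    have e2' := mul_left_cancel₀ hρ e2
    have hd : r₂ u.arg - r₁ u.arg ≠ 0 := (sub_pos.2 hr).ne'
    have hnn : ‖u‖ = ‖u'‖ := by
      rw [position, position, div_left_inj' hd] at e1'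
      linarith
    have huu := hu hnn
    rw [← hnn] at e2'
    rw [← huu, ← hx2] at hx2'
    rw [Prod.mk.injEq]
    refine ⟨huu, ?_⟩
    by_cases hs : position (r₁ u.arg) (r₂ u.arg) ‖u‖ ^ 2 = 1
    · have hG := P.eq_zero u hx.1 ((position_sq_eq_one hr).1 hs)
      rw [hx2, hG] at hx2'
      rw [hG] at hx2
      rw [pow_eq_zero_iff two_ne_zero] at hx2 hx2'
      rw [hx2, hx2']
    · have hs' : Real.sqrt (1 - position (r₁ u.arg) (r₂ u.arg) ‖u‖ ^ 2) ≠ 0 := by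
        rw [Real.sqrt_ne_zero']
        have := lt_of_le_of_ne (position_sq_le hn.1 hn.2) hs
        linarith
      have e3 := mul_right_cancel₀ hs' e2'
      rcases sq_eq_sq_iff_eq_or_eq_neg.1 hx2' with h3 | h3
      · exact h3.symm
      · rw [h3, Real.sign_neg] at e3
        have : Real.sign δ = 0 := by linarith
        rw [Real.sign_eq_zero_iff] at this
        rw [h3, this, neg_zero]

lemma surjOn_toSphere (P : PolarData G Ω θ₁ θ₂ r₁ r₂) (h : IsRadialRegion G Ω) :
    Set.SurjOn (toSphere θ₁ θ₂ r₁ r₂) (double G Ω)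
      (Metric.sphere (0 : EuclideanSpace ℝ (Fin 3)) 1) := by
  intro v hv
  rw [mem_sphere_zero_iff_norm, EuclideanSpace.norm_eq, Real.sqrt_eq_one] at hv
  simp only [Fin.sum_univ_three, Real.norm_eq_abs, sq_abs] at hv
  have hd : 0 < θ₂ - θ₁ := sub_pos.2 P.lt
  set θ : ℝ := (θ₁ + θ₂ + v 0 * (θ₂ - θ₁)) / 2 with hθdef
  have hv0 : |v 0| ≤ 1 := by
    rw [← sq_le_one_iff_abs_le_one]; nlinarith [sq_nonneg (v 1), sq_nonneg (v 2)]
  obtain ⟨hv0l, hv0r⟩ := abs_le.1 hv0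
  have hθ : θ ∈ Set.Icc θ₁ θ₂ := by
    constructor <;> simp only [θ] <;> nlinarith
  have hheight : height θ₁ θ₂ θ = v 0 := by
    rw [height, div_eq_iff hd.ne']; simp only [θ]; ring
  have hIoc : θ ∈ Set.Ioc (-Real.pi) Real.pi :=
    ⟨by linarith [hθ.1, P.neg_pi_lt], by linarith [hθ.2, P.lt_pi]⟩
  have key : ∀ r, r₁ θ ≤ r → r ≤ r₂ θ → ((r : ℂ) * cis θ ∈ base Ω ∧
      ((r : ℂ) * cis θ).arg = θ ∧ ‖(r : ℂ) * cis θ‖ = r) := by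
    intro r h1 h2
    have h0 := (P.pos θ hθ).trans_le h1
    exact ⟨(P.mem_iff θ hθ r h0).2 ⟨h1, h2⟩, arg_mul_cis h0 hIoc, norm_mul_cis h0.le θ⟩
  by_cases hend : v 0 ^ 2 = 1
  · have h1 : v 1 = 0 := by nlinarith [sq_nonneg (v 1), sq_nonneg (v 2)]
    have h2 : v 2 = 0 := by nlinarith [sq_nonneg (v 1), sq_nonneg (v 2)]
    obtain ⟨k1, k2, k3⟩ := key (r₁ θ) le_rfl (P.le θ hθ)
    have hG := P.eq_zero _ k1 (Or.inl (by rw [k2, k3]))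
    refine ⟨((r₁ θ : ℂ) * cis θ, 0), ⟨k1, by simp only; rw [hG]; norm_num⟩, ?_⟩
    ext i
    fin_cases i
    · simp [toSphere, k2, hheight]
    · simp [toSphere, k2, hheight, hend, h1]
    · simp [toSphere, h2]
  · have hlt : v 0 ^ 2 < 1 := lt_of_le_of_ne (by nlinarith [sq_nonneg (v 1), sq_nonneg (v 2)]) hend
    have hρ : 0 < Real.sqrt (1 - v 0 ^ 2) := Real.sqrt_pos.2 (by linarith)
    have hρ2 : Real.sqrt (1 - v 0 ^ 2) ^ 2 = 1 - v 0 ^ 2 := Real.sq_sqrt (by linarith)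
    set ρ := Real.sqrt (1 - v 0 ^ 2)
    have hr : r₁ θ < r₂ θ := by
      rw [P.lt_iff θ hθ]
      have hne : ¬ (θ = θ₁ ∨ θ = θ₂) := by
        rw [← P.height_sq_eq_one, hheight]; exact hend
      push Not at hne
      exact ⟨lt_of_le_of_ne hθ.1 (Ne.symm hne.1), lt_of_le_of_ne hθ.2 hne.2⟩
    set s := v 1 / ρ
    have hs : ρ * s = v 1 := by simp only [s]; field_simp
    have hs1 : s ^ 2 ≤ 1 := by
      have : ρ ^ 2 * s ^ 2 ≤ ρ ^ 2 * 1 := by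
        rw [← mul_pow, hs, hρ2]; nlinarith [sq_nonneg (v 2)]
      exact le_of_mul_le_mul_left this (by positivity)
    obtain ⟨hsl, hsr⟩ := abs_le.1 ((sq_le_one_iff_abs_le_one s).1 hs1)
    have hd' : 0 < r₂ θ - r₁ θ := sub_pos.2 hr
    set r : ℝ := (r₁ θ + r₂ θ + s * (r₂ θ - r₁ θ)) / 2
    have hr1 : r₁ θ ≤ r := by simp only [r]; nlinarith
    have hr2 : r ≤ r₂ θ := by simp only [r]; nlinarith
    have hpos : position (r₁ θ) (r₂ θ) r = s := by
      rw [position, div_eq_iff hd'.ne']; simp only [r]; ring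
    obtain ⟨k1, k2, k3⟩ := key r hr1 hr2
    set u := (r : ℂ) * cis θ
    have hG := h.nonneg u (base_subset k1)
    have hv2 : v 2 ^ 2 = ρ ^ 2 * (1 - s ^ 2) := by
      have : ρ ^ 2 * s ^ 2 = v 1 ^ 2 := by rw [← mul_pow, hs]
      linarith
    refine ⟨(u, Real.sign (v 2) * Real.sqrt (G u)), ⟨k1, ?_⟩, ?_⟩
    · simp only [mul_pow, Real.sq_sqrt hG]
      by_cases hz : v 2 = 0
      · have hs2 : s ^ 2 = 1 := by
          rw [hz] at hv2
          have := (mul_eq_zero.1 (hv2.symm.trans (by norm_num))).resolve_left (by positivity)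
          linarith
        have := P.eq_zero u k1 (by rw [k2, k3, ← position_sq_eq_one hr, hpos, hs2])
        rw [this, mul_zero]
      · rcases Real.sign_apply_eq_of_ne_zero _ hz with h3 | h3 <;> rw [h3] <;> norm_num
    · have hthird : Real.sign (Real.sign (v 2) * Real.sqrt (G u)) * Real.sqrt (1 - s ^ 2) * ρ
          = v 2 := by
        have h4 : Real.sqrt (1 - s ^ 2) * ρ = |v 2| := by
          rw [← Real.sqrt_sq_eq_abs, hv2, Real.sqrt_mul (by positivity),
            Real.sqrt_sq hρ.le, mul_comm]
        rw [mul_assoc, h4]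
        by_cases hz : v 2 = 0
        · rw [hz]; simp
        have hs2 : s ^ 2 ≠ 1 := fun hs2 => hz (by
          rw [hs2, sub_self, mul_zero] at hv2; exact pow_eq_zero_iff two_ne_zero |>.1 hv2)
        have hr1' : r₁ θ < r := lt_of_le_of_ne hr1 (fun hh => hs2 (by
          rw [← hpos, position_sq_eq_one hr]; exact Or.inl hh.symm))
        have hr2' : r < r₂ θ := lt_of_le_of_ne hr2 (fun hh => hs2 (by
          rw [← hpos, position_sq_eq_one hr]; exact Or.inr hh))
        have hGp : 0 < Real.sqrt (G u) := Real.sqrt_pos.2 (P.pos_of_mem θ hθ r hr1' hr2')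
        rcases lt_or_gt_of_ne hz with h5 | h5
        · rw [Real.sign_of_neg h5, Real.sign_of_neg (by linarith), abs_of_neg h5]; ring
        · rw [Real.sign_of_pos h5, Real.sign_of_pos (by linarith), abs_of_pos h5]; ring
      ext i
      fin_cases i
      · simp [toSphere, k2, hheight]
      · simp only [toSphere, k2, k3, hheight, hpos]; exact hs
      · simp only [toSphere, k2, k3, hheight, hpos]
        refine Eq.trans ?_ hthird
        show ρ * _ = _
        ring

end PolarData

/-- The double of the base component of a radial region is a 2-sphere, and the base component is
relatively open. -/
theorem double_bijOn_sphere (h : IsRadialRegion G Ω) :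
    (∃ f : ℂ × ℝ → EuclideanSpace ℝ (Fin 3), ContinuousOn f (double G Ω) ∧
      Set.BijOn f (double G Ω) (Metric.sphere 0 1)) ∧
    ∀ u ∈ base Ω, ∀ᶠ v in nhds u, v ∈ Ω → v ∈ base Ω := by
  obtain ⟨θ₁, θ₂, r₁, r₂, P⟩ := h.exists_polarData
  exact ⟨⟨_, P.continuousOn_toSphere h, fun x hx => P.toSphere_mem h.zero_notMem hx,
    P.injOn_toSphere h, P.surjOn_toSphere h⟩, P.eventually_mem⟩

end IsRadialRegion

/-! ### The discriminant of a diagonal -/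

/-- For the diagonal `x` of a matrix `y` in `SU(3)` this is
`|y_{i+1,i+2}|² + |y_{i+2,i+1}|²`. -/
noncomputable def pairSum (x : Fin 3 → ℂ) (i : Fin 3) : ℝ :=
  1 + Complex.normSq (x i) - Complex.normSq (x (i + 1)) - Complex.normSq (x (i + 2))

/-- For the diagonal `x` of a matrix `y` in `SU(3)` this is `y_{i+1,i+2} y_{i+2,i+1}`. -/
noncomputable def pairProd (x : Fin 3 → ℂ) (i : Fin 3) : ℂ := x (i + 1) * x (i + 2) - conj (x i)

/-- For the diagonal `x` of a matrix `y` in `SU(3)` this is the square of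
`|y_{i,i+1}|² - |y_{i+1,i}|²`, which does not depend on `i`. -/
noncomputable def disc (x : Fin 3 → ℂ) : ℝ :=
  (1 - Complex.normSq (x 0) - Complex.normSq (x 1) - Complex.normSq (x 2)) ^ 2 -
    4 * (Complex.normSq (x 0) * Complex.normSq (x 1) + Complex.normSq (x 1) * Complex.normSq (x 2) +
      Complex.normSq (x 2) * Complex.normSq (x 0)) + 8 * (x 0 * x 1 * x 2).re

/-- The conditions on `x` to be the diagonal of a matrix in `SU(3)`. -/
def IsDiagonal (x : Fin 3 → ℂ) : Prop := 0 ≤ disc x ∧ ∀ i, 0 ≤ pairSum x i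

lemma disc_eq (x : Fin 3 → ℂ) (i : Fin 3) :
    disc x = pairSum x i ^ 2 - 4 * Complex.normSq (pairProd x i) := by
  fin_cases i <;>
  · simp only [disc, pairSum, pairProd, Complex.normSq_apply, Complex.mul_re, Complex.mul_im,
      Complex.sub_re, Complex.sub_im, Complex.conj_re, Complex.conj_im, Fin.isValue, Fin.reduceAdd,
      Fin.mk_zero, Fin.mk_one, Fin.reduceFinMk, zero_add]
    ring

lemma pairSum_ne_zero {x : Fin 3 → ℂ} (h : 0 < disc x) (i : Fin 3) : pairSum x i ≠ 0 := by
  intro h0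
  rw [disc_eq x i, h0] at h
  nlinarith [Complex.normSq_nonneg (pairProd x i)]

lemma disc_nonpos_of_pairSum {x : Fin 3 → ℂ} {i : Fin 3} (h : pairSum x i = 0) : disc x ≤ 0 := by
  rw [disc_eq x i, h]
  nlinarith [Complex.normSq_nonneg (pairProd x i)]

lemma normSq_le_one_of_isDiagonal {x : Fin 3 → ℂ} (h : IsDiagonal x) (i : Fin 3) :
    Complex.normSq (x i) ≤ 1 := by
  have h0 := h.2 0
  have h1 := h.2 1
  have h2 := h.2 2
  simp only [pairSum, Fin.isValue, Fin.reduceAdd, zero_add] at h0 h1 h2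
  fin_cases i <;> simp only [Fin.isValue, Fin.mk_zero, Fin.mk_one, Fin.reduceFinMk] <;>
    linarith

/-- A quartic with negative leading coefficient cannot be alternately nonnegative and nonpositive
at five points: its fourth divided difference is the leading coefficient. -/
lemma false_of_five_signs {k₀ k₁ k₂ k₃ k₄ : ℝ} (hk : k₄ < 0) {g : ℝ → ℝ}
    (hg : ∀ t, g t = k₄ * t ^ 4 + k₃ * t ^ 3 + k₂ * t ^ 2 + k₁ * t + k₀) {x₀ x₁ x₂ x₃ x₄ : ℝ}
    (h01 : x₀ < x₁) (h12 : x₁ < x₂) (h23 : x₂ < x₃) (h34 : x₃ < x₄)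
    (h0 : 0 ≤ g x₀) (h1 : g x₁ ≤ 0) (h2 : 0 ≤ g x₂) (h3 : g x₃ ≤ 0) (h4 : 0 ≤ g x₄) : False := by
  -- shift to `x₂ = 0` and use positive gaps
  obtain ⟨a, ha⟩ : ∃ a, a = x₁ - x₀ := ⟨_, rfl⟩
  obtain ⟨b, hb⟩ : ∃ b, b = x₂ - x₁ := ⟨_, rfl⟩
  obtain ⟨c, hc⟩ : ∃ c, c = x₃ - x₂ := ⟨_, rfl⟩
  obtain ⟨d, hd⟩ : ∃ d, d = x₄ - x₃ := ⟨_, rfl⟩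
  have ha' : 0 < a := by linarith
  have hb' : 0 < b := by linarith
  have hc' : 0 < c := by linarith
  have hd' : 0 < d := by linarith
  have e1 : x₁ = x₂ - b := by linarith
  have e0 : x₀ = x₂ - b - a := by linarith
  have e3 : x₃ = x₂ + c := by linarith
  have e4 : x₄ = x₂ + c + d := by linarith
  have key : g x₀ / (a * (a + b) * (a + b + c) * (a + b + c + d)) -
      g x₁ / (a * b * (b + c) * (b + c + d)) + g x₂ / ((a + b) * b * c * (c + d)) -
      g x₃ / ((a + b + c) * (b + c) * c * d) +
      g x₄ / ((a + b + c + d) * (b + c + d) * (c + d) * d) = k₄ := by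
    rw [hg, hg, hg, hg, hg, e0, e1, e3, e4]
    field_simp
    ring
  have p0 : 0 ≤ g x₀ / (a * (a + b) * (a + b + c) * (a + b + c + d)) := by positivity
  have p1 : g x₁ / (a * b * (b + c) * (b + c + d)) ≤ 0 :=
    div_nonpos_of_nonpos_of_nonneg h1 (by positivity)
  have p2 : 0 ≤ g x₂ / ((a + b) * b * c * (c + d)) := by positivity
  have p3 : g x₃ / ((a + b + c) * (b + c) * c * d) ≤ 0 :=
    div_nonpos_of_nonpos_of_nonneg h3 (by positivity)
  have p4 : 0 ≤ g x₄ / ((a + b + c + d) * (b + c + d) * (c + d) * d) := by positivity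
  linarith

lemma false_of_three_signs {k₀ k₁ k₂ : ℝ} (hk : k₂ < 0) {g : ℝ → ℝ}
    (hg : ∀ t, g t = k₂ * t ^ 2 + k₁ * t + k₀) {x₀ x₁ x₂ : ℝ} (h01 : x₀ < x₁) (h12 : x₁ < x₂)
    (h0 : 0 ≤ g x₀) (h1 : g x₁ ≤ 0) (h2 : 0 ≤ g x₂) : False := by
  have key : g x₀ * (x₂ - x₁) - g x₁ * (x₂ - x₀) + g x₂ * (x₁ - x₀) =
      k₂ * ((x₁ - x₀) * (x₂ - x₁) * (x₂ - x₀)) := by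
    rw [hg, hg, hg]; ring
  have p0 : 0 ≤ g x₀ * (x₂ - x₁) := mul_nonneg h0 (by linarith)
  have p1 : g x₁ * (x₂ - x₀) ≤ 0 := mul_nonpos_of_nonpos_of_nonneg h1 (by linarith)
  have p2 : 0 ≤ g x₂ * (x₁ - x₀) := mul_nonneg h2 (by linarith)
  have p3 : 0 < (x₁ - x₀) * (x₂ - x₁) * (x₂ - x₀) :=
    mul_pos (mul_pos (by linarith) (by linarith)) (by linarith)
  nlinarith

/-- The leading coefficient of the discriminant in the direction `y`. -/
noncomputable def discLead (y : Fin 3 → ℂ) : ℝ :=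
  (Complex.normSq (y 0) + Complex.normSq (y 1) + Complex.normSq (y 2)) ^ 2 -
    4 * (Complex.normSq (y 0) * Complex.normSq (y 1) + Complex.normSq (y 1) * Complex.normSq (y 2) +
      Complex.normSq (y 2) * Complex.normSq (y 0))

lemma normSq_add_real_smul (x y : ℂ) (t : ℝ) : Complex.normSq (x + t * y) =
    Complex.normSq y * t ^ 2 + 2 * (conj x * y).re * t + Complex.normSq x := by
  simp only [Complex.normSq_apply, Complex.add_re, Complex.add_im, Complex.mul_re, Complex.mul_im,
    Complex.ofReal_re, Complex.ofReal_im, Complex.conj_re, Complex.conj_im]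
  ring

/-- The gradient of the discriminant: its derivative in the direction `y` is
`re ∑ yᵢ * discGrad x i`. -/
noncomputable def discGrad (x : Fin 3 → ℂ) (i : Fin 3) : ℂ :=
  8 * (pairProd x i + conj (x i) * (pairSum x i / 2 : ℝ))

lemma disc_line (x y : Fin 3 → ℂ) : ∃ k₂ k₃ : ℝ, ∀ t : ℝ, disc (fun i => x i + t * y i) =
    discLead y * t ^ 4 + k₃ * t ^ 3 + k₂ * t ^ 2 + (∑ i, y i * discGrad x i).re * t + disc x := by
  have hre : ∀ t : ℝ, ((x 0 + t * y 0) * (x 1 + t * y 1) * (x 2 + t * y 2)).re =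
      (y 0 * y 1 * y 2).re * t ^ 3 + (x 0 * y 1 * y 2 + y 0 * x 1 * y 2 + y 0 * y 1 * x 2).re * t ^ 2 +
      (y 0 * x 1 * x 2 + x 0 * y 1 * x 2 + x 0 * x 1 * y 2).re * t + (x 0 * x 1 * x 2).re := by
    intro t
    simp only [Complex.add_re, Complex.add_im, Complex.mul_re, Complex.mul_im,
      Complex.ofReal_re, Complex.ofReal_im]
    ring
  have hgrad : (∑ i, y i * discGrad x i).re =
      8 * (y 0 * x 1 * x 2 + x 0 * y 1 * x 2 + x 0 * x 1 * y 2).re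
      - 4 * (1 - Complex.normSq (x 0) - Complex.normSq (x 1) - Complex.normSq (x 2)) *
        ((conj (x 0) * y 0).re + (conj (x 1) * y 1).re + (conj (x 2) * y 2).re)
      - 8 * ((conj (x 0) * y 0).re * (Complex.normSq (x 1) + Complex.normSq (x 2)) +
        (conj (x 1) * y 1).re * (Complex.normSq (x 0) + Complex.normSq (x 2)) +
        (conj (x 2) * y 2).re * (Complex.normSq (x 1) + Complex.normSq (x 0))) := by
    simp only [Fin.sum_univ_three, discGrad, pairSum, pairProd, Complex.add_re, Complex.mul_re,
      Complex.mul_im, Complex.ofReal_re, Complex.ofReal_im, Complex.conj_re, Complex.conj_im,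
      Complex.add_im, Complex.sub_re, Complex.sub_im, Fin.isValue, Fin.reduceAdd, zero_add,
      Complex.re_ofNat, Complex.im_ofNat]
    ring
  set A := Complex.normSq (x 0)
  set B := Complex.normSq (x 1)
  set C := Complex.normSq (x 2)
  set L := Complex.normSq (y 0)
  set M := Complex.normSq (y 1)
  set N := Complex.normSq (y 2)
  set p := (conj (x 0) * y 0).re
  set q := (conj (x 1) * y 1).re
  set r := (conj (x 2) * y 2).re
  refine ⟨4 * (p + q + r) ^ 2 - 2 * (1 - A - B - C) * (L + M + N) -
      4 * (A * M + L * B + 4 * p * q + B * N + M * C + 4 * q * r + C * L + N * A + 4 * r * p) +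
      8 * (x 0 * y 1 * y 2 + y 0 * x 1 * y 2 + y 0 * y 1 * x 2).re,
    4 * (p + q + r) * (L + M + N) - 8 * (p * M + L * q + q * N + M * r + r * L + N * p) +
      8 * (y 0 * y 1 * y 2).re, fun t => ?_⟩
  simp only [disc, discLead]
  rw [hre, hgrad, normSq_add_real_smul, normSq_add_real_smul, normSq_add_real_smul]
  ring

/-- Where two off-diagonal entries vanish the discriminant vanishes to second order. -/
lemma disc_line_of_pairSum {x : Fin 3 → ℂ} {i : Fin 3} (hS : pairSum x i = 0) (hd : 0 ≤ disc x)
    (y : Fin 3 → ℂ) : ∃ k₀ k₁ : ℝ, ∀ t : ℝ, disc (fun i => x i + t * y i) =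
      t ^ 2 * (discLead y * t ^ 2 + k₁ * t + k₀) := by
  have hF : pairProd x i = 0 := by
    rw [disc_eq x i, hS] at hd
    rw [← Complex.normSq_eq_zero]
    linarith [Complex.normSq_nonneg (pairProd x i)]
  obtain ⟨k₂, k₃, hk⟩ := disc_line x y
  have hdx : disc x = 0 := by rw [disc_eq x i, hS, hF]; simp
  -- `disc = pairSum ^ 2 - 4 |pairProd| ^ 2` and both are `O(t)`
  obtain ⟨s₁, s₂, hs⟩ : ∃ s₁ s₂ : ℝ, ∀ t : ℝ, pairSum (fun i => x i + t * y i) i =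
      t * (s₁ + s₂ * t) := by
    refine ⟨2 * (conj (x i) * y i).re - 2 * (conj (x (i + 1)) * y (i + 1)).re -
      2 * (conj (x (i + 2)) * y (i + 2)).re, Complex.normSq (y i) - Complex.normSq (y (i + 1)) -
      Complex.normSq (y (i + 2)), fun t => ?_⟩
    simp only [pairSum] at hS ⊢
    rw [normSq_add_real_smul, normSq_add_real_smul, normSq_add_real_smul]
    linear_combination hS
  obtain ⟨f₁, f₂, hf⟩ : ∃ f₁ f₂ : ℂ, ∀ t : ℝ, pairProd (fun i => x i + t * y i) i =
      t * (f₁ + f₂ * t) := by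
    refine ⟨x (i + 1) * y (i + 2) + y (i + 1) * x (i + 2) - conj (y i), y (i + 1) * y (i + 2),
      fun t => ?_⟩
    simp only [pairProd, map_add, map_mul, Complex.conj_ofReal] at hF ⊢
    linear_combination hF
  have hk1 : (∑ j, y j * discGrad x j).re = 0 := by
    have h1 := fun t : ℝ => (hk t).symm.trans (disc_eq (fun i => x i + t * y i) i)
    simp only [hs, hf, hdx, Complex.normSq_mul, Complex.normSq_ofReal] at h1
    -- both sides are `t` times a function continuous at `0`; compare the limits
    have hlim : ∀ᶠ t : ℝ in nhdsWithin 0 {0}ᶜ, discLead y * t ^ 3 + k₃ * t ^ 2 + k₂ * t +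
        (∑ j, y j * discGrad x j).re =
        t * ((s₁ + s₂ * t) ^ 2 - 4 * Complex.normSq (f₁ + f₂ * t)) := by
      filter_upwards [self_mem_nhdsWithin] with t ht
      have := h1 t
      have ht' : t ≠ 0 := ht
      apply mul_left_cancel₀ ht'
      linear_combination this
    have hc1 : Continuous fun t : ℝ => discLead y * t ^ 3 + k₃ * t ^ 2 + k₂ * t +
        (∑ j, y j * discGrad x j).re := by fun_prop
    have hc2 : Continuous fun t : ℝ =>
        t * ((s₁ + s₂ * t) ^ 2 - 4 * Complex.normSq (f₁ + f₂ * t)) := by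
      have : Continuous Complex.normSq := Complex.continuous_normSq
      fun_prop
    have hl1 := (hc1.tendsto 0).mono_left (nhdsWithin_le_nhds (s := {0}ᶜ))
    have hl2 := (hc2.tendsto 0).mono_left (nhdsWithin_le_nhds (s := {0}ᶜ))
    have := tendsto_nhds_unique (hl1.congr' hlim) hl2
    simpa using this
  refine ⟨k₂, k₃, fun t => ?_⟩
  rw [hk, hk1, hdx]; ring

/-! ### Slices of the set of diagonals by complex lines -/

/-- The point with parameter `u` on the complex line through `v` in the direction `w`. -/
def slicePt (v w : Fin 3 → ℂ) (u : ℂ) : Fin 3 → ℂ := fun i => v i + u * w i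

/-- The part of the complex line that consists of diagonals of matrices in `SU(3)`. -/
def sliceRegion (v w : Fin 3 → ℂ) : Set ℂ := {u | IsDiagonal (slicePt v w u)}

lemma slicePt_line (v w : Fin 3 → ℂ) (O e : ℂ) (t : ℝ) :
    slicePt v w (O + t * e) = fun i => slicePt v w O i + t * (e * w i) := by
  funext i; simp only [slicePt]; ring

lemma continuous_slicePt (v w : Fin 3 → ℂ) : Continuous (slicePt v w) := by
  unfold slicePt; fun_prop

lemma contDiff_normSq : ContDiff ℝ 1 (fun z : ℂ => Complex.normSq z) := by
  have h : (fun z : ℂ => Complex.normSq z) = fun z => Complex.reCLM z * Complex.reCLM z +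
      Complex.imCLM z * Complex.imCLM z := by
    funext z; simp [Complex.normSq_apply]
  rw [h]
  exact (Complex.reCLM.contDiff.mul Complex.reCLM.contDiff).add
    (Complex.imCLM.contDiff.mul Complex.imCLM.contDiff)

lemma contDiff_disc_slicePt (v w : Fin 3 → ℂ) : ContDiff ℝ 1 (fun u => disc (slicePt v w u)) := by
  have hx : ∀ i, ContDiff ℝ 1 (fun u => slicePt v w u i) := fun i => by
    unfold slicePt; fun_prop
  have hn : ∀ i, ContDiff ℝ 1 (fun u => Complex.normSq (slicePt v w u i)) := fun i =>
    contDiff_normSq.comp (hx i)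
  have hr : ContDiff ℝ 1
      (fun u => (slicePt v w u 0 * slicePt v w u 1 * slicePt v w u 2).re) :=
    Complex.reCLM.contDiff.comp (((hx 0).mul (hx 1)).mul (hx 2))
  unfold disc
  exact (((((contDiff_const.sub (hn 0)).sub (hn 1)).sub (hn 2)).pow 2).sub
    (contDiff_const.mul ((((hn 0).mul (hn 1)).add ((hn 1).mul (hn 2))).add
      ((hn 2).mul (hn 0))))).add (contDiff_const.mul hr)

lemma continuous_disc_slicePt (v w : Fin 3 → ℂ) : Continuous (fun u => disc (slicePt v w u)) :=
  (contDiff_disc_slicePt v w).continuous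

lemma continuous_pairSum_slicePt (v w : Fin 3 → ℂ) (i : Fin 3) :
    Continuous (fun u => pairSum (slicePt v w u) i) := by
  have hn : ∀ i, Continuous (fun u => Complex.normSq (slicePt v w u i)) := fun i =>
    Complex.continuous_normSq.comp ((continuous_apply i).comp (continuous_slicePt v w))
  unfold pairSum
  exact ((continuous_const.add (hn i)).sub (hn _)).sub (hn _)

lemma isCompact_sliceRegion {v w : Fin 3 → ℂ} (hw : w 0 ≠ 0) : IsCompact (sliceRegion v w) := by
  refine Metric.isCompact_of_isClosed_isBounded ?_ ?_
  · have : sliceRegion v w = {u | 0 ≤ disc (slicePt v w u)} ∩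
        ⋂ i, {u | 0 ≤ pairSum (slicePt v w u) i} := by
      ext u; simp [sliceRegion, IsDiagonal]
    rw [this]
    exact (isClosed_le continuous_const (continuous_disc_slicePt v w)).inter
      (isClosed_iInter fun i => isClosed_le continuous_const (continuous_pairSum_slicePt v w i))
  · rw [isBounded_iff_forall_norm_le]
    refine ⟨(1 + ‖v 0‖) / ‖w 0‖, fun u hu => ?_⟩
    have h1 := normSq_le_one_of_isDiagonal hu 0
    rw [Complex.normSq_eq_norm_sq, sq_le_one_iff_abs_le_one, abs_norm] at h1
    have h2 : ‖u‖ * ‖w 0‖ ≤ 1 + ‖v 0‖ := by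
      rw [← norm_mul]
      calc ‖u * w 0‖ = ‖slicePt v w u 0 - v 0‖ := by simp [slicePt]
        _ ≤ _ := (norm_sub_le _ _).trans (by linarith)
    rwa [le_div_iff₀ (norm_pos_iff.2 hw)]

lemma mem_nhds_of_pairSum_pos {v w : Fin 3 → ℂ} {u : ℂ}
    (hu : ∀ i, 0 < pairSum (slicePt v w u) i) :
    ∀ᶠ u' in nhds u, 0 ≤ disc (slicePt v w u') → u' ∈ sliceRegion v w := by
  have : ∀ᶠ u' in nhds u, ∀ i, 0 < pairSum (slicePt v w u') i :=
    Filter.eventually_all.2 fun i =>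
      (continuous_pairSum_slicePt v w i).tendsto u (lt_mem_nhds (hu i))
  filter_upwards [this] with u' h1 h2
  exact ⟨h2, fun i => (h1 i).le⟩

/-- The region can only be left through `disc < 0` or through a point where some `pairSum`
vanishes. -/
lemma exists_pairSum_eq_zero {v w : Fin 3 → ℂ} {γ : ℝ → ℂ} (hγ : Continuous γ) {a b : ℝ}
    (hpos : ∀ t ∈ Set.uIcc a b, 0 ≤ disc (slicePt v w (γ t)))
    (ha : γ a ∉ sliceRegion v w) (hb : γ b ∈ sliceRegion v w) :
    ∃ t ∈ Set.uIcc a b, γ t ∈ sliceRegion v w ∧ ∃ i, pairSum (slicePt v w (γ t)) i = 0 := by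
  have hc : ∀ i, Continuous fun t => pairSum (slicePt v w (γ t)) i := fun i =>
    (continuous_pairSum_slicePt v w i).comp hγ
  have h1 : IsClosed {t | ∀ i, 0 ≤ pairSum (slicePt v w (γ t)) i} := by
    simp only [Set.ofPred_forall]
    exact isClosed_iInter fun i => isClosed_le continuous_const (hc i)
  have h2 : IsClosed {t | ∃ i, pairSum (slicePt v w (γ t)) i ≤ 0} := by
    simp only [Set.ofPred_exists]
    exact isClosed_iUnion_of_finite fun i => isClosed_le (hc i) continuous_const
  obtain ⟨t, ht, ht1, i, hi⟩ := isPreconnected_closed_iff.1 (isPreconnected_uIcc (a := a) (b := b))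
    _ _ h1 h2 (fun t _ => by
      by_cases h : ∀ i, 0 ≤ pairSum (slicePt v w (γ t)) i
      · exact Or.inl h
      · push Not at h
        obtain ⟨i, hi⟩ := h
        exact Or.inr ⟨i, hi.le⟩)
    ⟨b, Set.right_mem_uIcc, hb.2⟩
    ⟨a, Set.left_mem_uIcc, by
      by_contra hcon
      apply ha
      refine ⟨hpos a Set.left_mem_uIcc, fun i => ?_⟩
      by_contra hi
      exact hcon ⟨i, (not_le.1 hi).le⟩⟩
  exact ⟨t, ht, ⟨hpos t ht, ht1⟩, i, le_antisymm hi (ht1 i)⟩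

/-- The data for sweeping out a slice by the pencil of lines through a point `O` outside the
region with `disc ≥ 0`. There is at most one point `c` of the region where a `pairSum` vanishes. -/
structure PencilData (v w : Fin 3 → ℂ) (O c : ℂ) : Prop where
  dir_ne_zero : w 0 ≠ 0
  lead_neg : discLead w < 0
  disc_nonneg : 0 ≤ disc (slicePt v w O)
  notMem : O ∉ sliceRegion v w
  unique : ∀ u ∈ sliceRegion v w, (∃ i, pairSum (slicePt v w u) i = 0) → u = c
  extend : c ∈ sliceRegion v w → (∃ i, pairSum (slicePt v w c) i = 0) →
    ∃ t : ℝ, 0 < t ∧ t ≠ 1 ∧ O + t * (c - O) ∈ sliceRegion v w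
  grad_ne_zero : ∀ u ∈ sliceRegion v w, disc (slicePt v w u) = 0 →
    (∀ i, 0 < pairSum (slicePt v w u) i) → ∑ i, w i * discGrad (slicePt v w u) i ≠ 0

lemma discLead_mul (e : ℂ) (w : Fin 3 → ℂ) :
    discLead (fun i => e * w i) = Complex.normSq e ^ 2 * discLead w := by
  simp only [discLead, Complex.normSq_mul]; ring

namespace PencilData

variable {v w : Fin 3 → ℂ} {O c : ℂ}

lemma five (P : PencilData v w O c) {e : ℂ} (he : e ≠ 0) {x₀ x₁ x₂ x₃ x₄ : ℝ}
    (h01 : x₀ < x₁) (h12 : x₁ < x₂) (h23 : x₂ < x₃) (h34 : x₃ < x₄)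
    (h0 : 0 ≤ disc (slicePt v w (O + x₀ * e))) (h1 : disc (slicePt v w (O + x₁ * e)) ≤ 0)
    (h2 : 0 ≤ disc (slicePt v w (O + x₂ * e))) (h3 : disc (slicePt v w (O + x₃ * e)) ≤ 0)
    (h4 : 0 ≤ disc (slicePt v w (O + x₄ * e))) : False := by
  obtain ⟨k₂, k₃, hk⟩ := disc_line (slicePt v w O) (fun i => e * w i)
  have hlead : discLead (fun i => e * w i) < 0 := by
    rw [discLead_mul]
    have := Complex.normSq_pos.2 he
    exact mul_neg_of_pos_of_neg (by positivity) P.lead_neg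
  refine false_of_five_signs (k₀ := disc (slicePt v w O))
    (k₁ := (∑ i, e * w i * discGrad (slicePt v w O) i).re) (k₂ := k₂) (k₃ := k₃) hlead
    (g := fun t => disc (slicePt v w (O + t * e)))
    (fun t => ?_) h01 h12 h23 h34 h0 h1 h2 h3 h4
  rw [slicePt_line, hk]

lemma three (P : PencilData v w O c) {e : ℂ} (he : e ≠ 0) {y x₀ x₁ x₂ : ℝ}
    (hy : O + y * e ∈ sliceRegion v w) (hy' : ∃ i, pairSum (slicePt v w (O + y * e)) i = 0)
    (h01 : x₀ < x₁) (h12 : x₁ < x₂) (hy0 : x₀ ≠ y) (hy1 : x₁ ≠ y) (hy2 : x₂ ≠ y)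
    (h0 : 0 ≤ disc (slicePt v w (O + x₀ * e))) (h1 : disc (slicePt v w (O + x₁ * e)) ≤ 0)
    (h2 : 0 ≤ disc (slicePt v w (O + x₂ * e))) : False := by
  obtain ⟨i, hi⟩ := hy'
  obtain ⟨k₀, k₁, hk⟩ := disc_line_of_pairSum hi hy.1 (fun i => e * w i)
  have hlead : discLead (fun i => e * w i) < 0 := by
    rw [discLead_mul]
    have := Complex.normSq_pos.2 he
    exact mul_neg_of_pos_of_neg (by positivity) P.lead_neg
  have hline : ∀ x : ℝ, disc (slicePt v w (O + x * e)) = (x - y) ^ 2 *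
      (discLead (fun i => e * w i) * (x - y) ^ 2 + k₁ * (x - y) + k₀) := by
    intro x
    rw [← hk, ← slicePt_line]
    congr 2; push_cast; ring
  rw [hline] at h0 h1 h2
  have hsq : ∀ x : ℝ, x ≠ y → 0 < (x - y) ^ 2 := fun x hx => by
    have := sub_ne_zero.2 hx
    positivity
  refine false_of_three_signs hlead
    (g := fun t => discLead (fun i => e * w i) * t ^ 2 + k₁ * t + k₀) (fun t => rfl)
    (x₀ := x₀ - y) (x₁ := x₁ - y) (x₂ := x₂ - y) (by linarith) (by linarith) ?_ ?_ ?_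
  · exact nonneg_of_mul_nonneg_right h0 (hsq _ hy0)
  · exact nonpos_of_mul_nonpos_right h1 (hsq _ hy1)
  · exact nonneg_of_mul_nonneg_right h2 (hsq _ hy2)

/-- Between `O` and a point of the region other than `c` there is a point with `disc ≤ 0`. -/
lemma exists_disc_nonpos (P : PencilData v w O c) {e : ℂ} {t : ℝ}
    (hu : O + t * e ∈ sliceRegion v w) :
    (∃ s : ℝ, 0 < s ∧ s < 1 ∧ disc (slicePt v w (O + (s * t : ℝ) * e)) ≤ 0) ∨
      ((∃ i, pairSum (slicePt v w (O + t * e)) i = 0) ∧ O + t * e = c) := by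
  by_contra hcon
  push Not at hcon
  obtain ⟨h1, h2⟩ := hcon
  obtain ⟨s, hs, hsm, hsz⟩ := exists_pairSum_eq_zero (v := v) (w := w)
    (γ := fun s : ℝ => O + (s * t : ℝ) * e) (by fun_prop) (a := 0) (b := 1) (fun s hs => by
      rw [Set.uIcc_of_le zero_le_one] at hs
      rcases hs.1.eq_or_lt with rfl | h3
      · simpa using P.disc_nonneg
      rcases hs.2.eq_or_lt with rfl | h4
      · simpa using hu.1
      exact (h1 s h3 h4).le) (by simpa using P.notMem) (by simpa using hu)
  rw [Set.uIcc_of_le zero_le_one] at hs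
  have hnp : disc (slicePt v w (O + (s * t : ℝ) * e)) ≤ 0 := by
    obtain ⟨i, hi⟩ := hsz
    exact disc_nonpos_of_pairSum hi
  rcases hs.1.eq_or_lt with h3 | h3
  · rw [← h3] at hsm
    exact P.notMem (by simpa using hsm)
  rcases hs.2.eq_or_lt with h4 | h4
  · rw [h4, one_mul] at hsz hsm
    exact h2 hsz (P.unique _ hsm hsz)
  · exact absurd (h1 s h3 h4) (not_lt.2 hnp)

lemma disc_pos_between (P : PencilData v w O c) {e : ℂ} {t s : ℝ} (he : e ≠ 0)
    (h1 : O + (1 : ℝ) * e ∈ sliceRegion v w) (h2 : O + t * e ∈ sliceRegion v w) (hs1 : 1 < s)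
    (hst : s < t) : 0 < disc (slicePt v w (O + s * e)) := by
  by_contra hneg
  push Not at hneg
  rcases P.exists_disc_nonpos h1 with ⟨s', hs0, hs1', hd⟩ | ⟨hz, -⟩
  · rw [mul_one] at hd
    exact P.five he (x₀ := 0) (x₁ := s') (x₂ := 1) (x₃ := s) (x₄ := t) hs0 hs1' hs1 hst
      (by simpa using P.disc_nonneg) hd h1.1 hneg h2.1
  · exact P.three he (y := 1) (x₀ := 0) (x₁ := s) (x₂ := t) h1 hz (by linarith) hst (by norm_num)
      (by linarith) (by linarith) (by simpa using P.disc_nonneg) hneg h2.1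

lemma segment_mem (P : PencilData v w O c) {e : ℂ} {t s : ℝ} (he : e ≠ 0)
    (h1 : O + (1 : ℝ) * e ∈ sliceRegion v w) (h2 : O + t * e ∈ sliceRegion v w) (hs1 : 1 < s)
    (hst : s < t) : O + s * e ∈ sliceRegion v w := by
  by_contra hcon
  have hγ : Continuous fun x : ℝ => O + (x : ℂ) * e := by fun_prop
  obtain ⟨x, hx, hxm, hxz⟩ := exists_pairSum_eq_zero (v := v) (w := w) hγ (a := s) (b := t)
    (fun x hx => by
      rw [Set.uIcc_of_le hst.le] at hx
      rcases hx.2.eq_or_lt with rfl | h4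
      · exact h2.1
      · exact (P.disc_pos_between he h1 h2 (hs1.trans_le hx.1) h4).le) hcon h2
  obtain ⟨y, hy, hym, hyz⟩ := exists_pairSum_eq_zero (v := v) (w := w) hγ (a := s) (b := 1)
    (fun x hx => by
      rw [Set.uIcc_of_ge hs1.le] at hx
      rcases hx.1.eq_or_lt with rfl | h4
      · exact h1.1
      · exact (P.disc_pos_between he h1 h2 h4 (hx.2.trans_lt hst)).le) hcon h1
  rw [Set.uIcc_of_le hst.le] at hx
  rw [Set.uIcc_of_ge hs1.le] at hy
  have hxy := (P.unique _ hxm hxz).trans (P.unique _ hym hyz).symm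
  have hxy' : x = y := by
    have := mul_right_cancel₀ he (add_left_cancel hxy)
    exact_mod_cast this
  have hxs : x = s := le_antisymm (hxy' ▸ hy.2) hx.1
  rw [hxs] at hxm
  exact hcon hxm

lemma not_opposite (P : PencilData v w O c) {e : ℂ} {t : ℝ} (he : e ≠ 0) (ht : 0 < t)
    (h1 : O + (1 : ℝ) * e ∈ sliceRegion v w) (h2 : O + (-t : ℝ) * e ∈ sliceRegion v w) :
    False := by
  have h0 : 0 ≤ disc (slicePt v w (O + (0 : ℝ) * e)) := by simpa using P.disc_nonneg
  rcases P.exists_disc_nonpos h1 with ⟨s, hs0, hs1, hd⟩ | ⟨hz, hc⟩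
  · rw [mul_one] at hd
    rcases P.exists_disc_nonpos h2 with ⟨s', hs0', hs1', hd'⟩ | ⟨hz', -⟩
    · exact P.five he (x₀ := -t) (x₁ := s' * -t) (x₂ := 0) (x₃ := s) (x₄ := 1) (by nlinarith)
        (by nlinarith) hs0 hs1 h2.1 hd' h0 hd h1.1
    · exact P.three he (y := -t) (x₀ := 0) (x₁ := s) (x₂ := 1) h2 hz' hs0 hs1 (by linarith)
        (by linarith) (by linarith) h0 hd h1.1
  · rcases P.exists_disc_nonpos h2 with ⟨s', hs0', hs1', hd'⟩ | ⟨-, hc'⟩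
    · exact P.three he (y := 1) (x₀ := -t) (x₁ := s' * -t) (x₂ := 0) h1 hz (by nlinarith)
        (by nlinarith) (by linarith) (by nlinarith) (by norm_num) h2.1 hd' h0
    · have := mul_right_cancel₀ he (add_left_cancel (hc.trans hc'.symm))
      have h3 : (1 : ℝ) = -t := by exact_mod_cast this
      linarith

lemma fderiv_ne_zero {u e : ℂ} (he : e ≠ 0)
    (hg : ∑ i, w i * discGrad (slicePt v w u) i ≠ 0) {z : ℂ} (hz : O + z * e = u) :
    fderiv ℝ (fun z : ℂ => disc (slicePt v w (O + z * e))) z ≠ 0 := by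
  intro h0
  set Γ := ∑ i, w i * discGrad (slicePt v w u) i
  have hsm : ContDiff ℝ 1 (fun z : ℂ => disc (slicePt v w (O + z * e))) :=
    (contDiff_disc_slicePt v w).comp (by fun_prop)
  -- differentiate in the direction in which the derivative is `|Γ|²`
  set d := conj Γ / e
  have hd : HasDerivAt (fun t : ℝ => disc (slicePt v w (O + (z + t * d) * e))) 0 0 := by
    have h1 : HasDerivAt (fun t : ℝ => z + (t : ℂ) * d) d 0 := by
      simpa using ((Complex.ofRealCLM.hasDerivAt (x := (0 : ℝ))).mul_const d).const_add z
    have h2 : HasFDerivAt (fun z : ℂ => disc (slicePt v w (O + z * e)))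
        (fderiv ℝ (fun z : ℂ => disc (slicePt v w (O + z * e))) z) (z + ((0 : ℝ) : ℂ) * d) := by
      simpa using (hsm.differentiable (by norm_num) z).hasFDerivAt
    have := h2.comp_hasDerivAt (0 : ℝ) h1
    rw [h0] at this
    exact this
  obtain ⟨k₂, k₃, hk⟩ := disc_line (slicePt v w u) (fun i => conj Γ * w i)
  have hline : ∀ t : ℝ, disc (slicePt v w (O + (z + t * d) * e)) =
      discLead (fun i => conj Γ * w i) * t ^ 4 + k₃ * t ^ 3 + k₂ * t ^ 2 +
        (∑ i, conj Γ * w i * discGrad (slicePt v w u) i).re * t + disc (slicePt v w u) := by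
    intro t
    rw [← hk, ← slicePt_line, ← hz]
    congr 2
    simp only [d]
    field_simp
    ring
  have hd' : HasDerivAt (fun t : ℝ => discLead (fun i => conj Γ * w i) * t ^ 4 + k₃ * t ^ 3 +
      k₂ * t ^ 2 + (∑ i, conj Γ * w i * discGrad (slicePt v w u) i).re * t + disc (slicePt v w u))
      (∑ i, conj Γ * w i * discGrad (slicePt v w u) i).re 0 := by
    have h4 := ((hasDerivAt_pow 4 (0 : ℝ)).const_mul (discLead (fun i => conj Γ * w i)))
    have h3 := ((hasDerivAt_pow 3 (0 : ℝ)).const_mul k₃)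
    have h2 := ((hasDerivAt_pow 2 (0 : ℝ)).const_mul k₂)
    have h1 := ((hasDerivAt_id (0 : ℝ)).const_mul
      (∑ i, conj Γ * w i * discGrad (slicePt v w u) i).re)
    simpa using (((h4.add h3).add h2).add h1).add_const (disc (slicePt v w u))
  have hval := hd'.unique (hd.congr_of_eventuallyEq
    (Filter.Eventually.of_forall fun t => (hline t).symm))
  have hΓ : ∑ i, conj Γ * w i * discGrad (slicePt v w u) i = (Complex.normSq Γ : ℂ) := by
    rw [Complex.normSq_eq_conj_mul_self, Finset.mul_sum]
    exact Finset.sum_congr rfl fun i _ => mul_assoc _ _ _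
  rw [hΓ, Complex.ofReal_re, Complex.normSq_eq_zero] at hval
  exact hg hval

/-- The pencil through `O` makes the slice, in the coordinate centred at `O`, a radial region. -/
theorem isRadialRegion (P : PencilData v w O c) {u₀ : ℂ} (hu₀ : u₀ ∈ sliceRegion v w) :
    IsRadialRegion (fun z : ℂ => disc (slicePt v w (O + z * (u₀ - O))))
      {z : ℂ | O + z * (u₀ - O) ∈ sliceRegion v w} := by
  have hne : u₀ - O ≠ 0 := fun h => P.notMem (sub_eq_zero.1 h ▸ hu₀)
  set e₀ := u₀ - O
  have hcont : Continuous fun z : ℂ => O + z * e₀ := by fun_prop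
  have he : ∀ z : ℂ, O + z * e₀ ∈ sliceRegion v w → z * e₀ ≠ 0 := fun z hz h0 =>
    P.notMem (by simpa [h0] using hz)
  have hnhds : ∀ z : ℂ, O + z * e₀ ∈ sliceRegion v w → 0 < disc (slicePt v w (O + z * e₀)) →
      {z : ℂ | O + z * e₀ ∈ sliceRegion v w} ∈ nhds z := by
    intro z hz hpos
    have h1 := mem_nhds_of_pairSum_pos (v := v) (w := w) (u := O + z * e₀) fun i =>
      lt_of_le_of_ne (hz.2 i) (pairSum_ne_zero hpos i).symm
    have h2 : ∀ᶠ z' in nhds z, 0 < disc (slicePt v w (O + z' * e₀)) :=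
      ((continuous_disc_slicePt v w).comp hcont).tendsto z (lt_mem_nhds hpos)
    filter_upwards [hcont.tendsto z h1, h2] with z' h3 h4
    exact h3 h4.le
  refine ⟨?_, ?_, ?_, ?_, fun z hz => hz.1, hnhds, ?_, ?_, ?_⟩
  · have hcl : IsClosed {z : ℂ | O + z * e₀ ∈ sliceRegion v w} :=
      (isCompact_sliceRegion P.dir_ne_zero).isClosed.preimage hcont
    have himg : {z : ℂ | O + z * e₀ ∈ sliceRegion v w} =
        (fun u => (u - O) / e₀) '' sliceRegion v w := by
      ext z
      constructor
      · intro hz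
        exact ⟨_, hz, by field_simp; ring⟩
      · rintro ⟨u, hu, rfl⟩
        show O + (u - O) / e₀ * e₀ ∈ sliceRegion v w
        rwa [div_mul_cancel₀ _ hne, add_sub_cancel]
    rw [himg]
    exact (isCompact_sliceRegion P.dir_ne_zero).image (by fun_prop)
  · exact (contDiff_disc_slicePt v w).comp (by fun_prop)
  · show O + 1 * e₀ ∈ sliceRegion v w
    simpa [e₀] using hu₀
  · show ¬ (O + 0 * e₀ ∈ sliceRegion v w)
    simpa using P.notMem
  · intro z hz t ht s hs hst
    have h1 : O + ((1 : ℝ) : ℂ) * (z * e₀) ∈ sliceRegion v w := by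
      rw [Complex.ofReal_one, one_mul]; exact hz
    have h2 : O + (t : ℂ) * (z * e₀) ∈ sliceRegion v w := by rw [← mul_assoc]; exact ht
    have h3 := P.segment_mem (he z hz) h1 h2 hs hst
    have h4 := P.disc_pos_between (he z hz) h1 h2 hs hst
    rw [← mul_assoc] at h3 h4
    exact ⟨h3, h4⟩
  · intro z hz t ht hm
    refine P.not_opposite (he z hz) ht (by rw [Complex.ofReal_one, one_mul]; exact hz) ?_
    rw [← mul_assoc, Complex.ofReal_neg]; exact hm
  · intro z hz
    by_cases hpos : 0 < disc (slicePt v w (O + z * e₀))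
    · left
      have hc : Filter.Tendsto (fun t : ℝ => (t : ℂ) * z) (nhds 1) (nhds z) := by
        have : Continuous fun t : ℝ => (t : ℂ) * z := by fun_prop
        simpa using this.tendsto 1
      have h1 : ∀ᶠ t : ℝ in nhds 1, (t : ℂ) * z ∈ {z : ℂ | O + z * e₀ ∈ sliceRegion v w} :=
        hc (hnhds z hz hpos)
      have h2 : ∀ᶠ t : ℝ in nhdsWithin 1 (Set.Ioi 1),
          (t : ℂ) * z ∈ {z : ℂ | O + z * e₀ ∈ sliceRegion v w} :=
        h1.filter_mono nhdsWithin_le_nhds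
      obtain ⟨t, ht, ht'⟩ := (h2.and self_mem_nhdsWithin).exists
      have ht1 : 1 < t := ht'
      exact ⟨t, by linarith, ht1.ne', ht⟩
    have h0 : disc (slicePt v w (O + z * e₀)) = 0 := le_antisymm (not_lt.1 hpos) hz.1
    by_cases hz0 : ∃ i, pairSum (slicePt v w (O + z * e₀)) i = 0
    · left
      have hcz := P.unique _ hz hz0
      obtain ⟨t, ht, ht1, hm⟩ := P.extend (hcz ▸ hz) (hcz ▸ hz0)
      refine ⟨t, ht, ht1, ?_⟩
      show O + (t : ℂ) * z * e₀ ∈ sliceRegion v w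
      rw [← hcz] at hm
      simpa [mul_assoc] using hm
    · right
      push Not at hz0
      have hpos' : ∀ i, 0 < pairSum (slicePt v w (O + z * e₀)) i := fun i =>
        lt_of_le_of_ne (hz.2 i) (hz0 i).symm
      refine ⟨fderiv_ne_zero hne (P.grad_ne_zero _ hz h0 hpos') rfl, ?_⟩
      exact hcont.tendsto z (mem_nhds_of_pairSum_pos hpos')

end PencilData

/-! ### Slices of fixed spectra -/

/-- The characteristic polynomial `T³ - s T² + s̄ T - 1` of a matrix in `SU(3)` of trace `s` has a
multiple root. -/
def HasDoubleRoot (s : ℂ) : Prop :=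
  ∃ κ : ℂ, κ ^ 3 - s * κ ^ 2 + conj s * κ - 1 = 0 ∧ 3 * κ ^ 2 - 2 * s * κ + conj s = 0

/-- Three distinct eigenvalues of a matrix in `SU(3)`. -/
structure IsRegularSpectrum (l : Fin 3 → ℂ) : Prop where
  conj_mul : ∀ i, conj (l i) * l i = 1
  prod : l 0 * l 1 * l 2 = 1
  injective : Function.Injective l

/-- The direction in which a diagonal `x` may vary while `∑ xᵢ` and `∑ lᵢ xᵢ` are fixed. -/
def specDir (l : Fin 3 → ℂ) (i : Fin 3) : ℂ := l (i + 1) - l (i + 2)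

/-- `abc + (1 - |a|² - |b|² - |c|²) / 2` for the diagonal `(a, b, c)`. -/
noncomputable def discMid (x : Fin 3 → ℂ) : ℂ := x 0 * x 1 * x 2 +
  ((1 - Complex.normSq (x 0) - Complex.normSq (x 1) - Complex.normSq (x 2)) / 2 : ℝ)

lemma discMid_sq (x : Fin 3 → ℂ) :
    discMid x ^ 2 = pairProd x 0 * pairProd x 1 * pairProd x 2 + (disc x / 4 : ℝ) := by
  apply Complex.ext <;>
  · simp only [discMid, pairProd, disc, Complex.normSq_apply, Complex.add_re, Complex.mul_re,
      Complex.mul_im, Complex.ofReal_re, Complex.ofReal_im, Complex.conj_re, Complex.conj_im,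
      Complex.add_im, Complex.sub_re, Complex.sub_im, Fin.isValue, Fin.reduceAdd, zero_add, pow_two]
    ring

lemma discMid_eq (x : Fin 3 → ℂ) (i : Fin 3) :
    discMid x = (pairSum x i / 2 : ℝ) + x i * pairProd x i := by
  fin_cases i <;>
  · apply Complex.ext <;>
    · simp only [discMid, pairProd, pairSum, Complex.normSq_apply, Complex.add_re, Complex.mul_re,
        Complex.mul_im, Complex.ofReal_re, Complex.ofReal_im, Complex.conj_re, Complex.conj_im,
        Complex.add_im, Complex.sub_re, Complex.sub_im, Fin.isValue, Fin.reduceAdd, Fin.zero_eta,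
        Fin.mk_one, Fin.reduceFinMk, zero_add]
      ring

/-- `|y₀₁ y₁₂ y₂₀|² = |y₀₁|² |y₁₂|² |y₂₀|²` in terms of the diagonal of `y`. -/
lemma normSq_discMid_add (x : Fin 3 → ℂ) {d : ℝ} (hd : d ^ 2 = disc x) :
    Complex.normSq (discMid x + (d / 2 : ℝ)) = (pairSum x 0 + d) / 2 * ((pairSum x 1 + d) / 2) *
      ((pairSum x 2 + d) / 2) := by
  have h1 : Complex.normSq (x 0 * x 1 * x 2) =
      Complex.normSq (x 0) * Complex.normSq (x 1) * Complex.normSq (x 2) := by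
    rw [Complex.normSq_mul, Complex.normSq_mul]
  have h2 : discMid x + (d / 2 : ℝ) = x 0 * x 1 * x 2 +
      ((1 - Complex.normSq (x 0) - Complex.normSq (x 1) - Complex.normSq (x 2) + d) / 2 : ℝ) := by
    rw [discMid]; push_cast; ring
  rw [h2, Complex.normSq_add, h1, Complex.conj_ofReal, Complex.re_mul_ofReal, Complex.normSq_ofReal]
  simp only [disc] at hd
  simp only [pairSum, Fin.isValue, Fin.reduceAdd, zero_add]
  linear_combination
    -(1 - Complex.normSq (x 0) - Complex.normSq (x 1) - Complex.normSq (x 2) + d) / 8 * hd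

lemma normSq_pairProd {x : Fin 3 → ℂ} (hd : disc x = 0) (i : Fin 3) :
    Complex.normSq (pairProd x i) = (pairSum x i / 2) ^ 2 := by
  have := disc_eq x i
  rw [hd] at this
  linarith

/-- A critical diagonal all of whose off-diagonal phases agree belongs to a symmetric matrix which
differs from a scalar by a matrix of rank one. -/
lemma hasDoubleRoot_of_phase {x : Fin 3 → ℂ} (hd : disc x = 0) (hs : ∀ i, 0 < pairSum x i) {ξ : ℂ}
    (hξ : ∀ i, pairProd x i = (pairSum x i / 2 : ℝ) * ξ) : HasDoubleRoot (∑ i, x i) := by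
  have hp : ∀ i, ((pairSum x i / 2 : ℝ) : ℂ) ≠ 0 := fun i => by
    have := hs i
    exact_mod_cast (by positivity : pairSum x i / 2 ≠ 0)
  have hξ0 : ξ ≠ 0 := by
    rintro rfl
    have := normSq_pairProd hd 0
    rw [hξ, mul_zero, map_zero] at this
    have h0 := hs 0
    nlinarith
  have hF : ∀ i, pairProd x i ≠ 0 := fun i => by rw [hξ]; exact mul_ne_zero (hp i) hξ0
  obtain ⟨κ, hκ⟩ : ∃ κ, κ * ξ = -1 := ⟨-ξ⁻¹, by field_simp⟩
  have hpF : ∀ i, ((pairSum x i / 2 : ℝ) : ℂ) = -κ * pairProd x i := fun i => by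
    rw [hξ]; linear_combination ((pairSum x i / 2 : ℝ) : ℂ) * hκ
  have hm : ∀ i, discMid x = pairProd x i * (x i - κ) := fun i => by
    rw [discMid_eq x i, hpF]; ring
  have hm2 : discMid x ^ 2 = pairProd x 0 * pairProd x 1 * pairProd x 2 := by
    rw [discMid_sq, hd]; simp
  have hm0 : discMid x ≠ 0 := fun h => by
    rw [h] at hm2
    exact mul_ne_zero (mul_ne_zero (hF 0) (hF 1)) (hF 2) (by rw [← hm2]; ring)
  have hX : discMid x = (x 0 - κ) * (x 1 - κ) * (x 2 - κ) := by
    apply mul_left_cancel₀ (pow_ne_zero 2 hm0)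
    calc discMid x ^ 2 * discMid x = discMid x * discMid x * discMid x := by ring
      _ = _ := by
        rw [hm2]
        nth_rewrite 1 [hm 0]; nth_rewrite 1 [hm 1]; rw [hm 2]; ring
  have hXi : ∀ i, x i - κ ≠ 0 := fun i h => hm0 (by rw [hm i, h, mul_zero])
  have hF0 : pairProd x 0 = (x 1 - κ) * (x 2 - κ) := mul_right_cancel₀ (hXi 0) (by
    rw [← hm 0, hX]; ring)
  have hF1 : pairProd x 1 = (x 2 - κ) * (x 0 - κ) := mul_right_cancel₀ (hXi 1) (by
    rw [← hm 1, hX]; ring)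
  have hF2 : pairProd x 2 = (x 0 - κ) * (x 1 - κ) := mul_right_cancel₀ (hXi 2) (by
    rw [← hm 2, hX])
  have hp0 := hpF 0
  rw [hF0] at hp0
  simp only [pairProd, Fin.isValue, Fin.reduceAdd, zero_add] at hF0 hF1 hF2
  simp only [pairSum, Fin.isValue, zero_add] at hp0
  push_cast [Complex.normSq_eq_conj_mul_self] at hp0
  refine ⟨κ, ?_, ?_⟩
  · simp only [Fin.sum_univ_three, map_add]
    linear_combination -2 * hp0 - (κ + x 0) * hF0 + (x 1 - κ) * hF1 + (x 2 - κ) * hF2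
  · simp only [Fin.sum_univ_three, map_add]
    linear_combination -hF0 - hF1 - hF2

lemma normSq_eq_one_iff {z : ℂ} : Complex.normSq z = 1 ↔ conj z * z = 1 := by
  rw [← Complex.normSq_eq_conj_mul_self]
  exact_mod_cast Iff.rfl

namespace IsRegularSpectrum

variable {l : Fin 3 → ℂ}

lemma ne_zero (hl : IsRegularSpectrum l) (i : Fin 3) : l i ≠ 0 := fun h => by
  simpa [h] using hl.conj_mul i

lemma normSq_eq_one (hl : IsRegularSpectrum l) (i : Fin 3) : Complex.normSq (l i) = 1 :=
  normSq_eq_one_iff.2 (hl.conj_mul i)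

lemma conj_eq (hl : IsRegularSpectrum l) (i : Fin 3) : conj (l i) = l (i + 1) * l (i + 2) := by
  apply mul_right_cancel₀ (hl.ne_zero i)
  rw [hl.conj_mul, ← hl.prod]
  fin_cases i <;> simp <;> ring

lemma specDir_ne_zero (hl : IsRegularSpectrum l) (i : Fin 3) : specDir l i ≠ 0 := fun h => by
  have := hl.injective (sub_eq_zero.1 h)
  fin_cases i <;> simp at this

lemma conj_specDir (hl : IsRegularSpectrum l) (i : Fin 3) :
    conj (specDir l i) = - (l i * specDir l i) := by
  simp only [specDir, map_sub, hl.conj_eq]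
  fin_cases i <;> simp <;> ring

lemma im_specDir_ne_zero (hl : IsRegularSpectrum l) :
    (specDir l 0 * conj (specDir l 1)).im ≠ 0 := by
  intro h
  have h3 := Complex.conj_eq_iff_im.2 h
  rw [map_mul, Complex.conj_conj, hl.conj_specDir, hl.conj_specDir] at h3
  have h4 : (l 0 - l 1) * (specDir l 0 * specDir l 1) = 0 := by linear_combination -h3
  rcases mul_eq_zero.1 h4 with h5 | h5
  · have := hl.injective (sub_eq_zero.1 h5)
    simp at this
  · exact mul_ne_zero (hl.specDir_ne_zero 0) (hl.specDir_ne_zero 1) h5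

lemma discLead_specDir_neg (hl : IsRegularSpectrum l) : discLead (specDir l) < 0 := by
  have hsum : specDir l 2 = -specDir l 0 - specDir l 1 := by
    simp only [specDir, Fin.isValue, Fin.reduceAdd]; ring
  have h1 : discLead (specDir l) = -4 * (specDir l 0 * conj (specDir l 1)).im ^ 2 := by
    simp only [discLead, hsum, Complex.normSq_apply, Complex.mul_im, Complex.conj_re,
      Complex.conj_im, Complex.sub_re, Complex.sub_im, Complex.neg_re, Complex.neg_im]
    ring
  have h2 := hl.im_specDir_ne_zero
  rw [h1]
  have : 0 < (specDir l 0 * conj (specDir l 1)).im ^ 2 := by positivity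
  linarith

end IsRegularSpectrum

lemma mul_sub_eq_zero_of_sums {w₀ w₁ w₂ l₀ l₁ l₂ x₀ x₁ x₂ y₀ y₁ y₂ : ℂ} (hw : w₀ + w₁ + w₂ = 0)
    (hlw : l₀ * w₀ + l₁ * w₁ + l₂ * w₂ = 0) (hx : w₀ * x₀ + w₁ * x₁ + w₂ * x₂ = 0)
    (hy : l₀ * w₀ * y₀ + l₁ * w₁ * y₁ + l₂ * w₂ * y₂ = 0) (h0 : y₀ * x₀ = 1) (h1 : y₁ * x₁ = 1)
    (h2 : y₂ * x₂ = 1) : w₁ * (x₁ - x₀) * (l₁ * y₁ - l₂ * y₂) = 0 := by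
  linear_combination l₂ * y₂ * x₀ * hw + hlw - l₂ * y₂ * hx - x₀ * hy + l₀ * w₀ * h0
    + l₁ * w₁ * h1 + l₂ * w₂ * h2

/-- If `∑ wᵢ ξᵢ = 0` with unimodular `ξᵢ`, then the `ξᵢ` agree or the `l̄ᵢ ξᵢ` do. -/
lemma phases_of_sum_eq_zero {l : Fin 3 → ℂ} (hl : IsRegularSpectrum l) {ξ : Fin 3 → ℂ}
    (hξ : ∀ i, conj (ξ i) * ξ i = 1) (h : ∑ i, specDir l i * ξ i = 0) :
    (∃ ζ, ∀ i, ξ i = ζ) ∨ ∃ ζ, ∀ i, conj (l i) * ξ i = ζ := by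
  have hc : ∑ i, l i * specDir l i * conj (ξ i) = 0 := by
    have := congrArg conj h
    simp only [map_sum, map_mul, hl.conj_specDir, map_zero] at this
    simp only [Fin.sum_univ_three] at this ⊢
    linear_combination -this
  simp only [Fin.sum_univ_three] at h hc
  have hw : specDir l 0 + specDir l 1 + specDir l 2 = 0 := by
    simp only [specDir, Fin.isValue, Fin.reduceAdd, zero_add]; ring
  have hlw : l 0 * specDir l 0 + l 1 * specDir l 1 + l 2 * specDir l 2 = 0 := by
    simp only [specDir, Fin.isValue, Fin.reduceAdd, zero_add]; ring
  have k0 := mul_sub_eq_zero_of_sums hw hlw h hc (hξ 0) (hξ 1) (hξ 2)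
  have k1 := mul_sub_eq_zero_of_sums (w₀ := specDir l 1) (w₁ := specDir l 2) (w₂ := specDir l 0)
    (l₀ := l 1) (l₁ := l 2) (l₂ := l 0) (x₀ := ξ 1) (x₁ := ξ 2) (x₂ := ξ 0)
    (by linear_combination hw) (by linear_combination hlw) (by linear_combination h)
    (by linear_combination hc) (hξ 1) (hξ 2) (hξ 0)
  by_cases h01 : ξ 1 = ξ 0
  · left
    have h2 : specDir l 2 * (ξ 2 - ξ 0) = 0 := by
      rw [h01] at h; linear_combination h - ξ 0 * hw
    have h3 := sub_eq_zero.1 ((mul_eq_zero.1 h2).resolve_left (hl.specDir_ne_zero 2))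
    exact ⟨ξ 0, fun i => by fin_cases i <;> simp [h01, h3]⟩
  · right
    have h12 : ξ 2 - ξ 1 ≠ 0 := fun h12 => by
      have h2 : specDir l 0 * (ξ 1 - ξ 0) = 0 := by
        linear_combination -h + ξ 1 * hw + specDir l 2 * h12
      rcases mul_eq_zero.1 h2 with h3 | h3
      · exact hl.specDir_ne_zero 0 h3
      · exact h01 (sub_eq_zero.1 h3)
    have e1 : l 1 * conj (ξ 1) = l 2 * conj (ξ 2) := sub_eq_zero.1
      ((mul_eq_zero.1 k0).resolve_left (mul_ne_zero (hl.specDir_ne_zero 1) (sub_ne_zero.2 h01)))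
    have e2 : l 2 * conj (ξ 2) = l 0 * conj (ξ 0) := sub_eq_zero.1
      ((mul_eq_zero.1 k1).resolve_left (mul_ne_zero (hl.specDir_ne_zero 2) h12))
    have c1 := congrArg conj e1
    have c2 := congrArg conj e2
    simp only [map_mul, Complex.conj_conj] at c1 c2
    refine ⟨conj (l 0) * ξ 0, fun i => ?_⟩
    fin_cases i
    · rfl
    · exact c1.trans c2
    · exact c2

lemma pairSum_mul {l : Fin 3 → ℂ} (hl : IsRegularSpectrum l) (x : Fin 3 → ℂ) (i : Fin 3) :
    pairSum (fun i => l i * x i) i = pairSum x i := by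
  simp only [pairSum, Complex.normSq_mul, hl.normSq_eq_one, one_mul]

lemma pairProd_mul {l : Fin 3 → ℂ} (hl : IsRegularSpectrum l) (x : Fin 3 → ℂ) (i : Fin 3) :
    pairProd (fun i => l i * x i) i = conj (l i) * pairProd x i := by
  simp only [pairProd, map_mul, hl.conj_eq]; ring

/-- At a critical point of the boundary of a slice one of the two matrices `y`, `l y` has a
multiple eigenvalue. -/
lemma hasDoubleRoot_of_critical {l : Fin 3 → ℂ} (hl : IsRegularSpectrum l) {x : Fin 3 → ℂ}
    (hd : disc x = 0) (hs : ∀ i, 0 < pairSum x i) (h : ∑ i, specDir l i * discGrad x i = 0) :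
    HasDoubleRoot (∑ i, x i) ∨ HasDoubleRoot (∑ i, l i * x i) := by
  have hp : ∀ i, ((pairSum x i / 2 : ℝ) : ℂ) ≠ 0 := fun i => by
    have := hs i
    exact_mod_cast (by positivity : pairSum x i / 2 ≠ 0)
  have hF : ∀ i, conj (pairProd x i) * pairProd x i = ((pairSum x i / 2 : ℝ) : ℂ) ^ 2 := fun i => by
    rw [← Complex.normSq_eq_conj_mul_self, normSq_pairProd hd, Complex.ofReal_pow]
  obtain ⟨ξ, hξ⟩ : ∃ ξ : Fin 3 → ℂ, ∀ i, pairProd x i = (pairSum x i / 2 : ℝ) * ξ i :=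
    ⟨fun i => pairProd x i / (pairSum x i / 2 : ℝ), fun i => by rw [mul_div_cancel₀ _ (hp i)]⟩
  have hξ1 : ∀ i, conj (ξ i) * ξ i = 1 := fun i => by
    have := hF i
    rw [hξ, map_mul, Complex.conj_ofReal] at this
    apply mul_left_cancel₀ (pow_ne_zero 2 (hp i))
    linear_combination this
  have hm0 : discMid x ≠ 0 := fun h0 => by
    have := discMid_sq x
    rw [h0, hd, hξ, hξ, hξ, zero_div, Complex.ofReal_zero] at this
    have h1 : ∀ i, ξ i ≠ 0 := fun i h => by simpa [h] using hξ1 i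
    exact mul_ne_zero (mul_ne_zero (mul_ne_zero (hp 0) (h1 0)) (mul_ne_zero (hp 1) (h1 1)))
      (mul_ne_zero (hp 2) (h1 2)) (by linear_combination -this)
  have hgrad : ∀ i, discGrad x i = 8 * conj (discMid x) * ξ i := fun i => by
    rw [discGrad, discMid_eq x i, hξ, map_add, map_mul, map_mul, Complex.conj_ofReal]
    linear_combination -8 * conj (x i) * (pairSum x i / 2 : ℝ) * hξ1 i
  have hsum : ∑ i, specDir l i * ξ i = 0 := by
    have h1 : ∑ i, specDir l i * discGrad x i =
        8 * conj (discMid x) * ∑ i, specDir l i * ξ i := by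
      rw [Finset.mul_sum]
      exact Finset.sum_congr rfl fun i _ => by rw [hgrad]; ring
    rw [h1] at h
    refine (mul_eq_zero.1 h).resolve_left (mul_ne_zero (by norm_num) ?_)
    simpa using hm0
  rcases phases_of_sum_eq_zero hl hξ1 hsum with ⟨ζ, hζ⟩ | ⟨ζ, hζ⟩
  · left
    exact hasDoubleRoot_of_phase hd hs fun i => by rw [hξ, hζ]
  · right
    refine hasDoubleRoot_of_phase (x := fun i => l i * x i) (ξ := ζ) ?_ ?_ fun i => ?_
    · rw [disc_eq _ 0, pairSum_mul hl, pairProd_mul hl, Complex.normSq_mul, Complex.normSq_conj,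
        hl.normSq_eq_one, one_mul, ← disc_eq x 0, hd]
    · simpa only [pairSum_mul hl] using hs
    · rw [pairProd_mul hl, pairSum_mul hl, hξ, ← hζ i]; ring

/-- A slice on which the spectra of `y` and of `l y` are fixed and simple, and such that a common
eigenvector of `y` and `l` is fixed by both. -/
structure IsRegularSlice (l v : Fin 3 → ℂ) : Prop extends IsRegularSpectrum l where
  not_hasDoubleRoot : ¬ HasDoubleRoot (∑ i, v i)
  not_hasDoubleRoot' : ¬ HasDoubleRoot (∑ i, l i * v i)
  eq_one : ∀ u ∈ sliceRegion v (specDir l), ∀ i,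
    Complex.normSq (slicePt v (specDir l) u i) = 1 → l i = 1 ∧ slicePt v (specDir l) u i = 1

lemma sum_slicePt (l v : Fin 3 → ℂ) (u : ℂ) : ∑ i, slicePt v (specDir l) u i = ∑ i, v i := by
  simp only [slicePt, specDir, Fin.sum_univ_three, Fin.isValue, Fin.reduceAdd, zero_add]; ring

lemma sum_mul_slicePt (l v : Fin 3 → ℂ) (u : ℂ) :
    ∑ i, l i * slicePt v (specDir l) u i = ∑ i, l i * v i := by
  simp only [slicePt, specDir, Fin.sum_univ_three, Fin.isValue, Fin.reduceAdd, zero_add]; ring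

/-- Where two off-diagonal entries vanish there is a diagonal entry of modulus one. -/
lemma IsDiagonal.exists_normSq_eq_one {x : Fin 3 → ℂ} (h : IsDiagonal x) {i : Fin 3}
    (hi : pairSum x i = 0) : ∃ j, Complex.normSq (x j) = 1 := by
  have hF : pairProd x i = 0 := by
    have := h.1
    rw [disc_eq x i, hi] at this
    rw [← Complex.normSq_eq_zero]
    linarith [Complex.normSq_nonneg (pairProd x i)]
  have h1 : Complex.normSq (x (i + 1)) * Complex.normSq (x (i + 2)) = Complex.normSq (x i) := by
    rw [← Complex.normSq_mul, sub_eq_zero.1 hF, Complex.normSq_conj]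
  rw [pairSum] at hi
  have h2 : (Complex.normSq (x (i + 1)) - 1) * (Complex.normSq (x (i + 2)) - 1) = 0 := by
    linear_combination h1 + hi
  rcases mul_eq_zero.1 h2 with h3 | h3
  · exact ⟨_, sub_eq_zero.1 h3⟩
  · exact ⟨_, sub_eq_zero.1 h3⟩

/-- If a diagonal entry is `1`, the two others are conjugate to each other. -/
lemma IsDiagonal.eq_conj {x : Fin 3 → ℂ} (h : IsDiagonal x) {i : Fin 3} (hi : x i = 1) :
    x (i + 2) = conj (x (i + 1)) ∧ pairSum x (i + 1) = 0 ∧ pairSum x (i + 2) = 0 := by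
  have e1 : i + 1 + 2 = i := by fin_cases i <;> rfl
  have e2 : i + 1 + 1 = i + 2 := by fin_cases i <;> rfl
  have e3 : i + 2 + 1 = i := by fin_cases i <;> rfl
  have e4 : i + 2 + 2 = i + 1 := by fin_cases i <;> rfl
  have h1 := h.2 (i + 1)
  have h2 := h.2 (i + 2)
  have h3 : pairSum x (i + 1) = 0 := by
    simp only [pairSum, e1, e2, e3, e4, hi, map_one] at h1 h2 ⊢
    linarith
  refine ⟨?_, h3, ?_⟩
  · have := h.1
    rw [disc_eq x (i + 1), h3] at this
    have h4 : pairProd x (i + 1) = 0 := by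
      rw [← Complex.normSq_eq_zero]
      linarith [Complex.normSq_nonneg (pairProd x (i + 1))]
    rw [pairProd, e1, e2, hi, mul_one] at h4
    exact sub_eq_zero.1 h4
  · simp only [pairSum, e1, e2, e3, e4, hi, map_one] at h3 ⊢
    linarith

namespace IsRegularSlice

variable {l v : Fin 3 → ℂ}

lemma grad_ne_zero (hl : IsRegularSlice l v) (u : ℂ) (hd : disc (slicePt v (specDir l) u) = 0)
    (hs : ∀ i, 0 < pairSum (slicePt v (specDir l) u) i) :
    ∑ i, specDir l i * discGrad (slicePt v (specDir l) u) i ≠ 0 := fun h => by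
  rcases hasDoubleRoot_of_critical hl.toIsRegularSpectrum hd hs h with h1 | h1
  · rw [sum_slicePt] at h1; exact hl.not_hasDoubleRoot h1
  · rw [sum_mul_slicePt] at h1; exact hl.not_hasDoubleRoot' h1

lemma eq_of_pairSum (hl : IsRegularSlice l v) {u u' : ℂ} (hu : u ∈ sliceRegion v (specDir l))
    (hu' : u' ∈ sliceRegion v (specDir l)) (h : ∃ i, pairSum (slicePt v (specDir l) u) i = 0)
    (h' : ∃ i, pairSum (slicePt v (specDir l) u') i = 0) : u = u' := by
  obtain ⟨i, hi⟩ := h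
  obtain ⟨i', hi'⟩ := h'
  obtain ⟨j, hj⟩ := IsDiagonal.exists_normSq_eq_one hu hi
  obtain ⟨j', hj'⟩ := IsDiagonal.exists_normSq_eq_one hu' hi'
  obtain ⟨a1, a2⟩ := hl.eq_one u hu j hj
  obtain ⟨b1, b2⟩ := hl.eq_one u' hu' j' hj'
  have e : j = j' := hl.injective (a1.trans b1.symm)
  subst e
  have := a2.trans b2.symm
  simp only [slicePt, add_right_inj] at this
  exact mul_right_cancel₀ (hl.specDir_ne_zero j) this

/-- If the slice contains a point where two off-diagonal entries vanish, the centre of the pencil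
is chosen near this point, on the line through it along which the matrix remains real. -/
lemma exists_pencilData_of_pairSum (hl : IsRegularSlice l v) {c : ℂ}
    (hc : c ∈ sliceRegion v (specDir l)) {i : Fin 3}
    (hi : pairSum (slicePt v (specDir l) c) i = 0) : ∃ O, PencilData v (specDir l) O c := by
  obtain ⟨j, hj⟩ := hc.exists_normSq_eq_one hi
  obtain ⟨hlj, hxj⟩ := hl.eq_one c hc j hj
  have e1 : j + 1 + 2 = j := by fin_cases j <;> rfl
  have e2 : j + 1 + 1 = j + 2 := by fin_cases j <;> rfl
  have e3 : j + 2 + 1 = j := by fin_cases j <;> rfl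
  have e4 : j + 2 + 2 = j + 1 := by fin_cases j <;> rfl
  have hwj := hl.specDir_ne_zero j
  have hl12 : l (j + 1) * l (j + 2) = 1 := by rw [← hl.conj_eq, hlj, map_one]
  obtain ⟨hconj, -, -⟩ := hc.eq_conj hxj
  set X : ℝ → Fin 3 → ℂ := fun s => slicePt v (specDir l) (c + s / specDir l j) with hX
  have hX0 : ∀ s k, X s k = slicePt v (specDir l) c k + s * (specDir l k / specDir l j) := by
    intro s k; simp only [hX, slicePt]; ring
  have hXj : ∀ s, X s j = ((1 + s : ℝ) : ℂ) := fun s => by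
    rw [hX0, hxj, div_self hwj]; push_cast; ring
  have hXc : ∀ s, X s (j + 2) = conj (X s (j + 1)) := fun s => by
    rw [hX0, hX0, map_add, hconj, map_mul, Complex.conj_ofReal, map_div₀, hl.conj_specDir,
      hl.conj_specDir, hlj]
    have : specDir l (j + 2) = l (j + 1) * specDir l (j + 1) := by
      simp only [specDir, e1, e2, e3, e4, hlj]
      linear_combination -hl12
    rw [this]
    field_simp
  have hXn : ∀ s, Complex.normSq (X s (j + 2)) = Complex.normSq (X s (j + 1)) := fun s => by
    rw [hXc, Complex.normSq_conj]
  have hp1 : ∀ s, pairSum (X s) (j + 1) = 1 - (1 + s) ^ 2 := fun s => by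
    simp only [pairSum, e1, e2, hXn, hXj, Complex.normSq_ofReal]; ring
  have hp2 : ∀ s, pairSum (X s) (j + 2) = 1 - (1 + s) ^ 2 := fun s => by
    simp only [pairSum, e3, e4, hXn, hXj, Complex.normSq_ofReal]; ring
  have hp0 : ∀ s, pairSum (X s) j = 1 + (1 + s) ^ 2 - 2 * Complex.normSq (X s (j + 1)) := fun s => by
    simp only [pairSum, hXn, hXj, Complex.normSq_ofReal]; ring
  have hdisc : ∀ s, disc (X s) = s ^ 2 * ((2 + s) ^ 2 - 4 * Complex.normSq (X s (j + 1))) :=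
    fun s => by
    have h1 : pairProd (X s) (j + 1) = conj (X s (j + 1)) * (s : ℝ) := by
      simp only [pairProd, e1, e2, hXj, hXc]; push_cast; ring
    rw [disc_eq _ (j + 1), hp1, h1, Complex.normSq_mul, Complex.normSq_conj, Complex.normSq_ofReal]
    ring
  have hlt : Complex.normSq (X 0 (j + 1)) < 1 := by
    have h0 : X 0 = slicePt v (specDir l) c := by simp [hX]
    rw [h0]
    refine lt_of_le_of_ne (normSq_le_one_of_isDiagonal hc _) fun h => ?_
    have := hl.injective (hlj.trans (hl.eq_one c hc (j + 1) h).1.symm)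
    fin_cases j <;> simp at this
  have hcont : Continuous fun s => Complex.normSq (X s (j + 1)) := by
    have h1 : Continuous fun s : ℝ => X s (j + 1) := by simp only [hX0]; fun_prop
    exact Complex.continuous_normSq.comp h1
  have hev : ∀ᶠ s in nhds (0 : ℝ), 0 < (2 + s) ^ 2 - 4 * Complex.normSq (X s (j + 1)) ∧
      0 < 1 + (1 + s) ^ 2 - 2 * Complex.normSq (X s (j + 1)) ∧ s < 1 := by
    refine Filter.Eventually.and ?_ (Filter.Eventually.and ?_ (gt_mem_nhds one_pos))
    · have h1 : Continuous fun s => (2 + s) ^ 2 - 4 * Complex.normSq (X s (j + 1)) := by fun_prop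
      exact h1.tendsto 0 (lt_mem_nhds (by norm_num; linarith))
    · have h1 : Continuous fun s => 1 + (1 + s) ^ 2 - 2 * Complex.normSq (X s (j + 1)) := by
        fun_prop
      exact h1.tendsto 0 (lt_mem_nhds (by norm_num; linarith))
  have hev' := (by simpa using (continuous_neg (G := ℝ)).tendsto 0 :
    Filter.Tendsto (fun s : ℝ => -s) (nhds 0) (nhds 0)).eventually hev
  obtain ⟨s, ⟨⟨h1, h2, hs1⟩, h3, h4, -⟩, hs⟩ := (((hev.and hev').filter_mono
    (nhdsWithin_le_nhds (s := Set.Ioi 0))).and self_mem_nhdsWithin).exists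
  have hs0 : 0 < s := hs
  refine ⟨c + s / specDir l j, hl.specDir_ne_zero 0, hl.discLead_specDir_neg, ?_, ?_, ?_, ?_, ?_⟩
  · show 0 ≤ disc (X s)
    rw [hdisc]; positivity
  · intro hmem
    have h5 : 0 ≤ pairSum (X s) (j + 1) := hmem.2 (j + 1)
    rw [hp1] at h5
    nlinarith
  · exact fun u hu hz => hl.eq_of_pairSum hu hc hz ⟨i, hi⟩
  · intro _ _
    refine ⟨2, two_pos, by norm_num, ?_⟩
    have h5 : c + (s : ℂ) / specDir l j + ((2 : ℝ) : ℂ) * (c - (c + s / specDir l j)) =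
        c + ((-s : ℝ) : ℂ) / specDir l j := by push_cast; ring
    rw [h5]
    have hd : 0 < disc (X (-s)) := by
      rw [hdisc]; exact mul_pos (by rw [neg_sq]; positivity) h3
    refine ⟨hd.le, fun k => ?_⟩
    show 0 ≤ pairSum (X (-s)) k
    have hk : k = j ∨ k = j + 1 ∨ k = j + 2 := by
      clear * -
      fin_cases j <;> fin_cases k <;> simp
    rcases hk with rfl | rfl | rfl
    · rw [hp0]; exact h4.le
    · rw [hp1]; nlinarith
    · rw [hp2]; nlinarith
  · exact fun u _ hd hs => hl.grad_ne_zero u hd hs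

/-- If no off-diagonal entry vanishes on the slice, a centre of the pencil exists because
`discMid ^ 2 - disc / 4`, suitably modified on the slice, would otherwise be a nowhere vanishing
function on the plane which is asymptotic to `u ^ 6`. -/
lemma exists_disc_nonneg_notMem (hl : IsRegularSlice l v)
    (h : ∀ u ∈ sliceRegion v (specDir l), ∀ i, pairSum (slicePt v (specDir l) u) i ≠ 0) :
    ∃ O, 0 ≤ disc (slicePt v (specDir l) O) ∧ O ∉ sliceRegion v (specDir l) := by
  by_contra hcon
  push Not at hcon
  set x := slicePt v (specDir l)
  have hpos : ∀ u, 0 ≤ disc (x u) → ∀ i, 0 < pairSum (x u) i := fun u hu i =>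
    lt_of_le_of_ne ((hcon u hu).2 i) (h u (hcon u hu) i).symm
  have hneg : ∀ u, discMid (x u) ^ 2 - (disc (x u) / 4 : ℝ) =
      pairProd (x u) 0 * pairProd (x u) 1 * pairProd (x u) 2 := fun u => by
    rw [discMid_sq]; ring
  set H : ℂ → ℂ := fun u => (discMid (x u) + (Real.sqrt (disc (x u)) / 2 : ℝ)) ^ 2 +
    (max (-disc (x u)) 0 / 4 : ℝ) with hH
  have hHneg : ∀ u, disc (x u) < 0 → H u = pairProd (x u) 0 * pairProd (x u) 1 * pairProd (x u) 2 := by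
    intro u hu
    rw [← hneg, hH]
    simp only [Real.sqrt_eq_zero_of_nonpos hu.le, max_eq_left (neg_nonneg.2 hu.le)]
    push_cast; ring
  have hxc : ∀ i, Continuous fun u => x u i := fun i =>
    (continuous_apply i).comp (continuous_slicePt v (specDir l))
  have hdc : Continuous fun u => disc (x u) := continuous_disc_slicePt v (specDir l)
  have hmc : Continuous fun u => discMid (x u) := by
    have := Complex.continuous_normSq
    have h0 := hxc 0
    have h1 := hxc 1
    have h2 := hxc 2
    simp only [discMid]
    fun_prop
  have hHc : Continuous H := by
    have h1 : Continuous fun u => Real.sqrt (disc (x u)) := Real.continuous_sqrt.comp hdc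
    have h2 : Continuous fun u => max (-disc (x u)) 0 := hdc.neg.max continuous_const
    simp only [hH]
    fun_prop
  have hH0 : ∀ u, H u ≠ 0 := by
    intro u
    rcases lt_or_ge (disc (x u)) 0 with hu | hu
    · have hF : ∀ i, pairProd (x u) i ≠ 0 := fun i h0 => by
        rw [disc_eq _ i, h0, map_zero] at hu
        nlinarith [sq_nonneg (pairSum (x u) i)]
      rw [hHneg u hu]
      exact mul_ne_zero (mul_ne_zero (hF 0) (hF 1)) (hF 2)
    · have h1 : H u = (discMid (x u) + (Real.sqrt (disc (x u)) / 2 : ℝ)) ^ 2 := by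
        simp only [hH, max_eq_right (neg_nonpos.2 hu)]; simp
      rw [h1]
      refine pow_ne_zero 2 fun h0 => ?_
      have h2 := normSq_discMid_add (x u) (Real.sq_sqrt hu)
      rw [h0, map_zero] at h2
      have hs := Real.sqrt_nonneg (disc (x u))
      have p0 := hpos u hu 0
      have p1 := hpos u hu 1
      have p2 := hpos u hu 2
      have : 0 < (pairSum (x u) 0 + Real.sqrt (disc (x u))) / 2 *
        ((pairSum (x u) 1 + Real.sqrt (disc (x u))) / 2) *
        ((pairSum (x u) 2 + Real.sqrt (disc (x u))) / 2) := by positivity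
      linarith
  have hinv : Filter.Tendsto (fun u : ℂ => u⁻¹) (Filter.cocompact ℂ) (nhds 0) :=
    Filter.tendsto_inv₀_cobounded.mono_left (by rw [Metric.cobounded_eq_cocompact])
  have hne0 : ∀ᶠ u : ℂ in Filter.cocompact ℂ, u ≠ 0 :=
    (isCompact_singleton (x := (0 : ℂ))).compl_mem_cocompact
  have hlim : ∀ i, Filter.Tendsto (fun u => pairProd (x u) i / u ^ 2) (Filter.cocompact ℂ)
      (nhds (specDir l (i + 1) * specDir l (i + 2))) := by
    intro i
    have h1 : ∀ k, Filter.Tendsto (fun u : ℂ => v k * u⁻¹ + specDir l k) (Filter.cocompact ℂ)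
        (nhds (specDir l k)) := fun k => by
      simpa using (hinv.const_mul (v k)).add_const (specDir l k)
    have h2 : Filter.Tendsto (fun u : ℂ => conj (x u i) / u ^ 2) (Filter.cocompact ℂ) (nhds 0) := by
      rw [tendsto_zero_iff_norm_tendsto_zero]
      have h3 : Filter.Tendsto (fun u : ℂ => ‖v i * u⁻¹ + specDir l i‖ * ‖u⁻¹‖)
          (Filter.cocompact ℂ) (nhds 0) := by
        simpa using (h1 i).norm.mul hinv.norm
      refine h3.congr' ?_
      filter_upwards [hne0] with u hu
      rw [norm_div, RCLike.norm_conj, ← norm_mul, ← norm_div]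
      congr 1
      show _ = (v i + u * specDir l i) / u ^ 2
      field_simp
    have h4 := ((h1 (i + 1)).mul (h1 (i + 2))).sub h2
    rw [sub_zero] at h4
    refine h4.congr' ?_
    filter_upwards [hne0] with u hu
    simp only [pairProd]
    rw [sub_div]
    congr 1
    show _ = (v (i + 1) + u * specDir l (i + 1)) * (v (i + 2) + u * specDir l (i + 2)) / u ^ 2
    field_simp
  have hfin : Filter.Tendsto (fun u => H u / u ^ 6) (Filter.cocompact ℂ)
      (nhds (specDir l 1 * specDir l 2 * (specDir l 2 * specDir l 0) *
        (specDir l 0 * specDir l 1))) := by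
    have h1 := ((hlim 0).mul (hlim 1)).mul (hlim 2)
    refine h1.congr' ?_
    filter_upwards [hne0, (isCompact_sliceRegion (v := v)
      (hl.specDir_ne_zero 0)).compl_mem_cocompact] with u hu hu'
    have h2 : disc (x u) < 0 := by
      by_contra h3
      exact hu' (hcon u (not_lt.1 h3))
    rw [hHneg u h2]
    field_simp
  have w0 := hl.specDir_ne_zero 0
  have w1 := hl.specDir_ne_zero 1
  have w2 := hl.specDir_ne_zero 2
  exact false_of_tendsto_div_pow hHc hH0 (n := 6) (by norm_num)
    (mul_ne_zero (mul_ne_zero (mul_ne_zero w1 w2) (mul_ne_zero w2 w0)) (mul_ne_zero w0 w1)) hfin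

theorem exists_pencilData (hl : IsRegularSlice l v) : ∃ O c, PencilData v (specDir l) O c := by
  by_cases h : ∃ u ∈ sliceRegion v (specDir l), ∃ i, pairSum (slicePt v (specDir l) u) i = 0
  · obtain ⟨c, hc, i, hi⟩ := h
    obtain ⟨O, hO⟩ := hl.exists_pencilData_of_pairSum hc hi
    exact ⟨O, c, hO⟩
  · push Not at h
    obtain ⟨O, hO, hO'⟩ := hl.exists_disc_nonneg_notMem h
    exact ⟨O, 0, hl.specDir_ne_zero 0, hl.discLead_specDir_neg, hO, hO',
      fun u hu ⟨i, hi⟩ => absurd hi (h u hu i),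
      fun hc ⟨i, hi⟩ => absurd hi (h _ hc i), fun u _ hd hs => hl.grad_ne_zero u hd hs⟩

end IsRegularSlice

/-! ### Matrices in `SU(3)` with given diagonal -/

namespace SU3

/-- The diagonal of `y`. -/
def diag (y : Matrix (Fin 3) (Fin 3) ℂ) (i : Fin 3) : ℂ := y i i

/-- `|y₀₁|² - |y₁₀|²`; for `y` in `SU(3)` it equals `|y₁₂|² - |y₂₁|²` and `|y₂₀|² - |y₀₂|²`. -/
noncomputable def chirality (y : Matrix (Fin 3) (Fin 3) ℂ) : ℝ :=
  Complex.normSq (y 0 1) - Complex.normSq (y 1 0)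

lemma conj_apply (y : SU 3) (i j : Fin 3) : conj ((y : Matrix (Fin 3) (Fin 3) ℂ) i j) =
    (y : Matrix (Fin 3) (Fin 3) ℂ) (i + 1) (j + 1) *
      (y : Matrix (Fin 3) (Fin 3) ℂ) (i + 2) (j + 2) -
    (y : Matrix (Fin 3) (Fin 3) ℂ) (i + 1) (j + 2) *
      (y : Matrix (Fin 3) (Fin 3) ℂ) (i + 2) (j + 1) := by
  have hdet : (y : Matrix (Fin 3) (Fin 3) ℂ).det = 1 :=
    (Matrix.mem_specialUnitaryGroup_iff.1 y.2).2
  have h1 : (y : Matrix (Fin 3) (Fin 3) ℂ).conjTranspose =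
      (y : Matrix (Fin 3) (Fin 3) ℂ).adjugate := by
    have h2 := Matrix.adjugate_mul (y : Matrix (Fin 3) (Fin 3) ℂ)
    rw [hdet, one_smul] at h2
    calc (y : Matrix (Fin 3) (Fin 3) ℂ).conjTranspose =
        (y : Matrix (Fin 3) (Fin 3) ℂ).adjugate * ((y : Matrix (Fin 3) (Fin 3) ℂ) *
          (y : Matrix (Fin 3) (Fin 3) ℂ).conjTranspose) := by
          rw [← Matrix.mul_assoc, h2, Matrix.one_mul]
      _ = _ := by rw [SU_mul_conjTranspose, Matrix.mul_one]
  have h3 := congrFun (congrFun h1 j) i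
  rw [Matrix.conjTranspose_apply, Matrix.adjugate_fin_three] at h3
  rw [starRingEnd_apply, h3]
  fin_cases i <;> fin_cases j <;> simp <;> ring

/-- Matrices whose entries are conjugate to their cofactors are unitary up to the determinant. -/
lemma mem_of_conj_apply {y : Matrix (Fin 3) (Fin 3) ℂ}
    (h : ∀ i j, conj (y i j) = y (i + 1) (j + 1) * y (i + 2) (j + 2) -
      y (i + 1) (j + 2) * y (i + 2) (j + 1)) (hdet : y.det = 1) :
    y ∈ Matrix.specialUnitaryGroup (Fin 3) ℂ := by
  rw [Matrix.mem_specialUnitaryGroup_iff, Matrix.mem_unitaryGroup_iff]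
  refine ⟨?_, hdet⟩
  have h1 : star y = y.adjugate := by
    ext j i
    rw [Matrix.star_apply, Matrix.adjugate_fin_three, ← starRingEnd_apply, h]
    fin_cases i <;> fin_cases j <;> simp <;> ring
  rw [h1, Matrix.mul_adjugate, hdet, one_smul]

lemma normSq_row (y : SU 3) (i : Fin 3) :
    Complex.normSq ((y : Matrix (Fin 3) (Fin 3) ℂ) i i) +
      Complex.normSq ((y : Matrix (Fin 3) (Fin 3) ℂ) i (i + 1)) +
      Complex.normSq ((y : Matrix (Fin 3) (Fin 3) ℂ) i (i + 2)) = 1 := by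
  have h := congrFun (congrFun (SU_mul_conjTranspose y) i) i
  rw [Matrix.mul_apply, Fin.sum_univ_three, Matrix.one_apply_eq] at h
  simp only [Matrix.conjTranspose_apply, ← starRingEnd_apply, Complex.mul_conj] at h
  have h' : Complex.normSq ((y : Matrix (Fin 3) (Fin 3) ℂ) i 0) +
      Complex.normSq ((y : Matrix (Fin 3) (Fin 3) ℂ) i 1) +
      Complex.normSq ((y : Matrix (Fin 3) (Fin 3) ℂ) i 2) = 1 := by exact_mod_cast h
  fin_cases i <;> simp at h' ⊢ <;> linarith

lemma normSq_col (y : SU 3) (i : Fin 3) :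
    Complex.normSq ((y : Matrix (Fin 3) (Fin 3) ℂ) i i) +
      Complex.normSq ((y : Matrix (Fin 3) (Fin 3) ℂ) (i + 1) i) +
      Complex.normSq ((y : Matrix (Fin 3) (Fin 3) ℂ) (i + 2) i) = 1 := by
  have h := congrFun (congrFun (SU_conjTranspose_mul y) i) i
  rw [Matrix.mul_apply, Fin.sum_univ_three, Matrix.one_apply_eq] at h
  simp only [Matrix.conjTranspose_apply, ← starRingEnd_apply, ← Complex.normSq_eq_conj_mul_self] at h
  have h' : Complex.normSq ((y : Matrix (Fin 3) (Fin 3) ℂ) 0 i) +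
      Complex.normSq ((y : Matrix (Fin 3) (Fin 3) ℂ) 1 i) +
      Complex.normSq ((y : Matrix (Fin 3) (Fin 3) ℂ) 2 i) = 1 := by exact_mod_cast h
  fin_cases i <;> simp at h' ⊢ <;> linarith

lemma pairProd_diag (y : SU 3) (i : Fin 3) : pairProd (diag y) i =
    (y : Matrix (Fin 3) (Fin 3) ℂ) (i + 1) (i + 2) *
      (y : Matrix (Fin 3) (Fin 3) ℂ) (i + 2) (i + 1) := by
  rw [pairProd, diag, diag, diag, conj_apply]; ring

lemma pairSum_diag (y : SU 3) (i : Fin 3) : pairSum (diag y) i =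
    Complex.normSq ((y : Matrix (Fin 3) (Fin 3) ℂ) (i + 1) (i + 2)) +
      Complex.normSq ((y : Matrix (Fin 3) (Fin 3) ℂ) (i + 2) (i + 1)) := by
  have h0 := normSq_col y i
  have h1 := normSq_row y (i + 1)
  have h2 := normSq_row y (i + 2)
  simp only [pairSum, diag]
  fin_cases i <;> simp at h0 h1 h2 ⊢ <;> linarith

lemma chirality_eq (y : SU 3) (i : Fin 3) : chirality y =
    Complex.normSq ((y : Matrix (Fin 3) (Fin 3) ℂ) (i + 1) (i + 2)) -
      Complex.normSq ((y : Matrix (Fin 3) (Fin 3) ℂ) (i + 2) (i + 1)) := by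
  have h0 := normSq_row y 0
  have h1 := normSq_row y 1
  have h2 := normSq_row y 2
  have k0 := normSq_col y 0
  have k1 := normSq_col y 1
  have k2 := normSq_col y 2
  simp only [chirality]
  fin_cases i <;> simp at h0 h1 h2 k0 k1 k2 ⊢ <;> linarith

lemma chirality_sq (y : SU 3) : chirality y ^ 2 = disc (diag y) := by
  rw [disc_eq _ 0, pairSum_diag, pairProd_diag, Complex.normSq_mul, chirality_eq y 0]; ring

lemma isDiagonal_diag (y : SU 3) : IsDiagonal (diag y) :=
  ⟨by rw [← chirality_sq]; positivity, fun i => by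
    rw [pairSum_diag]; exact add_nonneg (Complex.normSq_nonneg _) (Complex.normSq_nonneg _)⟩

/-- The matrix with diagonal `x` and off-diagonal entries `y_{i+1,i+2} = P i`,
`y_{i+2,i+1} = Q i`. -/
def ofEntries (x P Q : Fin 3 → ℂ) : Matrix (Fin 3) (Fin 3) ℂ :=
  !![x 0, P 2, Q 1; Q 2, x 1, P 0; P 1, Q 0, x 2]

lemma ofEntries_mem {x P Q : Fin 3 → ℂ} (hF : ∀ i, P i * Q i = pairProd x i)
    (hP : ∀ i, conj (P i) = P (i + 1) * P (i + 2) - Q i * x i)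
    (hQ : ∀ i, conj (Q i) = Q (i + 1) * Q (i + 2) - P i * x i)
    (hs : Complex.normSq (P 2) + Complex.normSq (Q 1) = 1 - Complex.normSq (x 0)) :
    ofEntries x P Q ∈ Matrix.specialUnitaryGroup (Fin 3) ℂ := by
  have hx : ∀ i, conj (x i) = x (i + 1) * x (i + 2) - P i * Q i := fun i => by
    rw [hF, pairProd]; ring
  have h0 := hx 0
  have h1 := hx 1
  have h2 := hx 2
  have p0 := hP 0
  have p1 := hP 1
  have p2 := hP 2
  have q0 := hQ 0
  have q1 := hQ 1
  have q2 := hQ 2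
  simp only [Fin.isValue, Fin.reduceAdd, zero_add] at h0 h1 h2 p0 p1 p2 q0 q1 q2
  refine mem_of_conj_apply (fun i j => ?_) ?_
  · fin_cases i <;> fin_cases j <;> simp [ofEntries, h0, h1, h2, p0, p1, p2, q0, q1, q2] <;> ring
  · rw [Matrix.det_fin_three]
    have hs' : conj (P 2) * P 2 + conj (Q 1) * Q 1 = 1 - conj (x 0) * x 0 := by
      simp only [← Complex.normSq_eq_conj_mul_self]; exact_mod_cast hs
    rw [p2, q1, h0] at hs'
    simp only [ofEntries, Matrix.cons_val', Matrix.cons_val_zero, Matrix.cons_val_one,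
      Matrix.cons_val, Matrix.of_apply]
    linear_combination hs'

lemma conj_pairProd (x : Fin 3 → ℂ) (i : Fin 3) : conj (pairProd x i) + x i * (pairSum x i : ℝ) +
    x i ^ 2 * pairProd x i = pairProd x (i + 1) * pairProd x (i + 2) := by
  simp only [pairProd, pairSum]
  push_cast [Complex.normSq_eq_conj_mul_self]
  fin_cases i <;> simp <;> ring

lemma normSq_pairProd_eq {x : Fin 3 → ℂ} {d : ℝ} (hd : d ^ 2 = disc x) (i : Fin 3) :
    Complex.normSq (pairProd x i) = (pairSum x i + d) / 2 * ((pairSum x i - d) / 2) := by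
  have := disc_eq x i
  linarith

/-- Given the entries `y₀₁, y₁₂, y₂₀`, the entries `y₁₀, y₂₁, y₀₂` are determined by the diagonal. -/
lemma exists_entries_of_ne_zero {x P : Fin 3 → ℂ} {d : ℝ} (hd : d ^ 2 = disc x)
    (hP : ∀ i, Complex.normSq (P i) = (pairSum x i + d) / 2) (hP0 : ∀ i, P i ≠ 0)
    (hm : P 0 * P 1 * P 2 = discMid x + (d / 2 : ℝ)) :
    ∃ Q : Fin 3 → ℂ, (∀ i, P i * Q i = pairProd x i) ∧
      (∀ i, conj (P i) = P (i + 1) * P (i + 2) - Q i * x i) ∧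
      (∀ i, conj (Q i) = Q (i + 1) * Q (i + 2) - P i * x i) ∧
      ∀ i, Complex.normSq (Q i) = (pairSum x i - d) / 2 := by
  have hm' : ∀ i, P i * (P (i + 1) * P (i + 2)) = discMid x + (d / 2 : ℝ) := fun i => by
    rw [← hm]; fin_cases i <;> simp <;> ring
  have hp0 : ∀ i, (pairSum x i + d) / 2 ≠ 0 := fun i => by
    rw [← hP i]; exact Complex.normSq_eq_zero.not.2 (hP0 i)
  have hPc : ∀ i, conj (P i) * P i = (((pairSum x i + d) / 2 : ℝ) : ℂ) := fun i => by
    rw [← hP, Complex.normSq_eq_conj_mul_self]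
  obtain ⟨Q, hQ⟩ : ∃ Q : Fin 3 → ℂ, ∀ i, P i * Q i = pairProd x i :=
    ⟨fun i => pairProd x i / P i, fun i => mul_div_cancel₀ _ (hP0 i)⟩
  have hQn : ∀ i, Complex.normSq (Q i) = (pairSum x i - d) / 2 := fun i => by
    apply mul_left_cancel₀ (hp0 i)
    rw [← normSq_pairProd_eq hd, ← hQ, Complex.normSq_mul, hP]
  refine ⟨Q, hQ, fun i => ?_, fun i => ?_, hQn⟩
  · apply mul_right_cancel₀ (hP0 i)
    have h1 := hm' i
    rw [discMid_eq x i] at h1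
    rw [hPc]
    push_cast at h1 ⊢
    linear_combination -h1 + x i * hQ i
  · have h1 := hm' i
    rw [discMid_eq x i] at h1
    have h2 := conj_pairProd x i
    have h3 : conj (Q i) * Q i = (((pairSum x i - d) / 2 : ℝ) : ℂ) := by
      rw [← hQn, Complex.normSq_eq_conj_mul_self]
    rw [← hQ i, ← hQ (i + 1), ← hQ (i + 2), map_mul] at h2
    rw [← hQ i] at h1
    have h4 := hPc i
    have h5 : (((pairSum x i + d) / 2 : ℝ) : ℂ) ≠ 0 := by exact_mod_cast hp0 i
    apply mul_left_cancel₀ (mul_ne_zero (hP0 (i + 1)) (hP0 (i + 2)))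
    apply mul_left_cancel₀ h5
    push_cast at *
    linear_combination (x i * conj (Q i) * Q i - P (i + 1) * P (i + 2) * conj (Q i)) * h4 +
      (conj (P i) * conj (Q i) + (pairSum x i + d) / 2 * x i) * h1 +
      (pairSum x i + d) / 2 * x i * h3 + (pairSum x i + d) / 2 * h2

lemma exists_entries {x : Fin 3 → ℂ} {d : ℝ} (hx : IsDiagonal x) (hd : d ^ 2 = disc x)
    (hd0 : 0 ≤ d) : ∃ P Q : Fin 3 → ℂ, (∀ i, P i * Q i = pairProd x i) ∧
      (∀ i, conj (P i) = P (i + 1) * P (i + 2) - Q i * x i) ∧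
      (∀ i, conj (Q i) = Q (i + 1) * Q (i + 2) - P i * x i) ∧
      (∀ i, Complex.normSq (P i) = (pairSum x i + d) / 2) ∧
      ∀ i, Complex.normSq (Q i) = (pairSum x i - d) / 2 := by
  rcases hd0.eq_or_lt with rfl | hd0
  · -- the matrix may be chosen symmetric
    have hdx : disc x = 0 := by rw [← hd]; norm_num
    have hm2 : discMid x ^ 2 = pairProd x 0 * pairProd x 1 * pairProd x 2 := by
      rw [discMid_sq, hdx]; simp
    obtain ⟨z, hz, hzm⟩ : ∃ z : Fin 3 → ℂ, (∀ i, z i ^ 2 = pairProd x i) ∧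
        z 0 * z 1 * z 2 = discMid x := by
      choose r hr using fun i => IsAlgClosed.exists_pow_nat_eq (pairProd x i) (n := 2) two_pos
      have h1 : (r 0 * r 1 * r 2) ^ 2 = discMid x ^ 2 := by
        rw [hm2, ← hr 0, ← hr 1, ← hr 2]; ring
      rcases sq_eq_sq_iff_eq_or_eq_neg.1 h1 with h2 | h2
      · exact ⟨r, hr, h2⟩
      · refine ⟨![-r 0, r 1, r 2], fun i => ?_, ?_⟩
        · fin_cases i
          · simpa using hr 0
          · exact hr 1
          · exact hr 2
        · simp only [Matrix.cons_val]
          linear_combination -h2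
    have hzn : ∀ i, Complex.normSq (z i) = pairSum x i / 2 := fun i => by
      have h1 : Complex.normSq (z i) ^ 2 = (pairSum x i / 2) ^ 2 := by
        rw [← normSq_pairProd hdx, ← hz, map_pow]
      exact (sq_eq_sq₀ (Complex.normSq_nonneg _) (by linarith [hx.2 i])).1 h1
    have hcz : ∀ i, conj (z i) = z (i + 1) * z (i + 2) - z i * x i := by
      intro i
      by_cases h0 : z i = 0
      · have h1 := conj_pairProd x i
        have h2 := hzn i
        rw [h0, map_zero] at h2
        have h3 : pairSum x i = 0 := by linarith
        rw [← hz, ← hz, ← hz, h0, h3] at h1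
        have h4 : z (i + 1) * z (i + 2) = 0 := by
          rw [← sq_eq_zero_iff, mul_pow, ← h1]; simp
        rw [h0, h4]; simp
      · apply mul_right_cancel₀ h0
        rw [← Complex.normSq_eq_conj_mul_self, hzn]
        have h1 : z i * (z (i + 1) * z (i + 2)) = discMid x := by
          rw [← hzm]; fin_cases i <;> simp <;> ring
        rw [discMid_eq x i] at h1
        linear_combination -h1 + x i * hz i
    exact ⟨z, z, fun i => by rw [← hz]; ring, hcz, hcz, fun i => by rw [hzn, add_zero],
      fun i => by rw [hzn, sub_zero]⟩
  · have hp : ∀ i, 0 < (pairSum x i + d) / 2 := fun i => by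
      have := hx.2 i
      positivity
    have hr : ∀ i, ((Real.sqrt ((pairSum x i + d) / 2) : ℝ) : ℂ) ≠ 0 := fun i => by
      exact_mod_cast (Real.sqrt_pos.2 (hp i)).ne'
    have hrn : ∀ i, Complex.normSq (Real.sqrt ((pairSum x i + d) / 2) : ℝ) =
        (pairSum x i + d) / 2 := fun i => by
      rw [Complex.normSq_ofReal, Real.mul_self_sqrt (hp i).le]
    have hPn : ∀ i, Complex.normSq ((![(Real.sqrt ((pairSum x 0 + d) / 2) : ℝ),
        (Real.sqrt ((pairSum x 1 + d) / 2) : ℝ), (discMid x + (d / 2 : ℝ)) /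
          ((Real.sqrt ((pairSum x 0 + d) / 2) : ℝ) * (Real.sqrt ((pairSum x 1 + d) / 2) : ℝ))] :
        Fin 3 → ℂ) i) = (pairSum x i + d) / 2 := fun i => by
      fin_cases i
      · exact hrn 0
      · exact hrn 1
      · show Complex.normSq (_ / _) = (pairSum x 2 + d) / 2
        rw [Complex.normSq_div, Complex.normSq_mul, hrn, hrn, normSq_discMid_add x hd]
        exact mul_div_cancel_left₀ _ (mul_ne_zero (hp 0).ne' (hp 1).ne')
    obtain ⟨Q, h1, h2, h3, h4⟩ := exists_entries_of_ne_zero hd hPn (fun i h0 => by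
      have := hPn i
      rw [h0, map_zero] at this
      exact (hp i).ne this) (by
        simp only [Matrix.cons_val]
        have h0 := hr 0
        have h1 := hr 1
        field_simp)
    exact ⟨_, Q, h1, h2, h3, hPn, h4⟩

/-- Every `x` satisfying the inequalities of `IsDiagonal` is the diagonal of a matrix in `SU(3)`,
with either sign of the chirality. -/
theorem exists_of_isDiagonal {x : Fin 3 → ℂ} {d : ℝ} (hx : IsDiagonal x) (hd : d ^ 2 = disc x) :
    ∃ y : SU 3, diag y = x ∧ chirality y = d := by
  wlog hd0 : 0 ≤ d generalizing d
  · obtain ⟨y, hy, hy'⟩ := this (d := -d) (by rw [neg_sq, hd]) (by linarith)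
    obtain ⟨h1, h2⟩ := Matrix.mem_specialUnitaryGroup_iff.1 y.2
    have hmem : (y : Matrix (Fin 3) (Fin 3) ℂ).transpose ∈ Matrix.specialUnitaryGroup (Fin 3) ℂ :=
      mem_of_conj_apply (fun i j => by
        have := conj_apply y j i
        simp only [Matrix.transpose_apply]
        rw [this]; ring) (by rw [Matrix.det_transpose, h2])
    refine ⟨⟨_, hmem⟩, ?_, ?_⟩
    · rw [← hy]; rfl
    · rw [← neg_neg d, ← hy']
      simp [chirality]
  obtain ⟨P, Q, h1, h2, h3, h4, h5⟩ := exists_entries hx hd hd0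
  refine ⟨⟨ofEntries x P Q, ofEntries_mem h1 h2 h3 ?_⟩, ?_, ?_⟩
  · rw [h4, h5, pairSum, pairSum]
    simp only [Fin.isValue, Fin.reduceAdd]; ring
  · funext i
    fin_cases i <;> rfl
  · show Complex.normSq (P 2) - Complex.normSq (Q 2) = d
    rw [h4, h5]; ring

lemma sum_entries (y : SU 3) : (y : Matrix (Fin 3) (Fin 3) ℂ) 0 1 *
    (y : Matrix (Fin 3) (Fin 3) ℂ) 1 2 * (y : Matrix (Fin 3) (Fin 3) ℂ) 2 0 =
    discMid (diag y) + (chirality y / 2 : ℝ) := by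
  have h1 := conj_apply y 0 1
  have h2 : conj ((y : Matrix (Fin 3) (Fin 3) ℂ) 0 1) * (y : Matrix (Fin 3) (Fin 3) ℂ) 0 1 =
      ((pairSum (diag y) 2 + chirality y) / 2 : ℝ) := by
    rw [← Complex.normSq_eq_conj_mul_self, pairSum_diag, chirality]
    congr 1
    simp only [Fin.isValue, Fin.reduceAdd]; ring
  rw [h1] at h2
  have h3 := pairProd_diag y 2
  rw [discMid_eq _ 2, h3]
  simp only [diag, Fin.isValue, Fin.reduceAdd] at h2 ⊢
  push_cast at h2 ⊢
  linear_combination h2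

lemma normSq_entry (y : SU 3) (i : Fin 3) :
    Complex.normSq ((y : Matrix (Fin 3) (Fin 3) ℂ) (i + 1) (i + 2)) =
      (pairSum (diag y) i + chirality y) / 2 ∧
    Complex.normSq ((y : Matrix (Fin 3) (Fin 3) ℂ) (i + 2) (i + 1)) =
      (pairSum (diag y) i - chirality y) / 2 := by
  rw [chirality_eq y i, pairSum_diag]
  constructor <;> ring

/-- If a diagonal entry has modulus one, its row and column vanish outside the diagonal. -/
lemma entries_eq_zero (y : SU 3) {j : Fin 3} (h : Complex.normSq (diag y j) = 1) {k : Fin 3}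
    (hk : k ≠ j) : (y : Matrix (Fin 3) (Fin 3) ℂ) j k = 0 ∧
      (y : Matrix (Fin 3) (Fin 3) ℂ) k j = 0 := by
  have h1 := normSq_row y j
  have h2 := normSq_col y j
  simp only [diag] at h
  rw [h] at h1 h2
  have n1 := Complex.normSq_nonneg ((y : Matrix (Fin 3) (Fin 3) ℂ) j (j + 1))
  have n2 := Complex.normSq_nonneg ((y : Matrix (Fin 3) (Fin 3) ℂ) j (j + 2))
  have n3 := Complex.normSq_nonneg ((y : Matrix (Fin 3) (Fin 3) ℂ) (j + 1) j)
  have n4 := Complex.normSq_nonneg ((y : Matrix (Fin 3) (Fin 3) ℂ) (j + 2) j)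
  have hk' : k = j + 1 ∨ k = j + 2 := by
    revert hk; clear * -; revert j k; decide
  rcases hk' with rfl | rfl
  · exact ⟨Complex.normSq_eq_zero.1 (by linarith), Complex.normSq_eq_zero.1 (by linarith)⟩
  · exact ⟨Complex.normSq_eq_zero.1 (by linarith), Complex.normSq_eq_zero.1 (by linarith)⟩

lemma conj_div_mul_div {a b : ℂ} (h : Complex.normSq a = Complex.normSq b) (ha : a ≠ 0) :
    conj (b / a) * (b / a) = 1 := by
  rw [← Complex.normSq_eq_conj_mul_self, Complex.normSq_div, h,
    div_self (by rw [← h]; exact Complex.normSq_eq_zero.not.2 ha), Complex.ofReal_one]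

/-- If `a b = a' b'` with `a ≠ 0` and `|a| = |a'|`, then `b' = conj (a' / a) * b`. -/
lemma eq_conj_div_mul {a b a' b' : ℂ} (h : Complex.normSq a = Complex.normSq a') (ha : a ≠ 0)
    (hab : a * b = a' * b') : b' = conj (a' / a) * b := by
  have h1 := conj_div_mul_div h ha
  have h2 : a' / a * b' = b := by
    field_simp
    linear_combination -hab
  linear_combination -b' * h1 + conj (a' / a) * h2

/-- Two matrices in `SU(3)` with the same diagonal and the same chirality are conjugate by a
diagonal matrix. -/
theorem exists_conj_of_diag_eq {y y' : SU 3} (hd : diag y = diag y')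
    (hc : chirality y = chirality y') : ∃ t : Fin 3 → ℂ, (∀ i, conj (t i) * t i = 1) ∧
      ∀ i j, (y' : Matrix (Fin 3) (Fin 3) ℂ) i j =
        t i * (y : Matrix (Fin 3) (Fin 3) ℂ) i j * conj (t j) := by
  wlog h0 : 0 ≤ chirality y generalizing y y'
  · have htr : ∀ y : SU 3, (y : Matrix (Fin 3) (Fin 3) ℂ).transpose ∈
        Matrix.specialUnitaryGroup (Fin 3) ℂ := fun y =>
      mem_of_conj_apply (fun i j => by
        have := conj_apply y j i
        simp only [Matrix.transpose_apply]
        rw [this]; ring)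
        (by rw [Matrix.det_transpose, (Matrix.mem_specialUnitaryGroup_iff.1 y.2).2])
    have hch : ∀ y : SU 3, chirality (y : Matrix (Fin 3) (Fin 3) ℂ).transpose = -chirality y :=
      fun y => by simp [chirality]
    obtain ⟨t, ht, hty⟩ := this (y := ⟨_, htr y⟩) (y' := ⟨_, htr y'⟩) hd
      (by simp only [hch, hc]) (by simp only [hch]; linarith)
    refine ⟨fun i => conj (t i), fun i => ?_, fun i j => ?_⟩
    · rw [Complex.conj_conj, mul_comm, ht]
    · have := hty j i
      simp only [Matrix.transpose_apply] at this
      rw [this, Complex.conj_conj]; ring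
  have hn1 : ∀ i : Fin 3, Complex.normSq ((y : Matrix (Fin 3) (Fin 3) ℂ) (i + 1) (i + 2)) =
      Complex.normSq ((y' : Matrix (Fin 3) (Fin 3) ℂ) (i + 1) (i + 2)) := fun i => by
    rw [(normSq_entry y i).1, (normSq_entry y' i).1, hd, hc]
  have hF : ∀ i : Fin 3, (y : Matrix (Fin 3) (Fin 3) ℂ) (i + 1) (i + 2) *
      (y : Matrix (Fin 3) (Fin 3) ℂ) (i + 2) (i + 1) =
      (y' : Matrix (Fin 3) (Fin 3) ℂ) (i + 1) (i + 2) *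
      (y' : Matrix (Fin 3) (Fin 3) ℂ) (i + 2) (i + 1) := fun i => by
    rw [← pairProd_diag, ← pairProd_diag, hd]
  have hdd : ∀ i, (y' : Matrix (Fin 3) (Fin 3) ℂ) i i = (y : Matrix (Fin 3) (Fin 3) ℂ) i i :=
    fun i => (congrFun hd i).symm
  have hunit : ∀ i : Fin 3, (y : Matrix (Fin 3) (Fin 3) ℂ) (i + 1) (i + 2) ≠ 0 →
      conj ((y' : Matrix (Fin 3) (Fin 3) ℂ) (i + 1) (i + 2) /
        (y : Matrix (Fin 3) (Fin 3) ℂ) (i + 1) (i + 2)) *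
        ((y' : Matrix (Fin 3) (Fin 3) ℂ) (i + 1) (i + 2) /
        (y : Matrix (Fin 3) (Fin 3) ℂ) (i + 1) (i + 2)) = 1 := fun i hi =>
    conj_div_mul_div (hn1 i) hi
  have hother : ∀ i : Fin 3, (y : Matrix (Fin 3) (Fin 3) ℂ) (i + 1) (i + 2) ≠ 0 →
      (y' : Matrix (Fin 3) (Fin 3) ℂ) (i + 2) (i + 1) =
        conj ((y' : Matrix (Fin 3) (Fin 3) ℂ) (i + 1) (i + 2) /
          (y : Matrix (Fin 3) (Fin 3) ℂ) (i + 1) (i + 2)) *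
          (y : Matrix (Fin 3) (Fin 3) ℂ) (i + 2) (i + 1) := fun i hi =>
    eq_conj_div_mul (hn1 i) hi (hF i)
  by_cases hne : ∀ i : Fin 3, (y : Matrix (Fin 3) (Fin 3) ℂ) (i + 1) (i + 2) ≠ 0
  · have hsum : (y : Matrix (Fin 3) (Fin 3) ℂ) 0 1 * (y : Matrix (Fin 3) (Fin 3) ℂ) 1 2 *
        (y : Matrix (Fin 3) (Fin 3) ℂ) 2 0 = (y' : Matrix (Fin 3) (Fin 3) ℂ) 0 1 *
        (y' : Matrix (Fin 3) (Fin 3) ℂ) 1 2 * (y' : Matrix (Fin 3) (Fin 3) ℂ) 2 0 := by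
      rw [sum_entries, sum_entries, hd, hc]
    have e0 : (y : Matrix (Fin 3) (Fin 3) ℂ) 1 2 ≠ 0 := hne 0
    have e1 : (y : Matrix (Fin 3) (Fin 3) ℂ) 2 0 ≠ 0 := hne 1
    have e2 : (y : Matrix (Fin 3) (Fin 3) ℂ) 0 1 ≠ 0 := hne 2
    have u0 := hunit 0 e0
    have u1 := hunit 1 e1
    have u2 := hunit 2 e2
    have o0 := hother 0 e0
    have o1 := hother 1 e1
    have o2 := hother 2 e2
    simp only [Fin.isValue, Fin.reduceAdd, zero_add] at u0 u1 u2 o0 o1 o2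
    obtain ⟨r0, hr0⟩ : ∃ r, r = (y' : Matrix (Fin 3) (Fin 3) ℂ) 1 2 /
      (y : Matrix (Fin 3) (Fin 3) ℂ) 1 2 := ⟨_, rfl⟩
    obtain ⟨r1, hr1⟩ : ∃ r, r = (y' : Matrix (Fin 3) (Fin 3) ℂ) 2 0 /
      (y : Matrix (Fin 3) (Fin 3) ℂ) 2 0 := ⟨_, rfl⟩
    obtain ⟨r2, hr2⟩ : ∃ r, r = (y' : Matrix (Fin 3) (Fin 3) ℂ) 0 1 /
      (y : Matrix (Fin 3) (Fin 3) ℂ) 0 1 := ⟨_, rfl⟩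
    rw [← hr0] at u0 o0
    rw [← hr1] at u1 o1
    rw [← hr2] at u2 o2
    have hr : r0 * r1 * r2 = 1 := by
      rw [hr0, hr1, hr2]
      field_simp
      linear_combination -hsum
    have f0 : (y' : Matrix (Fin 3) (Fin 3) ℂ) 1 2 = r0 * (y : Matrix (Fin 3) (Fin 3) ℂ) 1 2 := by
      rw [hr0, div_mul_cancel₀ _ e0]
    have f1 : (y' : Matrix (Fin 3) (Fin 3) ℂ) 2 0 = r1 * (y : Matrix (Fin 3) (Fin 3) ℂ) 2 0 := by
      rw [hr1, div_mul_cancel₀ _ e1]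
    have f2 : (y' : Matrix (Fin 3) (Fin 3) ℂ) 0 1 = r2 * (y : Matrix (Fin 3) (Fin 3) ℂ) 0 1 := by
      rw [hr2, div_mul_cancel₀ _ e2]
    have hr1' : conj r2 * conj r0 = r1 := by
      linear_combination -conj r2 * conj r0 * hr + r1 * r2 * conj r2 * u0 + r1 * u2
    have hr1'' : conj r1 = r2 * r0 := by
      rw [← hr1']; simp
    refine ⟨![1, conj r2, r1], fun i => ?_, fun i j => ?_⟩
    · fin_cases i
      · simp
      · show conj (conj r2) * conj r2 = 1
        rw [Complex.conj_conj, mul_comm, u2]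
      · simpa using u1
    · fin_cases i <;> fin_cases j
      · simp [hdd]
      · simp [f2, mul_comm]
      · simp [o1, mul_comm]
      · simp [o2]
      · simp only [hdd, Fin.mk_one, Fin.isValue, Matrix.cons_val_one, Matrix.cons_val_zero,
          Complex.conj_conj]
        linear_combination -(y : Matrix (Fin 3) (Fin 3) ℂ) 1 1 * u2
      · simp only [f0, hr1'', Fin.mk_one, Fin.reduceFinMk, Fin.isValue, Matrix.cons_val]
        linear_combination -(y : Matrix (Fin 3) (Fin 3) ℂ) 1 2 * r0 * u2
      · simp [f1]
      · simp only [o0, ← hr1', Fin.mk_one, Fin.reduceFinMk, Fin.isValue, Matrix.cons_val,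
          Complex.conj_conj]
        linear_combination -(y : Matrix (Fin 3) (Fin 3) ℂ) 2 1 * conj r0 * u2
      · simp only [hdd, Fin.reduceFinMk, Fin.isValue, Matrix.cons_val]
        linear_combination -(y : Matrix (Fin 3) (Fin 3) ℂ) 2 2 * u1
  · push Not at hne
    obtain ⟨i, hi⟩ := hne
    have n1 := (normSq_entry y i).1
    have n2 := (isDiagonal_diag y).2 i
    rw [hi, map_zero] at n1
    have hc0 : chirality y = 0 := by linarith
    have hs : pairSum (diag y) i = 0 := by linarith
    obtain ⟨j, hj⟩ := (isDiagonal_diag y).exists_normSq_eq_one hs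
    have hj' : Complex.normSq (diag y' j) = 1 := by rw [← hd, hj]
    -- both matrices have the block `{j + 1, j + 2}`
    obtain ⟨r, hr, h1, h2⟩ : ∃ r, conj r * r = 1 ∧
        (y' : Matrix (Fin 3) (Fin 3) ℂ) (j + 1) (j + 2) =
          r * (y : Matrix (Fin 3) (Fin 3) ℂ) (j + 1) (j + 2) ∧
        (y' : Matrix (Fin 3) (Fin 3) ℂ) (j + 2) (j + 1) =
          conj r * (y : Matrix (Fin 3) (Fin 3) ℂ) (j + 2) (j + 1) := by
      by_cases hz : (y : Matrix (Fin 3) (Fin 3) ℂ) (j + 1) (j + 2) = 0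
      · have hz' : (y' : Matrix (Fin 3) (Fin 3) ℂ) (j + 1) (j + 2) = 0 := by
          rw [← Complex.normSq_eq_zero, ← hn1, hz, map_zero]
        have a1 := normSq_entry y j
        have a2 := normSq_entry y' j
        rw [hz, map_zero] at a1
        rw [hz', map_zero] at a2
        have b1 := a1.2
        have b2 := a2.2
        have b3 : pairSum (diag y) j = 0 := by linarith [a1.1]
        have b4 : pairSum (diag y') j = 0 := by rw [← hd, b3]
        rw [b3, hc0] at b1
        rw [b4, ← hc, hc0] at b2
        rw [sub_zero, zero_div, Complex.normSq_eq_zero] at b1 b2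
        exact ⟨1, by simp, by rw [hz, hz', mul_zero], by rw [b1, b2, mul_zero]⟩
      · exact ⟨_, hunit j hz, by rw [div_mul_cancel₀ _ hz], hother j hz⟩
    refine ⟨Function.update 1 (j + 1) r, fun k => ?_, fun k k' => ?_⟩
    · by_cases hk : k = j + 1
      · subst hk; simp [hr]
      · simp [hk]
    · have hjj : ∀ k : Fin 3, k = j ∨ k = j + 1 ∨ k = j + 2 := by
        clear * -; revert j; decide
      have d1 : j + 1 ≠ j := by clear * -; revert j; decide
      have d2 : j + 2 ≠ j := by clear * -; revert j; decide
      have d3 : j + 2 ≠ j + 1 := by clear * -; revert j; decide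
      rcases hjj k with rfl | rfl | rfl <;> rcases hjj k' with hk | hk | hk <;> subst hk
      · simp [hdd, d1.symm]
      · rw [(entries_eq_zero y hj d1).1, (entries_eq_zero y' hj' d1).1]; simp
      · rw [(entries_eq_zero y hj d2).1, (entries_eq_zero y' hj' d2).1]; simp
      · rw [(entries_eq_zero y hj d1).2, (entries_eq_zero y' hj' d1).2]; simp
      · simp only [hdd, Function.update_self]
        linear_combination -(y : Matrix (Fin 3) (Fin 3) ℂ) (j + 1) (j + 1) * hr
      · rw [h1]; simp [d3]
      · rw [(entries_eq_zero y hj d2).2, (entries_eq_zero y' hj' d2).2]; simp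
      · rw [h2]; simp [d3, mul_comm]
      · simp [hdd, d3]

end SU3

/-! ### Diagonalization in `SU(3)` -/

namespace SU3

/-- Complex `3 × 3` matrices. -/
abbrev Mat := Matrix (Fin 3) (Fin 3) ℂ

/-- The eigenvalues of a matrix in `SU(3)`, with multiplicity and in some order. -/
structure IsSpectrum (l : Fin 3 → ℂ) : Prop where
  conj_mul : ∀ i, conj (l i) * l i = 1
  prod : l 0 * l 1 * l 2 = 1

lemma star_diagonal (l : Fin 3 → ℂ) :
    star (Matrix.diagonal l) = Matrix.diagonal fun i => conj (l i) := by
  rw [Matrix.star_eq_conjTranspose, Matrix.diagonal_conjTranspose]; rfl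

namespace IsSpectrum

variable {l l' : Fin 3 → ℂ}

lemma mem (hl : IsSpectrum l) : Matrix.diagonal l ∈ Matrix.specialUnitaryGroup (Fin 3) ℂ := by
  rw [Matrix.mem_specialUnitaryGroup_iff, Matrix.mem_unitaryGroup_iff', star_diagonal,
    Matrix.diagonal_mul_diagonal, Matrix.det_diagonal, Fin.prod_univ_three]
  exact ⟨by simp [hl.conj_mul], hl.prod⟩

/-- The diagonal matrix with the given eigenvalues. -/
def toSU (hl : IsSpectrum l) : SU 3 := ⟨Matrix.diagonal l, hl.mem⟩

lemma coe_toSU (hl : IsSpectrum l) : (hl.toSU : Mat) = Matrix.diagonal l := rfl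

lemma of_mem (h : Matrix.diagonal l ∈ Matrix.specialUnitaryGroup (Fin 3) ℂ) : IsSpectrum l := by
  rw [Matrix.mem_specialUnitaryGroup_iff, Matrix.mem_unitaryGroup_iff', star_diagonal,
    Matrix.diagonal_mul_diagonal, Matrix.det_diagonal, Fin.prod_univ_three] at h
  refine ⟨fun i => ?_, h.2⟩
  simpa using congrFun (congrFun h.1 i) i

lemma ne_zero (hl : IsSpectrum l) (i : Fin 3) : l i ≠ 0 := fun h => by
  simpa [h] using hl.conj_mul i

lemma conj_eq (hl : IsSpectrum l) (i : Fin 3) : conj (l i) = l (i + 1) * l (i + 2) := by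
  apply mul_right_cancel₀ (hl.ne_zero i)
  rw [hl.conj_mul, ← hl.prod]
  fin_cases i <;> simp <;> ring

lemma regular (hl : IsSpectrum l) (h : Function.Injective l) : IsRegularSpectrum l :=
  ⟨hl.conj_mul, hl.prod, h⟩

lemma comp (hl : IsSpectrum l) (σ : Equiv.Perm (Fin 3)) : IsSpectrum (l ∘ σ) :=
  ⟨fun i => hl.conj_mul _, by
    have h1 := Equiv.prod_comp σ l
    rw [Fin.prod_univ_three, Fin.prod_univ_three, hl.prod] at h1
    exact h1⟩

lemma conj_sum (hl : IsSpectrum l) : conj (∑ i, l i) = l 1 * l 2 + l 2 * l 0 + l 0 * l 1 := by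
  simp only [map_add, hl.conj_eq, Fin.sum_univ_three, Fin.isValue, Fin.reduceAdd, zero_add]

/-- The trace determines the eigenvalues. -/
lemma exists_perm (hl : IsSpectrum l) (hl' : IsSpectrum l') (h : ∑ i, l i = ∑ i, l' i) :
    ∃ σ : Equiv.Perm (Fin 3), l = l' ∘ σ := by
  obtain ⟨i, hi⟩ : ∃ i, l 0 = l' i := by
    have h1 := hl.conj_sum
    have h2 := hl'.conj_sum
    have h3 := hl.prod
    have h4 := hl'.prod
    rw [h, h2] at h1
    simp only [Fin.sum_univ_three] at h
    have h5 : (l 0 - l' 0) * ((l 0 - l' 1) * (l 0 - l' 2)) = 0 := by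
      linear_combination (l 0) ^ 2 * h + l 0 * h1 + h3 - h4
    rcases mul_eq_zero.1 h5 with h6 | h6
    · exact ⟨0, sub_eq_zero.1 h6⟩
    rcases mul_eq_zero.1 h6 with h6 | h6
    · exact ⟨1, sub_eq_zero.1 h6⟩
    · exact ⟨2, sub_eq_zero.1 h6⟩
  have hl'' := hl'.comp (Equiv.swap 0 i)
  have hs : ∑ k, l k = ∑ k, (l' ∘ Equiv.swap 0 i) k := by
    rw [h]; exact (Equiv.sum_comp (Equiv.swap 0 i) l').symm
  have h0 : l 0 = (l' ∘ Equiv.swap 0 i) 0 := by simpa using hi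
  obtain ⟨m, hm⟩ : ∃ m, m = l' ∘ Equiv.swap 0 i := ⟨_, rfl⟩
  rw [← hm] at hl'' hs h0
  suffices h : ∃ σ : Equiv.Perm (Fin 3), l = m ∘ σ by
    obtain ⟨σ, hσ⟩ := h
    exact ⟨σ.trans (Equiv.swap 0 i), by rw [hσ, hm]; rfl⟩
  have h3 := hl.prod
  rw [← hl''.prod, h0, mul_assoc, mul_assoc] at h3
  have h4 := mul_left_cancel₀ (hl''.ne_zero 0) h3
  simp only [Fin.sum_univ_three, h0] at hs
  have h5 : (l 1 - m 1) * (l 1 - m 2) = 0 := by linear_combination l 1 * hs - h4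
  rcases mul_eq_zero.1 h5 with h6 | h6
  · refine ⟨1, funext fun k => ?_⟩
    have h7 := sub_eq_zero.1 h6
    fin_cases k
    · exact h0
    · exact h7
    · show l 2 = m 2
      linear_combination hs - h7
  · refine ⟨Equiv.swap 1 2, funext fun k => ?_⟩
    have h7 := sub_eq_zero.1 h6
    fin_cases k
    · exact h0
    · exact h7
    · show l 2 = m 1
      linear_combination hs - h7

end IsSpectrum

lemma hasDoubleRoot_iff {l : Fin 3 → ℂ} (hl : IsSpectrum l) :
    HasDoubleRoot (∑ i, l i) ↔ ¬ Function.Injective l := by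
  have h1 := hl.conj_sum
  have h2 := hl.prod
  constructor
  · rintro ⟨κ, hκ, hκ'⟩ hinj
    rw [h1] at hκ hκ'
    simp only [Fin.sum_univ_three] at hκ hκ'
    have h3 : (κ - l 0) * ((κ - l 1) * (κ - l 2)) = 0 := by linear_combination hκ - h2
    have h01 : l 0 - l 1 ≠ 0 := sub_ne_zero.2 fun h => by simpa using hinj h
    have h02 : l 0 - l 2 ≠ 0 := sub_ne_zero.2 fun h => by simpa using hinj h
    have h12 : l 1 - l 2 ≠ 0 := sub_ne_zero.2 fun h => by simpa using hinj h
    rcases mul_eq_zero.1 h3 with h4 | h4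
    · rw [sub_eq_zero.1 h4] at hκ'
      exact mul_ne_zero h01 h02 (by linear_combination hκ')
    rcases mul_eq_zero.1 h4 with h4 | h4
    · rw [sub_eq_zero.1 h4] at hκ'
      exact mul_ne_zero h01 h12 (by linear_combination -hκ')
    · rw [sub_eq_zero.1 h4] at hκ'
      exact mul_ne_zero h02 h12 (by linear_combination hκ')
  · intro hinj
    simp only [Function.Injective, not_forall] at hinj
    obtain ⟨i, j, hij, hne⟩ := hinj
    refine ⟨l i, ?_, ?_⟩ <;> rw [h1] <;> simp only [Fin.sum_univ_three]
    · have h3 : (l i - l 0) * ((l i - l 1) * (l i - l 2)) = 0 := by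
        fin_cases i <;> simp
      linear_combination h3 + h2
    · fin_cases i <;> fin_cases j <;> simp at hij hne <;> simp only [Fin.mk_one, Fin.zero_eta,
        Fin.reduceFinMk, Fin.isValue] <;> rw [hij] <;> ring

/-! #### Conjugation into diagonal form -/

lemma exists_specialUnitary_smul {U : Mat} (hU : U ∈ Matrix.unitaryGroup (Fin 3) ℂ) :
    ∃ (g : SU 3) (ζ : ℂ), conj ζ * ζ = 1 ∧ (g : Mat) = ζ • U := by
  have hdet := Matrix.det_of_mem_unitary hU
  rw [Unitary.mem_iff] at hdet
  obtain ⟨ζ, hζ⟩ := IsAlgClosed.exists_pow_nat_eq (conj U.det) (n := 3) three_pos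
  have h1 : conj U.det * U.det = 1 := hdet.1
  have hn : Complex.normSq ζ = 1 := by
    have h2 : Complex.normSq ζ ^ 3 = 1 := by
      rw [← map_pow, hζ, Complex.normSq_conj]; exact normSq_eq_one_iff.2 h1
    exact (pow_eq_one_iff_of_nonneg (Complex.normSq_nonneg ζ) three_ne_zero).1 h2
  have hζ1 := normSq_eq_one_iff.1 hn
  refine ⟨⟨ζ • U, ?_⟩, ζ, hζ1, rfl⟩
  rw [Matrix.mem_specialUnitaryGroup_iff, Matrix.mem_unitaryGroup_iff']
  refine ⟨?_, ?_⟩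
  · rw [star_smul, Matrix.smul_mul, Matrix.mul_smul, smul_smul, Matrix.mem_unitaryGroup_iff'.1 hU]
    have : star ζ * ζ = 1 := hζ1
    rw [this, one_smul]
  · rw [Matrix.det_smul, Fintype.card_fin, hζ, h1]

/-- A unitary matrix is diagonalizable: its Cayley transform is Hermitian. -/
lemma exists_unitary_mul_eq (X : SU 3) : ∃ U ∈ Matrix.unitaryGroup (Fin 3) ℂ, ∃ l : Fin 3 → ℂ,
    (X : Mat) * U = U * Matrix.diagonal l := by
  obtain ⟨μ, hμ, hdet⟩ : ∃ μ : ℂ, conj μ * μ = 1 ∧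
      (Matrix.scalar (Fin 3) μ - (X : Mat)).det ≠ 0 := by
    by_contra hcon
    push Not at hcon
    have hroot : ∀ μ : ℂ, conj μ * μ = 1 → μ ∈ (X : Mat).charpoly.roots.toFinset := fun μ hμ => by
      rw [Multiset.mem_toFinset, Polynomial.mem_roots (Matrix.charpoly_monic _).ne_zero,
        Polynomial.IsRoot, Matrix.eval_charpoly]
      exact hcon μ hμ
    have hsub : ({1, -1, Complex.I, -Complex.I} : Finset ℂ) ⊆ (X : Mat).charpoly.roots.toFinset := by
      intro μ hμ
      simp only [Finset.mem_insert, Finset.mem_singleton] at hμ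
      apply hroot
      rcases hμ with rfl | rfl | rfl | rfl <;> simp
    have hcard : ({1, -1, Complex.I, -Complex.I} : Finset ℂ).card = 4 := by
      rw [Finset.card_insert_of_notMem, Finset.card_insert_of_notMem, Finset.card_insert_of_notMem,
        Finset.card_singleton] <;> simp [Complex.ext_iff] <;> norm_num
    have h1 := Finset.card_le_card hsub
    have h2 := Multiset.toFinset_card_le (X : Mat).charpoly.roots
    have h3 := Polynomial.card_roots' (X : Mat).charpoly
    rw [Matrix.charpoly_natDegree_eq_dim, Fintype.card_fin] at h3
    omega
  set N : Mat := Matrix.scalar (Fin 3) μ - (X : Mat) with hN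
  have hNu : IsUnit N.det := isUnit_iff_ne_zero.2 hdet
  set P : Mat := Matrix.scalar (Fin 3) μ + (X : Mat) with hP
  have hXX : (X : Mat).conjTranspose * (X : Mat) = 1 := SU_conjTranspose_mul X
  set H : Mat := Complex.I • (P * N⁻¹) with hH
  have hsc : (Matrix.scalar (Fin 3) μ).conjTranspose = Matrix.scalar (Fin 3) (conj μ) := by
    simp [Matrix.scalar_apply, Matrix.diagonal_conjTranspose]
  have hscm : Matrix.scalar (Fin 3) (conj μ) * Matrix.scalar (Fin 3) μ = 1 := by
    rw [← map_mul, hμ, map_one]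
  have hNP : N.conjTranspose * P = -(P.conjTranspose * N) := by
    rw [hN, hP, Matrix.conjTranspose_sub, Matrix.conjTranspose_add, hsc]
    simp only [Matrix.sub_mul, Matrix.mul_add, Matrix.add_mul, Matrix.mul_sub, hXX, hscm]
    abel
  have hHH : H.IsHermitian := by
    have h1 : N.conjTranspose * H.conjTranspose * N = N.conjTranspose * H * N := by
      rw [hH, Matrix.conjTranspose_smul, Matrix.conjTranspose_mul]
      simp only [Matrix.mul_smul, Matrix.smul_mul]
      rw [← Matrix.mul_assoc N.conjTranspose, ← Matrix.conjTranspose_mul,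
        Matrix.nonsing_inv_mul N hNu, Matrix.conjTranspose_one, Matrix.one_mul,
        Matrix.mul_assoc N.conjTranspose, Matrix.mul_assoc P,
        Matrix.nonsing_inv_mul N hNu, Matrix.mul_one, hNP]
      simp
    have hNc : IsUnit N.conjTranspose.det := by
      rw [Matrix.det_conjTranspose]; exact hNu.star
    have h2 := congrArg (fun M => (N.conjTranspose)⁻¹ * M * N⁻¹) h1
    simp only [Matrix.mul_assoc, Matrix.mul_nonsing_inv N hNu, Matrix.mul_one] at h2
    rwa [← Matrix.mul_assoc, ← Matrix.mul_assoc, Matrix.nonsing_inv_mul _ hNc, Matrix.one_mul,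
      Matrix.one_mul] at h2
  have hspec := hHH.spectral_theorem
  rw [Unitary.conjStarAlgAut_apply] at hspec
  set U : Mat := hHH.eigenvectorUnitary.1 with hU
  have hUm : U ∈ Matrix.unitaryGroup (Fin 3) ℂ := (hHH.eigenvectorUnitary).2
  have hHU : H * U = U * Matrix.diagonal (RCLike.ofReal ∘ hHH.eigenvalues) := by
    nth_rewrite 1 [hspec]
    rw [Matrix.mul_assoc, Matrix.mem_unitaryGroup_iff'.1 hUm, Matrix.mul_one]
  -- `X (H + i) = μ (H - i)`
  have hXH : (X : Mat) * (H + Complex.I • 1) = μ • (H - Complex.I • 1) := by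
    have h1 : H * N = Complex.I • P := by
      rw [hH, Matrix.smul_mul, Matrix.mul_assoc, Matrix.nonsing_inv_mul N hNu, Matrix.mul_one]
    have hXN : (X : Mat) * N = N * X := by
      rw [hN, Matrix.mul_sub, Matrix.sub_mul,
        (Matrix.scalar_commute (n := Fin 3) μ (fun r => mul_comm _ _) (X : Mat)).eq]
    have hsμ : ∀ M : Mat, Matrix.scalar (Fin 3) μ * M = μ • M := fun M => by
      rw [Matrix.scalar_apply, Matrix.smul_eq_diagonal_mul]
    have h2 : ((X : Mat) * (H + Complex.I • 1)) * N = (μ • (H - Complex.I • 1)) * N := by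
      rw [Matrix.mul_assoc, Matrix.add_mul, h1, Matrix.smul_mul, Matrix.one_mul, Matrix.smul_mul,
        Matrix.sub_mul, h1, Matrix.smul_mul, Matrix.one_mul, ← smul_add, ← smul_sub,
        Matrix.mul_smul, smul_comm μ, hP, hN]
      congr 1
      rw [← hsμ, Matrix.mul_add, Matrix.mul_sub, Matrix.mul_add, Matrix.mul_sub, Matrix.mul_add,
        Matrix.mul_sub, (Matrix.scalar_commute (n := Fin 3) μ (fun r => mul_comm _ _) (X : Mat)).eq]
      abel
    have h3 := congrArg (fun M => M * N⁻¹) h2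
    simpa only [Matrix.mul_assoc, Matrix.mul_nonsing_inv N hNu, Matrix.mul_one] using h3
  refine ⟨U, hUm, fun i => μ * ((hHH.eigenvalues i : ℂ) - Complex.I) /
    ((hHH.eigenvalues i : ℂ) + Complex.I), ?_⟩
  have h4 : (X : Mat) * U * Matrix.diagonal (fun i => (hHH.eigenvalues i : ℂ) + Complex.I) =
      U * Matrix.diagonal (fun i => μ * ((hHH.eigenvalues i : ℂ) - Complex.I)) := by
    have e1 : Matrix.diagonal (fun i => (hHH.eigenvalues i : ℂ) + Complex.I) =
        Matrix.diagonal (RCLike.ofReal ∘ hHH.eigenvalues) + Complex.I • (1 : Mat) := by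
      rw [Matrix.smul_one_eq_diagonal, Matrix.diagonal_add]; rfl
    have e2 : Matrix.diagonal (fun i => μ * ((hHH.eigenvalues i : ℂ) - Complex.I)) =
        μ • (Matrix.diagonal (RCLike.ofReal ∘ hHH.eigenvalues) - Complex.I • (1 : Mat)) := by
      rw [Matrix.smul_one_eq_diagonal, Matrix.diagonal_sub, ← Matrix.diagonal_smul]; rfl
    rw [e1, e2, Matrix.mul_assoc, Matrix.mul_add, ← hHU, Matrix.mul_smul U μ, Matrix.mul_sub, ← hHU]
    have := congrArg (· * U) hXH
    simpa [Matrix.mul_assoc, Matrix.add_mul, Matrix.sub_mul] using this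
  have hne : ∀ i, (hHH.eigenvalues i : ℂ) + Complex.I ≠ 0 := fun i h => by
    have := congrArg Complex.im h
    simp at this
  ext i j
  have h5 := congrFun (congrFun h4 i) j
  rw [Matrix.mul_diagonal, Matrix.mul_diagonal] at h5
  rw [Matrix.mul_diagonal, ← mul_div_assoc, eq_div_iff (hne j), h5]

lemma coe_conj (g X : SU 3) : ((g * X * g⁻¹ : SU 3) : Mat) =
    (g : Mat) * (X : Mat) * (g : Mat).conjTranspose := rfl

lemma trace_conj (g X : SU 3) : ((g * X * g⁻¹ : SU 3) : Mat).trace = (X : Mat).trace := by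
  rw [coe_conj, Matrix.trace_mul_comm, ← Matrix.mul_assoc, SU_conjTranspose_mul, Matrix.one_mul]

lemma trace_inv (X : SU 3) : ((X⁻¹ : SU 3) : Mat).trace = conj (X : Mat).trace := by
  rw [SU_coe_inv, Matrix.trace_conjTranspose]; rfl

lemma trace_toSU {l : Fin 3 → ℂ} (hl : IsSpectrum l) : (hl.toSU : Mat).trace = ∑ i, l i := by
  rw [hl.coe_toSU, Matrix.trace_diagonal]

lemma exists_eq_conj_of_unitary {X : SU 3} {U : Mat} (hU : U ∈ Matrix.unitaryGroup (Fin 3) ℂ)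
    {l : Fin 3 → ℂ} (h : (X : Mat) * U = U * Matrix.diagonal l) :
    ∃ (hl : IsSpectrum l) (g : SU 3), X = g * hl.toSU * g⁻¹ := by
  obtain ⟨g, ζ, hζ, hg⟩ := exists_specialUnitary_smul hU
  have h1 : (X : Mat) * g = g * Matrix.diagonal l := by
    rw [hg, Matrix.mul_smul, h, Matrix.smul_mul]
  have h2 : ((g⁻¹ * X * g : SU 3) : Mat) = Matrix.diagonal l := by
    show (g : Mat).conjTranspose * (X : Mat) * g = _
    rw [Matrix.mul_assoc, h1, ← Matrix.mul_assoc, SU_conjTranspose_mul, Matrix.one_mul]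
  have hl : IsSpectrum l := .of_mem (h2 ▸ (g⁻¹ * X * g : SU 3).2)
  refine ⟨hl, g, ?_⟩
  have h3 : hl.toSU = g⁻¹ * X * g := Subtype.ext h2.symm
  rw [h3]; group

theorem exists_eq_conj (X : SU 3) :
    ∃ (l : Fin 3 → ℂ) (hl : IsSpectrum l) (g : SU 3), X = g * hl.toSU * g⁻¹ := by
  obtain ⟨U, hU, l, h⟩ := exists_unitary_mul_eq X
  exact ⟨l, exists_eq_conj_of_unitary hU h⟩

theorem exists_eq_conj_of_trace {l : Fin 3 → ℂ} (hl : IsSpectrum l) {X : SU 3}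
    (h : (X : Mat).trace = ∑ i, l i) : ∃ g : SU 3, X = g * hl.toSU * g⁻¹ := by
  obtain ⟨U, hU, l', h'⟩ := exists_unitary_mul_eq X
  obtain ⟨hl', g, hg⟩ := exists_eq_conj_of_unitary hU h'
  obtain ⟨σ, rfl⟩ := hl.exists_perm hl' (by rw [← h, hg, trace_conj, trace_toSU])
  have hp : (X : Mat) * U.submatrix id σ = U.submatrix id σ * Matrix.diagonal (l' ∘ σ) := by
    ext i j
    rw [Matrix.mul_diagonal]
    have := congrFun (congrFun h' i) (σ j)
    rw [Matrix.mul_diagonal] at this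
    simpa [Matrix.mul_apply] using this
  have hpU : U.submatrix id σ ∈ Matrix.unitaryGroup (Fin 3) ℂ := by
    rw [Matrix.mem_unitaryGroup_iff'] at hU ⊢
    ext i j
    have := congrFun (congrFun hU (σ i)) (σ j)
    simpa [Matrix.mul_apply, Matrix.one_apply] using this
  exact (exists_eq_conj_of_unitary hpU hp).2

theorem isConj_of_trace_eq {X X' : SU 3} (h : (X : Mat).trace = (X' : Mat).trace) :
    IsConj X X' := by
  obtain ⟨l, hl, g, rfl⟩ := exists_eq_conj X
  rw [trace_conj, trace_toSU] at h
  obtain ⟨g', rfl⟩ := exists_eq_conj_of_trace hl h.symm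
  rw [isConj_iff]
  exact ⟨g' * g⁻¹, by group⟩

lemma charpoly_eq {l : Fin 3 → ℂ} (hl : IsSpectrum l) {X : SU 3} (h : (X : Mat).trace = ∑ i, l i) :
    (X : Mat).charpoly = ∏ i, (Polynomial.X - Polynomial.C (l i)) := by
  obtain ⟨g, rfl⟩ := exists_eq_conj_of_trace hl h
  rw [← Matrix.charpoly_diagonal, ← hl.coe_toSU, Submonoid.coe_mul, Matrix.charpoly_mul_comm,
    ← Submonoid.coe_mul]
  congr 2
  group

lemma roots_charpoly {l : Fin 3 → ℂ} (hl : IsSpectrum l) {X : SU 3}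
    (h : (X : Mat).trace = ∑ i, l i) :
    (X : Mat).charpoly.roots = Finset.univ.val.map l := by
  rw [charpoly_eq hl h]
  have := Polynomial.roots_multiset_prod_X_sub_C (Finset.univ.val.map l)
  rw [Multiset.map_map] at this
  exact this

lemma hasRepeatedEigenvalue_iff {l : Fin 3 → ℂ} (hl : IsSpectrum l) {X : SU 3}
    (h : (X : Mat).trace = ∑ i, l i) : HasRepeatedEigenvalue X ↔ ¬ Function.Injective l := by
  have h1 : Function.Injective l ↔ (Finset.univ.val.map l).Nodup := by
    constructor
    · intro hi
      exact Finset.univ.nodup.map hi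
    · intro hn i j hij
      exact Multiset.inj_on_of_nodup_map hn i (Finset.mem_univ_val i) j (Finset.mem_univ_val j) hij
  rw [HasRepeatedEigenvalue, roots_charpoly hl h, h1, Multiset.nodup_iff_count_le_one]
  push Not
  rfl

lemma hasThreeDistinctEigenvalues_iff {l : Fin 3 → ℂ} (hl : IsSpectrum l) {X : SU 3}
    (h : (X : Mat).trace = ∑ i, l i) : HasThreeDistinctEigenvalues X ↔ Function.Injective l := by
  have h1 : {μ : ℂ | Module.End.HasEigenvalue (Matrix.toLin' (X : Mat)) μ} = Set.range l := by
    ext μ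
    rw [Set.mem_ofPred_eq, Module.End.hasEigenvalue_iff_isRoot_charpoly, Matrix.charpoly_toLin',
      ← Polynomial.mem_roots (Matrix.charpoly_monic _).ne_zero, roots_charpoly hl h]
    simp only [Multiset.mem_map, Finset.mem_val, Finset.mem_univ, true_and, Set.mem_range]
  rw [HasThreeDistinctEigenvalues, h1]
  constructor
  · intro hc
    have h2 : (Set.range l).ncard = Fintype.card (Fin 3) := hc
    rw [← Set.image_univ] at h2
    exact Set.injOn_univ.1 (Set.injOn_of_ncard_image_eq (by rw [h2, Set.ncard_univ]; simp))
  · intro hi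
    rw [← Set.image_univ, Set.ncard_image_of_injective _ hi, Set.ncard_univ]; simp

/-- Conjugation by a diagonal unitary matrix. -/
lemma exists_conj_of_phases {t : Fin 3 → ℂ} (ht : ∀ i, conj (t i) * t i = 1) :
    ∃ g : SU 3, (∀ (l : Fin 3 → ℂ) (hl : IsSpectrum l), g * hl.toSU * g⁻¹ = hl.toSU) ∧
      ∀ y y' : SU 3, (∀ i j, (y' : Mat) i j = t i * (y : Mat) i j * conj (t j)) →
        y' = g * y * g⁻¹ := by
  have hU : Matrix.diagonal t ∈ Matrix.unitaryGroup (Fin 3) ℂ := by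
    rw [Matrix.mem_unitaryGroup_iff', star_diagonal, Matrix.diagonal_mul_diagonal]
    simp [ht]
  obtain ⟨g, ζ, hζ, hg⟩ := exists_specialUnitary_smul hU
  have key : ∀ y : SU 3, ∀ i j, ((g * y * g⁻¹ : SU 3) : Mat) i j =
      t i * (y : Mat) i j * conj (t j) := fun y i j => by
    rw [coe_conj, hg, Matrix.conjTranspose_smul, ← Matrix.star_eq_conjTranspose, star_diagonal,
      Matrix.smul_mul, Matrix.smul_mul, Matrix.mul_smul, smul_smul, Matrix.smul_apply,
      Matrix.mul_diagonal, Matrix.diagonal_mul, mul_comm ζ]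
    have : star ζ * ζ = 1 := hζ
    rw [this, one_smul]
  refine ⟨g, fun l hl => Subtype.ext ?_, fun y y' h => Subtype.ext ?_⟩
  · ext i j
    rw [key, hl.coe_toSU]
    by_cases hij : i = j
    · subst hij
      rw [Matrix.diagonal_apply_eq]
      linear_combination l i * ht i
    · rw [Matrix.diagonal_apply_ne _ hij]; simp
  · ext i j
    rw [key, h]

end SU3

/-! ### Groups with the presentation of a Brieskorn sphere -/

/-- The group `π` is presented by the generators `x, y, z, h` and the relations
`x ^ p = y ^ q = h ^ a`, `z ^ r = h ^ c`, `x y z = 1`, `h` central: the generators generate, and by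
`lift` any elements of a group satisfying the relations are their images under a homomorphism. -/
structure IsBrieskornGroup (p q r : ℕ) (a c : ℤ) {π : Type} [Group π] (x y z h : π) : Prop where
  coprime_pq : Nat.Coprime p q
  coprime_pr : Nat.Coprime p r
  coprime_qr : Nat.Coprime q r
  pos_p : 0 < p
  pos_q : 0 < q
  pos_r : 0 < r
  eq_one : a * r * (p + q) + c * p * q = 1
  x_pow : x ^ p = h ^ a
  y_pow : y ^ q = h ^ a
  z_pow : z ^ r = h ^ c
  mul : x * y * z = 1
  comm_x : h * x = x * h
  comm_y : h * y = y * h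
  comm_z : h * z = z * h
  closure : Subgroup.closure {x, y, z, h} = ⊤
  lift : ∀ {G : Type} [Group G] (X Y Z H : G), X ^ p = H ^ a → Y ^ q = H ^ a → Z ^ r = H ^ c →
    X * Y * Z = 1 → H * X = X * H → H * Y = Y * H → H * Z = Z * H →
    ∃ φ : π →* G, φ x = X ∧ φ y = Y ∧ φ z = Z ∧ φ h = H

namespace IsBrieskornGroup

variable {p q r : ℕ} {a c : ℤ} {π : Type} [Group π] {x y z h : π}

theorem brieskornGroup (hp : 0 < p) (hq : 0 < q) (hr : 0 < r)
    (hpq : Nat.Coprime p q) (hpr : Nat.Coprime p r) (hqr : Nat.Coprime q r)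
    (hac : a * r * (p + q) + c * p * q = 1) :
    IsBrieskornGroup p q r a c (brieskornGen p q r a c .x) (brieskornGen p q r a c .y)
      (brieskornGen p q r a c .z) (brieskornGen p q r a c .h) := by
  have hrel : ∀ w ∈ brieskornRels p q r a c, PresentedGroup.mk (brieskornRels p q r a c) w = 1 :=
    fun w hw => PresentedGroup.one_of_mem hw
  have hof : ∀ s, PresentedGroup.mk (brieskornRels p q r a c) (FreeGroup.of s) =
      brieskornGen p q r a c s := fun s => rfl
  have h1 := hrel (FreeGroup.of .x ^ p * (FreeGroup.of .h ^ a)⁻¹) (by simp [brieskornRels])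
  have h2 := hrel (FreeGroup.of .y ^ q * (FreeGroup.of .h ^ a)⁻¹) (by simp [brieskornRels])
  have h3 := hrel (FreeGroup.of .z ^ r * (FreeGroup.of .h ^ c)⁻¹) (by simp [brieskornRels])
  have h4 := hrel (FreeGroup.of .x * FreeGroup.of .y * FreeGroup.of .z) (by simp [brieskornRels])
  have h5 := hrel (FreeGroup.of .h * FreeGroup.of .x * (FreeGroup.of .h)⁻¹ * (FreeGroup.of .x)⁻¹)
    (by simp [brieskornRels])
  have h6 := hrel (FreeGroup.of .h * FreeGroup.of .y * (FreeGroup.of .h)⁻¹ * (FreeGroup.of .y)⁻¹)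
    (by simp [brieskornRels])
  have h7 := hrel (FreeGroup.of .h * FreeGroup.of .z * (FreeGroup.of .h)⁻¹ * (FreeGroup.of .z)⁻¹)
    (by simp [brieskornRels])
  simp only [map_mul, map_inv, map_pow, map_zpow, hof] at h1 h2 h3 h4 h5 h6 h7
  refine ⟨hpq, hpr, hqr, hp, hq, hr, hac, mul_inv_eq_one.1 h1, mul_inv_eq_one.1 h2,
    mul_inv_eq_one.1 h3, h4, mul_inv_eq_iff_eq_mul.1 (mul_inv_eq_one.1 h5),
    mul_inv_eq_iff_eq_mul.1 (mul_inv_eq_one.1 h6), mul_inv_eq_iff_eq_mul.1 (mul_inv_eq_one.1 h7),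
    ?_, ?_⟩
  · rw [← PresentedGroup.closure_range_of]
    congr 1
    ext w
    constructor
    · rintro (rfl | rfl | rfl | rfl)
      exacts [⟨.x, rfl⟩, ⟨.y, rfl⟩, ⟨.z, rfl⟩, ⟨.h, rfl⟩]
    · rintro ⟨s, rfl⟩
      cases s
      · exact Or.inl rfl
      · exact Or.inr (Or.inl rfl)
      · exact Or.inr (Or.inr (Or.inl rfl))
      · exact Or.inr (Or.inr (Or.inr rfl))
  · intro G _ X Y Z H r1 r2 r3 r4 r5 r6 r7
    set f : BrieskornGen → G := fun s => match s with
      | .x => X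
      | .y => Y
      | .z => Z
      | .h => H with hf
    have hrels : ∀ w ∈ brieskornRels p q r a c, FreeGroup.lift f w = 1 := by
      intro w hw
      simp only [brieskornRels, Set.mem_insert_iff, Set.mem_singleton_iff] at hw
      rcases hw with rfl | rfl | rfl | rfl | rfl | rfl | rfl <;>
        simp only [map_mul, map_inv, map_pow, map_zpow, FreeGroup.lift_apply_of, hf]
      · rw [r1, mul_inv_cancel]
      · rw [r2, mul_inv_cancel]
      · rw [r3, mul_inv_cancel]
      · exact r4
      · rw [r5]; group
      · rw [r6]; group
      · rw [r7]; group
    exact ⟨PresentedGroup.toGroup hrels, PresentedGroup.toGroup.of hrels,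
      PresentedGroup.toGroup.of hrels, PresentedGroup.toGroup.of hrels,
      PresentedGroup.toGroup.of hrels⟩

theorem map (B : IsBrieskornGroup p q r a c x y z h) {π' : Type} [Group π'] (e : π ≃* π') :
    IsBrieskornGroup p q r a c (e x) (e y) (e z) (e h) := by
  refine ⟨B.coprime_pq, B.coprime_pr, B.coprime_qr, B.pos_p, B.pos_q, B.pos_r, B.eq_one,
    by rw [← map_pow, B.x_pow, map_zpow], by rw [← map_pow, B.y_pow, map_zpow],
    by rw [← map_pow, B.z_pow, map_zpow], by rw [← map_mul, ← map_mul, B.mul, map_one],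
    by rw [← map_mul, B.comm_x, map_mul], by rw [← map_mul, B.comm_y, map_mul],
    by rw [← map_mul, B.comm_z, map_mul], ?_, ?_⟩
  · have h1 := congrArg (Subgroup.map e.toMonoidHom) B.closure
    rw [MonoidHom.map_closure, ← MonoidHom.range_eq_map,
      MonoidHom.range_eq_top.2 e.surjective] at h1
    rw [← h1]
    congr 1
    simp [Set.image_insert_eq]
  · intro G _ X Y Z H r1 r2 r3 r4 r5 r6 r7
    obtain ⟨φ, h1, h2, h3, h4⟩ := B.lift X Y Z H r1 r2 r3 r4 r5 r6 r7
    exact ⟨φ.comp e.symm.toMonoidHom, by simp [h1], by simp [h2], by simp [h3], by simp [h4]⟩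

/-- A property holding for the generators and inherited by products and inverses holds. -/
lemma induction (B : IsBrieskornGroup p q r a c x y z h) {P : π → Prop} (hx : P x) (hy : P y)
    (hz : P z) (hh : P h) (h1 : P 1) (hmul : ∀ g g', P g → P g' → P (g * g'))
    (hinv : ∀ g, P g → P g⁻¹) (g : π) : P g := by
  have hg : g ∈ Subgroup.closure {x, y, z, h} := by rw [B.closure]; trivial
  induction hg using Subgroup.closure_induction with
  | mem w hw =>
    rcases hw with rfl | rfl | rfl | rfl <;> assumption
  | one => exact h1
  | mul _ _ _ _ h2 h3 => exact hmul _ _ h2 h3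
  | inv _ _ h2 => exact hinv _ h2

lemma hom_ext (B : IsBrieskornGroup p q r a c x y z h) {G : Type*} [Group G] {φ ψ : π →* G}
    (hx : φ x = ψ x) (hy : φ y = ψ y) (hz : φ z = ψ z) (hh : φ h = ψ h) : φ = ψ := by
  ext g
  refine B.induction (P := fun g => φ g = ψ g) hx hy hz hh (by simp) (fun g g' h1 h2 => ?_)
    (fun g h1 => ?_) g
  · rw [map_mul, map_mul, h1, h2]
  · rw [map_inv, map_inv, h1]

lemma z_eq (B : IsBrieskornGroup p q r a c x y z h) : z = (x * y)⁻¹ :=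
  (inv_eq_of_mul_eq_one_right B.mul).symm

/-- The group is perfect: a homomorphism with commutative image is trivial. -/
theorem hom_eq_one (B : IsBrieskornGroup p q r a c x y z h) {G : Type*} [Group G] (φ : π →* G)
    (hcomm : Commute (φ x) (φ y)) : φ = 1 := by
  have hz : φ z = (φ x * φ y)⁻¹ := by rw [B.z_eq, map_inv, map_mul]
  have e1 : φ x ^ p = φ h ^ a := by rw [← map_pow, B.x_pow, map_zpow]
  have e2 : φ y ^ q = φ h ^ a := by rw [← map_pow, B.y_pow, map_zpow]
  have e3 : (φ x * φ y) ^ r = φ h ^ (-c) := by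
    rw [← inv_inj, ← inv_pow, ← hz, ← map_pow, B.z_pow, map_zpow, ← zpow_neg, neg_neg]
  have hh : φ h = 1 := by
    have f1 : φ x ^ (p * (q * r)) = φ h ^ (a * ((q * r : ℕ) : ℤ)) := by
      rw [pow_mul, e1, zpow_mul, zpow_natCast]
    have f2 : φ y ^ (q * (p * r)) = φ h ^ (a * ((p * r : ℕ) : ℤ)) := by
      rw [pow_mul, e2, zpow_mul, zpow_natCast]
    have f3 : (φ x * φ y) ^ (r * (p * q)) = φ h ^ (-c * ((p * q : ℕ) : ℤ)) := by
      rw [pow_mul, e3, zpow_mul, zpow_natCast]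
    have n1 : r * (p * q) = p * (q * r) := by ring
    have n2 : q * (p * r) = p * (q * r) := by ring
    rw [n1, hcomm.mul_pow, f1, ← n2, f2, ← zpow_add] at f3
    have f4 : φ h ^ (1 : ℤ) = 1 := by
      rw [← B.eq_one]
      have : a * r * (p + q) + c * p * q = (a * ((q * r : ℕ) : ℤ) + a * ((p * r : ℕ) : ℤ)) -
          (-c * ((p * q : ℕ) : ℤ)) := by push_cast; ring
      rw [this, zpow_sub, f3, mul_inv_cancel]
    simpa using f4
  rw [hh, one_zpow] at e1 e2 e3
  have hx : φ x = 1 := by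
    have h1 : φ x ^ (q * r) = 1 := by
      have h2 : (φ x * φ y) ^ (q * r) = 1 := by rw [mul_comm, pow_mul, e3, one_pow]
      rw [hcomm.mul_pow, pow_mul (φ y), e2, one_pow, mul_one] at h2
      exact h2
    have h3 := (B.coprime_pq.mul_right B.coprime_pr)
    exact orderOf_eq_one_iff.1 (Nat.dvd_one.1 (h3 ▸ Nat.dvd_gcd (orderOf_dvd_of_pow_eq_one e1)
      (orderOf_dvd_of_pow_eq_one h1)))
  have hy : φ y = 1 := by
    rw [hx, one_mul] at e3
    exact orderOf_eq_one_iff.1 (Nat.dvd_one.1 (B.coprime_qr ▸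
      Nat.dvd_gcd (orderOf_dvd_of_pow_eq_one e2) (orderOf_dvd_of_pow_eq_one e3)))
  exact B.hom_ext hx hy (by rw [hz, hx, hy]; simp) hh

end IsBrieskornGroup

/-! ### Reducible representations -/

open SU3

/-- A common fixed vector of the image of `α`. -/
def HasFixedVector {π : Type} [Group π] (α : π →* SU 3) : Prop :=
  ∃ v : Fin 3 → ℂ, v ≠ 0 ∧ ∀ γ, (α γ : Mat).mulVec v = v

section

variable {π : Type} [Group π]

lemma isIrred_iff (α : π →* SU 3) : IsIrred α ↔ ∀ W : Submodule ℂ (Fin 3 → ℂ),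
    (∀ γ, ∀ w ∈ W, (α γ : Mat).mulVec w ∈ W) → W = ⊥ ∨ W = ⊤ := by
  constructor
  · intro h W hW
    have := h.eq_bot_or_eq_top (⟨W, fun γ w hw => hW γ w hw⟩ : Subrepresentation _)
    rcases this with h1 | h1
    · left; exact congrArg Subrepresentation.toSubmodule h1
    · right; exact congrArg Subrepresentation.toSubmodule h1
  · intro h
    have hnt : Nontrivial (Subrepresentation ((stdRep 3).comp α)) := by
      refine ⟨⟨⊥, ⊤, fun h1 => ?_⟩⟩
      have h2 : (⊥ : Submodule ℂ (Fin 3 → ℂ)) = ⊤ := congrArg Subrepresentation.toSubmodule h1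
      exact bot_ne_top h2
    refine { hnt with eq_bot_or_eq_top := fun W => ?_ }
    rcases h W.toSubmodule (fun γ w hw => W.apply_mem_toSubmodule γ hw) with h1 | h1
    · left; exact Subrepresentation.toSubmodule_injective h1
    · right; exact Subrepresentation.toSubmodule_injective h1

lemma not_isIrred_of_eigenvector {α : π →* SU 3} {v : Fin 3 → ℂ} (hv : v ≠ 0)
    (h : ∀ γ, ∃ c : ℂ, (α γ : Mat).mulVec v = c • v) : ¬ IsIrred α := by
  intro hirr
  rcases (isIrred_iff α).1 hirr (Submodule.span ℂ {v}) (fun γ w hw => by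
    obtain ⟨d, rfl⟩ := Submodule.mem_span_singleton.1 hw
    obtain ⟨c, hc⟩ := h γ
    rw [Matrix.mulVec_smul, hc]
    exact Submodule.smul_mem _ _ (Submodule.smul_mem _ _ (Submodule.mem_span_singleton_self v)))
    with h1 | h1
  · exact hv (Submodule.span_singleton_eq_bot.1 h1)
  · have h2 := finrank_span_singleton (K := ℂ) hv
    rw [h1, finrank_top] at h2
    simp at h2

/-- Schur's lemma. -/
lemma IsIrred.eq_smul {α : π →* SU 3} (hα : IsIrred α) {M : Mat}
    (hM : ∀ γ, (α γ : Mat) * M = M * (α γ : Mat)) : ∃ c : ℂ, M = c • 1 := by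
  obtain ⟨c, hc⟩ := Module.End.exists_eigenvalue (Matrix.toLin' M)
  refine ⟨c, ?_⟩
  rcases (isIrred_iff α).1 hα (Module.End.eigenspace (Matrix.toLin' M) c) (fun γ w hw => by
    rw [Module.End.mem_eigenspace_iff, Matrix.toLin'_apply] at hw ⊢
    rw [Matrix.mulVec_mulVec, ← hM, ← Matrix.mulVec_mulVec, hw, Matrix.mulVec_smul]) with h1 | h1
  · exact absurd h1 hc
  · apply Matrix.toLin'.injective
    refine LinearMap.ext fun w => ?_
    have : w ∈ Module.End.eigenspace (Matrix.toLin' M) c := by rw [h1]; trivial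
    rw [Module.End.mem_eigenspace_iff] at this
    rw [this, Matrix.toLin'_apply, Matrix.smul_mulVec, Matrix.one_mulVec]

lemma star_dotProduct_mulVec (g : SU 3) (v w : Fin 3 → ℂ) :
    star v ⬝ᵥ (g : Mat).mulVec w = star (((g⁻¹ : SU 3) : Mat).mulVec v) ⬝ᵥ w := by
  rw [SU_coe_inv, Matrix.star_mulVec, Matrix.conjTranspose_conjTranspose, Matrix.dotProduct_mulVec]

/-- The orthogonal complement for the standard Hermitian form. -/
def starOrthogonal (W : Submodule ℂ (Fin 3 → ℂ)) : Submodule ℂ (Fin 3 → ℂ) where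
  carrier := {v | ∀ w ∈ W, star v ⬝ᵥ w = 0}
  zero_mem' := fun w _ => by simp
  add_mem' := fun {v v'} hv hv' w hw => by
    rw [star_add, add_dotProduct, hv w hw, hv' w hw, add_zero]
  smul_mem' := fun t v hv w hw => by
    rw [star_smul, smul_dotProduct, hv w hw, smul_zero]

/-- A reducible representation preserves a line: the orthogonal complement of an invariant plane is
an invariant line. -/
lemma exists_eigenvector_of_not_isIrred {α : π →* SU 3} (hα : ¬ IsIrred α) :
    ∃ v : Fin 3 → ℂ, v ≠ 0 ∧ ∀ γ, ∃ c : ℂ, (α γ : Mat).mulVec v = c • v := by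
  rw [isIrred_iff] at hα
  push Not at hα
  obtain ⟨W, hW, hbot, htop⟩ := hα
  have hline : ∀ L : Submodule ℂ (Fin 3 → ℂ), (∀ γ, ∀ w ∈ L, (α γ : Mat).mulVec w ∈ L) →
      Module.finrank ℂ L = 1 →
      ∃ v : Fin 3 → ℂ, v ≠ 0 ∧ ∀ γ, ∃ c : ℂ, (α γ : Mat).mulVec v = c • v := by
    intro L hL h1
    obtain ⟨v, hv, hv'⟩ := finrank_eq_one_iff'.1 h1
    refine ⟨v, by simpa using hv, fun γ => ?_⟩
    obtain ⟨c, hc⟩ := hv' ⟨_, hL γ v v.2⟩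
    exact ⟨c, (congrArg Subtype.val hc).symm⟩
  have hW' : ∀ γ, ∀ w ∈ starOrthogonal W, (α γ : Mat).mulVec w ∈ starOrthogonal W := by
    intro γ v hv w hw
    have h1 := star_dotProduct_mulVec (α γ)⁻¹ v w
    rw [inv_inv, ← map_inv] at h1
    rw [← h1]
    exact hv _ (hW γ⁻¹ w hw)
  have hdisj : Disjoint W (starOrthogonal W) := by
    rw [Submodule.disjoint_def]
    intro v hv hv'
    open ComplexOrder in
    exact dotProduct_star_self_eq_zero.1 (hv' v hv)
  have hne : starOrthogonal W ≠ ⊥ := by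
    obtain ⟨f, hf, hfW⟩ := Submodule.exists_le_ker_of_lt_top W (lt_top_iff_ne_top.2 htop)
    have hfs : ∀ w, f w = star (fun i => star (f (Pi.single i 1))) ⬝ᵥ w := fun w => by
      rw [LinearMap.pi_apply_eq_sum_univ f w]
      simp only [dotProduct, Pi.star_apply, star_star, smul_eq_mul]
      refine Finset.sum_congr rfl fun i _ => ?_
      rw [mul_comm]
      congr 2
      funext j
      simp [Pi.single_apply, eq_comm]
    intro h0
    have h1 : (fun i => star (f (Pi.single i 1))) ∈ starOrthogonal W := fun w hw => by
      rw [← hfs]; exact hfW hw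
    rw [h0, Submodule.mem_bot] at h1
    apply hf
    refine LinearMap.ext fun w => ?_
    rw [hfs, h1]; simp
  have h1 := Submodule.finrank_add_finrank_le_of_disjoint hdisj
  have h2 := Submodule.one_le_finrank_iff.2 hbot
  have h3 := Submodule.one_le_finrank_iff.2 hne
  rw [Module.finrank_fin_fun] at h1
  have h4 : Module.finrank ℂ W = 1 ∨ Module.finrank ℂ (starOrthogonal W) = 1 := by omega
  rcases h4 with h4 | h4
  · exact hline W hW h4
  · exact hline _ hW' h4

end

namespace IsBrieskornGroup

variable {p q r : ℕ} {a c : ℤ} {π : Type} [Group π] {x y z h : π}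

/-- Since the group is perfect, a common eigenvector is fixed. -/
lemma mulVec_eq_self (B : IsBrieskornGroup p q r a c x y z h) {α : π →* SU 3} {v : Fin 3 → ℂ}
    (hv : v ≠ 0) (hα : ∀ γ, ∃ c : ℂ, (α γ : Mat).mulVec v = c • v) (γ : π) :
    (α γ : Mat).mulVec v = v := by
  choose χ hχ using hα
  have hinj : ∀ s t : ℂ, s • v = t • v → s = t := fun s t h => smul_left_injective ℂ hv h
  let χ' : π →* ℂ :=
    { toFun := χ
      map_one' := hinj _ _ (by rw [← hχ, map_one, one_smul]; exact Matrix.one_mulVec v)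
      map_mul' := fun g g' => hinj _ _ (by
        rw [← hχ, map_mul, Submonoid.coe_mul, ← Matrix.mulVec_mulVec, hχ, Matrix.mulVec_smul, hχ,
          smul_smul, mul_comm]) }
  have h1 := B.hom_eq_one χ'.toHomUnits (Commute.all _ _)
  have h2 : χ γ = 1 := by
    have := congrArg Units.val (DFunLike.congr_fun h1 γ)
    have h3 : χ' γ = 1 := by simpa using this
    exact h3
  rw [hχ, h2, one_smul]

theorem not_isIrred_iff (B : IsBrieskornGroup p q r a c x y z h) {α : π →* SU 3} :
    ¬ IsIrred α ↔ HasFixedVector α := by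
  constructor
  · intro h
    obtain ⟨v, hv, hα⟩ := exists_eigenvector_of_not_isIrred h
    exact ⟨v, hv, B.mulVec_eq_self hv hα⟩
  · rintro ⟨v, hv, hα⟩
    exact not_isIrred_of_eigenvector hv fun γ => ⟨1, by rw [hα, one_smul]⟩

/-- A common eigenvector of the images of `x`, `y` and `h` is fixed by the whole image. -/
lemma hasFixedVector_of_eigenvector (B : IsBrieskornGroup p q r a c x y z h) {α : π →* SU 3}
    {v : Fin 3 → ℂ} (hv : v ≠ 0) (hx : ∃ c : ℂ, (α x : Mat).mulVec v = c • v)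
    (hy : ∃ c : ℂ, (α y : Mat).mulVec v = c • v) (hh : ∃ c : ℂ, (α h : Mat).mulVec v = c • v) :
    ∀ γ, (α γ : Mat).mulVec v = v := by
  have hmul : ∀ g g', (∃ c : ℂ, (α g : Mat).mulVec v = c • v) →
      (∃ c : ℂ, (α g' : Mat).mulVec v = c • v) → ∃ c : ℂ, (α (g * g') : Mat).mulVec v = c • v := by
    rintro g g' ⟨c, hc⟩ ⟨c', hc'⟩
    exact ⟨c' * c, by rw [map_mul, Submonoid.coe_mul, ← Matrix.mulVec_mulVec, hc',
      Matrix.mulVec_smul, hc, smul_smul]⟩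
  have hinv : ∀ g, (∃ c : ℂ, (α g : Mat).mulVec v = c • v) →
      ∃ c : ℂ, (α g⁻¹ : Mat).mulVec v = c • v := by
    rintro g ⟨c, hc⟩
    have h1 : ((α g)⁻¹ : SU 3).1.mulVec ((α g : Mat).mulVec v) = v := by
      rw [Matrix.mulVec_mulVec]
      have : ((α g)⁻¹ : SU 3).1 * (α g : Mat) = 1 := SU_conjTranspose_mul _
      rw [this, Matrix.one_mulVec]
    rw [hc, Matrix.mulVec_smul] at h1
    have hc0 : c ≠ 0 := by
      rintro rfl
      rw [zero_smul] at h1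
      exact hv h1.symm
    refine ⟨c⁻¹, ?_⟩
    rw [map_inv, eq_inv_smul_iff₀ hc0]
    exact h1
  apply B.mulVec_eq_self hv
  refine B.induction hx hy ?_ hh ⟨1, by rw [map_one, one_smul]; exact Matrix.one_mulVec v⟩ hmul hinv
  rw [B.z_eq]
  exact hinv _ (hmul _ _ hx hy)

end IsBrieskornGroup

/-! ### Representations in `SU(2)` -/

namespace SU2

lemma conj_apply (A : SU 2) : conj ((A : Matrix (Fin 2) (Fin 2) ℂ) 0 0) =
      (A : Matrix (Fin 2) (Fin 2) ℂ) 1 1 ∧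
    conj ((A : Matrix (Fin 2) (Fin 2) ℂ) 0 1) = -(A : Matrix (Fin 2) (Fin 2) ℂ) 1 0 ∧
    conj ((A : Matrix (Fin 2) (Fin 2) ℂ) 1 0) = -(A : Matrix (Fin 2) (Fin 2) ℂ) 0 1 ∧
    conj ((A : Matrix (Fin 2) (Fin 2) ℂ) 1 1) = (A : Matrix (Fin 2) (Fin 2) ℂ) 0 0 := by
  have hdet : (A : Matrix (Fin 2) (Fin 2) ℂ).det = 1 :=
    (Matrix.mem_specialUnitaryGroup_iff.1 A.2).2
  have h1 : (A : Matrix (Fin 2) (Fin 2) ℂ).conjTranspose =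
      (A : Matrix (Fin 2) (Fin 2) ℂ).adjugate := by
    have h2 := Matrix.adjugate_mul (A : Matrix (Fin 2) (Fin 2) ℂ)
    rw [hdet, one_smul] at h2
    calc (A : Matrix (Fin 2) (Fin 2) ℂ).conjTranspose =
        (A : Matrix (Fin 2) (Fin 2) ℂ).adjugate * ((A : Matrix (Fin 2) (Fin 2) ℂ) *
          (A : Matrix (Fin 2) (Fin 2) ℂ).conjTranspose) := by
          rw [← Matrix.mul_assoc, h2, Matrix.one_mul]
      _ = _ := by rw [SU_mul_conjTranspose, Matrix.mul_one]
  have h2 := fun i j => congrFun (congrFun h1 i) j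
  simp only [Matrix.conjTranspose_apply, Matrix.adjugate_fin_two] at h2
  exact ⟨h2 0 0, h2 1 0, h2 0 1, h2 1 1⟩

lemma normSq_add (A : SU 2) : Complex.normSq ((A : Matrix (Fin 2) (Fin 2) ℂ) 0 0) +
    Complex.normSq ((A : Matrix (Fin 2) (Fin 2) ℂ) 0 1) = 1 := by
  have hdet : (A : Matrix (Fin 2) (Fin 2) ℂ).det = 1 :=
    (Matrix.mem_specialUnitaryGroup_iff.1 A.2).2
  rw [Matrix.det_fin_two] at hdet
  have h : conj ((A : Matrix (Fin 2) (Fin 2) ℂ) 0 0) * (A : Matrix (Fin 2) (Fin 2) ℂ) 0 0 +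
      conj ((A : Matrix (Fin 2) (Fin 2) ℂ) 0 1) * (A : Matrix (Fin 2) (Fin 2) ℂ) 0 1 = 1 := by
    rw [(conj_apply A).1, (conj_apply A).2.1]
    linear_combination hdet
  simp only [← Complex.normSq_eq_conj_mul_self] at h
  exact_mod_cast h

/-- A scalar matrix in `SU(2)` is `1` or `-1`. -/
lemma eq_of_smul {A : SU 2} {c : ℂ} (h : (A : Matrix (Fin 2) (Fin 2) ℂ) = c • 1) :
    (A : Matrix (Fin 2) (Fin 2) ℂ) = 1 ∨ (A : Matrix (Fin 2) (Fin 2) ℂ) = -1 := by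
  have hdet : (A : Matrix (Fin 2) (Fin 2) ℂ).det = 1 :=
    (Matrix.mem_specialUnitaryGroup_iff.1 A.2).2
  rw [h, Matrix.det_smul, Matrix.det_one, Fintype.card_fin, mul_one, sq_eq_one_iff] at hdet
  rcases hdet with rfl | rfl
  · left; rw [h, one_smul]
  · right; rw [h, neg_smul, one_smul]

/-- The centralizer of a non-scalar `2 × 2` matrix is commutative. -/
lemma commute_of_commute {K M N : Matrix (Fin 2) (Fin 2) ℂ} (hK : ∀ c : ℂ, K ≠ c • 1)
    (hM : M * K = K * M) (hN : N * K = K * N) : M * N = N * M := by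
  have key : ∀ L : Matrix (Fin 2) (Fin 2) ℂ, L * K = K * L → ∃ s t : ℂ, L = s • K + t • 1 := by
    intro L hL
    have h00 := congrFun (congrFun hL 0) 0
    have h01 := congrFun (congrFun hL 0) 1
    have h10 := congrFun (congrFun hL 1) 0
    simp only [Matrix.mul_apply, Fin.sum_univ_two] at h00 h01 h10
    have hext : ∀ s : ℂ, L 0 1 = s * K 0 1 → L 1 0 = s * K 1 0 →
        L 0 0 - L 1 1 = s * (K 0 0 - K 1 1) → ∃ s t : ℂ, L = s • K + t • 1 := by
      intro s h1 h2 h3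
      refine ⟨s, L 0 0 - s * K 0 0, ?_⟩
      ext i j
      fin_cases i <;> fin_cases j <;> simp
      · exact h1
      · exact h2
      · linear_combination -h3
    by_cases k1 : K 0 1 = 0
    · by_cases k2 : K 1 0 = 0
      · have k3 : K 0 0 - K 1 1 ≠ 0 := fun k3 => hK (K 0 0) (by
          ext i j
          fin_cases i <;> fin_cases j <;> simp [k1, k2]
          linear_combination -k3)
        refine hext ((L 0 0 - L 1 1) / (K 0 0 - K 1 1)) ?_ ?_ (div_mul_cancel₀ _ k3).symm
        · rw [k1, mul_zero]
          refine (mul_eq_zero.1 (?_ : L 0 1 * (K 0 0 - K 1 1) = 0)).resolve_right k3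
          rw [k1] at h01
          linear_combination -h01
        · rw [k2, mul_zero]
          refine (mul_eq_zero.1 (?_ : L 1 0 * (K 0 0 - K 1 1) = 0)).resolve_right k3
          rw [k2] at h10
          linear_combination h10
      · refine hext (L 1 0 / K 1 0) ?_ (div_mul_cancel₀ _ k2).symm ?_
        · field_simp; linear_combination h00
        · field_simp; linear_combination -h10
    · refine hext (L 0 1 / K 0 1) (div_mul_cancel₀ _ k1).symm ?_ ?_
      · field_simp; linear_combination -h00
      · field_simp; linear_combination h01
  obtain ⟨s, t, rfl⟩ := key M hM
  obtain ⟨s', t', rfl⟩ := key N hN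
  simp only [Matrix.mul_add, Matrix.add_mul, Matrix.smul_mul, Matrix.mul_smul, Matrix.mul_one,
    Matrix.one_mul]
  module

end SU2

namespace SU3

lemma hasThreeDistinctEigenvalues_iff_trace (X : SU 3) :
    HasThreeDistinctEigenvalues X ↔ ¬ HasDoubleRoot (X : Mat).trace := by
  obtain ⟨l, hl, g, rfl⟩ := exists_eq_conj X
  have h : ((g * hl.toSU * g⁻¹ : SU 3) : Mat).trace = ∑ i, l i := by
    rw [trace_conj, trace_toSU]
  rw [hasThreeDistinctEigenvalues_iff hl h, h, hasDoubleRoot_iff hl, not_not]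

lemma hasRepeatedEigenvalue_iff_trace (X : SU 3) :
    HasRepeatedEigenvalue X ↔ HasDoubleRoot (X : Mat).trace := by
  obtain ⟨l, hl, g, rfl⟩ := exists_eq_conj X
  have h : ((g * hl.toSU * g⁻¹ : SU 3) : Mat).trace = ∑ i, l i := by
    rw [trace_conj, trace_toSU]
  rw [hasRepeatedEigenvalue_iff hl h, h, hasDoubleRoot_iff hl]

lemma trace_inclSU2 (A : SU 2) : (inclSU2 A : Mat).trace =
    1 + (A : Matrix (Fin 2) (Fin 2) ℂ).trace := by
  show (blockOne A).trace = _
  simp [Matrix.trace, blockOne, Fin.sum_univ_three]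
  ring

lemma inclSU2_injective : Function.Injective inclSU2 := by
  intro A B h
  have h1 : blockOne A = blockOne B := congrArg Subtype.val h
  have h2 := fun i j => congrFun (congrFun h1 i) j
  apply Subtype.ext
  ext i j
  fin_cases i <;> fin_cases j
  · simpa [blockOne] using h2 0 0
  · simpa [blockOne] using h2 0 1
  · simpa [blockOne] using h2 1 0
  · simpa [blockOne] using h2 1 1

/-- An element of `SU(2)` that has a repeated eigenvalue in `SU(3)` is a scalar. -/
lemma eq_one_or_neg_one_of_hasDoubleRoot {A : SU 2} (h : HasDoubleRoot (inclSU2 A : Mat).trace) :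
    (A : Matrix (Fin 2) (Fin 2) ℂ) = 1 ∨ (A : Matrix (Fin 2) (Fin 2) ℂ) = -1 := by
  obtain ⟨c1, c2, c3, c4⟩ := SU2.conj_apply A
  obtain ⟨κ, h1, h2⟩ := h
  obtain ⟨t, ht⟩ : ∃ t : ℝ, (A : Matrix (Fin 2) (Fin 2) ℂ).trace = (2 * t : ℝ) ∧
      t = ((A : Matrix (Fin 2) (Fin 2) ℂ) 0 0).re := by
    refine ⟨_, ?_, rfl⟩
    rw [Matrix.trace_fin_two, ← c1, Complex.add_conj]
  obtain ⟨ht, hre⟩ := ht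
  rw [trace_inclSU2, ht, map_add, map_one, Complex.conj_ofReal] at h1 h2
  have ht1 : t = 1 ∨ t = -1 := by
    have h3 : (κ - 1) * (κ ^ 2 - (2 * t : ℝ) * κ + 1) = 0 := by linear_combination h1
    have h4 : (κ ^ 2 - (2 * t : ℝ) * κ + 1) + (κ - 1) * (2 * κ - (2 * t : ℝ)) = 0 := by
      linear_combination h2
    by_cases hκ : κ = 1
    · rw [hκ] at h4
      left
      have h5 : ((2 * t : ℝ) : ℂ) = ((2 : ℝ) : ℂ) := by push_cast at h4 ⊢; linear_combination -h4
      have := Complex.ofReal_injective h5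
      linarith
    · have hκ' := sub_ne_zero.2 hκ
      have h5 := (mul_eq_zero.1 h3).resolve_left hκ'
      rw [h5, zero_add] at h4
      have h6 := (mul_eq_zero.1 h4).resolve_left hκ'
      have h7 : κ ^ 2 = 1 := by
        linear_combination -h5 + κ * h6
      rcases sq_eq_one_iff.1 h7 with h8 | h8
      · exact absurd h8 hκ
      · right
        rw [h8] at h6
        have h9 : ((2 * t : ℝ) : ℂ) = ((-2 : ℝ) : ℂ) := by
          push_cast at h6 ⊢; linear_combination -h6
        have := Complex.ofReal_injective h9
        linarith
  have hn := SU2.normSq_add A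
  rw [Complex.normSq_apply, Complex.normSq_apply, ← hre] at hn
  have hsq : t * t = 1 := by rcases ht1 with rfl | rfl <;> norm_num
  have e1 : ((A : Matrix (Fin 2) (Fin 2) ℂ) 0 0).im = 0 := by nlinarith
  have e2 : ((A : Matrix (Fin 2) (Fin 2) ℂ) 0 1).re = 0 := by nlinarith
  have e3 : ((A : Matrix (Fin 2) (Fin 2) ℂ) 0 1).im = 0 := by nlinarith
  have f0 : (A : Matrix (Fin 2) (Fin 2) ℂ) 0 0 = t := Complex.ext hre.symm (by simp [e1])
  have f1 : (A : Matrix (Fin 2) (Fin 2) ℂ) 0 1 = 0 := Complex.ext e2 e3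
  have f2 : (A : Matrix (Fin 2) (Fin 2) ℂ) 1 0 = 0 := by
    have := c2; rw [f1, map_zero] at this; linear_combination this
  have f3 : (A : Matrix (Fin 2) (Fin 2) ℂ) 1 1 = t := by rw [← c1, f0, Complex.conj_ofReal]
  apply SU2.eq_of_smul (c := t)
  ext i j
  fin_cases i <;> fin_cases j <;> simp [f0, f1, f2, f3]

lemma blockOne_injective : Function.Injective blockOne := by
  intro A B h1
  have h2 := fun i j => congrFun (congrFun h1 i) j
  ext i j
  fin_cases i <;> fin_cases j
  · simpa [blockOne] using h2 0 0
  · simpa [blockOne] using h2 0 1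
  · simpa [blockOne] using h2 1 0
  · simpa [blockOne] using h2 1 1

lemma mem_of_blockOne_mem {A : Matrix (Fin 2) (Fin 2) ℂ}
    (h : blockOne A ∈ Matrix.specialUnitaryGroup (Fin 3) ℂ) :
    A ∈ Matrix.specialUnitaryGroup (Fin 2) ℂ := by
  rw [Matrix.mem_specialUnitaryGroup_iff, Matrix.mem_unitaryGroup_iff] at h ⊢
  obtain ⟨h1, h2⟩ := h
  refine ⟨blockOne_injective ?_, ?_⟩
  · rw [blockOne_mul, Matrix.star_eq_conjTranspose, blockOne_conjTranspose, blockOne_one,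
      ← Matrix.star_eq_conjTranspose, h1]
  · rw [← h2, Matrix.det_fin_three, Matrix.det_fin_two]
    simp [blockOne]

/-- The half turn about a unit vector. -/
lemma exists_halfTurn {w : Fin 3 → ℂ} (hw : star w ⬝ᵥ w = 1) :
    ∃ R : SU 3, (R : Mat) = (2 : ℂ) • Matrix.vecMulVec w (star w) - 1 := by
  have hw' : conj (w 0) * w 0 + conj (w 1) * w 1 + conj (w 2) * w 2 = 1 := by
    rw [← hw]; simp [dotProduct, Fin.sum_univ_three]
  refine ⟨⟨(2 : ℂ) • Matrix.vecMulVec w (star w) - 1, ?_⟩, rfl⟩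
  rw [Matrix.mem_specialUnitaryGroup_iff, Matrix.mem_unitaryGroup_iff]
  have hs : star ((2 : ℂ) • Matrix.vecMulVec w (star w) - 1 : Mat) =
      (2 : ℂ) • Matrix.vecMulVec w (star w) - 1 := by
    ext i j
    fin_cases i <;> fin_cases j <;> simp [Matrix.vecMulVec, Matrix.star_apply, mul_comm]
  refine ⟨?_, ?_⟩
  · have hvv : Matrix.vecMulVec w (star w) * Matrix.vecMulVec w (star w) =
        Matrix.vecMulVec w (star w) := by
      rw [Matrix.vecMulVec_mul_vecMulVec, hw, one_smul]
    rw [hs, Matrix.mul_sub, Matrix.sub_mul, Matrix.smul_mul, Matrix.mul_smul, hvv, Matrix.mul_one,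
      Matrix.one_mul]
    module
  · rw [Matrix.det_fin_three]
    simp [Matrix.vecMulVec]
    linear_combination 2 * hw'

lemma isSpectrum_halfTurn : IsSpectrum ![-1, -1, 1] :=
  ⟨fun i => by fin_cases i <;> simp, by simp⟩

end SU3

/-- A representation with a fixed vector is conjugate to one with image in `SU(2) × {1}`: its image
commutes with the half turn about the fixed vector. -/
theorem HasFixedVector.exists_inclSU2 {π : Type} [Group π] {α : π →* SU 3} (h : HasFixedVector α) :
    ∃ (g : SU 3) (ρ : π →* SU 2), ∀ γ, inclSU2 (ρ γ) = g * α γ * g⁻¹ := by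
  obtain ⟨v, hv, hα⟩ := h
  obtain ⟨w, hw, hαw⟩ : ∃ w : Fin 3 → ℂ, star w ⬝ᵥ w = 1 ∧ ∀ γ, (α γ : Mat).mulVec w = w := by
    obtain ⟨n, hn, hn0⟩ : ∃ n : ℝ, star v ⬝ᵥ v = n ∧ 0 < n := by
      refine ⟨∑ i, Complex.normSq (v i), ?_, ?_⟩
      · push_cast
        exact Finset.sum_congr rfl fun i _ => (Complex.normSq_eq_conj_mul_self).symm
      · obtain ⟨i, hi⟩ := Function.ne_iff.1 hv
        exact Finset.sum_pos' (fun i _ => Complex.normSq_nonneg _)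
          ⟨i, Finset.mem_univ i, Complex.normSq_pos.2 hi⟩
    refine ⟨((Real.sqrt n)⁻¹ : ℂ) • v, ?_, fun γ => by rw [Matrix.mulVec_smul, hα]⟩
    have hs : ((Real.sqrt n : ℝ) : ℂ) * (Real.sqrt n : ℝ) = n := by
      rw [← Complex.ofReal_mul, Real.mul_self_sqrt hn0.le]
    have hs0 : ((Real.sqrt n : ℝ) : ℂ) ≠ 0 := by exact_mod_cast (Real.sqrt_pos.2 hn0).ne'
    rw [star_smul, smul_dotProduct, dotProduct_smul, hn, smul_eq_mul, smul_eq_mul, ← hs]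
    have : star ((Real.sqrt n : ℝ) : ℂ)⁻¹ = ((Real.sqrt n : ℝ) : ℂ)⁻¹ := by
      rw [star_inv₀]; congr 1; exact Complex.conj_ofReal _
    rw [this]
    field_simp
  obtain ⟨R, hR⟩ := exists_halfTurn hw
  have hw' : w ⬝ᵥ star w = 1 := by rw [dotProduct_comm, hw]
  have hRw : (R : Mat).mulVec w = w := by
    rw [hR, Matrix.sub_mulVec, Matrix.smul_mulVec, Matrix.vecMulVec_mulVec, hw, Matrix.one_mulVec]
    ext i; simp; ring
  have hcomm : ∀ γ, α γ * R = R * α γ := fun γ => by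
    have h1 : Matrix.vecMul (star w) (α γ : Mat) = star w := by
      have h2 := congrArg star (hαw γ⁻¹)
      rw [map_inv, SU_coe_inv, Matrix.star_mulVec, Matrix.conjTranspose_conjTranspose] at h2
      exact h2
    apply Subtype.ext
    rw [Submonoid.coe_mul, Submonoid.coe_mul, hR, Matrix.mul_sub, Matrix.sub_mul, Matrix.mul_smul,
      Matrix.smul_mul, Matrix.mul_vecMulVec, Matrix.vecMulVec_mul, hαw, h1, Matrix.mul_one,
      Matrix.one_mul]
  obtain ⟨g, hg⟩ := exists_eq_conj_of_trace isSpectrum_halfTurn (X := R) (by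
    rw [hR, Matrix.trace_sub, Matrix.trace_smul, Matrix.trace_vecMulVec, hw', Matrix.trace_one]
    simp [Fin.sum_univ_three]; norm_num)
  have hD : ∀ γ, g⁻¹ * α γ * g * isSpectrum_halfTurn.toSU =
      isSpectrum_halfTurn.toSU * (g⁻¹ * α γ * g) := fun γ => by
    have h1 := hcomm γ
    rw [hg] at h1
    have h2 := congrArg (fun k => g⁻¹ * k * g) h1
    simpa [mul_assoc] using h2
  -- the image of the fixed vector spans the third coordinate axis
  obtain ⟨u, hu⟩ : ∃ u, u = ((g⁻¹ : SU 3) : Mat).mulVec w := ⟨_, rfl⟩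
  have hgu : (g : Mat).mulVec u = w := by
    rw [hu, Matrix.mulVec_mulVec]
    have : (g : Mat) * ((g⁻¹ : SU 3) : Mat) = 1 := SU_mul_conjTranspose g
    rw [this, Matrix.one_mulVec]
  have hDu : (isSpectrum_halfTurn.toSU : Mat).mulVec u = u := by
    have h1 : isSpectrum_halfTurn.toSU = g⁻¹ * R * g := by rw [hg]; group
    rw [h1, Submonoid.coe_mul, Submonoid.coe_mul, ← Matrix.mulVec_mulVec, ← Matrix.mulVec_mulVec,
      hgu, hRw, ← hu]
  have hβu : ∀ γ, ((g⁻¹ * α γ * g : SU 3) : Mat).mulVec u = u := fun γ => by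
    rw [Submonoid.coe_mul, Submonoid.coe_mul, ← Matrix.mulVec_mulVec, ← Matrix.mulVec_mulVec,
      hgu, hαw, ← hu]
  rw [IsSpectrum.coe_toSU] at hDu
  have hu0 : u 0 = 0 := by
    have := congrFun hDu 0
    simp [Matrix.mulVec_diagonal] at this
    linear_combination -(1 / 2 : ℂ) * this
  have hu1 : u 1 = 0 := by
    have := congrFun hDu 1
    simp [Matrix.mulVec_diagonal] at this
    linear_combination -(1 / 2 : ℂ) * this
  have hu2 : u 2 ≠ 0 := fun h2 => by
    have h3 : u = 0 := by
      funext i; fin_cases i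
      exacts [hu0, hu1, h2]
    rw [h3, Matrix.mulVec_zero] at hgu
    rw [← hgu] at hw
    simp at hw
  have hblock : ∀ γ, ∃ A : SU 2, inclSU2 A = g⁻¹ * α γ * g := fun γ => by
    obtain ⟨b, hb⟩ : ∃ b, b = g⁻¹ * α γ * g := ⟨_, rfl⟩
    have h1 := hD γ
    have h2 := hβu γ
    rw [← hb] at h1 h2 ⊢
    have h3 : (b : Mat) * Matrix.diagonal ![-1, -1, 1] = Matrix.diagonal ![-1, -1, 1] * (b : Mat) :=
      congrArg Subtype.val h1
    have h4 := fun i j => congrFun (congrFun h3 i) j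
    simp only [Matrix.mul_diagonal, Matrix.diagonal_mul] at h4
    have b02 : (b : Mat) 0 2 = 0 := by
      have := h4 0 2; simp at this; linear_combination (1 / 2 : ℂ) * this
    have b12 : (b : Mat) 1 2 = 0 := by
      have := h4 1 2; simp at this; linear_combination (1 / 2 : ℂ) * this
    have b20 : (b : Mat) 2 0 = 0 := by
      have := h4 2 0; simp at this; linear_combination -(1 / 2 : ℂ) * this
    have b21 : (b : Mat) 2 1 = 0 := by
      have := h4 2 1; simp at this; linear_combination -(1 / 2 : ℂ) * this
    have b22 : (b : Mat) 2 2 = 1 := by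
      have := congrFun h2 2
      rw [Matrix.mulVec, dotProduct, Fin.sum_univ_three, hu0, hu1] at this
      apply mul_right_cancel₀ hu2
      linear_combination this
    have hbl : blockOne !![(b : Mat) 0 0, (b : Mat) 0 1; (b : Mat) 1 0, (b : Mat) 1 1] = (b : Mat) := by
      ext i j
      fin_cases i <;> fin_cases j <;> simp [blockOne, b02, b12, b20, b21, b22]
    exact ⟨⟨_, mem_of_blockOne_mem (hbl ▸ b.2)⟩, Subtype.ext hbl⟩
  choose ρ hρ using hblock
  refine ⟨g⁻¹, ⟨⟨ρ, inclSU2_injective ?_⟩, fun γ γ' => inclSU2_injective ?_⟩, fun γ => ?_⟩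
  · rw [hρ, map_one, map_one]; group
  · show inclSU2 (ρ (γ * γ')) = inclSU2 (ρ γ * ρ γ')
    rw [map_mul, hρ, hρ, hρ, map_mul]; group
  · show inclSU2 (ρ γ) = _
    rw [hρ, inv_inv]

lemma hasFixedVector_inclSU2 {π : Type} [Group π] (ρ : π →* SU 2) :
    HasFixedVector (inclSU2.comp ρ) := by
  refine ⟨![0, 0, 1], fun h => by simpa using congrFun h 2, fun γ => ?_⟩
  show (blockOne (ρ γ)).mulVec _ = _
  ext i
  fin_cases i <;> simp [blockOne, Matrix.mulVec, dotProduct, Fin.sum_univ_three]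

namespace IsBrieskornGroup

variable {p q r : ℕ} {a c : ℤ} {π : Type} [Group π] {x y z h : π}

/-- In a nontrivial representation in `SU(2)` the generator `h` goes to `1` or `-1`. -/
lemma map_h_eq (B : IsBrieskornGroup p q r a c x y z h) {ρ : π →* SU 2} (hρ : ρ ≠ 1) :
    (ρ h : Matrix (Fin 2) (Fin 2) ℂ) = 1 ∨ (ρ h : Matrix (Fin 2) (Fin 2) ℂ) = -1 := by
  by_cases hs : ∃ c : ℂ, (ρ h : Matrix (Fin 2) (Fin 2) ℂ) = c • 1
  · obtain ⟨c, hc⟩ := hs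
    exact SU2.eq_of_smul hc
  · push Not at hs
    refine absurd (B.hom_eq_one ρ (Subtype.ext ?_)) hρ
    refine SU2.commute_of_commute hs ?_ ?_
    · have := congrArg (fun g => (ρ g : Matrix (Fin 2) (Fin 2) ℂ)) B.comm_x
      simpa using this.symm
    · have := congrArg (fun g => (ρ g : Matrix (Fin 2) (Fin 2) ℂ)) B.comm_y
      simpa using this.symm

lemma not_hasDoubleRoot_of_ne_one (B : IsBrieskornGroup p q r a c x y z h) {ρ : π →* SU 2}
    (hρ : ρ ≠ 1) {g : π} (hg : g = x ∨ g = y ∨ g = z) :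
    ¬ HasDoubleRoot (inclSU2 (ρ g) : Mat).trace := by
  intro hd
  have hc : ∀ k, Commute (ρ g) (ρ k) := fun k => Subtype.ext (by
    rcases eq_one_or_neg_one_of_hasDoubleRoot hd with h1 | h1 <;>
      simp [h1])
  refine hρ (B.hom_eq_one ρ ?_)
  rcases hg with rfl | rfl | rfl
  · exact hc y
  · exact (hc x).symm
  · have h1 := hc x
    rw [B.z_eq, map_inv, Commute.inv_left_iff, map_mul] at h1
    have h2 : ρ x * (ρ y * ρ x) = ρ x * (ρ x * ρ y) := by
      have := h1.eq
      rw [mul_assoc] at this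
      exact this
    exact (mul_left_cancel h2).symm

end IsBrieskornGroup

/-! ### Pairs of matrices up to conjugation -/

lemma IsRegularSpectrum.eq_slicePt {l : Fin 3 → ℂ} (hl : IsRegularSpectrum l) {v x : Fin 3 → ℂ}
    (h1 : ∑ i, x i = ∑ i, v i) (h2 : ∑ i, l i * x i = ∑ i, l i * v i) :
    x = slicePt v (specDir l) ((x 0 - v 0) / specDir l 0) := by
  have hw := hl.specDir_ne_zero 0
  simp only [Fin.sum_univ_three] at h1 h2
  funext i
  rw [slicePt, div_mul_eq_mul_div]
  have key : (x i - v i) * specDir l 0 = (x 0 - v 0) * specDir l i := by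
    fin_cases i <;> simp only [specDir, Fin.zero_eta, Fin.mk_one, Fin.reduceFinMk, Fin.isValue,
      Fin.reduceAdd, zero_add]
    · linear_combination h2 - l 2 * h1
    · linear_combination l 1 * h1 - h2
  field_simp
  linear_combination key

lemma IsRegularSpectrum.real_eq {l : Fin 3 → ℂ} (hl : IsRegularSpectrum l) {m n : Fin 3 → ℝ}
    (h1 : ∑ i, m i = ∑ i, n i) (h2 : ∑ i, l i * m i = ∑ i, l i * n i) : m = n := by
  have h3 := hl.eq_slicePt (x := fun i => (m i : ℂ)) (v := fun i => (n i : ℂ))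
    (by exact_mod_cast h1) h2
  set u := ((m 0 : ℂ) - n 0) / specDir l 0
  have h4 : ∀ i, ((m i - n i : ℝ) : ℂ) = u * specDir l i := fun i => by
    have := congrFun h3 i
    simp only [slicePt] at this
    push_cast
    linear_combination this
  have h5 : (((m 0 - n 0) * (m 1 - n 1) : ℝ) : ℂ) =
      (Complex.normSq u : ℝ) * (specDir l 0 * conj (specDir l 1)) := by
    have h6 := congrArg conj (h4 1)
    rw [Complex.conj_ofReal, map_mul] at h6
    rw [Complex.ofReal_mul, h6, h4 0, Complex.normSq_eq_conj_mul_self]; ring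
  have h6 := congrArg Complex.im h5
  rw [Complex.ofReal_im, Complex.im_ofReal_mul] at h6
  have h7 := (mul_eq_zero.1 h6.symm).resolve_right hl.im_specDir_ne_zero
  rw [Complex.normSq_eq_zero] at h7
  funext i
  have h8 := h4 i
  rw [h7, zero_mul, Complex.ofReal_eq_zero] at h8
  linarith

namespace SU3

lemma trace_eq_sum_diag (Y g : SU 3) :
    (Y : Mat).trace = ∑ i, diag ((g⁻¹ * Y * g : SU 3) : Mat) i := by
  have h := trace_conj g⁻¹ Y
  rw [inv_inv] at h
  rw [← h]; rfl

lemma trace_mul_eq_sum_diag {l : Fin 3 → ℂ} (hl : IsSpectrum l) (Y g : SU 3) :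
    ((g * hl.toSU * g⁻¹ * Y : SU 3) : Mat).trace =
      ∑ i, l i * diag ((g⁻¹ * Y * g : SU 3) : Mat) i := by
  have h := trace_conj g⁻¹ (g * hl.toSU * g⁻¹ * Y)
  rw [inv_inv] at h
  rw [← h]
  have h2 : g⁻¹ * (g * hl.toSU * g⁻¹ * Y) * g = hl.toSU * (g⁻¹ * Y * g) := by group
  rw [h2, Submonoid.coe_mul, hl.coe_toSU, Matrix.trace]
  simp only [Matrix.diag_apply, Matrix.diagonal_mul]
  rfl

/-- A pair is determined up to conjugation by the spectrum of the first matrix and by the diagonal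
and the chirality of the second one in an eigenbasis of the first. -/
lemma exists_conj_pair {l : Fin 3 → ℂ} (hl : IsSpectrum l) {g g' Y Y' : SU 3}
    (hd : diag ((g⁻¹ * Y * g : SU 3) : Mat) = diag ((g'⁻¹ * Y' * g' : SU 3) : Mat))
    (hc : chirality ((g⁻¹ * Y * g : SU 3) : Mat) = chirality ((g'⁻¹ * Y' * g' : SU 3) : Mat)) :
    ∃ k : SU 3, g' * hl.toSU * g'⁻¹ = k * (g * hl.toSU * g⁻¹) * k⁻¹ ∧ Y' = k * Y * k⁻¹ := by
  obtain ⟨t, ht, hty⟩ := exists_conj_of_diag_eq hd hc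
  obtain ⟨k, hk1, hk2⟩ := exists_conj_of_phases ht
  have h1 := hk1 l hl
  have h2 := hk2 _ _ hty
  refine ⟨g' * k * g⁻¹, ?_, ?_⟩
  · nth_rewrite 1 [← h1]; group
  · have h3 : Y' = g' * (g'⁻¹ * Y' * g') * g'⁻¹ := by group
    rw [h3, h2]; group

/-- In an eigenbasis of `X`, a matrix `Y` with a double eigenvalue is `m + (n - m) v v*`. -/
lemma diag_of_double {m : Fin 3 → ℂ} (hm : IsSpectrum m) (h01 : m 0 = m 1) (k : SU 3) :
    (∀ i, diag ((k * hm.toSU * k⁻¹ : SU 3) : Mat) i =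
      m 0 + (m 2 - m 0) * Complex.normSq ((k : Mat) i 2)) ∧
    chirality ((k * hm.toSU * k⁻¹ : SU 3) : Mat) = 0 ∧
    ∑ i, Complex.normSq ((k : Mat) i 2) = 1 := by
  have hkk : ∀ i j, (k : Mat) i 0 * conj ((k : Mat) j 0) + (k : Mat) i 1 * conj ((k : Mat) j 1) +
      (k : Mat) i 2 * conj ((k : Mat) j 2) = (1 : Mat) i j := fun i j => by
    rw [← SU_mul_conjTranspose k, Matrix.mul_apply, Fin.sum_univ_three]; rfl
  have hent : ∀ i j, ((k * hm.toSU * k⁻¹ : SU 3) : Mat) i j =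
      m 0 * (1 : Mat) i j + (m 2 - m 0) * ((k : Mat) i 2 * conj ((k : Mat) j 2)) := fun i j => by
    rw [coe_conj, hm.coe_toSU, Matrix.mul_apply, Fin.sum_univ_three, Matrix.mul_diagonal,
      Matrix.mul_diagonal, Matrix.mul_diagonal]
    simp only [Matrix.conjTranspose_apply, ← starRingEnd_apply]
    rw [← hkk, h01]; ring
  refine ⟨fun i => ?_, ?_, ?_⟩
  · rw [diag, hent, Matrix.one_apply_eq, Complex.mul_conj, mul_one]
  · rw [chirality, hent, hent]
    simp only [Complex.normSq_mul, Complex.normSq_conj, Matrix.one_apply, Fin.isValue,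
      zero_ne_one, one_ne_zero, if_false, mul_zero, zero_add]
    ring
  · have h := congrFun (congrFun (SU_conjTranspose_mul k) 2) 2
    rw [Matrix.mul_apply, Matrix.one_apply_eq] at h
    simp only [Matrix.conjTranspose_apply, ← starRingEnd_apply,
      ← Complex.normSq_eq_conj_mul_self] at h
    exact_mod_cast h

lemma exists_spectrum_of_double {Y : SU 3} (hY : HasDoubleRoot (Y : Mat).trace) :
    ∃ m : Fin 3 → ℂ, IsSpectrum m ∧ m 0 = m 1 ∧ (Y : Mat).trace = ∑ i, m i := by
  obtain ⟨m, hm, g, rfl⟩ := exists_eq_conj Y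
  rw [trace_conj, trace_toSU] at hY ⊢
  rw [hasDoubleRoot_iff hm] at hY
  simp only [Function.Injective, not_forall] at hY
  obtain ⟨i, j, hij, hne⟩ := hY
  have hperm : ∀ i j : Fin 3, i ≠ j → ∃ σ : Equiv.Perm (Fin 3), σ 0 = i ∧ σ 1 = j := by decide
  obtain ⟨σ, h0, h1⟩ := hperm i j hne
  exact ⟨m ∘ σ, hm.comp σ, by simp [h0, h1, hij], (Equiv.sum_comp σ m).symm⟩

/-- Rigidity: if one matrix of a pair has simple spectrum and the other one a double eigenvalue, the
traces of both and of their product determine the pair up to conjugation. -/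
theorem exists_conj_pair_of_double {X Y X' Y' : SU 3} (h1 : (X : Mat).trace = (X' : Mat).trace)
    (h2 : (Y : Mat).trace = (Y' : Mat).trace)
    (h3 : ((X * Y : SU 3) : Mat).trace = ((X' * Y' : SU 3) : Mat).trace)
    (hX : ¬ HasDoubleRoot (X : Mat).trace) (hY : HasDoubleRoot (Y : Mat).trace) :
    ∃ k : SU 3, X' = k * X * k⁻¹ ∧ Y' = k * Y * k⁻¹ := by
  obtain ⟨l, hl, g, rfl⟩ := exists_eq_conj X
  rw [trace_conj, trace_toSU] at h1 hX
  obtain ⟨g', rfl⟩ := exists_eq_conj_of_trace hl h1.symm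
  rw [hasDoubleRoot_iff hl, not_not] at hX
  have hlr := hl.regular hX
  obtain ⟨m, hm, h01, hmY⟩ := exists_spectrum_of_double hY
  obtain ⟨k, hk⟩ := exists_eq_conj_of_trace hm hmY
  obtain ⟨k', hk'⟩ := exists_eq_conj_of_trace hm (h2.symm.trans hmY)
  have e : g⁻¹ * Y * g = (g⁻¹ * k) * hm.toSU * (g⁻¹ * k)⁻¹ := by rw [hk]; group
  have e' : g'⁻¹ * Y' * g' = (g'⁻¹ * k') * hm.toSU * (g'⁻¹ * k')⁻¹ := by rw [hk']; group
  rw [trace_mul_eq_sum_diag, trace_mul_eq_sum_diag] at h3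
  obtain ⟨a1, a2, a3⟩ := diag_of_double hm h01 (g⁻¹ * k)
  obtain ⟨b1, b2, b3⟩ := diag_of_double hm h01 (g'⁻¹ * k')
  rw [← e] at a1 a2
  rw [← e'] at b1 b2
  refine exists_conj_pair hl ?_ (a2.trans b2.symm)
  by_cases hm2 : m 2 = m 0
  · funext i
    rw [a1, b1, hm2, sub_self, zero_mul, zero_mul]
  · have hne := sub_ne_zero.2 hm2
    have hreal := hlr.real_eq (a3.trans b3.symm) (by
      simp only [a1, b1, Fin.sum_univ_three] at h3 ⊢
      apply mul_left_cancel₀ hne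
      linear_combination h3)
    funext i
    rw [a1, b1, congrFun hreal i]

lemma exists_hyperplane {X : SU 3} (hX : HasDoubleRoot (X : Mat).trace) :
    ∃ (μ : ℂ) (φ : Fin 3 → ℂ), ∀ w, φ ⬝ᵥ w = 0 → (X : Mat).mulVec w = μ • w := by
  obtain ⟨m, hm, h01, hmX⟩ := exists_spectrum_of_double hX
  obtain ⟨g, rfl⟩ := exists_eq_conj_of_trace hm hmX
  refine ⟨m 0, fun j => ((g⁻¹ : SU 3) : Mat) 2 j, fun w hw => ?_⟩
  have h1 : (((g⁻¹ : SU 3) : Mat).mulVec w) 2 = 0 := hw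
  have h2 : (Matrix.diagonal m).mulVec (((g⁻¹ : SU 3) : Mat).mulVec w) =
      m 0 • ((g⁻¹ : SU 3) : Mat).mulVec w := by
    ext i
    rw [Matrix.mulVec_diagonal, Pi.smul_apply, smul_eq_mul]
    fin_cases i
    · rfl
    · show m 1 * _ = m 0 * _
      rw [h01]
    · show m 2 * (((g⁻¹ : SU 3) : Mat).mulVec w) 2 = m 0 * (((g⁻¹ : SU 3) : Mat).mulVec w) 2
      rw [h1, mul_zero, mul_zero]
  rw [Submonoid.coe_mul, Submonoid.coe_mul, ← Matrix.mulVec_mulVec, ← Matrix.mulVec_mulVec,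
    hm.coe_toSU, h2, Matrix.mulVec_smul, Matrix.mulVec_mulVec]
  have : (g : Mat) * ((g⁻¹ : SU 3) : Mat) = 1 := SU_mul_conjTranspose g
  rw [this, Matrix.one_mulVec]

/-- Two planes of eigenvectors meet. -/
lemma exists_common_eigenvector {X Y : SU 3} (hX : HasDoubleRoot (X : Mat).trace)
    (hY : HasDoubleRoot (Y : Mat).trace) : ∃ v : Fin 3 → ℂ, v ≠ 0 ∧
      (∃ c : ℂ, (X : Mat).mulVec v = c • v) ∧ ∃ c : ℂ, (Y : Mat).mulVec v = c • v := by
  obtain ⟨μ, φ, hφ⟩ := exists_hyperplane hX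
  obtain ⟨ν, ψ, hψ⟩ := exists_hyperplane hY
  obtain ⟨v, hv, hv'⟩ := Matrix.exists_mulVec_eq_zero_iff (M := Matrix.of ![φ, ψ, 0]) |>.2 (by
    rw [Matrix.det_fin_three]; simp)
  exact ⟨v, hv, ⟨μ, hφ v (congrFun hv' 0)⟩, ⟨ν, hψ v (congrFun hv' 1)⟩⟩

/-- In an eigenbasis of a matrix with simple spectrum, a fixed vector of both matrices is a
coordinate vector. -/
lemma exists_diag_eq_one {l : Fin 3 → ℂ} (hl : IsSpectrum l) (hinj : Function.Injective l)
    {g Y : SU 3} {v : Fin 3 → ℂ} (hv : v ≠ 0) (h1 : ((g * hl.toSU * g⁻¹ : SU 3) : Mat).mulVec v = v)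
    (h2 : (Y : Mat).mulVec v = v) : ∃ j, l j = 1 ∧ diag ((g⁻¹ * Y * g : SU 3) : Mat) j = 1 := by
  obtain ⟨u, hu⟩ : ∃ u, u = ((g⁻¹ : SU 3) : Mat).mulVec v := ⟨_, rfl⟩
  have hgu : (g : Mat).mulVec u = v := by
    rw [hu, Matrix.mulVec_mulVec]
    have : (g : Mat) * ((g⁻¹ : SU 3) : Mat) = 1 := SU_mul_conjTranspose g
    rw [this, Matrix.one_mulVec]
  have hDu : ∀ i, l i * u i = u i := by
    have h3 : (hl.toSU : Mat).mulVec u = u := by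
      have h4 : hl.toSU = g⁻¹ * (g * hl.toSU * g⁻¹) * g := by group
      rw [h4, Submonoid.coe_mul, Submonoid.coe_mul, ← Matrix.mulVec_mulVec,
        ← Matrix.mulVec_mulVec, hgu, h1, ← hu]
    intro i
    have := congrFun h3 i
    rwa [hl.coe_toSU, Matrix.mulVec_diagonal] at this
  have hYu : ((g⁻¹ * Y * g : SU 3) : Mat).mulVec u = u := by
    rw [Submonoid.coe_mul, Submonoid.coe_mul, ← Matrix.mulVec_mulVec, ← Matrix.mulVec_mulVec, hgu,
      h2, ← hu]
  obtain ⟨j, hj⟩ : ∃ j, u j ≠ 0 := by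
    by_contra hcon
    push Not at hcon
    have h3 : u = 0 := funext hcon
    rw [h3, Matrix.mulVec_zero] at hgu
    exact hv hgu.symm
  have hlj : l j = 1 := mul_right_cancel₀ hj (by rw [hDu, one_mul])
  refine ⟨j, hlj, ?_⟩
  have hu0 : ∀ i, i ≠ j → u i = 0 := fun i hi => by
    by_contra h3
    have h4 : l i = 1 := mul_right_cancel₀ h3 (by rw [hDu, one_mul])
    exact hi (hinj (h4.trans hlj.symm))
  have h3 := congrFun hYu j
  rw [Matrix.mulVec, dotProduct, Finset.sum_eq_single j (fun i _ hi => by rw [hu0 i hi, mul_zero])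
    (by simp)] at h3
  exact mul_right_cancel₀ hj (by rw [diag, h3, one_mul])

lemma chirality_eq_zero {y : SU 3} {i : Fin 3} (h : pairSum (diag y) i = 0) :
    chirality y = 0 := by
  have h1 := chirality_sq y
  have h2 := disc_nonpos_of_pairSum h
  rw [← h1] at h2
  exact pow_eq_zero_iff two_ne_zero |>.1 (le_antisymm h2 (sq_nonneg _))

/-- A pair with a common fixed vector, the first matrix having simple spectrum, is determined up to
conjugation by the traces of both and of their product. -/
theorem exists_conj_pair_of_fixed {X Y X' Y' : SU 3} (h1 : (X : Mat).trace = (X' : Mat).trace)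
    (h2 : (Y : Mat).trace = (Y' : Mat).trace)
    (h3 : ((X * Y : SU 3) : Mat).trace = ((X' * Y' : SU 3) : Mat).trace)
    (hX : ¬ HasDoubleRoot (X : Mat).trace) {v v' : Fin 3 → ℂ} (hv : v ≠ 0) (hv' : v' ≠ 0)
    (hXv : (X : Mat).mulVec v = v) (hYv : (Y : Mat).mulVec v = v)
    (hXv' : (X' : Mat).mulVec v' = v') (hYv' : (Y' : Mat).mulVec v' = v') :
    ∃ k : SU 3, X' = k * X * k⁻¹ ∧ Y' = k * Y * k⁻¹ := by
  obtain ⟨l, hl, g, rfl⟩ := exists_eq_conj X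
  rw [trace_conj, trace_toSU] at h1 hX
  obtain ⟨g', rfl⟩ := exists_eq_conj_of_trace hl h1.symm
  rw [hasDoubleRoot_iff hl, not_not] at hX
  have hlr := hl.regular hX
  rw [trace_mul_eq_sum_diag, trace_mul_eq_sum_diag] at h3
  rw [trace_eq_sum_diag Y g, trace_eq_sum_diag Y' g'] at h2
  obtain ⟨j, hj1, hj2⟩ := exists_diag_eq_one hl hX hv hXv hYv
  obtain ⟨j', hj1', hj2'⟩ := exists_diag_eq_one hl hX hv' hXv' hYv'
  have hjj : j' = j := hX (hj1'.trans hj1.symm)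
  subst hjj
  have c1 := chirality_eq_zero ((isDiagonal_diag _).eq_conj hj2).2.1
  have c2 := chirality_eq_zero ((isDiagonal_diag _).eq_conj hj2').2.1
  refine exists_conj_pair hl ?_ (c1.trans c2.symm)
  rw [hlr.eq_slicePt h2 h3]
  have h4 := congrFun (hlr.eq_slicePt h2 h3) j'
  rw [hj2, slicePt, hj2'] at h4
  have h5 := (mul_eq_zero.1 (by linear_combination -h4 :
    (diag ((g⁻¹ * Y * g : SU 3) : Mat) 0 - diag ((g'⁻¹ * Y' * g' : SU 3) : Mat) 0) /
      specDir l 0 * specDir l j' = 0)).resolve_right (hlr.specDir_ne_zero j')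
  rw [h5]
  funext i
  simp [slicePt]

end SU3

/-! ### Representations with given traces -/

namespace IsBrieskornGroup

variable {p q r : ℕ} {a c : ℤ} {π : Type} [Group π] {x y z h : π}

lemma h_eq (B : IsBrieskornGroup p q r a c x y z h) :
    h = x ^ (p * (r * (p + q))) * (x * y)⁻¹ ^ (r * (p * q)) := by
  rw [← B.z_eq, pow_mul x p, pow_mul z r, B.x_pow, B.z_pow, ← zpow_natCast, ← zpow_natCast, ← zpow_mul,
    ← zpow_mul, ← zpow_add]
  have : a * ((r * (p + q) : ℕ) : ℤ) + c * ((p * q : ℕ) : ℤ) = 1 := by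
    rw [← B.eq_one]; push_cast; ring
  rw [this, zpow_one]

lemma hom_ext' (B : IsBrieskornGroup p q r a c x y z h) {G : Type*} [Group G] {φ ψ : π →* G}
    (hx : φ x = ψ x) (hy : φ y = ψ y) : φ = ψ :=
  B.hom_ext hx hy (by rw [B.z_eq, map_inv, map_inv, map_mul, map_mul, hx, hy])
    (by rw [B.h_eq]; simp only [map_mul, map_pow, map_inv, hx, hy])

lemma repClass_eq (B : IsBrieskornGroup p q r a c x y z h) {α β : π →* SU 3} {k : SU 3}
    (hx : β x = k * α x * k⁻¹) (hy : β y = k * α y * k⁻¹) : repClass α = repClass β := by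
  have h1 : β = (MulAut.conj k).toMonoidHom.comp α := B.hom_ext' hx hy
  exact Quotient.sound ⟨k, fun γ => by rw [h1]; rfl⟩

end IsBrieskornGroup

lemma repClass_eq_iff {π : Type} [Group π] {α β : π →* SU 3} :
    repClass α = repClass β ↔ ∃ k : SU 3, ∀ γ, β γ = k * α γ * k⁻¹ := Quotient.eq

/-- The traces of the images of the generators agree. -/
structure SameTraces {π : Type} [Group π] (x y z h : π) (α β : π →* SU 3) : Prop where
  x : (α x : Mat).trace = (β x : Mat).trace
  y : (α y : Mat).trace = (β y : Mat).trace
  z : (α z : Mat).trace = (β z : Mat).trace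
  h : (α h : Mat).trace = (β h : Mat).trace

namespace SU3

lemma mem_center_of_smul {X : SU 3} {c : ℂ} (hX : (X : Mat) = c • 1) :
    X ∈ Subgroup.center (SU 3) := by
  rw [Subgroup.mem_center_iff]
  intro g
  apply Subtype.ext
  rw [Submonoid.coe_mul, Submonoid.coe_mul, hX]
  simp

lemma eq_one_of_trace {X : SU 3} (hX : (X : Mat).trace = 3) : X = 1 := by
  have h1 : IsSpectrum (fun _ => (1 : ℂ)) := ⟨fun i => by simp, by simp⟩
  obtain ⟨g, rfl⟩ := exists_eq_conj_of_trace h1 (X := X) (by rw [hX]; simp)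
  have h2 : h1.toSU = 1 := Subtype.ext Matrix.diagonal_one
  rw [h2]; group

lemma trace_one : ((1 : SU 3) : Mat).trace = 3 := by
  rw [Submonoid.coe_one, Matrix.trace_one]; simp

lemma pow_three_of_smul {X : SU 3} {c : ℂ} (hX : (X : Mat) = c • 1) : c ^ 3 = 1 := by
  have := (Matrix.mem_specialUnitaryGroup_iff.1 X.2).2
  rw [hX, Matrix.det_smul, Matrix.det_one, Fintype.card_fin, mul_one] at this
  exact this

lemma trace_of_smul {X : SU 3} {c : ℂ} (hX : (X : Mat) = c • 1) : (X : Mat).trace = 3 * c := by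
  rw [hX, Matrix.trace_smul, Matrix.trace_one]; simp [mul_comm]

end SU3

lemma trace_eq_of_repClass_eq {π : Type} [Group π] {α β : π →* SU 3}
    (h : repClass α = repClass β) (γ : π) : (α γ : Mat).trace = (β γ : Mat).trace := by
  obtain ⟨k, hk⟩ := repClass_eq_iff.1 h
  rw [hk, trace_conj]

lemma HasFixedVector.of_repClass_eq {π : Type} [Group π] {α β : π →* SU 3}
    (hα : HasFixedVector α) (h : repClass α = repClass β) : HasFixedVector β := by
  obtain ⟨k, hk⟩ := repClass_eq_iff.1 h
  obtain ⟨v, hv, hv'⟩ := hα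
  have hkk : ((k⁻¹ : SU 3) : Mat).mulVec ((k : Mat).mulVec v) = v := by
    rw [Matrix.mulVec_mulVec]
    have : ((k⁻¹ : SU 3) : Mat) * (k : Mat) = 1 := SU_conjTranspose_mul k
    rw [this, Matrix.one_mulVec]
  refine ⟨(k : Mat).mulVec v, fun h0 => hv ?_, fun γ => ?_⟩
  · rw [← hkk, h0, Matrix.mulVec_zero]
  · rw [hk, Submonoid.coe_mul, Submonoid.coe_mul, ← Matrix.mulVec_mulVec, ← Matrix.mulVec_mulVec,
      hkk, hv']

lemma HasFixedVector.exists_repClass_inclSU2 {π : Type} [Group π] {α : π →* SU 3}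
    (h : HasFixedVector α) : ∃ ρ : π →* SU 2, repClass (inclSU2.comp ρ) = repClass α := by
  obtain ⟨g, ρ, hρ⟩ := h.exists_inclSU2
  exact ⟨ρ, (repClass_eq_iff.2 ⟨g, hρ⟩).symm⟩

namespace IsBrieskornGroup

variable {p q r : ℕ} {a c : ℤ} {π : Type} [Group π] {x y z h : π}

lemma isIrred_of_repClass_eq (B : IsBrieskornGroup p q r a c x y z h) {α β : π →* SU 3}
    (hαβ : repClass α = repClass β) (hα : IsIrred α) : IsIrred β := by
  by_contra hβ
  exact B.not_isIrred_iff.2 ((B.not_isIrred_iff.1 hβ).of_repClass_eq hαβ.symm) hα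

lemma comm_h (B : IsBrieskornGroup p q r a c x y z h) (γ : π) : γ * h = h * γ := by
  refine B.induction (P := fun γ => γ * h = h * γ) B.comm_x.symm B.comm_y.symm B.comm_z.symm rfl
    (by simp) (fun g g' h1 h2 => ?_) (fun g h1 => ?_) γ
  · rw [mul_assoc, h2, ← mul_assoc, h1, mul_assoc]
  · rw [inv_mul_eq_iff_eq_mul, ← mul_assoc, h1, mul_assoc, mul_inv_cancel, mul_one]

/-- An irreducible representation sends the central element `h` to a scalar. -/
lemma exists_map_h_eq_smul (B : IsBrieskornGroup p q r a c x y z h) {α : π →* SU 3}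
    (hα : IsIrred α) : ∃ c : ℂ, (α h : Mat) = c • 1 :=
  hα.eq_smul fun γ => by
    have := congrArg (fun g => (α g : Mat)) (B.comm_h γ)
    simpa using this

lemma eq_one_of_repClass_eq {α : π →* SU 3} (h : repClass α = repClass (1 : π →* SU 3)) :
    α = 1 := by
  obtain ⟨k, hk⟩ := repClass_eq_iff.1 h.symm
  ext1 γ
  rw [hk]; simp

/-- A nontrivial reducible representation sends `h` to `1` or to a matrix of trace `-1`, and sends
the other generators to matrices with simple spectrum. -/
lemma of_hasFixedVector (B : IsBrieskornGroup p q r a c x y z h) {α : π →* SU 3}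
    (hα : HasFixedVector α) (h1 : α ≠ 1) :
    (α h = 1 ∨ (α h : Mat).trace = -1) ∧ ¬ HasDoubleRoot (α x : Mat).trace ∧
      ¬ HasDoubleRoot (α y : Mat).trace ∧ ¬ HasDoubleRoot (α z : Mat).trace := by
  obtain ⟨ρ, hρ⟩ := hα.exists_repClass_inclSU2
  have hρ1 : ρ ≠ 1 := by
    rintro rfl
    exact h1 (eq_one_of_repClass_eq (by rw [← hρ]; congr 1; ext1; simp))
  have htr := trace_eq_of_repClass_eq hρ
  refine ⟨?_, ?_, ?_, ?_⟩
  · rcases B.map_h_eq hρ1 with h2 | h2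
    · left
      apply eq_one_of_trace
      rw [← htr]
      have : ρ h = 1 := Subtype.ext h2
      simp [this]
    · right
      rw [← htr, MonoidHom.comp_apply, trace_inclSU2, h2]
      simp; norm_num
  · rw [← htr]; exact B.not_hasDoubleRoot_of_ne_one hρ1 (Or.inl rfl)
  · rw [← htr]; exact B.not_hasDoubleRoot_of_ne_one hρ1 (Or.inr (Or.inl rfl))
  · rw [← htr]; exact B.not_hasDoubleRoot_of_ne_one hρ1 (Or.inr (Or.inr rfl))

lemma isIrred_trace_h_ne (B : IsBrieskornGroup p q r a c x y z h) {α : π →* SU 3}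
    (hα : IsIrred α) : (α h : Mat).trace ≠ -1 := by
  intro h1
  obtain ⟨c, hc⟩ := B.exists_map_h_eq_smul hα
  have h2 := pow_three_of_smul hc
  rw [trace_of_smul hc] at h1
  have h3 : c = -(1 / 3) := by linear_combination (1 / 3 : ℂ) * h1
  rw [h3] at h2
  norm_num at h2

/-- Unless its trace is `-1`, the image of `h` is a scalar. -/
lemma map_h_eq_smul (B : IsBrieskornGroup p q r a c x y z h) {α : π →* SU 3}
    (hα : (α h : Mat).trace ≠ -1) : (α h : Mat) = ((α h : Mat).trace / 3) • 1 := by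
  by_cases hirr : IsIrred α
  · obtain ⟨c, hc⟩ := B.exists_map_h_eq_smul hirr
    rw [trace_of_smul hc]
    rw [mul_div_cancel_left₀ _ (by norm_num : (3 : ℂ) ≠ 0)]
    exact hc
  · have h1 : α h = 1 := by
      by_cases h1 : α = 1
      · rw [h1]; rfl
      · exact (B.of_hasFixedVector (B.not_isIrred_iff.1 hirr) h1).1.resolve_right hα
    rw [h1, trace_one]
    simp

lemma map_h_eq_map_h (B : IsBrieskornGroup p q r a c x y z h) {α β : π →* SU 3}
    (hs : SameTraces x y z h α β) (hα : (α h : Mat).trace ≠ -1) : α h = β h := by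
  have h1 := B.map_h_eq_smul hα
  have h2 := B.map_h_eq_smul (α := β) (hs.h ▸ hα)
  exact Subtype.ext (h1.trans ((congrArg (fun t => (t / 3) • (1 : Mat)) hs.h).trans h2.symm))

lemma trace_mul (B : IsBrieskornGroup p q r a c x y z h) (α : π →* SU 3) :
    ((α x * α y : SU 3) : Mat).trace = conj (α z : Mat).trace := by
  rw [B.z_eq, map_inv, map_mul, trace_inv, Complex.conj_conj]

lemma eq_one_of_sameTraces (B : IsBrieskornGroup p q r a c x y z h) {α : π →* SU 3}
    (hs : SameTraces x y z h α 1) : α = 1 := by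
  refine B.hom_ext' (eq_one_of_trace ?_) (eq_one_of_trace ?_)
  · rw [hs.x]; exact trace_one
  · rw [hs.y]; exact trace_one

/-- Reducible representations are classified by their traces. -/
theorem repClass_eq_of_hasFixedVector (B : IsBrieskornGroup p q r a c x y z h) {α β : π →* SU 3}
    (hs : SameTraces x y z h α β) (hα : HasFixedVector α) (hβ : HasFixedVector β) :
    repClass α = repClass β := by
  by_cases h1 : α = 1
  · subst h1
    rw [B.eq_one_of_sameTraces ⟨hs.x.symm, hs.y.symm, hs.z.symm, hs.h.symm⟩]
  obtain ⟨v, hv, hv'⟩ := hα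
  obtain ⟨w, hw, hw'⟩ := hβ
  obtain ⟨k, hk, hk'⟩ := exists_conj_pair_of_fixed hs.x hs.y
    (by rw [B.trace_mul, B.trace_mul, hs.z]) (B.of_hasFixedVector ⟨v, hv, hv'⟩ h1).2.1 hv hw
    (hv' x) (hv' y) (hw' x) (hw' y)
  exact B.repClass_eq hk hk'

/-- If two of the generators `x, y, z` have a multiple eigenvalue, two planes of eigenvectors meet in
a common eigenvector. -/
lemma hasFixedVector_of_common_eigenvector (B : IsBrieskornGroup p q r a c x y z h)
    {α : π →* SU 3} (hα : (α h : Mat).trace ≠ -1)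
    (h2 : (HasDoubleRoot (α x : Mat).trace ∧ HasDoubleRoot (α y : Mat).trace) ∨
      (HasDoubleRoot (α y : Mat).trace ∧ HasDoubleRoot (α z : Mat).trace) ∨
      (HasDoubleRoot (α x : Mat).trace ∧ HasDoubleRoot (α z : Mat).trace)) :
    HasFixedVector α := by
  have hh : ∀ v : Fin 3 → ℂ, ∃ c : ℂ, (α h : Mat).mulVec v = c • v := fun v =>
    ⟨_, by rw [B.map_h_eq_smul hα, Matrix.smul_mulVec, Matrix.one_mulVec]⟩
  have hmul : ∀ (g g' : SU 3) (v : Fin 3 → ℂ), (∃ c : ℂ, (g : Mat).mulVec v = c • v) →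
      (∃ c : ℂ, (g' : Mat).mulVec v = c • v) →
      ∃ c : ℂ, ((g * g' : SU 3) : Mat).mulVec v = c • v := by
    rintro g g' v ⟨c, hc⟩ ⟨c', hc'⟩
    exact ⟨c' * c, by rw [Submonoid.coe_mul, ← Matrix.mulVec_mulVec, hc', Matrix.mulVec_smul, hc,
      smul_smul]⟩
  have hinv : ∀ (g : SU 3) (v : Fin 3 → ℂ), v ≠ 0 → (∃ c : ℂ, (g : Mat).mulVec v = c • v) →
      ∃ c : ℂ, ((g⁻¹ : SU 3) : Mat).mulVec v = c • v := by
    rintro g v hv ⟨c, hc⟩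
    have h1 : ((g⁻¹ : SU 3) : Mat).mulVec ((g : Mat).mulVec v) = v := by
      rw [Matrix.mulVec_mulVec]
      have : ((g⁻¹ : SU 3) : Mat) * (g : Mat) = 1 := SU_conjTranspose_mul _
      rw [this, Matrix.one_mulVec]
    rw [hc, Matrix.mulVec_smul] at h1
    have hc0 : c ≠ 0 := by
      rintro rfl
      rw [zero_smul] at h1
      exact hv h1.symm
    exact ⟨c⁻¹, by rw [eq_inv_smul_iff₀ hc0]; exact h1⟩
  have hx : α x = (α z)⁻¹ * (α y)⁻¹ := by
    rw [← map_inv, ← map_inv, ← map_mul, B.z_eq]; congr 1; group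
  have hy : α y = (α x)⁻¹ * (α z)⁻¹ := by
    rw [← map_inv, ← map_inv, ← map_mul, B.z_eq]; congr 1; group
  rcases h2 with ⟨d1, d2⟩ | ⟨d1, d2⟩ | ⟨d1, d2⟩ <;>
    obtain ⟨v, hv, e1, e2⟩ := exists_common_eigenvector d1 d2
  · exact ⟨v, hv, B.hasFixedVector_of_eigenvector hv e1 e2 (hh v)⟩
  · refine ⟨v, hv, B.hasFixedVector_of_eigenvector hv ?_ e1 (hh v)⟩
    rw [hx]; exact hmul _ _ _ (hinv _ _ hv e2) (hinv _ _ hv e1)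
  · refine ⟨v, hv, B.hasFixedVector_of_eigenvector hv e1 ?_ (hh v)⟩
    rw [hy]; exact hmul _ _ _ (hinv _ _ hv e1) (hinv _ _ hv e2)

/-- If exactly one of the generators `x, y, z` has a multiple eigenvalue, the traces determine the
representation. -/
theorem repClass_eq_of_double (B : IsBrieskornGroup p q r a c x y z h) {α β : π →* SU 3}
    (hs : SameTraces x y z h α β)
    (hd : (HasDoubleRoot (α x : Mat).trace ∧ ¬ HasDoubleRoot (α y : Mat).trace) ∨
      (HasDoubleRoot (α y : Mat).trace ∧ ¬ HasDoubleRoot (α x : Mat).trace) ∨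
      (HasDoubleRoot (α z : Mat).trace ∧ ¬ HasDoubleRoot (α x : Mat).trace)) :
    repClass α = repClass β := by
  have hxy : ((α x * α y : SU 3) : Mat).trace = ((β x * β y : SU 3) : Mat).trace := by
    rw [B.trace_mul, B.trace_mul, hs.z]
  rcases hd with ⟨d1, d2⟩ | ⟨d1, d2⟩ | ⟨d1, d2⟩
  · obtain ⟨k, hk, hk'⟩ := exists_conj_pair_of_double hs.y hs.x (by
      rw [Submonoid.coe_mul, Submonoid.coe_mul, Matrix.trace_mul_comm, ← Submonoid.coe_mul, hxy,
        Submonoid.coe_mul, Matrix.trace_mul_comm]) d2 d1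
    exact B.repClass_eq hk' hk
  · obtain ⟨k, hk, hk'⟩ := exists_conj_pair_of_double hs.x hs.y hxy d2 d1
    exact B.repClass_eq hk hk'
  · have htr : ∀ α : π →* SU 3, ((α x * α z : SU 3) : Mat).trace = conj (α y : Mat).trace := by
      intro α
      have h1 : α z * α x = (α y)⁻¹ := by
        rw [← map_mul, ← map_inv, B.z_eq]; congr 1; group
      rw [Submonoid.coe_mul, Matrix.trace_mul_comm, ← Submonoid.coe_mul, h1, trace_inv]
    have hy : ∀ α : π →* SU 3, α y = (α x)⁻¹ * (α z)⁻¹ := by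
      intro α
      rw [← map_inv, ← map_inv, ← map_mul, B.z_eq]; congr 1; group
    obtain ⟨k, hk, hk'⟩ := exists_conj_pair_of_double hs.x hs.z (by rw [htr, htr, hs.y]) d2 d1
    exact B.repClass_eq hk (by rw [hy β, hk, hk', hy α]; group)

end IsBrieskornGroup

/-! ### The first cohomology of a Brieskorn group -/

open groupCohomology

/-- An invariant anisotropic symmetric bilinear form for a representation. -/
structure IsInvariantForm {π : Type} [Group π] {V : Type} [AddCommGroup V] [Module ℝ V]
    (ρ : Representation ℝ π V) (b : LinearMap.BilinForm ℝ V) : Prop where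
  symm : ∀ v w, b v w = b w v
  anisotropic : ∀ v, b v v = 0 → v = 0
  map : ∀ g v w, b (ρ g v) (ρ g w) = b v w

namespace IsInvariantForm

variable {π : Type} [Group π] {V : Type} [AddCommGroup V] [Module ℝ V]
  {ρ : Representation ℝ π V} {b : LinearMap.BilinForm ℝ V}

lemma isRefl (hb : IsInvariantForm ρ b) : b.IsRefl := fun v w h => by rw [hb.symm, h]

lemma nondegenerate (hb : IsInvariantForm ρ b) : b.Nondegenerate :=
  ⟨fun v h => hb.anisotropic v (h v), fun v h => hb.anisotropic v (h v)⟩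

lemma map_right (hb : IsInvariantForm ρ b) {g : π} {v w : V} (hw : ρ g w = w) :
    b (ρ g v) w = b v w := by
  conv_lhs => rw [← hw]
  exact hb.map g v w

/-- A vector orthogonal to the image of `1 - g` is fixed by `g`. -/
lemma apply_eq_self (hb : IsInvariantForm ρ b) {g : π} {w : V}
    (hw : ∀ v, b (v - ρ g v) w = 0) : ρ g w = w := by
  have h1 := hw w
  rw [map_sub, LinearMap.sub_apply] at h1
  rw [← sub_eq_zero]
  apply hb.anisotropic
  simp only [map_sub, LinearMap.sub_apply, hb.map, hb.symm w (ρ g w)]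
  linarith

/-- The image of `1 - g` is the orthogonal complement of the fixed vectors of `g`. -/
lemma mem_range [FiniteDimensional ℝ V] (hb : IsInvariantForm ρ b) {g : π} {u : V}
    (hu : ∀ w, ρ g w = w → b u w = 0) : u ∈ LinearMap.range (1 - ρ g) := by
  rw [← LinearMap.BilinForm.orthogonal_orthogonal hb.nondegenerate hb.isRefl
    (LinearMap.range (1 - ρ g)), LinearMap.BilinForm.mem_orthogonal_iff]
  intro w hw
  rw [LinearMap.BilinForm.mem_orthogonal_iff] at hw
  rw [hb.symm]
  exact hu w (hb.apply_eq_self fun v => hw _ ⟨v, rfl⟩)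

end IsInvariantForm

section Cocycles

variable {π : Type} [Group π] {V : Type} [AddCommGroup V] [Module ℝ V]
  {ρ : Representation ℝ π V}

lemma cocycle_mul (f : cocycles₁ (Rep.of ρ)) (g k : π) : f (g * k) = ρ g (f k) + f g :=
  (mem_cocycles₁_iff f).1 f.2 g k

lemma cocycle_one (f : cocycles₁ (Rep.of ρ)) : f 1 = 0 := cocycles₁_map_one f

lemma cocycle_zpow {f : cocycles₁ (Rep.of ρ)} {g : π} (hg : f g = 0) (n : ℤ) : f (g ^ n) = 0 := by
  -- the elements at which a cocycle vanishes form a subgroup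
  let S : Subgroup π :=
    { carrier := {g | f g = 0}
      one_mem' := cocycle_one f
      mul_mem' := fun {g k} (hg : f g = 0) (hk : f k = 0) => show f (g * k) = 0 by
        rw [cocycle_mul, hg, hk, map_zero, add_zero]
      inv_mem' := fun {g} (hg : f g = 0) => show f g⁻¹ = 0 by
        have h1 := cocycle_mul f g⁻¹ g
        rw [inv_mul_cancel, cocycle_one, hg, map_zero, zero_add] at h1
        exact h1.symm }
  exact S.zpow_mem (show g ∈ S from hg) n

lemma IsInvariantForm.cocycle_pow {b : LinearMap.BilinForm ℝ V} (hb : IsInvariantForm ρ b)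
    (f : cocycles₁ (Rep.of ρ)) {g : π} {w : V} (hw : ρ g w = w) (n : ℕ) :
    b (f (g ^ n)) w = n * b (f g) w := by
  induction n with
  | zero => rw [pow_zero, cocycle_one]; simp
  | succ n ih =>
    rw [pow_succ', cocycle_mul, map_add, LinearMap.add_apply, hb.map_right hw, ih]
    push_cast; ring

/-- If a cocycle vanishes at a power of `g`, its value at `g` is in the image of `1 - g`. -/
lemma IsInvariantForm.cocycle_mem_range [FiniteDimensional ℝ V] {b : LinearMap.BilinForm ℝ V}
    (hb : IsInvariantForm ρ b) (f : cocycles₁ (Rep.of ρ)) {g : π} {n : ℕ} (hn : 0 < n)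
    (h0 : f (g ^ n) = 0) : f g ∈ LinearMap.range (1 - ρ g) := by
  refine hb.mem_range fun w hw => ?_
  have h1 := hb.cocycle_pow f hw n
  rw [h0, map_zero, LinearMap.zero_apply] at h1
  rcases mul_eq_zero.1 h1.symm with h2 | h2
  · exact absurd (Nat.cast_eq_zero.1 h2) hn.ne'
  · exact h2

end Cocycles

namespace IsBrieskornGroup

variable {p q r : ℕ} {a c : ℤ} {π : Type} [Group π] {x y z h : π} {V : Type} [AddCommGroup V]
  [Module ℝ V] {ρ : Representation ℝ π V} {b : LinearMap.BilinForm ℝ V}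

/-- Since the group is perfect, a cocycle vanishes at a central element acting trivially. -/
lemma cocycle_h (B : IsBrieskornGroup p q r a c x y z h) (hb : IsInvariantForm ρ b)
    (hh : ρ h = 1) (f : cocycles₁ (Rep.of ρ)) : f h = 0 := by
  have hinv : ∀ g, ρ g (f h) = f h := fun g => by
    have h1 := cocycle_mul f g h
    rw [B.comm_h, cocycle_mul, hh, Module.End.one_apply, add_comm] at h1
    exact (add_right_cancel h1).symm
  let φ : π →* Multiplicative ℝ :=
    { toFun := fun g => Multiplicative.ofAdd (b (f g) (f h))
      map_one' := by rw [cocycle_one]; simp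
      map_mul' := fun g k => by
        rw [cocycle_mul, map_add, LinearMap.add_apply, hb.map_right (hinv g), add_comm]; rfl }
  have hφ := B.hom_eq_one φ (Commute.all _ _)
  exact hb.anisotropic _ (congrArg Multiplicative.toAdd (DFunLike.congr_fun hφ h))

lemma map_zpow_h (hh : ρ h = 1) (n : ℤ) : ρ (h ^ n) = 1 := by
  have h1 : ∀ m : ℕ, ρ (h ^ m) = 1 := fun m => by rw [map_pow, hh, one_pow]
  rcases Int.eq_nat_or_neg n with ⟨m, rfl | rfl⟩
  · rw [zpow_natCast]; exact h1 m
  · have : ρ (h ^ (-(m : ℤ))) * ρ (h ^ m) = 1 := by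
      rw [← map_mul, zpow_neg, zpow_natCast, inv_mul_cancel, map_one]
    rwa [h1, mul_one] at this

/-- Cocycles with prescribed values at `x, y, z`: the corresponding affine transformations satisfy
the relations of the group, with `h` acting as the identity. -/
lemma exists_cocycle (B : IsBrieskornGroup p q r a c x y z h) (hh : ρ h = 1) {u v w : V}
    (hu : u ∈ LinearMap.range (1 - ρ x)) (hv : v ∈ LinearMap.range (1 - ρ y))
    (hw : w ∈ LinearMap.range (1 - ρ z)) (h0 : u + ρ x v + ρ (x * y) w = 0) :
    ∃ f : cocycles₁ (Rep.of ρ), f x = u ∧ f y = v ∧ f z = w := by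
  obtain ⟨s, rfl⟩ := hu
  obtain ⟨t, rfl⟩ := hv
  obtain ⟨k, rfl⟩ := hw
  have hρ : ∀ g g' v, ρ (g * g') v = ρ g (ρ g' v) := fun g g' v => by
    rw [map_mul, Module.End.mul_apply]
  let σ : π →* Equiv.Perm V :=
    { toFun := fun g => ⟨ρ g, ρ g⁻¹,
        fun v => by rw [← hρ, inv_mul_cancel, map_one, Module.End.one_apply],
        fun v => by rw [← hρ, mul_inv_cancel, map_one, Module.End.one_apply]⟩
      map_one' := Equiv.ext fun v => by simp
      map_mul' := fun g g' => Equiv.ext fun v => hρ g g' v }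
  have hσ : ∀ g v, σ g v = ρ g v := fun g v => rfl
  -- the linear map of `g`, with the origin moved to `s`
  let A : V → π → Equiv.Perm V := fun s g => Equiv.addRight s * σ g * (Equiv.addRight s)⁻¹
  have hA : ∀ s g v, A s g v = ρ g v + (1 - ρ g) s := fun s g v => by
    have : A s g v = ρ g (v - s) + s := by
      simp [A, hσ, sub_eq_add_neg, Equiv.Perm.mul_apply]
    rw [this, map_sub, LinearMap.sub_apply, Module.End.one_apply]
    abel
  have hpow : ∀ s g (n : ℕ), ρ (g ^ n) = 1 → A s g ^ n = 1 := fun s g n hg => by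
    have h1 : σ (g ^ n) = 1 := Equiv.ext fun v => by rw [hσ, hg]; rfl
    rw [conj_pow, ← map_pow, h1, mul_one, mul_inv_cancel]
  obtain ⟨φ, hφx, hφy, hφz, hφh⟩ := B.lift (A s x) (A t y) (A k z) 1
    (by rw [one_zpow, hpow _ _ _ (by rw [B.x_pow, map_zpow_h hh])])
    (by rw [one_zpow, hpow _ _ _ (by rw [B.y_pow, map_zpow_h hh])])
    (by rw [one_zpow, hpow _ _ _ (by rw [B.z_pow, map_zpow_h hh])])
    (Equiv.ext fun v => by
      rw [Equiv.Perm.mul_apply, Equiv.Perm.mul_apply, hA, hA, hA, map_add, map_add, map_add,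
        ← hρ, ← hρ, ← hρ, B.mul, map_one, Module.End.one_apply, Equiv.Perm.one_apply,
        add_assoc, add_assoc]
      rw [add_comm] at h0
      have h0' : ρ (x * y) ((1 - ρ z) k) + (ρ x ((1 - ρ y) t) + (1 - ρ x) s) = 0 := by
        rw [← h0]; abel
      rw [h0', add_zero])
    (by rw [one_mul, mul_one]) (by rw [one_mul, mul_one]) (by rw [one_mul, mul_one])
  have haff : ∀ g, ∀ v, φ g v = ρ g v + φ g 0 := by
    have hAff : ∀ s g v, A s g v = ρ g v + A s g 0 := fun s g v => by rw [hA, hA]; simp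
    refine B.induction (fun v => ?_) (fun v => ?_) (fun v => ?_) (fun v => ?_) (fun v => ?_)
      (fun g g' h1 h2 v => ?_) (fun g h1 v => ?_)
    · rw [hφx]; exact hAff _ _ _
    · rw [hφy]; exact hAff _ _ _
    · rw [hφz]; exact hAff _ _ _
    · rw [hφh, hh]; simp
    · simp
    · rw [map_mul, Equiv.Perm.mul_apply, Equiv.Perm.mul_apply, h2 v, h1, h1 (φ g' 0), hρ, map_add]
      abel
    · apply (φ g).injective
      rw [h1 (ρ g⁻¹ v + φ g⁻¹ 0), map_add, ← hρ, mul_inv_cancel, map_one, Module.End.one_apply,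
        add_assoc, ← h1, ← Equiv.Perm.mul_apply, ← Equiv.Perm.mul_apply, ← map_mul,
        mul_inv_cancel, map_one]
      simp
  refine ⟨⟨fun g => φ g 0, (mem_cocycles₁_iff _).2 fun g g' => ?_⟩, ?_, ?_, ?_⟩
  · show φ (g * g') 0 = ρ g (φ g' 0) + φ g 0
    rw [map_mul, Equiv.Perm.mul_apply, haff]
  · show φ x 0 = _
    rw [hφx, hA, map_zero, zero_add]
  · show φ y 0 = _
    rw [hφy, hA, map_zero, zero_add]
  · show φ z 0 = _
    rw [hφz, hA, map_zero, zero_add]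

end IsBrieskornGroup

section Dimension

variable {π : Type} [Group π] {V : Type} [AddCommGroup V] [Module ℝ V]

/-- The projection from cocycles to cohomology. -/
noncomputable def cocycleClass (ρ : Representation ℝ π V) : cocycles₁ (Rep.of ρ) →ₗ[ℝ] H1 (Rep.of ρ) :=
  (H1π (Rep.of ρ)).hom

/-- The coboundary map. -/
def coboundaryMap (ρ : Representation ℝ π V) : V →ₗ[ℝ] cocycles₁ (Rep.of ρ) :=
  (d₀₁ (Rep.of ρ)).hom.codRestrict _ fun v => d₀₁_apply_mem_cocycles₁ (A := Rep.of ρ) v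

lemma coboundaryMap_apply (ρ : Representation ℝ π V) (v : V) (g : π) :
    coboundaryMap ρ v g = ρ g v - v := rfl

lemma ker_coboundaryMap (ρ : Representation ℝ π V) :
    LinearMap.ker (coboundaryMap ρ) = ρ.invariants := by
  ext v
  rw [LinearMap.mem_ker, Representation.mem_invariants]
  constructor
  · intro h1 g
    rw [← sub_eq_zero, ← coboundaryMap_apply, h1]; rfl
  · intro h1
    refine cocycles₁_ext fun g => ?_
    rw [coboundaryMap_apply, h1, sub_self]; rfl

lemma cocycleClass_surjective (ρ : Representation ℝ π V) :
    Function.Surjective (cocycleClass ρ) := fun ξ => by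
  induction ξ using H1_induction_on with | @h f => exact ⟨f, rfl⟩

lemma cocycleClass_eq_zero_iff {ρ : Representation ℝ π V} {f : cocycles₁ (Rep.of ρ)} :
    cocycleClass ρ f = 0 ↔ ∃ v : V, coboundaryMap ρ v = f := by
  refine (H1π_eq_zero_iff f).trans ⟨?_, ?_⟩
  · rintro ⟨v, hv⟩
    exact ⟨v, Subtype.ext hv⟩
  · rintro ⟨v, hv⟩
    exact ⟨v, congrArg Subtype.val hv⟩

lemma ker_cocycleClass (ρ : Representation ℝ π V) :
    LinearMap.ker (cocycleClass ρ) = LinearMap.range (coboundaryMap ρ) := by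
  ext f
  rw [LinearMap.mem_ker, LinearMap.mem_range, cocycleClass_eq_zero_iff]

variable {p q r : ℕ} {a c : ℤ} {x y z h : π} {ρ : Representation ℝ π V}
  {b : LinearMap.BilinForm ℝ V}

/-- The values of a cocycle at the generators, restricted by the relations
`x ^ p = y ^ q = z ^ r = 1` that hold in the module. -/
def cocycleValues [FiniteDimensional ℝ V] (B : IsBrieskornGroup p q r a c x y z h)
    (hb : IsInvariantForm ρ b) (hh : ρ h = 1) : cocycles₁ (Rep.of ρ) →ₗ[ℝ]
      LinearMap.range (1 - ρ x) × LinearMap.range (1 - ρ y) × LinearMap.range (1 - ρ z) where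
  toFun f := (⟨f x, hb.cocycle_mem_range f B.pos_p (by
      rw [B.x_pow]; exact cocycle_zpow (B.cocycle_h hb hh f) a)⟩,
    ⟨f y, hb.cocycle_mem_range f B.pos_q (by
      rw [B.y_pow]; exact cocycle_zpow (B.cocycle_h hb hh f) a)⟩,
    ⟨f z, hb.cocycle_mem_range f B.pos_r (by
      rw [B.z_pow]; exact cocycle_zpow (B.cocycle_h hb hh f) c)⟩)
  map_add' _ _ := rfl
  map_smul' _ _ := rfl

/-- The linearization of the relation `x y z = 1`. -/
noncomputable def relationMap (ρ : Representation ℝ π V) (x y z : π) :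
    LinearMap.range (1 - ρ x) × LinearMap.range (1 - ρ y) × LinearMap.range (1 - ρ z) →ₗ[ℝ] V :=
  (Submodule.subtype _).coprod
    ((ρ x ∘ₗ Submodule.subtype _).coprod (ρ (x * y) ∘ₗ Submodule.subtype _))

lemma relationMap_apply (ρ : Representation ℝ π V) (x y z : π) (u) :
    relationMap ρ x y z u = u.1 + ρ x u.2.1 + ρ (x * y) u.2.2 := by
  simp [relationMap, LinearMap.coprod_apply, add_assoc]

lemma cocycleValues_injective [FiniteDimensional ℝ V] (B : IsBrieskornGroup p q r a c x y z h)
    (hb : IsInvariantForm ρ b) (hh : ρ h = 1) : Function.Injective (cocycleValues B hb hh) := by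
  rw [injective_iff_map_eq_zero]
  intro f hf
  have h1 : f x = 0 := congrArg (fun u => (u.1 : V)) hf
  have h2 : f y = 0 := congrArg (fun u => (u.2.1 : V)) hf
  have h3 : f z = 0 := congrArg (fun u => (u.2.2 : V)) hf
  refine cocycles₁_ext fun g => ?_
  refine B.induction (P := fun g => f g = 0) h1 h2 h3 (B.cocycle_h hb hh f) (cocycle_one f)
    (fun g g' h4 h5 => ?_) (fun g h4 => ?_) g
  · rw [cocycle_mul, h4, h5, map_zero, add_zero]
  · have := cocycle_zpow h4 (-1)
    rwa [zpow_neg_one] at this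

lemma range_cocycleValues [FiniteDimensional ℝ V] (B : IsBrieskornGroup p q r a c x y z h)
    (hb : IsInvariantForm ρ b) (hh : ρ h = 1) :
    LinearMap.range (cocycleValues B hb hh) = LinearMap.ker (relationMap ρ x y z) := by
  ext u
  rw [LinearMap.mem_ker, relationMap_apply]
  constructor
  · rintro ⟨f, rfl⟩
    show f x + ρ x (f y) + ρ (x * y) (f z) = 0
    have h1 := cocycle_mul f (x * y) z
    rw [B.mul, cocycle_one, cocycle_mul] at h1
    rw [h1]; abel
  · intro h1
    obtain ⟨f, hx, hy, hz⟩ := B.exists_cocycle hh u.1.2 u.2.1.2 u.2.2.2 h1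
    exact ⟨f, Prod.ext (Subtype.ext hx) (Prod.ext (Subtype.ext hy) (Subtype.ext hz))⟩

lemma orthogonal_range_relationMap [FiniteDimensional ℝ V]
    (B : IsBrieskornGroup p q r a c x y z h) (hb : IsInvariantForm ρ b) (hh : ρ h = 1) :
    b.orthogonal (LinearMap.range (relationMap ρ x y z)) = ρ.invariants := by
  ext w
  rw [LinearMap.BilinForm.mem_orthogonal_iff, Representation.mem_invariants]
  constructor
  · intro h1
    have hx : ρ x w = w := hb.apply_eq_self fun v => by
      have := h1 _ ⟨(⟨v - ρ x v, ⟨v, rfl⟩⟩, 0, 0), rfl⟩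
      rw [relationMap_apply] at this
      simpa using this
    have hy : ρ y w = w := hb.apply_eq_self fun v => by
      have := h1 _ ⟨(0, ⟨v - ρ y v, ⟨v, rfl⟩⟩, 0), rfl⟩
      rw [relationMap_apply] at this
      simp only [ZeroMemClass.coe_zero, map_zero, zero_add, add_zero] at this
      rwa [hb.map_right hx] at this
    have hxy : ρ (x * y) w = w := by rw [map_mul, Module.End.mul_apply, hy, hx]
    have hz : ρ z w = w := hb.apply_eq_self fun v => by
      have := h1 _ ⟨(0, 0, ⟨v - ρ z v, ⟨v, rfl⟩⟩), rfl⟩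
      rw [relationMap_apply] at this
      simp only [ZeroMemClass.coe_zero, map_zero, zero_add] at this
      rwa [hb.map_right hxy] at this
    refine B.induction hx hy hz (by rw [hh]; rfl) (by rw [map_one]; rfl)
      (fun g g' h2 h3 => ?_) (fun g h2 => ?_)
    · rw [map_mul, Module.End.mul_apply, h3, h2]
    · conv_lhs => rw [← h2]
      rw [← Module.End.mul_apply, ← map_mul, inv_mul_cancel, map_one, Module.End.one_apply]
  · rintro h1 _ ⟨⟨⟨_, s, rfl⟩, ⟨_, t, rfl⟩, ⟨_, k, rfl⟩⟩, rfl⟩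
    rw [relationMap_apply]
    have key : ∀ g v, b ((1 - ρ g) v) w = 0 := fun g v => by
      rw [LinearMap.sub_apply, Module.End.one_apply, map_sub, LinearMap.sub_apply,
        hb.map_right (h1 g), sub_self]
    simp only [map_add, LinearMap.add_apply, hb.map_right (h1 _), key, add_zero]

/-- The dimension of the first cohomology, as a count of parameters and relations: a cocycle is
given by its values at `x, y, z`, which are subject to the linearized relation `x y z = 1`, and the
image of this relation is the orthogonal complement of the invariants. -/
theorem finrank_H1 [FiniteDimensional ℝ V] (B : IsBrieskornGroup p q r a c x y z h)
    (hb : IsInvariantForm ρ b) (hh : ρ h = 1) :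
    FiniteDimensional ℝ (H1 (Rep.of ρ)) ∧
    Module.finrank ℝ (H1 (Rep.of ρ)) + 2 * Module.finrank ℝ V =
      Module.finrank ℝ (LinearMap.range (1 - ρ x)) + Module.finrank ℝ (LinearMap.range (1 - ρ y)) +
      Module.finrank ℝ (LinearMap.range (1 - ρ z)) + 2 * Module.finrank ℝ ρ.invariants := by
  have hfin : FiniteDimensional ℝ (cocycles₁ (Rep.of ρ)) :=
    FiniteDimensional.of_injective _ (cocycleValues_injective B hb hh)
  have e1 := (cocycleClass ρ).finrank_range_add_finrank_ker
  rw [LinearMap.range_eq_top.2 (cocycleClass_surjective ρ), finrank_top, ker_cocycleClass] at e1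
  have e2 := (coboundaryMap ρ).finrank_range_add_finrank_ker
  rw [ker_coboundaryMap] at e2
  have e3 := (relationMap ρ x y z).finrank_range_add_finrank_ker
  rw [← range_cocycleValues B hb hh, LinearMap.finrank_range_of_inj (cocycleValues_injective B hb hh),
    Module.finrank_prod, Module.finrank_prod] at e3
  have e4 := LinearMap.BilinForm.finrank_orthogonal hb.nondegenerate
    (LinearMap.range (relationMap ρ x y z))
  rw [orthogonal_range_relationMap B hb hh] at e4
  have e5 := (LinearMap.range (relationMap ρ x y z)).finrank_le
  exact ⟨Module.Finite.of_surjective _ (cocycleClass_surjective ρ), by omega⟩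

/-- If a central element acts as `-1`, the cohomology vanishes. -/
theorem subsingleton_H1_of_neg {h : π} (hcomm : ∀ g : π, g * h = h * g)
    (hh : ∀ v, ρ h v = -v) : Subsingleton (H1 (Rep.of ρ)) := by
  refine subsingleton_of_forall_eq 0 fun ξ => ?_
  obtain ⟨f, rfl⟩ := cocycleClass_surjective ρ ξ
  rw [cocycleClass_eq_zero_iff]
  refine ⟨-((1 / 2 : ℝ) • f h), cocycles₁_ext fun g => ?_⟩
  rw [coboundaryMap_apply]
  have h1 := cocycle_mul f g h
  rw [hcomm, cocycle_mul, hh] at h1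
  have h2 : (2 : ℝ) • f g = f h - ρ g (f h) := by
    rw [neg_add_eq_iff_eq_add] at h1
    generalize ρ g (f h) = X at h1 ⊢
    rw [two_smul, h1]; abel
  have h3 : f g = (1 / 2 : ℝ) • (f h - ρ g (f h)) := by rw [← h2, smul_smul]; norm_num
  rw [map_neg, map_smul, h3, smul_sub]
  abel

end Dimension

/-! ### The modules `su(3)` and `ℂ²` -/

open groupCohomology

lemma Ad3_apply_coe (g : SU 3) (X : su3) : (Ad3 g X : Mat) = (g : Mat) * X * (g : Mat).conjTranspose :=
  rfl

lemma Ad3_eq_self_iff (g : SU 3) (X : su3) : Ad3 g X = X ↔ (g : Mat) * (X : Mat) = X * (g : Mat) := by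
  constructor
  · intro h
    have h1 := congrArg (fun X : su3 => (X : Mat) * (g : Mat)) h
    simp only [Ad3_apply_coe, Matrix.mul_assoc, SU_conjTranspose_mul, Matrix.mul_one] at h1
    exact h1
  · intro h
    apply Subtype.ext
    rw [Ad3_apply_coe, h, Matrix.mul_assoc, SU_mul_conjTranspose, Matrix.mul_one]

lemma Ad3_mul_apply (g g' : SU 3) (X : su3) : Ad3 (g * g') X = Ad3 g (Ad3 g' X) := by
  rw [map_mul, Module.End.mul_apply]

lemma Ad3_inv_apply_self (g : SU 3) (X : su3) : Ad3 g⁻¹ (Ad3 g X) = X := by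
  rw [← Ad3_mul_apply, inv_mul_cancel, map_one, Module.End.one_apply]

lemma Ad3_apply_inv_self (g : SU 3) (X : su3) : Ad3 g (Ad3 g⁻¹ X) = X := by
  rw [← Ad3_mul_apply, mul_inv_cancel, map_one, Module.End.one_apply]

lemma Ad3_injective (g : SU 3) : Function.Injective (Ad3 g) :=
  Function.LeftInverse.injective (Ad3_inv_apply_self g)

lemma stdRepReal_apply {n : ℕ} (g : SU n) (v : Fin n → ℂ) :
    stdRepReal n g v = (g : Matrix (Fin n) (Fin n) ℂ).mulVec v := rfl

/-- The invariant form `(X, Y) ↦ Re tr (X Y*)`. -/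
noncomputable def su3Form : LinearMap.BilinForm ℝ su3 :=
  LinearMap.mk₂ ℝ (fun X Y : su3 => ((X : Mat) * (Y : Mat).conjTranspose).trace.re)
    (fun X X' Y => by simp [Matrix.add_mul])
    (fun t X Y => by simp)
    (fun X Y Y' => by simp [Matrix.mul_add])
    (fun t X Y => by simp)

lemma su3Form_apply (X Y : su3) :
    su3Form X Y = ((X : Mat) * (Y : Mat).conjTranspose).trace.re := rfl

lemma isInvariantForm_su3 {π : Type} [Group π] (α : π →* SU 3) :
    IsInvariantForm (Ad3.comp α) su3Form := by
  refine ⟨fun X Y => ?_, fun X hX => ?_, fun g X Y => ?_⟩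
  · rw [su3Form_apply, su3Form_apply]
    conv_lhs => rw [← Matrix.conjTranspose_conjTranspose (X : Mat), ← Matrix.conjTranspose_mul,
      Matrix.trace_conjTranspose]
    simp
  · apply Subtype.ext
    have h : ∀ i j, Complex.normSq ((X : Mat) i j) = 0 := by
      have h1 : ∑ i, ∑ j, Complex.normSq ((X : Mat) i j) = 0 := by
        rw [← hX, su3Form_apply, Matrix.trace, Complex.re_sum]
        refine Finset.sum_congr rfl fun i _ => ?_
        rw [Matrix.diag_apply, Matrix.mul_apply, Complex.re_sum]
        refine Finset.sum_congr rfl fun j _ => ?_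
        rw [Matrix.conjTranspose_apply]
        simp [Complex.normSq_apply]
      intro i j
      have h2 := (Finset.sum_eq_zero_iff_of_nonneg (fun i _ =>
        Finset.sum_nonneg fun j _ => Complex.normSq_nonneg _)).1 h1 i (Finset.mem_univ i)
      exact (Finset.sum_eq_zero_iff_of_nonneg (fun j _ => Complex.normSq_nonneg _)).1 h2 j
        (Finset.mem_univ j)
    ext i j
    exact Complex.normSq_eq_zero.1 (h i j)
  · rw [su3Form_apply, su3Form_apply, MonoidHom.comp_apply, Ad3_apply_coe, Ad3_apply_coe]
    congr 1
    have h1 := SU_conjTranspose_mul (α g)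
    set A := (α g : Mat)
    calc _ = (A * X * (A.conjTranspose * A) * (Y : Mat).conjTranspose * A.conjTranspose).trace := by
          simp only [Matrix.conjTranspose_mul, Matrix.conjTranspose_conjTranspose, Matrix.mul_assoc]
      _ = (A * ((X : Mat) * (Y : Mat).conjTranspose * A.conjTranspose)).trace := by
          rw [h1]; simp only [Matrix.mul_one, Matrix.mul_assoc]
      _ = _ := by rw [Matrix.trace_mul_comm, Matrix.mul_assoc, h1, Matrix.mul_one]

/-- The invariant form on `ℂ²`. -/
noncomputable def C2Form : LinearMap.BilinForm ℝ (Fin 2 → ℂ) :=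
  LinearMap.mk₂ ℝ (fun v w => (v ⬝ᵥ star w).re)
    (fun v v' w => by simp [add_dotProduct])
    (fun t v w => by simp [mul_add])
    (fun v w w' => by simp [dotProduct_add])
    (fun t v w => by simp [mul_add])

lemma C2Form_apply (v w : Fin 2 → ℂ) : C2Form v w = (v ⬝ᵥ star w).re := rfl

lemma isInvariantForm_C2 {π : Type} [Group π] (ρ : π →* SU 2) :
    IsInvariantForm ((stdRepReal 2).comp ρ) C2Form := by
  refine ⟨fun v w => ?_, fun v hv => ?_, fun g v w => ?_⟩
  · rw [C2Form_apply, C2Form_apply]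
    simp [dotProduct, Fin.sum_univ_two]; ring
  · rw [C2Form_apply] at hv
    simp only [dotProduct, Fin.sum_univ_two, Pi.star_apply, Complex.star_def, Complex.mul_conj,
      Complex.add_re, Complex.ofReal_re] at hv
    have h0 := Complex.normSq_nonneg (v 0)
    have h1 := Complex.normSq_nonneg (v 1)
    have e0 : v 0 = 0 := Complex.normSq_eq_zero.1 (by linarith)
    have e1 : v 1 = 0 := Complex.normSq_eq_zero.1 (by linarith)
    ext i
    fin_cases i
    exacts [e0, e1]
  · rw [C2Form_apply, C2Form_apply, MonoidHom.comp_apply, stdRepReal_apply, stdRepReal_apply,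
      Matrix.star_mulVec, dotProduct_comm, ← Matrix.dotProduct_mulVec, Matrix.mulVec_mulVec,
      SU_conjTranspose_mul, Matrix.one_mulVec, dotProduct_comm]

/-- Coordinates on `su(3)`. -/
noncomputable def su3Equiv : (ℝ × ℝ × ℂ × ℂ × ℂ) ≃ₗ[ℝ] su3 where
  toFun u := ⟨!![u.1 * Complex.I, u.2.2.1, u.2.2.2.1;
      -conj u.2.2.1, u.2.1 * Complex.I, u.2.2.2.2;
      -conj u.2.2.2.1, -conj u.2.2.2.2, -(u.1 + u.2.1) * Complex.I], by
    refine ⟨?_, ?_⟩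
    · ext i j
      fin_cases i <;> fin_cases j <;> simp
    · simp [Matrix.trace, Fin.sum_univ_succ]; ring⟩
  map_add' u v := by
    apply Subtype.ext
    ext i j
    fin_cases i <;> fin_cases j <;> simp <;> ring
  map_smul' t u := by
    apply Subtype.ext
    ext i j
    fin_cases i <;> fin_cases j <;> simp <;> ring
  invFun X := (((X : Mat) 0 0).im, ((X : Mat) 1 1).im, (X : Mat) 0 1, (X : Mat) 0 2, (X : Mat) 1 2)
  left_inv u := by simp
  right_inv X := by
    apply Subtype.ext
    have h := fun i j => congrFun (congrFun X.2.1 i) j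
    have ht := X.2.2
    simp only [Matrix.conjTranspose_apply, Matrix.neg_apply] at h
    have hd : ∀ i, (X : Mat) i i = ((X : Mat) i i).im * Complex.I := fun i => by
      have h1 := congrArg Complex.re (h i i)
      simp at h1
      apply Complex.ext
      · simp; linarith
      · simp
    rw [Matrix.trace, Fin.sum_univ_three] at ht
    simp only [Matrix.diag_apply] at ht
    ext i j
    fin_cases i <;> fin_cases j <;> simp
    · exact (hd 0).symm
    · rw [neg_eq_iff_eq_neg]; exact h 1 0
    · exact (hd 1).symm
    · rw [neg_eq_iff_eq_neg]; exact h 2 0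
    · rw [neg_eq_iff_eq_neg]; exact h 2 1
    · rw [hd 0, hd 1] at ht
      linear_combination -ht

lemma finrank_su3 : Module.finrank ℝ su3 = 8 := by
  rw [← su3Equiv.finrank_eq]
  simp [Complex.finrank_real_complex]

lemma finrank_C2 : Module.finrank ℝ (Fin 2 → ℂ) = 4 := by
  rw [Module.finrank_pi_fintype]
  simp [Complex.finrank_real_complex]

instance : FiniteDimensional ℝ su3 := Module.Finite.equiv su3Equiv

lemma finrank_ker_conj (g X : SU 3) :
    Module.finrank ℝ (LinearMap.ker (1 - Ad3 (g * X * g⁻¹))) =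
      Module.finrank ℝ (LinearMap.ker (1 - Ad3 X)) := by
  have hmem : ∀ (Y : SU 3) v, v ∈ LinearMap.ker (1 - Ad3 Y) ↔ Ad3 Y v = v := fun Y v => by
    rw [LinearMap.mem_ker, LinearMap.sub_apply, Module.End.one_apply, sub_eq_zero, eq_comm]
  have h1 : (LinearMap.ker (1 - Ad3 X)).map (Ad3 g) = LinearMap.ker (1 - Ad3 (g * X * g⁻¹)) := by
    ext v
    rw [hmem]
    constructor
    · rintro ⟨w, hw, rfl⟩
      rw [Ad3_mul_apply, Ad3_inv_apply_self, Ad3_mul_apply, (hmem X w).1 hw]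
    · intro hv
      refine ⟨Ad3 g⁻¹ v, (hmem X _).2 ?_, ?_⟩
      · apply Ad3_injective g
        rw [← Ad3_mul_apply, ← Ad3_mul_apply, hv, ← Ad3_mul_apply, mul_inv_cancel, map_one, Module.End.one_apply]
      · rw [← Ad3_mul_apply, mul_inv_cancel, map_one, Module.End.one_apply]
  rw [← h1]
  exact (Submodule.equivMapOfInjective (Ad3 g) (Ad3_injective g) _).finrank_eq.symm

lemma mem_ker_toSU {l : Fin 3 → ℂ} (hl : IsSpectrum l) (X : su3) :
    X ∈ LinearMap.ker (1 - Ad3 hl.toSU) ↔ ∀ i j, l i * (X : Mat) i j = (X : Mat) i j * l j := by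
  rw [LinearMap.mem_ker, LinearMap.sub_apply, Module.End.one_apply, sub_eq_zero, eq_comm,
    Ad3_eq_self_iff, hl.coe_toSU, ← Matrix.ext_iff]
  simp only [Matrix.diagonal_mul, Matrix.mul_diagonal]

lemma su3Equiv_mem_ker {l : Fin 3 → ℂ} (hl : IsSpectrum l) (u : ℝ × ℝ × ℂ × ℂ × ℂ) :
    su3Equiv u ∈ LinearMap.ker (1 - Ad3 hl.toSU) ↔
      (l 0 = l 1 ∨ u.2.2.1 = 0) ∧ (l 0 = l 2 ∨ u.2.2.2.1 = 0) ∧ (l 1 = l 2 ∨ u.2.2.2.2 = 0) := by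
  have key : ∀ {a b w : ℂ}, a * w = w * b ↔ (a = b ∨ w = 0) := fun {a b w} => by
    rw [mul_comm, mul_eq_mul_left_iff]
  rw [mem_ker_toSU]
  constructor
  · intro h
    exact ⟨key.1 (h 0 1), key.1 (h 0 2), key.1 (h 1 2)⟩
  · rintro ⟨h1, h2, h3⟩ i j
    rw [key]
    fin_cases i <;> fin_cases j <;> simp [su3Equiv, h1, h2, h3, eq_comm (a := l 1) (b := l 0),
      eq_comm (a := l 2) (b := l 0), eq_comm (a := l 2) (b := l 1)]

lemma finrank_range_add_ker (Y : SU 3) :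
    Module.finrank ℝ (LinearMap.range (1 - Ad3 Y)) +
      Module.finrank ℝ (LinearMap.ker (1 - Ad3 Y)) = 8 := by
  rw [LinearMap.finrank_range_add_finrank_ker, finrank_su3]

/-- The conjugacy class of a matrix with three distinct eigenvalues has dimension `6`. -/
lemma finrank_range_of_regular {Y : SU 3} (hY : ¬ HasDoubleRoot (Y : Mat).trace) :
    Module.finrank ℝ (LinearMap.range (1 - Ad3 Y)) = 6 := by
  obtain ⟨l, hl, g, rfl⟩ := exists_eq_conj Y
  rw [trace_conj, trace_toSU, hasDoubleRoot_iff hl, not_not] at hY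
  have h1 := finrank_range_add_ker (g * hl.toSU * g⁻¹)
  rw [finrank_ker_conj] at h1
  let j : (ℝ × ℝ) →ₗ[ℝ] su3 := su3Equiv.toLinearMap ∘ₗ
    (LinearMap.prodMap LinearMap.id (LinearMap.inl ℝ ℝ (ℂ × ℂ × ℂ)))
  have hj : Function.Injective j := by
    refine su3Equiv.injective.comp ?_
    rintro ⟨s, t⟩ ⟨s', t'⟩ hst
    simpa using hst
  have h2 : LinearMap.range j = LinearMap.ker (1 - Ad3 hl.toSU) := by
    ext X
    obtain ⟨⟨s, t, u⟩, rfl⟩ := su3Equiv.surjective X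
    rw [su3Equiv_mem_ker]
    simp only [hY.eq_iff, show (0 : Fin 3) ≠ 1 by decide, show (0 : Fin 3) ≠ 2 by decide,
      show (1 : Fin 3) ≠ 2 by decide, false_or]
    constructor
    · rintro ⟨⟨s', t'⟩, hst⟩
      have := su3Equiv.injective hst
      simp only [LinearMap.prodMap_apply, LinearMap.inl_apply, Prod.mk.injEq] at this
      rw [← this.2.2]
      simp
    · rintro ⟨e1, e2, e3⟩
      refine ⟨(s, t), congrArg su3Equiv ?_⟩
      simp [Prod.ext_iff, e1, e2, e3]
  rw [← h2, LinearMap.finrank_range_of_inj hj] at h1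
  simp at h1
  omega

/-- The conjugacy class of a non-scalar matrix with a double eigenvalue has dimension `4`. -/
lemma finrank_range_of_double {Y : SU 3} (hY : HasDoubleRoot (Y : Mat).trace)
    (hs : ∀ c : ℂ, (Y : Mat) ≠ c • 1) :
    Module.finrank ℝ (LinearMap.range (1 - Ad3 Y)) = 4 := by
  obtain ⟨l, hl, h01, hlY⟩ := exists_spectrum_of_double hY
  obtain ⟨g, rfl⟩ := exists_eq_conj_of_trace hl hlY
  have h02 : l 0 ≠ l 2 := by
    intro h02
    refine hs (l 0) ?_
    have : Matrix.diagonal l = l 0 • (1 : Mat) := by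
      rw [Matrix.smul_one_eq_diagonal]
      congr 1
      ext i
      fin_cases i
      exacts [rfl, h01.symm, h02.symm]
    rw [coe_conj, hl.coe_toSU, this, Matrix.mul_smul, Matrix.mul_one, Matrix.smul_mul,
      SU_mul_conjTranspose]
  have h12 : l 1 ≠ l 2 := h01 ▸ h02
  have h1 := finrank_range_add_ker (g * hl.toSU * g⁻¹)
  rw [finrank_ker_conj] at h1
  let j : (ℝ × ℝ × ℂ) →ₗ[ℝ] su3 := su3Equiv.toLinearMap ∘ₗ
    (LinearMap.prodMap LinearMap.id
      (LinearMap.prodMap LinearMap.id (LinearMap.inl ℝ ℂ (ℂ × ℂ))))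
  have hj : Function.Injective j := by
    refine su3Equiv.injective.comp ?_
    rintro ⟨s, t, u⟩ ⟨s', t', u'⟩ hst
    simpa using hst
  have h2 : LinearMap.range j = LinearMap.ker (1 - Ad3 hl.toSU) := by
    ext X
    obtain ⟨⟨s, t, u, v⟩, rfl⟩ := su3Equiv.surjective X
    rw [su3Equiv_mem_ker]
    simp only [h01, h12, true_or, true_and, false_or]
    constructor
    · rintro ⟨⟨s', t', u'⟩, hst⟩
      have := su3Equiv.injective hst
      simp only [LinearMap.prodMap_apply, LinearMap.inl_apply, Prod.mk.injEq] at this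
      rw [← this.2.2.2]
      simp
    · rintro ⟨e1, e2⟩
      refine ⟨(s, t, u), congrArg su3Equiv ?_⟩
      simp [Prod.ext_iff, e1, e2]
  rw [← h2, LinearMap.finrank_range_of_inj hj] at h1
  simp [Complex.finrank_real_complex] at h1
  omega

/-! ### Cohomology with coefficients in `su(3)` and `ℂ²` -/

open groupCohomology

lemma nonempty_linearEquiv {M : Type*} [AddCommGroup M] [Module ℝ M] [FiniteDimensional ℝ M]
    {n : ℕ} (h : Module.finrank ℝ M = n) : Nonempty (M ≃ₗ[ℝ] (Fin n → ℝ)) :=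
  ⟨LinearEquiv.ofFinrankEq _ _ (by rw [h, Module.finrank_fin_fun])⟩

section

variable {π : Type} [Group π]

lemma mem_invariants_su3 (α : π →* SU 3) (X : su3) :
    X ∈ Representation.invariants (Ad3.comp α) ↔ ∀ g, (α g : Mat) * (X : Mat) = X * (α g : Mat) := by
  rw [Representation.mem_invariants]
  exact forall_congr' fun g => Ad3_eq_self_iff (α g) X

lemma IsIrred.invariants_eq_bot {α : π →* SU 3} (hα : IsIrred α) :
    Representation.invariants (Ad3.comp α) = ⊥ := by
  rw [eq_bot_iff]
  intro X hX
  rw [mem_invariants_su3] at hX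
  obtain ⟨c, hc⟩ := hα.eq_smul hX
  have h1 := X.2.2
  rw [hc, Matrix.trace_smul, Matrix.trace_one] at h1
  have hc0 : c = 0 := by simpa using h1
  rw [Submodule.mem_bot]
  apply Subtype.ext
  rw [hc, hc0, zero_smul]; rfl

lemma finrank_invariants_eq {α β : π →* SU 3} (h : repClass α = repClass β) :
    Module.finrank ℝ (Representation.invariants (Ad3.comp α)) =
      Module.finrank ℝ (Representation.invariants (Ad3.comp β)) := by
  obtain ⟨k, hk⟩ := repClass_eq_iff.1 h
  have h1 : (Representation.invariants (Ad3.comp α)).map (Ad3 k) =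
      Representation.invariants (Ad3.comp β) := by
    ext v
    constructor
    · rintro ⟨w, hw, rfl⟩ g
      show Ad3 (β g) (Ad3 k w) = _
      have : Ad3 (α g) w = w := hw g
      rw [hk, Ad3_mul_apply, Ad3_mul_apply, Ad3_inv_apply_self, this]
    · intro hv
      refine ⟨Ad3 k⁻¹ v, fun g => ?_, Ad3_apply_inv_self k v⟩
      have : Ad3 (β g) v = v := hv g
      show Ad3 (α g) (Ad3 k⁻¹ v) = _
      apply Ad3_injective k
      rw [← Ad3_mul_apply, ← Ad3_mul_apply, ← hk, this, Ad3_apply_inv_self]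
  rw [← h1]
  exact (Submodule.equivMapOfInjective (Ad3 k) (Ad3_injective k) _).finrank_eq

lemma Ad3_eq_one_of_smul {X : SU 3} {c : ℂ} (hX : (X : Mat) = c • 1) : Ad3 X = 1 := by
  ext1 v
  rw [Module.End.one_apply, Ad3_eq_self_iff, hX]
  simp

/-- A matrix of `SU(2)` other than `1` fixes no vector. -/
lemma SU2.eq_zero_of_mulVec {A : SU 2} (hA : A ≠ 1) {v : Fin 2 → ℂ}
    (hv : (A : Matrix (Fin 2) (Fin 2) ℂ).mulVec v = v) : v = 0 := by
  by_contra h0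
  have hdet : ((A : Matrix (Fin 2) (Fin 2) ℂ) - 1).det = 0 :=
    Matrix.exists_mulVec_eq_zero_iff.1 ⟨v, h0, by
      rw [Matrix.sub_mulVec, hv, Matrix.one_mulVec, sub_self]⟩
  have hdet' : (A : Matrix (Fin 2) (Fin 2) ℂ).det = 1 :=
    (Matrix.mem_specialUnitaryGroup_iff.1 A.2).2
  rw [Matrix.det_fin_two] at hdet hdet'
  simp only [Matrix.sub_apply, Matrix.one_apply_eq, Matrix.one_apply_ne (show (0 : Fin 2) ≠ 1 by decide),
    Matrix.one_apply_ne (show (1 : Fin 2) ≠ 0 by decide), sub_zero] at hdet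
  have htr : ((inclSU2 A : SU 3) : Mat).trace = 3 := by
    rw [trace_inclSU2, Matrix.trace_fin_two]
    linear_combination hdet' - hdet
  apply hA
  apply inclSU2_injective
  rw [map_one]
  exact eq_one_of_trace htr

end

lemma hasDoubleRoot_three : HasDoubleRoot 3 :=
  ⟨1, by rw [map_ofNat]; norm_num, by rw [map_ofNat]; norm_num⟩

namespace IsBrieskornGroup

variable {p q r : ℕ} {a c : ℤ} {π : Type} [Group π] {x y z h : π}

lemma map_ne_one (B : IsBrieskornGroup p q r a c x y z h) {ρ : π →* SU 2} (hρ : ρ ≠ 1) {g : π}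
    (hg : g = x ∨ g = y ∨ g = z) : ρ g ≠ 1 := by
  intro h1
  refine B.not_hasDoubleRoot_of_ne_one hρ hg ?_
  rw [h1, map_one, trace_one]
  exact hasDoubleRoot_three

/-- The invariants of `su(3)` for a nontrivial representation in `SU(2)` are the multiples of
`diag (i, i, -2i)`. -/
lemma finrank_invariants_inclSU2 (B : IsBrieskornGroup p q r a c x y z h) {ρ : π →* SU 2}
    (hρ : ρ ≠ 1) : Module.finrank ℝ (Representation.invariants (Ad3.comp (inclSU2.comp ρ))) = 1 := by
  have hX0 : su3Equiv (1, 1, 0, 0, 0) ∈ Representation.invariants (Ad3.comp (inclSU2.comp ρ)) := by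
    rw [mem_invariants_su3]
    intro g
    ext i j
    fin_cases i <;> fin_cases j <;>
      simp [su3Equiv, inclSU2, blockOne, Matrix.mul_apply, Fin.sum_univ_three, mul_comm]
  refine finrank_eq_one (⟨_, hX0⟩ : Representation.invariants _) (fun h0 => ?_) ?_
  · have h1 := su3Equiv.injective ((congrArg Subtype.val h0).trans (map_zero su3Equiv).symm)
    simpa using congrArg Prod.fst h1
  rintro ⟨X, hX⟩
  obtain ⟨⟨s, t, u, v, w⟩, rfl⟩ := su3Equiv.surjective X
  rw [mem_invariants_su3] at hX
  have hvw : ![v, w] = 0 := by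
    refine SU2.eq_zero_of_mulVec (B.map_ne_one hρ (Or.inl rfl)) ?_
    have h0 := congrFun (congrFun (hX x) 0) 2
    have h1 := congrFun (congrFun (hX x) 1) 2
    simp [su3Equiv, inclSU2, blockOne, Matrix.mul_apply, Fin.sum_univ_three] at h0 h1
    ext i
    fin_cases i
    · simpa [Matrix.mulVec, dotProduct, Fin.sum_univ_two] using h0
    · simpa [Matrix.mulVec, dotProduct, Fin.sum_univ_two] using h1
  let K : Matrix (Fin 2) (Fin 2) ℂ := !![s * Complex.I, u; -conj u, t * Complex.I]
  have hK : ∀ g, (ρ g : Matrix (Fin 2) (Fin 2) ℂ) * K = K * (ρ g : Matrix (Fin 2) (Fin 2) ℂ) := by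
    intro g
    have h1 := fun i j => congrFun (congrFun (hX g) i) j
    have e1 := h1 0 0
    have e2 := h1 0 1
    have e3 := h1 1 0
    have e4 := h1 1 1
    simp [su3Equiv, inclSU2, blockOne, Matrix.mul_apply, Fin.sum_univ_three] at e1 e2 e3 e4
    ext i j
    fin_cases i <;> fin_cases j <;> simp [K, Matrix.mul_apply, Fin.sum_univ_two]
    exacts [e1, e2, e3, e4]
  have hKs : ∃ k : ℂ, K = k • 1 := by
    by_contra hs
    push Not at hs
    exact hρ (B.hom_eq_one ρ (Subtype.ext (SU2.commute_of_commute hs (hK x) (hK y))))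
  obtain ⟨k, hk⟩ := hKs
  have e1 : (s : ℂ) * Complex.I = k := by simpa [K] using congrFun (congrFun hk 0) 0
  have e2 : u = 0 := by simpa [K] using congrFun (congrFun hk 0) 1
  have e3 : (t : ℂ) * Complex.I = k := by simpa [K] using congrFun (congrFun hk 1) 1
  have e4 : s = t := by
    rw [← e3] at e1
    exact_mod_cast mul_right_cancel₀ Complex.I_ne_zero e1
  have e5 : v = 0 := congrFun hvw 0
  have e6 : w = 0 := congrFun hvw 1
  refine ⟨s, Subtype.ext ?_⟩
  show s • su3Equiv (1, 1, 0, 0, 0) = su3Equiv (s, t, u, v, w)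
  rw [← map_smul]
  simp [e2, e5, e6, ← e4]

lemma not_scalar (B : IsBrieskornGroup p q r a c x y z h) {α : π →* SU 3} (hα : IsIrred α) {g : π}
    (hg : g = x ∨ g = y ∨ g = z) (k : ℂ) : (α g : Mat) ≠ k • 1 := by
  intro hk
  have hc : ∀ g', Commute (α g) (α g') := fun g' =>
    (Subgroup.mem_center_iff.1 (mem_center_of_smul hk) (α g')).symm
  have h1 : α = 1 := by
    refine B.hom_eq_one α ?_
    rcases hg with rfl | rfl | rfl
    · exact hc y
    · exact (hc x).symm
    · have hy : y = x⁻¹ * g⁻¹ := by rw [B.z_eq]; group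
      rw [hy, map_mul, map_inv, map_inv]
      exact ((Commute.refl _).inv_right).mul_right ((hc x).symm.inv_right)
  subst h1
  exact B.not_isIrred_iff.2 ⟨fun _ => 1, fun h0 => one_ne_zero (congrFun h0 0), fun γ => by simp⟩ hα

/-- The dimension of `H¹(su(3))` for an irreducible representation. -/
lemma finrank_H1su3_of_isIrred (B : IsBrieskornGroup p q r a c x y z h) {α : π →* SU 3}
    (hα : IsIrred α) : FiniteDimensional ℝ (H1su3 α) ∧
    Module.finrank ℝ (H1su3 α) + 16 = Module.finrank ℝ (LinearMap.range (1 - Ad3 (α x))) +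
      Module.finrank ℝ (LinearMap.range (1 - Ad3 (α y))) +
      Module.finrank ℝ (LinearMap.range (1 - Ad3 (α z))) := by
  obtain ⟨k, hk⟩ := B.exists_map_h_eq_smul hα
  have h1 := finrank_H1 B (isInvariantForm_su3 α) (Ad3_eq_one_of_smul hk)
  rw [finrank_su3, hα.invariants_eq_bot, finrank_bot] at h1
  exact h1

theorem finrank_H1su3_of_regular (B : IsBrieskornGroup p q r a c x y z h) {α : π →* SU 3}
    (hα : IsIrred α) (hx : ¬ HasDoubleRoot (α x : Mat).trace)
    (hy : ¬ HasDoubleRoot (α y : Mat).trace) (hz : ¬ HasDoubleRoot (α z : Mat).trace) :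
    Nonempty (H1su3 α ≃ₗ[ℝ] (Fin 2 → ℝ)) := by
  obtain ⟨h0, h1⟩ := B.finrank_H1su3_of_isIrred hα
  rw [finrank_range_of_regular hx, finrank_range_of_regular hy, finrank_range_of_regular hz] at h1
  exact nonempty_linearEquiv (by omega)

theorem subsingleton_H1su3 (B : IsBrieskornGroup p q r a c x y z h) {α : π →* SU 3}
    (hα : IsIrred α)
    (hd : (HasDoubleRoot (α x : Mat).trace ∧ ¬ HasDoubleRoot (α y : Mat).trace ∧
        ¬ HasDoubleRoot (α z : Mat).trace) ∨
      (HasDoubleRoot (α y : Mat).trace ∧ ¬ HasDoubleRoot (α x : Mat).trace ∧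
        ¬ HasDoubleRoot (α z : Mat).trace) ∨
      (HasDoubleRoot (α z : Mat).trace ∧ ¬ HasDoubleRoot (α x : Mat).trace ∧
        ¬ HasDoubleRoot (α y : Mat).trace)) :
    Subsingleton (H1su3 α) := by
  obtain ⟨h0, h1⟩ := B.finrank_H1su3_of_isIrred hα
  rw [← Module.finrank_zero_iff (R := ℝ)]
  rcases hd with ⟨d1, d2, d3⟩ | ⟨d1, d2, d3⟩ | ⟨d1, d2, d3⟩ <;>
  · rw [finrank_range_of_regular d2, finrank_range_of_regular d3,
      finrank_range_of_double d1 (B.not_scalar hα (by simp))] at h1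
    omega

theorem finrank_H1su3_of_hasFixedVector (B : IsBrieskornGroup p q r a c x y z h) {β : π →* SU 3}
    (hβ : HasFixedVector β) (h1 : β ≠ 1) (hh : β h = 1) :
    FiniteDimensional ℝ (H1su3 β) ∧ Module.finrank ℝ (H1su3 β) = 4 := by
  obtain ⟨ρ, hρ⟩ := hβ.exists_repClass_inclSU2
  have hρ1 : ρ ≠ 1 := by
    rintro rfl
    exact h1 (eq_one_of_repClass_eq (by rw [← hρ]; congr 1; ext1; simp))
  obtain ⟨-, hx, hy, hz⟩ := B.of_hasFixedVector hβ h1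
  have h2 := finrank_H1 B (isInvariantForm_su3 β) (show Ad3 (β h) = 1 by rw [hh, map_one])
  rw [finrank_su3, ← finrank_invariants_eq hρ, B.finrank_invariants_inclSU2 hρ1] at h2
  obtain ⟨h0, h2⟩ := h2
  refine ⟨h0, ?_⟩
  have e1 := finrank_range_of_regular hx
  have e2 := finrank_range_of_regular hy
  have e3 := finrank_range_of_regular hz
  have e : Module.finrank ℝ (H1su3 β) + 2 * 8 =
      Module.finrank ℝ (LinearMap.range (1 - Ad3 (β x))) +
      Module.finrank ℝ (LinearMap.range (1 - Ad3 (β y))) +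
      Module.finrank ℝ (LinearMap.range (1 - Ad3 (β z))) + 2 * 1 := h2
  rw [e1, e2, e3] at e
  omega

lemma finrank_range_stdRep {A : SU 2} (hA : A ≠ 1) :
    Module.finrank ℝ (LinearMap.range (1 - stdRepReal 2 A)) = 4 := by
  have h1 : LinearMap.ker (1 - stdRepReal 2 A) = ⊥ := by
    rw [eq_bot_iff]
    intro v hv
    rw [LinearMap.mem_ker, LinearMap.sub_apply, Module.End.one_apply, sub_eq_zero,
      stdRepReal_apply] at hv
    exact SU2.eq_zero_of_mulVec hA hv.symm
  rw [LinearMap.finrank_range_of_inj (LinearMap.ker_eq_bot.1 h1), finrank_C2]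

theorem finrank_H1C2 (B : IsBrieskornGroup p q r a c x y z h) {ρ : π →* SU 2} (hρ : ρ ≠ 1)
    (hh : ρ h = 1) : FiniteDimensional ℝ (H1C2 ρ) ∧ Module.finrank ℝ (H1C2 ρ) = 4 := by
  have h2 := finrank_H1 B (isInvariantForm_C2 ρ) (show stdRepReal 2 (ρ h) = 1 by rw [hh, map_one])
  have hinv : Representation.invariants ((stdRepReal 2).comp ρ) = ⊥ := by
    rw [eq_bot_iff]
    intro v hv
    exact SU2.eq_zero_of_mulVec (B.map_ne_one hρ (Or.inl rfl)) (hv x)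
  rw [finrank_C2, hinv, finrank_bot] at h2
  obtain ⟨h0, h2⟩ := h2
  refine ⟨h0, ?_⟩
  have e1 := finrank_range_stdRep (B.map_ne_one hρ (Or.inl rfl))
  have e2 := finrank_range_stdRep (B.map_ne_one hρ (Or.inr (Or.inl rfl)))
  have e3 := finrank_range_stdRep (B.map_ne_one hρ (Or.inr (Or.inr rfl)))
  have e : Module.finrank ℝ (H1C2 ρ) + 2 * 4 =
      Module.finrank ℝ (LinearMap.range (1 - stdRepReal 2 (ρ x))) +
      Module.finrank ℝ (LinearMap.range (1 - stdRepReal 2 (ρ y))) +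
      Module.finrank ℝ (LinearMap.range (1 - stdRepReal 2 (ρ z))) + 2 * 0 := h2
  rw [e1, e2, e3] at e
  omega

theorem subsingleton_H1C2 (B : IsBrieskornGroup p q r a c x y z h) {ρ : π →* SU 2}
    (hh : (ρ h : Matrix (Fin 2) (Fin 2) ℂ) = -1) : Subsingleton (H1C2 ρ) :=
  subsingleton_H1_of_neg B.comm_h fun v => by
    show stdRepReal 2 (ρ h) v = -v
    rw [stdRepReal_apply, hh, Matrix.neg_mulVec, Matrix.one_mulVec]

end IsBrieskornGroup

/-- The projection of `su(3) = su(2) ⊕ ℂ² ⊕ ℝ` to `ℂ²`. -/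
def projC2 (X : su3) : Fin 2 → ℂ := ![(X : Mat) 0 2, (X : Mat) 1 2]

lemma projC2_inclC2 (v : Fin 2 → ℂ) : projC2 (inclC2 v) = v := by
  ext i
  fin_cases i <;> simp [projC2, inclC2, offDiag]

lemma projC2_sub (X Y : su3) : projC2 (X - Y) = projC2 X - projC2 Y := by
  ext i
  fin_cases i <;> simp [projC2]

lemma projC2_Ad3 (A : SU 2) (X : su3) :
    projC2 (Ad3 (inclSU2 A) X) = stdRepReal 2 A (projC2 X) := by
  have h1 : (Ad3 (inclSU2 A) X : Mat) =
      blockOne A * (X : Mat) * blockOne (A : Matrix (Fin 2) (Fin 2) ℂ).conjTranspose := by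
    rw [blockOne_conjTranspose]; rfl
  rw [stdRepReal_apply]
  ext i
  simp only [projC2, h1, Matrix.mulVec, dotProduct, Fin.sum_univ_two, Matrix.mul_apply,
    Fin.sum_univ_three]
  fin_cases i <;> simp [blockOne]

/-- The inclusion `ℂ² → su(3)` has an equivariant left inverse, so it is injective on cohomology. -/
lemma inclH1_injective {π : Type} [Group π] (ρ : π →* SU 2) :
    Function.Injective (inclH1 ρ).hom := by
  rw [injective_iff_map_eq_zero]
  intro ξ hξ
  induction ξ using H1_induction_on with | @h f =>
  have h1 := congrArg (fun m => m.hom f)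
    (H1π_comp_map (A := C2Module ρ) (B := su3Module (inclSU2.comp ρ)) (MonoidHom.id π) (inclC2Module ρ))
  have h3 := h1.symm.trans hξ
  rw [ModuleCat.hom_comp, LinearMap.comp_apply] at h3
  obtain ⟨X, hX⟩ := (H1π_eq_zero_iff _).1 h3
  rw [H1π_eq_zero_iff]
  refine ⟨projC2 X, funext fun g => ?_⟩
  have h2 : Ad3 (inclSU2 (ρ g)) X - X = inclC2 (f g) := congrFun hX g
  show stdRepReal 2 (ρ g) (projC2 X) - projC2 X = f g
  rw [← projC2_Ad3, ← projC2_sub, h2, projC2_inclC2]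

theorem IsBrieskornGroup.inclH1_bijective {p q r : ℕ} {a c : ℤ} {π : Type} [Group π] {x y z h : π}
    (B : IsBrieskornGroup p q r a c x y z h) {ρ : π →* SU 2} (hρ : ρ ≠ 1) (hh : ρ h = 1) :
    Function.Bijective (inclH1 ρ) := by
  obtain ⟨h1, h2⟩ := B.finrank_H1C2 hρ hh
  obtain ⟨h3, h4⟩ := B.finrank_H1su3_of_hasFixedVector (hasFixedVector_inclSU2 ρ) (fun h0 => hρ (by
    ext1 g
    exact inclSU2_injective ((DFunLike.congr_fun h0 g).trans (map_one _).symm)))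
    (show inclSU2 (ρ h) = 1 by rw [hh, map_one])
  refine ⟨inclH1_injective ρ, ?_⟩
  exact (LinearMap.injective_iff_surjective_of_finrank_eq_finrank (h2.trans h4.symm)).1
    (inclH1_injective ρ)

/-! ### Topology of the representation variety -/

instance : CompactSpace (SU 3) := by
  refine (isCompact_iff_compactSpace (s := (Matrix.specialUnitaryGroup (Fin 3) ℂ : Set Mat))).1 ?_
  have hclosed : IsClosed (Matrix.specialUnitaryGroup (Fin 3) ℂ : Set Mat) := by
    have : (Matrix.specialUnitaryGroup (Fin 3) ℂ : Set Mat) =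
        {X : Mat | X * X.conjTranspose = 1} ∩ {X : Mat | X.det = 1} := by
      ext X
      rw [SetLike.mem_coe, Matrix.mem_specialUnitaryGroup_iff, Matrix.mem_unitaryGroup_iff]
      rfl
    rw [this]
    exact (isClosed_eq (by fun_prop) continuous_const).inter
      (isClosed_eq (by fun_prop) continuous_const)
  refine (isCompact_univ_pi fun _ : Fin 3 => isCompact_univ_pi fun _ : Fin 3 =>
    isCompact_closedBall (0 : ℂ) 1).of_isClosed_subset hclosed ?_
  intro X hX i _ j _
  rw [mem_closedBall_zero_iff]
  exact entry_norm_bound_of_unitary (Matrix.mem_specialUnitaryGroup_iff.1 hX).1 i j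

section

variable {π : Type} [Group π]

lemma continuous_eval (g : π) : Continuous fun α : π →* SU 3 => α g :=
  (continuous_apply g).comp continuous_induced_dom

lemma continuous_eval_coe (g : π) : Continuous fun α : π →* SU 3 => (α g : Mat) :=
  continuous_subtype_val.comp (continuous_eval g)

lemma repClass_surjective : Function.Surjective (repClass : (π →* SU 3) → RepVariety π) :=
  Quotient.mk_surjective

instance : CompactSpace (π →* SU 3) := by
  have hind : Topology.IsInducing fun (α : π →* SU 3) (γ : π) => α γ := ⟨rfl⟩
  rw [← isCompact_univ_iff, hind.isCompact_iff, Set.image_univ]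
  have : Set.range (fun (α : π →* SU 3) (γ : π) => α γ) =
      ⋂ (a : π) (b : π), {f : π → SU 3 | f (a * b) = f a * f b} := by
    ext f
    rw [Set.mem_iInter₂]
    constructor
    · rintro ⟨α, rfl⟩ a b
      exact map_mul α a b
    · intro hf
      exact ⟨MonoidHom.mk' f hf, rfl⟩
  rw [this]
  exact (isClosed_iInter fun a => isClosed_iInter fun b =>
    isClosed_eq (by fun_prop) (by fun_prop)).isCompact

instance : CompactSpace (RepVariety π) := inferInstanceAs (CompactSpace (Quotient (repSetoid π)))

/-- The trace of the image of a group element, as a function on the representation variety. -/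
def traceAt (g : π) : RepVariety π → ℂ :=
  Quotient.lift (fun α : π →* SU 3 => (α g : Mat).trace) fun _ _ h =>
    trace_eq_of_repClass_eq (Quotient.sound h) g

lemma continuous_traceAt (g : π) : Continuous (traceAt g) :=
  ((continuous_eval_coe g).matrix_trace).quotient_lift _

end

/-- The matrices of a given finite order have finitely many traces. -/
lemma SU3.finite_trace {n : ℕ} (hn : 0 < n) :
    {t : ℂ | ∃ X : SU 3, X ^ n = 1 ∧ (X : Mat).trace = t}.Finite := by
  have hfin : {w : ℂ | w ^ n = 1}.Finite := by
    refine (Polynomial.nthRoots n (1 : ℂ)).toFinset.finite_toSet.subset fun w hw => ?_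
    simpa [Polynomial.mem_nthRoots hn] using hw
  refine ((Set.Finite.pi' fun _ : Fin 3 => hfin).image fun l => ∑ i, l i).subset ?_
  rintro _ ⟨X, hX, rfl⟩
  obtain ⟨l, hl, g, rfl⟩ := exists_eq_conj X
  refine ⟨l, fun i => ?_, by rw [trace_conj, trace_toSU]⟩
  rw [conj_pow, mul_inv_eq_one, mul_eq_left] at hX
  have h1 := congrArg (fun X : SU 3 => (X : Mat) i i) hX
  simp only [SubmonoidClass.coe_pow, hl.coe_toSU, Matrix.diagonal_pow, Submonoid.coe_one,
    Matrix.diagonal_apply_eq, Matrix.one_apply_eq, Pi.pow_apply] at h1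
  exact h1

lemma isClopen_preimage_singleton {X : Type*} [TopologicalSpace X] {f : X → ℂ} (hf : Continuous f)
    (hfin : (Set.range f).Finite) (t : ℂ) : IsClopen (f ⁻¹' {t}) := by
  refine ⟨isClosed_singleton.preimage hf, ?_⟩
  have : f ⁻¹' {t} = (f ⁻¹' (Set.range f \ {t}))ᶜ := by
    ext x
    simp
  rw [this, isOpen_compl_iff]
  exact ((hfin.subset Set.sdiff_subset).isClosed).preimage hf

namespace IsBrieskornGroup

variable {p q r : ℕ} {a c : ℤ} {π : Type} [Group π] {x y z h : π}

lemma map_h_pow (B : IsBrieskornGroup p q r a c x y z h) (α : π →* SU 3) : α h ^ 6 = 1 := by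
  by_cases ht : (α h : Mat).trace = -1
  · have hα : HasFixedVector α := B.not_isIrred_iff.1 fun hα => B.isIrred_trace_h_ne hα ht
    obtain ⟨ρ, hρ⟩ := hα.exists_repClass_inclSU2
    obtain ⟨k, hk⟩ := repClass_eq_iff.1 hρ
    have hρ1 : ρ ≠ 1 := by
      rintro rfl
      have h1 := hk h
      simp only [MonoidHom.comp_apply, MonoidHom.one_apply, map_one, mul_one, mul_inv_cancel] at h1
      rw [h1, trace_one] at ht
      norm_num at ht
    have h2 : ρ h ^ 2 = 1 := by
      apply Subtype.ext
      rw [SubmonoidClass.coe_pow]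
      rcases B.map_h_eq hρ1 with h2 | h2 <;> rw [h2] <;> simp
    rw [hk, conj_pow, MonoidHom.comp_apply, ← map_pow, show 6 = 2 * 3 from rfl, pow_mul, h2]
    simp
  · have h1 := B.map_h_eq_smul ht
    have h2 := pow_three_of_smul h1
    apply Subtype.ext
    rw [SubmonoidClass.coe_pow, h1, smul_pow, one_pow, show 6 = 3 * 2 from rfl, pow_mul, h2,
      one_pow, one_smul]
    rfl

lemma finite_range_traceAt (B : IsBrieskornGroup p q r a c x y z h) {g : π}
    (hg : g = x ∨ g = y ∨ g = z ∨ g = h) : (Set.range (traceAt g)).Finite := by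
  have key : ∀ {n : ℕ} {k : ℤ}, 0 < n → g ^ n = h ^ k → (Set.range (traceAt g)).Finite := by
    intro n k hn hgn
    refine (finite_trace (n := n * 6) (by omega)).subset ?_
    rintro _ ⟨ξ, rfl⟩
    obtain ⟨α, rfl⟩ := repClass_surjective ξ
    refine ⟨α g, ?_, rfl⟩
    rw [pow_mul, ← map_pow, hgn, map_zpow, ← zpow_natCast, ← zpow_mul, mul_comm, zpow_mul,
      zpow_natCast, B.map_h_pow, one_zpow]
  rcases hg with rfl | rfl | rfl | rfl
  · exact key B.pos_p B.x_pow
  · exact key B.pos_q B.y_pow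
  · exact key B.pos_r B.z_pow
  · exact key (k := 1) one_pos (by simp)

end IsBrieskornGroup

/-- The classes of the representations with the same traces as `α`. -/
def traceLevel {π : Type} [Group π] (x y z h : π) (α : π →* SU 3) : Set (RepVariety π) :=
  traceAt x ⁻¹' {traceAt x (repClass α)} ∩ traceAt y ⁻¹' {traceAt y (repClass α)} ∩
    (traceAt z ⁻¹' {traceAt z (repClass α)} ∩ traceAt h ⁻¹' {traceAt h (repClass α)})

section

variable {π : Type} [Group π] {x y z h : π} {α β : π →* SU 3}

lemma mem_traceLevel : repClass β ∈ traceLevel x y z h α ↔ SameTraces x y z h α β := by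
  constructor
  · rintro ⟨⟨h1, h2⟩, h3, h4⟩
    exact ⟨h1.symm, h2.symm, h3.symm, h4.symm⟩
  · rintro ⟨h1, h2, h3, h4⟩
    exact ⟨⟨h1.symm, h2.symm⟩, h3.symm, h4.symm⟩

lemma SameTraces.refl (α : π →* SU 3) : SameTraces x y z h α α := ⟨rfl, rfl, rfl, rfl⟩

lemma SameTraces.symm (hs : SameTraces x y z h α β) : SameTraces x y z h β α :=
  ⟨hs.x.symm, hs.y.symm, hs.z.symm, hs.h.symm⟩

lemma SameTraces.trans {γ : π →* SU 3} (hs : SameTraces x y z h α β)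
    (hs' : SameTraces x y z h β γ) : SameTraces x y z h α γ :=
  ⟨hs.x.trans hs'.x, hs.y.trans hs'.y, hs.z.trans hs'.z, hs.h.trans hs'.h⟩

lemma SameTraces.of_repClass_eq (hs : repClass α = repClass β) : SameTraces x y z h α β :=
  ⟨trace_eq_of_repClass_eq hs _, trace_eq_of_repClass_eq hs _, trace_eq_of_repClass_eq hs _,
    trace_eq_of_repClass_eq hs _⟩

end

/-- Since the generators have finite order modulo the centre, traces are locally constant. -/
theorem IsBrieskornGroup.isClopen_traceLevel {p q r : ℕ} {a c : ℤ} {π : Type} [Group π]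
    {x y z h : π} (B : IsBrieskornGroup p q r a c x y z h) (α : π →* SU 3) :
    IsClopen (traceLevel x y z h α) := by
  have key : ∀ g, g = x ∨ g = y ∨ g = z ∨ g = h →
      IsClopen (traceAt g ⁻¹' {traceAt g (repClass α)}) := fun g hg =>
    isClopen_preimage_singleton (continuous_traceAt g) (B.finite_range_traceAt hg) _
  exact ((key x (by simp)).inter (key y (by simp))).inter
    ((key z (by simp)).inter (key h (by simp)))

/-- Traces are constant along path components. -/
lemma IsBrieskornGroup.sameTraces_of_joined {p q r : ℕ} {a c : ℤ} {π : Type} [Group π]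
    {x y z h : π} (B : IsBrieskornGroup p q r a c x y z h) {α β : π →* SU 3}
    (hj : Joined (repClass α) (repClass β)) : SameTraces x y z h α β := by
  rw [← mem_traceLevel]
  have h1 := (B.isClopen_traceLevel α).connectedComponent_subset
    (mem_traceLevel.2 (SameTraces.refl α))
  exact h1 (pathComponent_subset_component _ hj)

/-! ### Topological 2-spheres -/

section Sphere

variable {X : Type} [TopologicalSpace X] {C : Set X}

lemma IsTwoSphere.exists_ne (hC : IsTwoSphere C) (ξ : X) : ∃ η ∈ C, η ≠ ξ := by
  obtain ⟨e⟩ := hC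
  by_contra hcon
  push Not at hcon
  have hs : Subsingleton C := ⟨fun a b => Subtype.ext ((hcon a a.2).trans (hcon b b.2).symm)⟩
  have hs' := e.symm.injective.subsingleton
  let v : EuclideanSpace ℝ (Fin 3) := EuclideanSpace.single 0 1
  have hv : v ∈ Metric.sphere (0 : EuclideanSpace ℝ (Fin 3)) 1 := by simp [v]
  have hv' : -v ∈ Metric.sphere (0 : EuclideanSpace ℝ (Fin 3)) 1 := by simp [v]
  have h1 := congrArg Subtype.val (hs'.elim ⟨v, hv⟩ ⟨-v, hv'⟩)
  have h2 := congrArg (fun w : EuclideanSpace ℝ (Fin 3) => w 0) h1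
  norm_num [v] at h2

lemma IsTwoSphere.isPathConnected (hC : IsTwoSphere C) : IsPathConnected C := by
  obtain ⟨e⟩ := hC
  have h1 : IsPathConnected (Metric.sphere (0 : EuclideanSpace ℝ (Fin 3)) 1) :=
    isPathConnected_sphere (by rw [← Module.finrank_eq_rank]; simp) 0 zero_le_one
  rw [isPathConnected_iff_pathConnectedSpace] at h1 ⊢
  exact e.symm.surjective.pathConnectedSpace e.symm.continuous

lemma IsTwoSphere.pathComponent_eq (hC : IsTwoSphere C) (hclopen : IsClopen C) {ξ : X} (hξ : ξ ∈ C) :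
    pathComponent ξ = C := by
  apply Set.Subset.antisymm
  · exact (pathComponent_subset_component ξ).trans (hclopen.connectedComponent_subset hξ)
  · exact hC.isPathConnected.subset_pathComponent hξ

lemma pathComponent_eq_singleton {ξ : X} (hξ : IsClopen ({ξ} : Set X)) : pathComponent ξ = {ξ} := by
  apply Set.Subset.antisymm
  · exact (pathComponent_subset_component ξ).trans (hξ.connectedComponent_subset rfl)
  · rintro _ rfl
    exact mem_pathComponent_self _

lemma exists_stereographic (v : Metric.sphere (0 : EuclideanSpace ℝ (Fin 3)) 1) :
    Nonempty (({v}ᶜ : Set (Metric.sphere (0 : EuclideanSpace ℝ (Fin 3)) 1)) ≃ₜ (Fin 2 → ℝ)) := by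
  have : Fact (Module.finrank ℝ (EuclideanSpace ℝ (Fin 3)) = 2 + 1) := ⟨by simp⟩
  let e := stereographic' 2 v
  have h1 : e.source = {v}ᶜ := stereographic'_source v
  have h2 : e.target = Set.univ := stereographic'_target v
  exact ⟨(Homeomorph.setCongr h1.symm).trans (e.toHomeomorphSourceTarget.trans
    ((Homeomorph.setCongr h2).trans ((Homeomorph.Set.univ _).trans
      (EuclideanSpace.equiv (Fin 2) ℝ).toHomeomorph)))⟩

/-- A point of an open 2-sphere has a neighbourhood homeomorphic to the plane. -/
lemma IsTwoSphere.exists_nhd (hC : IsTwoSphere C) (hopen : IsOpen C) {ξ : X} (hξ : ξ ∈ C) :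
    ∃ U : Set X, IsOpen U ∧ ξ ∈ U ∧ Nonempty (U ≃ₜ (Fin 2 → ℝ)) := by
  obtain ⟨η, hη, hne⟩ := hC.exists_ne ξ
  obtain ⟨e⟩ := hC
  let η' : C := ⟨η, hη⟩
  obtain ⟨s⟩ := exists_stereographic (e η')
  have hV : IsOpen ({η'}ᶜ : Set C) := by
    have : ({η'}ᶜ : Set C) = e ⁻¹' {e η'}ᶜ := by
      ext a; simp
    rw [this]
    exact isOpen_compl_singleton.preimage e.continuous
  refine ⟨Subtype.val '' ({η'}ᶜ : Set C), hopen.isOpenMap_subtype_val _ hV,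
    ⟨⟨ξ, hξ⟩, fun h => hne (congrArg Subtype.val h).symm, rfl⟩, ?_⟩
  have e1 : ({η'}ᶜ : Set C) ≃ₜ (Subtype.val '' ({η'}ᶜ : Set C) : Set X) :=
    (hopen.isOpenEmbedding_subtypeVal.isEmbedding.homeomorphImage _)
  have e2 : ({η'}ᶜ : Set C) ≃ₜ ({e η'}ᶜ : Set (Metric.sphere (0 : EuclideanSpace ℝ (Fin 3)) 1)) :=
    e.subtype fun a => by simp
  exact ⟨e1.symm.trans (e2.trans s)⟩

/-- No point of an open 2-sphere has a four-dimensional Euclidean neighbourhood. -/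
lemma IsTwoSphere.not_homeomorph (hC : IsTwoSphere C) (hopen : IsOpen C) {ξ : X} (hξ : ξ ∈ C)
    {U : Set X} (hξU : ξ ∈ U) : IsEmpty (U ≃ₜ (Fin 4 → ℝ)) := by
  obtain ⟨e⟩ := hC
  refine ⟨fun φ => ?_⟩
  obtain ⟨s⟩ := exists_stereographic (e ⟨ξ, hξ⟩)
  let P : Fin 4 → ℝ := φ ⟨ξ, hξU⟩
  -- a small sphere of dimension two around the point, in the given chart
  let ι : EuclideanSpace ℝ (Fin 3) → Fin 4 → ℝ := fun w => ![w 0, w 1, w 2, 0]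
  have hι : Continuous ι := by
    refine continuous_pi fun i => ?_
    fin_cases i <;> simp [ι] <;> fun_prop
  have hW : IsOpen {w : Fin 4 → ℝ | (φ.symm w : X) ∈ C} :=
    hopen.preimage (continuous_subtype_val.comp φ.symm.continuous)
  have hev : ∀ᶠ t : ℝ in nhds 0, ∀ w ∈ Metric.sphere (0 : EuclideanSpace ℝ (Fin 3)) 1,
      (φ.symm (P + t • ι w) : X) ∈ C := by
    have hopen' : IsOpen {x : ℝ × EuclideanSpace ℝ (Fin 3) | (φ.symm (P + x.1 • ι x.2) : X) ∈ C} :=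
      hW.preimage (continuous_const.add (continuous_fst.smul (hι.comp continuous_snd)))
    have := (isCompact_sphere (0 : EuclideanSpace ℝ (Fin 3)) 1).eventually_forall_of_forall_eventually
      (x₀ := (0 : ℝ)) (P := fun t w => (φ.symm (P + t • ι w) : X) ∈ C) fun w hw => by
        refine hopen'.mem_nhds ?_
        simp [P, hξ]
    exact this
  obtain ⟨t, ht, ht0⟩ : ∃ t : ℝ, (∀ w ∈ Metric.sphere (0 : EuclideanSpace ℝ (Fin 3)) 1,
      (φ.symm (P + t • ι w) : X) ∈ C) ∧ t ≠ 0 := by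
    have h1 : ∀ᶠ t : ℝ in nhdsWithin 0 {0}ᶜ, ∀ w ∈ Metric.sphere (0 : EuclideanSpace ℝ (Fin 3)) 1,
      (φ.symm (P + t • ι w) : X) ∈ C := hev.filter_mono nhdsWithin_le_nhds
    exact (h1.and self_mem_nhdsWithin).exists
  have hιinj : ∀ w w', ι w = ι w' → w = w' := fun w w' h => by
    ext i
    fin_cases i
    exacts [congrFun h 0, congrFun h 1, congrFun h 2]
  have hP : ∀ w ∈ Metric.sphere (0 : EuclideanSpace ℝ (Fin 3)) 1, (φ.symm (P + t • ι w) : X) ≠ ξ := by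
    intro w hw h
    have h1 : φ.symm (P + t • ι w) = ⟨ξ, hξU⟩ := Subtype.ext h
    have h2 : P + t • ι w = P := by rw [← φ.apply_symm_apply (P + t • ι w), h1]
    have h3 : ι w = ι 0 := by
      have h4 : ι 0 = 0 := by
        funext i; fin_cases i <;> simp [ι]
      rw [h4]
      exact (smul_eq_zero.1 (add_eq_left.1 h2)).resolve_left ht0
    rw [hιinj _ _ h3] at hw
    simp at hw
  let S := Metric.sphere (0 : EuclideanSpace ℝ (Fin 3)) 1
  let F : S → (Fin 2 → ℝ) := fun w => s ⟨e ⟨φ.symm (P + t • ι w), ht w w.2⟩, fun h =>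
    hP w w.2 (congrArg Subtype.val (e.injective h))⟩
  have hF : Continuous F := by
    refine s.continuous.comp (Continuous.subtype_mk (e.continuous.comp (Continuous.subtype_mk ?_ _)) _)
    exact continuous_subtype_val.comp (φ.symm.continuous.comp
      (continuous_const.add ((hι.comp continuous_subtype_val).const_smul t)))
  have hFinj : Function.Injective F := by
    intro w w' h
    have h1 := congrArg (fun a : C => (a : X)) (e.injective (congrArg Subtype.val (s.injective h)))
    have h2 := φ.symm.injective (Subtype.ext h1)
    have h3 : t • ι w = t • ι w' := add_left_cancel h2
    exact Subtype.ext (hιinj _ _ (smul_right_injective _ ht0 h3))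
  let g : (Fin 2 → ℝ) → ℂ := fun u => ⟨u 0, u 1⟩
  have hg : Continuous g := by
    have : g = fun u => (u 0 : ℂ) + (u 1 : ℂ) * Complex.I := by
      funext u; apply Complex.ext <;> simp [g]
    rw [this]; fun_prop
  have hginj : Function.Injective g := fun u u' h => by
    funext i
    fin_cases i
    exacts [congrArg Complex.re h, congrArg Complex.im h]
  classical
  refine not_injective_sphere_plane (f := fun w => if hw : w ∈ S then g (F ⟨w, hw⟩) else 0) ?_ ?_
  · rw [continuousOn_iff_continuous_domRestrict]
    have : Set.domRestrict (Metric.sphere (0 : EuclideanSpace ℝ (Fin 3)) 1)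
        (fun w => if hw : w ∈ S then g (F ⟨w, hw⟩) else 0) = fun w => g (F w) := by
      funext w
      exact dif_pos w.2
    rw [this]
    exact hg.comp hF
  · intro w hw w' hw' h
    simp only [dif_pos (show w ∈ S from hw), dif_pos (show w' ∈ S from hw')] at h
    exact congrArg Subtype.val (hFinj (hginj h))

end Sphere

/-! ### The components of representations with regular generators -/

namespace SU3

/-- The projection to the `l i`-eigenspace of a matrix with spectrum `l`, as a polynomial in the
matrix. -/
noncomputable def eigenProj (l : Fin 3 → ℂ) (i : Fin 3) (X : Mat) : Mat :=
  ((l i - l (i + 1)) * (l i - l (i + 2)))⁻¹ • ((X - l (i + 1) • 1) * (X - l (i + 2) • 1))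

lemma continuous_eigenProj (l : Fin 3 → ℂ) (i : Fin 3) : Continuous (eigenProj l i) := by
  unfold eigenProj; fun_prop

lemma coe_one_conj (Y : SU 3) : ((1⁻¹ * Y * 1 : SU 3) : Mat) = Y := by
  rw [inv_one, one_mul, mul_one]

lemma conj_mul_conj (k : SU 3) (A B : Mat) : ((k : Mat) * A * (k : Mat).conjTranspose) *
    ((k : Mat) * B * (k : Mat).conjTranspose) = (k : Mat) * (A * B) * (k : Mat).conjTranspose := by
  calc _ = (k : Mat) * A * ((k : Mat).conjTranspose * (k : Mat)) * B * (k : Mat).conjTranspose := by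
        simp only [Matrix.mul_assoc]
    _ = _ := by rw [SU_conjTranspose_mul]; simp only [Matrix.mul_assoc, Matrix.one_mul]

lemma eigenProj_conj (l : Fin 3 → ℂ) (i : Fin 3) (k : SU 3) (X : Mat) :
    eigenProj l i ((k : Mat) * X * (k : Mat).conjTranspose) =
      (k : Mat) * eigenProj l i X * (k : Mat).conjTranspose := by
  have h1 : ∀ t : ℂ, (k : Mat) * X * (k : Mat).conjTranspose - t • 1 =
      (k : Mat) * (X - t • 1) * (k : Mat).conjTranspose := fun t => by
    rw [Matrix.mul_sub, Matrix.sub_mul, Matrix.mul_smul, Matrix.smul_mul, Matrix.mul_one,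
      SU_mul_conjTranspose]
  rw [eigenProj, eigenProj, h1, h1, conj_mul_conj, Matrix.mul_smul, Matrix.smul_mul]

lemma eigenProj_diagonal {l : Fin 3 → ℂ} (hl : Function.Injective l) (i : Fin 3) :
    eigenProj l i (Matrix.diagonal l) = Matrix.diagonal (Pi.single i 1) := by
  have hne : ∀ i j : Fin 3, i ≠ j → l i - l j ≠ 0 := fun i j hij => sub_ne_zero.2 (hl.ne hij)
  rw [eigenProj, Matrix.smul_one_eq_diagonal, Matrix.smul_one_eq_diagonal, Matrix.diagonal_sub,
    Matrix.diagonal_sub, Matrix.diagonal_mul_diagonal, ← Matrix.diagonal_smul]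
  congr 1
  funext j
  have key : ∀ i j : Fin 3, j = i ∨ j = i + 1 ∨ j = i + 2 := by decide
  have d1 : ∀ i : Fin 3, i ≠ i + 1 := by decide
  have d2 : ∀ i : Fin 3, i ≠ i + 2 := by decide
  rcases key i j with rfl | rfl | rfl
  · simp only [Pi.smul_apply, smul_eq_mul, Pi.single_eq_same]
    exact inv_mul_cancel₀ (mul_ne_zero (hne _ _ (d1 _)) (hne _ _ (d2 _)))
  · simp
  · simp

lemma trace_eigenProj_mul {l : Fin 3 → ℂ} (hl : IsSpectrum l) (hinj : Function.Injective l)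
    (g Y : SU 3) (i : Fin 3) :
    (eigenProj l i ((g * hl.toSU * g⁻¹ : SU 3) : Mat) * (Y : Mat)).trace =
      diag ((g⁻¹ * Y * g : SU 3) : Mat) i := by
  rw [coe_conj, eigenProj_conj, hl.coe_toSU, eigenProj_diagonal hinj, Matrix.mul_assoc,
    Matrix.mul_assoc, Matrix.trace_mul_comm, Matrix.mul_assoc]
  have h1 : (g : Mat).conjTranspose * (Y : Mat) * (g : Mat) = ((g⁻¹ * Y * g : SU 3) : Mat) := rfl
  rw [h1, Matrix.trace, Finset.sum_eq_single i]
  · simp [diag]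
  · intro j _ hj
    simp [hj]
  · simp

/-- The squared moduli of the entries of `Y` in an eigenbasis of `X` are polynomial functions of
`X`, `Y` and `Y*`. -/
lemma trace_eigenProj_mul_mul {l : Fin 3 → ℂ} (hl : IsSpectrum l) (hinj : Function.Injective l)
    (g Y : SU 3) (i j : Fin 3) :
    (eigenProj l i ((g * hl.toSU * g⁻¹ : SU 3) : Mat) * (Y : Mat) *
      (eigenProj l j ((g * hl.toSU * g⁻¹ : SU 3) : Mat) * (Y : Mat).conjTranspose)).trace =
      (Complex.normSq (((g⁻¹ * Y * g : SU 3) : Mat) i j) : ℂ) := by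
  rw [coe_conj, eigenProj_conj, eigenProj_conj, hl.coe_toSU, eigenProj_diagonal hinj,
    eigenProj_diagonal hinj]
  have h1 : ((g⁻¹ * Y * g : SU 3) : Mat) = (g : Mat).conjTranspose * (Y : Mat) * (g : Mat) := rfl
  set E := Matrix.diagonal (Pi.single i (1 : ℂ))
  set F := Matrix.diagonal (Pi.single j (1 : ℂ))
  set M := ((g⁻¹ * Y * g : SU 3) : Mat)
  have h2 : M.conjTranspose = (g : Mat).conjTranspose * (Y : Mat).conjTranspose * (g : Mat) := by
    rw [h1]
    simp [Matrix.conjTranspose_mul, Matrix.mul_assoc]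
  have h3 : ((g : Mat) * E * (g : Mat).conjTranspose * (Y : Mat) *
      ((g : Mat) * F * (g : Mat).conjTranspose * (Y : Mat).conjTranspose)).trace =
      (E * M * (F * M.conjTranspose)).trace := by
    rw [h2, h1]
    simp only [Matrix.mul_assoc]
    rw [Matrix.trace_mul_comm]
    simp only [Matrix.mul_assoc]
  rw [h3, Matrix.trace, Finset.sum_eq_single i]
  · rw [Matrix.diag_apply, Matrix.mul_apply, Finset.sum_eq_single j]
    · simp [E, F, Complex.mul_conj]
    · intro k _ hk
      simp [E, F, hk]
    · simp
  · intro k _ hk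
    simp only [Matrix.diag_apply, Matrix.mul_apply (M := E * M)]
    exact Finset.sum_eq_zero fun m _ => by simp [E, hk]
  · simp

/-- The parameter of the diagonal of `Y` on the slice through `v`, and the chirality of `Y`,
relative to an eigenbasis of `X`. -/
noncomputable def sliceCoord (l v : Fin 3 → ℂ) (X Y : Mat) : ℂ × ℝ :=
  (((eigenProj l 0 X * Y).trace - v 0) / specDir l 0,
    (eigenProj l 0 X * Y * (eigenProj l 1 X * Y.conjTranspose)).trace.re -
      (eigenProj l 1 X * Y * (eigenProj l 0 X * Y.conjTranspose)).trace.re)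

lemma sliceCoord_conj (l v : Fin 3 → ℂ) (k X Y : SU 3) :
    sliceCoord l v ((k * X * k⁻¹ : SU 3) : Mat) ((k * Y * k⁻¹ : SU 3) : Mat) =
      sliceCoord l v X Y := by
  have h0 := SU_conjTranspose_mul k
  have h2 : ∀ A : Mat, ((k : Mat) * A * (k : Mat).conjTranspose).trace = A.trace := fun A => by
    rw [Matrix.trace_mul_comm, ← Matrix.mul_assoc, h0, Matrix.one_mul]
  have h3 : ((k : Mat) * (Y : Mat) * (k : Mat).conjTranspose).conjTranspose =
      (k : Mat) * (Y : Mat).conjTranspose * (k : Mat).conjTranspose := by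
    simp [Matrix.conjTranspose_mul, Matrix.mul_assoc]
  simp only [sliceCoord, coe_conj, eigenProj_conj, conj_mul_conj, h2, h3]

lemma continuous_sliceCoord (l v : Fin 3 → ℂ) :
    Continuous fun p : Mat × Mat => sliceCoord l v p.1 p.2 := by
  have h := fun i => (continuous_eigenProj l i).comp (continuous_fst (X := Mat) (Y := Mat))
  simp only [Function.comp_def] at h
  have h0 := h 0
  have h1 := h 1
  have hs : Continuous fun p : Mat × Mat => p.2 := continuous_snd
  refine Continuous.prodMk ?_ ?_
  · exact (((h0.mul hs).matrix_trace).sub continuous_const).div_const _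
  · exact (Complex.continuous_re.comp
      (((h0.mul hs).mul (h1.mul hs.matrix_conjTranspose)).matrix_trace)).sub
      (Complex.continuous_re.comp
      (((h1.mul hs).mul (h0.mul hs.matrix_conjTranspose)).matrix_trace))

lemma sliceCoord_eq {l : Fin 3 → ℂ} (hl : IsSpectrum l) (hinj : Function.Injective l)
    (v : Fin 3 → ℂ) (g Y : SU 3) :
    sliceCoord l v ((g * hl.toSU * g⁻¹ : SU 3) : Mat) Y =
      ((diag ((g⁻¹ * Y * g : SU 3) : Mat) 0 - v 0) / specDir l 0,
        chirality ((g⁻¹ * Y * g : SU 3) : Mat)) := by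
  rw [sliceCoord, trace_eigenProj_mul hl hinj, trace_eigenProj_mul_mul hl hinj,
    trace_eigenProj_mul_mul hl hinj, Complex.ofReal_re, Complex.ofReal_re]
  rfl

end SU3

section

variable {π : Type} [Group π]

/-- The coordinates `SU3.sliceCoord` of the images of `x` and `y`, as functions on the
representation variety. -/
noncomputable def sliceMap (l v : Fin 3 → ℂ) (x y : π) : RepVariety π → ℂ × ℝ :=
  Quotient.lift (fun α : π →* SU 3 => sliceCoord l v (α x) (α y)) fun α β h => by
    obtain ⟨k, hk⟩ := h
    rw [hk, hk, sliceCoord_conj]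

lemma sliceMap_repClass (l v : Fin 3 → ℂ) (x y : π) (α : π →* SU 3) :
    sliceMap l v x y (repClass α) = sliceCoord l v (α x) (α y) := rfl

lemma continuous_sliceMap (l v : Fin 3 → ℂ) (x y : π) : Continuous (sliceMap l v x y) :=
  ((continuous_sliceCoord l v).comp
    ((continuous_eval_coe x).prodMk (continuous_eval_coe y))).quotient_lift _

end

lemma HasDoubleRoot.conj {s : ℂ} (h : HasDoubleRoot s) : HasDoubleRoot (conj s) := by
  obtain ⟨κ, h1, h2⟩ := h
  have hκ : κ ≠ 0 := by
    rintro rfl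
    simp at h1
  refine ⟨κ⁻¹, ?_, ?_⟩
  · rw [Complex.conj_conj]
    field_simp
    linear_combination -h1
  · rw [Complex.conj_conj]
    field_simp
    linear_combination κ * h2 - 3 * h1

namespace IsBrieskornGroup

variable {p q r : ℕ} {a c : ℤ} {π : Type} [Group π] {x y z h : π} {α : π →* SU 3}
  {l : Fin 3 → ℂ}

/-- Every matrix whose diagonal lies on the slice is the image of `y` under a representation with
the same traces and the same image of `x`. -/
lemma exists_of_mem_sliceRegion (B : IsBrieskornGroup p q r a c x y z h) (hl : IsSpectrum l)
    (hx : α x = hl.toSU) (hh : (α h : Mat).trace ≠ -1) {u : ℂ} {δ : ℝ}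
    (hu : u ∈ sliceRegion (diag (α y)) (specDir l))
    (hδ : δ ^ 2 = disc (slicePt (diag (α y)) (specDir l) u)) :
    ∃ β : π →* SU 3, SameTraces x y z h α β ∧ β x = hl.toSU ∧
      diag (β y) = slicePt (diag (α y)) (specDir l) u ∧ chirality (β y) = δ := by
  obtain ⟨Y, hY, hYc⟩ := exists_of_isDiagonal hu hδ
  have htr : (Y : Mat).trace = (α y : Mat).trace := by
    rw [trace_eq_sum_diag Y 1, trace_eq_sum_diag (α y) 1, coe_one_conj, coe_one_conj, hY, sum_slicePt]
  have htr' : ((hl.toSU * Y : SU 3) : Mat).trace = ((α x * α y : SU 3) : Mat).trace := by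
    have h1 := trace_mul_eq_sum_diag hl Y 1
    have h2 := trace_mul_eq_sum_diag hl (α y) 1
    rw [coe_one_conj, one_mul, inv_one, mul_one] at h1 h2
    rw [hx, h1, h2, hY, sum_mul_slicePt]
  obtain ⟨k, hk⟩ := isConj_iff.1 (isConj_of_trace_eq htr.symm)
  obtain ⟨m, hm⟩ := isConj_iff.1 (isConj_of_trace_eq htr'.symm)
  have hcen := fun g => (Subgroup.mem_center_iff.1 (mem_center_of_smul (B.map_h_eq_smul hh)) g).symm
  have hpow : ∀ (g : SU 3) (n : ℤ), g * α h ^ n * g⁻¹ = α h ^ n := fun g n => by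
    have := (show Commute (α h) g from hcen g).zpow_left n
    rw [← this.eq, mul_inv_cancel_right]
  have hz : (hl.toSU * Y)⁻¹ = m * α z * m⁻¹ := by
    rw [← hm, B.z_eq, map_inv, map_mul]; group
  obtain ⟨β, h1, h2, h3, h4⟩ := B.lift hl.toSU Y (hl.toSU * Y)⁻¹ (α h)
    (by rw [← hx, ← map_pow, B.x_pow, map_zpow])
    (by rw [← hk, conj_pow, ← map_pow, B.y_pow, map_zpow, hpow])
    (by rw [hz, conj_pow, ← map_pow, B.z_pow, map_zpow, hpow])
    (by group) (hcen _) (hcen _) (hcen _)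
  exact ⟨β, ⟨by rw [h1, hx], by rw [h2, htr], by rw [h3, hz, trace_conj], by rw [h4]⟩, h1,
    by rw [h2, hY], by rw [h2, hYc]⟩

lemma isRegularSlice (B : IsBrieskornGroup p q r a c x y z h) (hl : IsSpectrum l)
    (hx : α x = hl.toSU) (hh : (α h : Mat).trace ≠ -1) (hdx : ¬ HasDoubleRoot (α x : Mat).trace)
    (hdy : ¬ HasDoubleRoot (α y : Mat).trace) (hdz : ¬ HasDoubleRoot (α z : Mat).trace) :
    IsRegularSlice l (diag (α y)) := by
  have hinj : Function.Injective l := by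
    by_contra hinj
    rw [hx, trace_toSU, hasDoubleRoot_iff hl] at hdx
    exact hdx hinj
  have e1 : ∑ i, diag (α y : Mat) i = (α y : Mat).trace := by
    rw [trace_eq_sum_diag (α y) 1, coe_one_conj]
  have e2 : ∑ i, l i * diag (α y : Mat) i = conj (α z : Mat).trace := by
    rw [← B.trace_mul, hx]
    have h2 := trace_mul_eq_sum_diag hl (α y) 1
    rw [coe_one_conj, one_mul, inv_one, mul_one] at h2
    exact h2.symm
  refine { conj_mul := hl.conj_mul, prod := hl.prod, injective := hinj
           not_hasDoubleRoot := by rwa [e1]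
           not_hasDoubleRoot' := fun h1 => hdz ?_
           eq_one := fun u hu j hj => ?_ }
  · rw [e2] at h1
    simpa using h1.conj
  · obtain ⟨β, hs, hβx, hβy, -⟩ := B.exists_of_mem_sliceRegion hl hx hh hu
      (Real.sq_sqrt hu.1)
    -- the basis vector `e j` is an eigenvector of the image of this representation
    let e : Fin 3 → ℂ := Pi.single j 1
    have he : e ≠ 0 := fun h0 => by
      have := congrFun h0 j
      simp [e] at this
    have hex : (β x : Mat).mulVec e = l j • e := by
      rw [hβx, hl.coe_toSU]
      funext i
      rcases eq_or_ne i j with rfl | hij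
      · simp [e]
      · simp [e, hij]
    have hey : (β y : Mat).mulVec e = diag (β y) j • e := by
      rw [Matrix.mulVec_single_one]
      funext i
      rcases eq_or_ne i j with rfl | hij
      · simp [e, diag]
      · rw [← hβy] at hj
        simpa [e, hij] using (entries_eq_zero (β y) hj hij).2
    have hhβ : (β h : Mat).trace ≠ -1 := by rwa [← hs.h]
    have hfix := B.hasFixedVector_of_eigenvector he ⟨_, hex⟩ ⟨_, hey⟩
      ⟨_, by rw [B.map_h_eq_smul hhβ, Matrix.smul_mulVec, Matrix.one_mulVec]⟩
    have key : ∀ t : ℂ, t • e = e → t = 1 := fun t ht => by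
      have := congrFun ht j
      simpa [e] using this
    exact ⟨key _ (hex.symm.trans (hfix x)), by rw [← hβy]; exact key _ (hey.symm.trans (hfix y))⟩

/-- The diagonals realized by the representations with the same traces as `α`. -/
lemma exists_of_sameTraces (B : IsBrieskornGroup p q r a c x y z h) (hl : IsSpectrum l)
    (hinj : Function.Injective l) (hx : α x = hl.toSU) {β : π →* SU 3}
    (hs : SameTraces x y z h α β) :
    ∃ g : SU 3, β x = g * hl.toSU * g⁻¹ ∧
      diag ((g⁻¹ * β y * g : SU 3) : Mat) =
        slicePt (diag (α y)) (specDir l) (sliceMap l (diag (α y)) x y (repClass β)).1 ∧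
      chirality ((g⁻¹ * β y * g : SU 3) : Mat) =
        (sliceMap l (diag (α y)) x y (repClass β)).2 := by
  obtain ⟨g, hg⟩ := exists_eq_conj_of_trace hl (X := β x) (by rw [← hs.x, hx, trace_toSU])
  have e1 : ∑ i, diag ((g⁻¹ * β y * g : SU 3) : Mat) i = ∑ i, diag (α y : Mat) i := by
    rw [← trace_eq_sum_diag, ← hs.y, trace_eq_sum_diag (α y) 1, coe_one_conj]
  have e2 : ∑ i, l i * diag ((g⁻¹ * β y * g : SU 3) : Mat) i = ∑ i, l i * diag (α y : Mat) i := by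
    have h2 := trace_mul_eq_sum_diag hl (α y) 1
    rw [coe_one_conj, one_mul, inv_one, mul_one] at h2
    rw [← trace_mul_eq_sum_diag hl, ← hg, ← h2, ← hx, B.trace_mul, B.trace_mul, hs.z]
  refine ⟨g, hg, ?_, ?_⟩
  · rw [sliceMap_repClass, hg, sliceCoord_eq hl hinj]
    exact (IsRegularSpectrum.mk hl.conj_mul hl.prod hinj).eq_slicePt e1 e2
  · rw [sliceMap_repClass, hg, sliceCoord_eq hl hinj]

lemma injOn_sliceMap (B : IsBrieskornGroup p q r a c x y z h) (hl : IsSpectrum l)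
    (hinj : Function.Injective l) (hx : α x = hl.toSU) :
    Set.InjOn (sliceMap l (diag (α y)) x y) (traceLevel x y z h α) := by
  intro ξ hξ η hη heq
  obtain ⟨β, rfl⟩ := repClass_surjective ξ
  obtain ⟨γ, rfl⟩ := repClass_surjective η
  obtain ⟨g, hg, hgd, hgc⟩ := B.exists_of_sameTraces hl hinj hx (mem_traceLevel.1 hξ)
  obtain ⟨m, hm, hmd, hmc⟩ := B.exists_of_sameTraces hl hinj hx (mem_traceLevel.1 hη)
  obtain ⟨k, hk, hk'⟩ := exists_conj_pair hl (hgd.trans ((by rw [heq]) : _ = _) |>.trans hmd.symm)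
    (hgc.trans ((by rw [heq]) : _ = _) |>.trans hmc.symm)
  exact B.repClass_eq (by rw [hg, hm, hk]) hk'

lemma image_sliceMap (B : IsBrieskornGroup p q r a c x y z h) (hl : IsSpectrum l)
    (hinj : Function.Injective l) (hx : α x = hl.toSU) (hh : (α h : Mat).trace ≠ -1) :
    sliceMap l (diag (α y)) x y '' traceLevel x y z h α =
      {w | w.1 ∈ sliceRegion (diag (α y)) (specDir l) ∧
        w.2 ^ 2 = disc (slicePt (diag (α y)) (specDir l) w.1)} := by
  ext w
  constructor
  · rintro ⟨ξ, hξ, rfl⟩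
    obtain ⟨β, rfl⟩ := repClass_surjective ξ
    obtain ⟨g, hg, hgd, hgc⟩ := B.exists_of_sameTraces hl hinj hx (mem_traceLevel.1 hξ)
    refine ⟨?_, ?_⟩
    · show IsDiagonal _
      rw [← hgd]
      exact isDiagonal_diag _
    · rw [← hgd, ← hgc, chirality_sq]
  · rintro ⟨hu, hδ⟩
    obtain ⟨β, hs, hβx, hβy, hβc⟩ := B.exists_of_mem_sliceRegion hl hx hh hu hδ
    refine ⟨repClass β, mem_traceLevel.2 hs, ?_⟩
    have hβx' : β x = 1 * hl.toSU * 1⁻¹ := by rw [hβx]; group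
    have hw := (IsRegularSpectrum.mk hl.conj_mul hl.prod hinj).specDir_ne_zero 0
    rw [sliceMap_repClass, hβx', sliceCoord_eq hl hinj, coe_one_conj, hβy, hβc]
    refine Prod.ext ?_ rfl
    show (diag (α y) 0 + w.1 * specDir l 0 - diag (α y) 0) / specDir l 0 = w.1
    field_simp
    ring

/-- The classes with the traces of a representation whose generators `x, y, z` have simple spectrum
and whose `h` is not of trace `-1` form a disjoint union of clopen 2-spheres: the coordinates
`sliceMap` identify this set with the double of a plane region along its boundary. -/
theorem exists_sphere_of_eq_toSU (B : IsBrieskornGroup p q r a c x y z h) (hl : IsSpectrum l)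
    (hx : α x = hl.toSU) (hh : (α h : Mat).trace ≠ -1) (hdx : ¬ HasDoubleRoot (α x : Mat).trace)
    (hdy : ¬ HasDoubleRoot (α y : Mat).trace) (hdz : ¬ HasDoubleRoot (α z : Mat).trace) :
    ∃ C ⊆ traceLevel x y z h α, repClass α ∈ C ∧ IsClopen C ∧ IsTwoSphere C := by
  have hslice := B.isRegularSlice hl hx hh hdx hdy hdz
  have hinj := hslice.injective
  have himage := B.image_sliceMap hl hinj hx hh
  have hinjOn := B.injOn_sliceMap (z := z) (h := h) hl hinj hx
  have hcont := continuous_sliceMap l (diag (α y)) x y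
  set v := diag (α y : Mat)
  set w := specDir l
  obtain ⟨O, t, P⟩ := hslice.exists_pencilData
  have hself : repClass α ∈ traceLevel x y z h α := mem_traceLevel.2 (SameTraces.refl α)
  obtain ⟨u₀, hu₀⟩ : ∃ u₀, u₀ = (sliceMap l v x y (repClass α)).1 := ⟨_, rfl⟩
  have hu₀mem : u₀ ∈ sliceRegion v w := by
    have : sliceMap l v x y (repClass α) ∈ sliceMap l v x y '' traceLevel x y z h α :=
      ⟨_, hself, rfl⟩
    rw [himage] at this
    rw [hu₀]
    exact this.1
  have hne : u₀ - O ≠ 0 := fun h => P.notMem (sub_eq_zero.1 h ▸ hu₀mem)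
  have hR := P.isRadialRegion hu₀mem
  obtain ⟨⟨f, hf, hbij⟩, hnear⟩ := hR.double_bijOn_sphere
  set G : ℂ → ℝ := fun s => disc (slicePt v w (O + s * (u₀ - O)))
  set Ω : Set ℂ := {s : ℂ | O + s * (u₀ - O) ∈ sliceRegion v w}
  -- the coordinate centred at `O`
  let Ψ : RepVariety π → ℂ × ℝ := fun ξ =>
    (((sliceMap l v x y ξ).1 - O) / (u₀ - O), (sliceMap l v x y ξ).2)
  have hΨ : Continuous Ψ := by
    refine Continuous.prodMk ?_ (continuous_snd.comp hcont)
    exact ((continuous_fst.comp hcont).sub continuous_const).div_const _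
  have hΨ1 : ∀ ξ, O + (Ψ ξ).1 * (u₀ - O) = (sliceMap l v x y ξ).1 := fun ξ => by
    show O + ((sliceMap l v x y ξ).1 - O) / (u₀ - O) * (u₀ - O) = _
    rw [div_mul_cancel₀ _ hne]; ring
  have hΨinj : Set.InjOn Ψ (traceLevel x y z h α) := fun ξ hξ η hη heq => by
    refine hinjOn hξ hη (Prod.ext ?_ (congrArg (fun w : ℂ × ℝ => w.2) heq :))
    rw [← hΨ1, ← hΨ1, heq]
  have hΨΩ : ∀ ξ ∈ traceLevel x y z h α, (Ψ ξ).1 ∈ Ω := fun ξ hξ => by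
    show O + (Ψ ξ).1 * (u₀ - O) ∈ sliceRegion v w
    have : sliceMap l v x y ξ ∈ sliceMap l v x y '' traceLevel x y z h α := ⟨_, hξ, rfl⟩
    rw [himage] at this
    rw [hΨ1]
    exact this.1
  have hΨG : ∀ ξ ∈ traceLevel x y z h α, (Ψ ξ).2 ^ 2 = G (Ψ ξ).1 := fun ξ hξ => by
    show _ = disc (slicePt v w (O + (Ψ ξ).1 * (u₀ - O)))
    have : sliceMap l v x y ξ ∈ sliceMap l v x y '' traceLevel x y z h α := ⟨_, hξ, rfl⟩
    rw [himage] at this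
    rw [hΨ1]
    exact this.2
  have hbaseΩ : IsRadialRegion.base Ω ⊆ Ω := IsRadialRegion.base_subset
  set C : Set (RepVariety π) := {ξ | ξ ∈ traceLevel x y z h α ∧ (Ψ ξ).1 ∈ IsRadialRegion.base Ω}
  have hK := B.isClopen_traceLevel α
  have hbase : IsClosed (IsRadialRegion.base Ω) :=
    (isCompact_connectedComponentIn hR.isCompact hR.isCompact.isClosed 1).isClosed
  have hclosed : IsClosed C := hK.1.inter (hbase.preimage (continuous_fst.comp hΨ))
  have hopen : IsOpen C := by
    rw [isOpen_iff_mem_nhds]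
    rintro ξ ⟨h1, h2⟩
    filter_upwards [hK.2.mem_nhds h1, (continuous_fst.comp hΨ).continuousAt.eventually (hnear _ h2)]
      with η h3 h4
    exact ⟨h3, h4 (hΨΩ η h3)⟩
  have hmaps : Set.MapsTo Ψ C (IsRadialRegion.double G Ω) := fun ξ hξ => ⟨hξ.2, hΨG ξ hξ.1⟩
  have hsurj : Set.SurjOn Ψ C (IsRadialRegion.double G Ω) := by
    rintro ⟨s, δ⟩ ⟨h1, h2⟩
    have h3 : (O + s * (u₀ - O), δ) ∈ sliceMap l v x y '' traceLevel x y z h α := by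
      rw [himage]
      exact ⟨hbaseΩ h1, h2⟩
    obtain ⟨ξ, hξ, he⟩ := h3
    have he1 : Ψ ξ = (s, δ) := by
      refine Prod.ext ?_ (congrArg (fun w : ℂ × ℝ => w.2) he :)
      show ((sliceMap l v x y ξ).1 - O) / (u₀ - O) = s
      rw [he]
      field_simp
      ring
    exact ⟨ξ, ⟨hξ, by rw [he1]; exact h1⟩, he1⟩
  have hbij' : Set.BijOn (f ∘ Ψ) C (Metric.sphere 0 1) :=
    hbij.comp ⟨hmaps, hΨinj.mono fun ξ hξ => hξ.1, hsurj⟩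
  have hcontOn : ContinuousOn (f ∘ Ψ) C := hf.comp hΨ.continuousOn hmaps
  have hcompact : CompactSpace C := isCompact_iff_compactSpace.1 hclosed.isCompact
  refine ⟨C, fun ξ hξ => hξ.1, ⟨hself, ?_⟩, ⟨hclosed, hopen⟩, ?_⟩
  · have : (Ψ (repClass α)).1 = 1 := by
      show ((sliceMap l v x y (repClass α)).1 - O) / (u₀ - O) = 1
      rw [← hu₀, div_self hne]
    rw [this]
    exact mem_connectedComponentIn hR.one_mem
  · let e : C ≃ Metric.sphere (0 : EuclideanSpace ℝ (Fin 3)) 1 := hbij'.equiv _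
    have he : Continuous e := by
      refine Continuous.subtype_mk ?_ _
      exact continuousOn_iff_continuous_domRestrict.1 hcontOn
    exact ⟨he.homeoOfEquivCompactToT2⟩

end IsBrieskornGroup

/-! ### The classification -/

lemma IsTwoSphere.not_isOpen_singleton {X : Type} [TopologicalSpace X] {C : Set X}
    (hC : IsTwoSphere C) {ξ : X} (hξ : ξ ∈ C) : ¬ IsOpen ({ξ} : Set X) := by
  intro hopen
  obtain ⟨η, hη, hne⟩ := hC.exists_ne ξ
  have hconn : PathConnectedSpace C := isPathConnected_iff_pathConnectedSpace.1 hC.isPathConnected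
  obtain ⟨e⟩ := hC
  have ht2 : T2Space C := e.isEmbedding.t2Space
  have h1 : IsClopen ({⟨ξ, hξ⟩} : Set C) := by
    refine ⟨isClosed_singleton, ?_⟩
    have : ({⟨ξ, hξ⟩} : Set C) = Subtype.val ⁻¹' ({ξ} : Set X) := by
      ext a; simp [Subtype.ext_iff]
    rw [this]
    exact hopen.preimage continuous_subtype_val
  have h2 : (⟨η, hη⟩ : C) ∈ ({⟨ξ, hξ⟩} : Set C) := by
    rw [h1.eq_univ ⟨_, rfl⟩]; trivial
  exact hne (congrArg Subtype.val h2)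

namespace IsBrieskornGroup

variable {p q r : ℕ} {a c : ℤ} {π : Type} [Group π] {x y z h : π} {α : π →* SU 3}

theorem exists_sphere (B : IsBrieskornGroup p q r a c x y z h)
    (hh : (α h : Mat).trace ≠ -1) (hdx : ¬ HasDoubleRoot (α x : Mat).trace)
    (hdy : ¬ HasDoubleRoot (α y : Mat).trace) (hdz : ¬ HasDoubleRoot (α z : Mat).trace) :
    ∃ C ⊆ traceLevel x y z h α, repClass α ∈ C ∧ IsClopen C ∧ IsTwoSphere C := by
  obtain ⟨l, hl, g, hg⟩ := exists_eq_conj (α x)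
  let α' : π →* SU 3 := (MulAut.conj g⁻¹).toMonoidHom.comp α
  have hα' : repClass α = repClass α' := repClass_eq_iff.2 ⟨g⁻¹, fun γ => rfl⟩
  have htr := trace_eq_of_repClass_eq hα'
  have hx : α' x = hl.toSU := by
    show g⁻¹ * α x * g⁻¹⁻¹ = _
    rw [hg]; group
  rw [htr] at hh hdx hdy hdz
  have := B.exists_sphere_of_eq_toSU hl hx hh hdx hdy hdz
  rwa [← hα', show traceLevel x y z h α' = traceLevel x y z h α by
    rw [traceLevel, traceLevel, hα']] at this

lemma ne_one_of_repClass {ρ : π →* SU 2} {β : π →* SU 3} (h1 : β ≠ 1)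
    (hρ : repClass (inclSU2.comp ρ) = repClass β) : ρ ≠ 1 := by
  rintro rfl
  exact h1 (eq_one_of_repClass_eq (by rw [← hρ]; congr 1; ext1; simp))

/-- A representation with `tr α(h) = -1` is reducible and isolated. -/
lemma isTypeIb_of_trace (B : IsBrieskornGroup p q r a c x y z h) (ht : (α h : Mat).trace = -1) :
    IsTypeIb h (pathComponent (repClass α)) := by
  have hred : ∀ β : π →* SU 3, (β h : Mat).trace = -1 → HasFixedVector β := fun β hβ =>
    B.not_isIrred_iff.1 fun h1 => B.isIrred_trace_h_ne h1 hβ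
  have hlevel : traceLevel x y z h α = {repClass α} := by
    ext ξ
    obtain ⟨β, rfl⟩ := repClass_surjective ξ
    rw [mem_traceLevel, Set.mem_singleton_iff]
    constructor
    · intro hs
      exact (B.repClass_eq_of_hasFixedVector hs (hred α ht) (hred β (hs.h ▸ ht))).symm
    · intro he
      exact SameTraces.of_repClass_eq he.symm
  have hclopen := B.isClopen_traceLevel α
  rw [hlevel] at hclopen
  have h1 : α ≠ 1 := by
    rintro rfl
    rw [MonoidHom.one_apply, trace_one] at ht
    norm_num at ht
  rw [pathComponent_eq_singleton hclopen]
  refine ⟨α, rfl, hclopen.2, B.not_isIrred_iff.2 (hred α ht), (hred α ht).exists_repClass_inclSU2,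
    fun hh => ?_, fun _ => ⟨ht, fun ρ hρ => ?_⟩⟩
  · rw [hh, trace_one] at ht
    norm_num at ht
  · have hρh : (ρ h : Matrix (Fin 2) (Fin 2) ℂ) = -1 := by
      refine (B.map_h_eq (ne_one_of_repClass h1 hρ)).resolve_left fun h2 => ?_
      rw [← trace_eq_of_repClass_eq hρ, MonoidHom.comp_apply, trace_inclSU2, h2] at ht
      norm_num at ht
    exact ⟨hρh, B.subsingleton_H1C2 hρh⟩

lemma traceLevel_one (B : IsBrieskornGroup p q r a c x y z h) :
    traceLevel x y z h (1 : π →* SU 3) = {repClass 1} := by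
  ext ξ
  obtain ⟨β, rfl⟩ := repClass_surjective ξ
  rw [mem_traceLevel, Set.mem_singleton_iff]
  constructor
  · intro hs
    rw [B.eq_one_of_sameTraces hs.symm]
  · intro he
    exact SameTraces.of_repClass_eq he.symm

lemma hasFixedVector_one : HasFixedVector (1 : π →* SU 3) :=
  ⟨fun _ => 1, fun h0 => one_ne_zero (congrFun h0 0), fun γ => by simp⟩

lemma isClopen_singleton_one (B : IsBrieskornGroup p q r a c x y z h) :
    IsClopen ({repClass 1} : Set (RepVariety π)) := by
  rw [← B.traceLevel_one]
  exact B.isClopen_traceLevel 1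

lemma isTypeIb_one (B : IsBrieskornGroup p q r a c x y z h) :
    IsTypeIb h (pathComponent (repClass (1 : π →* SU 3))) := by
  rw [pathComponent_eq_singleton B.isClopen_singleton_one]
  exact ⟨1, rfl, B.isClopen_singleton_one.2, B.not_isIrred_iff.2 hasFixedVector_one,
    hasFixedVector_one.exists_repClass_inclSU2, fun _ => rfl, fun h1 => absurd rfl h1⟩

lemma isTypeIa_of_double (B : IsBrieskornGroup p q r a c x y z h)
    (ht : (α h : Mat).trace ≠ -1) (hα : IsIrred α)
    (hd : (HasDoubleRoot (α x : Mat).trace ∧ ¬ HasDoubleRoot (α y : Mat).trace ∧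
        ¬ HasDoubleRoot (α z : Mat).trace) ∨
      (HasDoubleRoot (α y : Mat).trace ∧ ¬ HasDoubleRoot (α x : Mat).trace ∧
        ¬ HasDoubleRoot (α z : Mat).trace) ∨
      (HasDoubleRoot (α z : Mat).trace ∧ ¬ HasDoubleRoot (α x : Mat).trace ∧
        ¬ HasDoubleRoot (α y : Mat).trace)) :
    IsTypeIa x y z h (pathComponent (repClass α)) := by
  have hlevel : traceLevel x y z h α = {repClass α} := by
    ext ξ
    obtain ⟨β, rfl⟩ := repClass_surjective ξ
    rw [mem_traceLevel, Set.mem_singleton_iff]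
    constructor
    · intro hs
      refine (B.repClass_eq_of_double hs ?_).symm
      rcases hd with ⟨d1, d2, -⟩ | ⟨d1, d2, -⟩ | ⟨d1, d2, -⟩
      exacts [Or.inl ⟨d1, d2⟩, Or.inr (Or.inl ⟨d1, d2⟩), Or.inr (Or.inr ⟨d1, d2⟩)]
    · intro he
      exact SameTraces.of_repClass_eq he.symm
  have hclopen := B.isClopen_traceLevel α
  rw [hlevel] at hclopen
  rw [pathComponent_eq_singleton hclopen]
  refine ⟨α, rfl, hclopen.2, hα, ?_, mem_center_of_smul (B.map_h_eq_smul ht),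
    B.subsingleton_H1su3 hα hd⟩
  have key : ∀ i : Fin 3, HasRepeatedEigenvalue (α (![x, y, z] i)) ↔
      HasDoubleRoot (α (![x, y, z] i) : Mat).trace := fun i => hasRepeatedEigenvalue_iff_trace _
  simp only [key]
  rcases hd with ⟨d1, d2, d3⟩ | ⟨d1, d2, d3⟩ | ⟨d1, d2, d3⟩
  · refine ⟨0, d1, fun i hi => ?_⟩
    fin_cases i
    exacts [rfl, absurd hi d2, absurd hi d3]
  · refine ⟨1, d1, fun i hi => ?_⟩
    fin_cases i
    exacts [absurd hi d2, rfl, absurd hi d3]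
  · refine ⟨2, d1, fun i hi => ?_⟩
    fin_cases i
    exacts [absurd hi d2, absurd hi d3, rfl]

/-- Irreducible classes on a sphere of classes with regular generators are smooth points. -/
lemma isSmoothPoint_of_sphere (B : IsBrieskornGroup p q r a c x y z h) {C : Set (RepVariety π)}
    (hC : IsTwoSphere C) (hopen : IsOpen C) {α : π →* SU 3} (hmem : repClass α ∈ C)
    (hα : IsIrred α) (hdx : ¬ HasDoubleRoot (α x : Mat).trace)
    (hdy : ¬ HasDoubleRoot (α y : Mat).trace) (hdz : ¬ HasDoubleRoot (α z : Mat).trace) :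
    IsSmoothPoint α ∧ Nonempty (H1su3 α ≃ₗ[ℝ] (Fin 2 → ℝ)) := by
  have h1 := B.finrank_H1su3_of_regular hα hdx hdy hdz
  exact ⟨⟨2, h1, hC.exists_nhd hopen hmem⟩, h1⟩

lemma isTypeII_of_regular (B : IsBrieskornGroup p q r a c x y z h)
    (hh : (α h : Mat).trace ≠ -1) (hdx : ¬ HasDoubleRoot (α x : Mat).trace)
    (hdy : ¬ HasDoubleRoot (α y : Mat).trace) (hdz : ¬ HasDoubleRoot (α z : Mat).trace) :
    IsTypeIIa x y z h (pathComponent (repClass α)) ∨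
      IsTypeIIb x y z h (pathComponent (repClass α)) := by
  obtain ⟨C, hsub, hmem, hclopen, hC⟩ := B.exists_sphere hh hdx hdy hdz
  rw [hC.pathComponent_eq hclopen hmem]
  have hs : ∀ β : π →* SU 3, repClass β ∈ C → SameTraces x y z h α β := fun β hβ =>
    mem_traceLevel.1 (hsub hβ)
  have hβx : ∀ β : π →* SU 3, repClass β ∈ C → ¬ HasDoubleRoot (β x : Mat).trace := fun β hβ =>
    (hs β hβ).x ▸ hdx
  have hβy : ∀ β : π →* SU 3, repClass β ∈ C → ¬ HasDoubleRoot (β y : Mat).trace := fun β hβ =>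
    (hs β hβ).y ▸ hdy
  have hβz : ∀ β : π →* SU 3, repClass β ∈ C → ¬ HasDoubleRoot (β z : Mat).trace := fun β hβ =>
    (hs β hβ).z ▸ hdz
  have hβh : ∀ β : π →* SU 3, repClass β ∈ C → β h = α h := fun β hβ =>
    (B.map_h_eq_map_h (hs β hβ) hh).symm
  by_cases hred : ∃ β : π →* SU 3, repClass β ∈ C ∧ ¬ IsIrred β
  · right
    obtain ⟨β, hβC, hβ⟩ := hred
    have hfix := B.not_isIrred_iff.1 hβ
    have hβ1 : β ≠ 1 := by
      rintro rfl
      refine hβx 1 hβC ?_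
      rw [MonoidHom.one_apply, trace_one]
      exact hasDoubleRoot_three
    have hβh1 : β h = 1 := (B.of_hasFixedVector hfix hβ1).1.resolve_right (by
      rwa [← (hs β hβC).h])
    obtain ⟨hfin, hrank⟩ := B.finrank_H1su3_of_hasFixedVector hfix hβ1 hβh1
    refine ⟨hC, ⟨β, hβC, hβ, fun γ hγ hγ' => ?_, ?_, nonempty_linearEquiv hrank,
      hfix.exists_repClass_inclSU2, fun ρ hρ => ?_, fun γ hγ hne => ?_⟩, fun γ hγ => ?_⟩
    · exact B.repClass_eq_of_hasFixedVector ((hs γ hγ).symm.trans (hs β hβC))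
        (B.not_isIrred_iff.1 hγ') hfix
    · rintro ⟨n, ⟨e⟩, U, -, hβU, ⟨φ⟩⟩
      have hn : n = 4 := by
        have := e.finrank_eq
        rw [hrank, Module.finrank_fin_fun] at this
        exact this.symm
      subst hn
      exact (hC.not_homeomorph hclopen.2 hβC hβU).false φ
    · have hρ1 := ne_one_of_repClass hβ1 hρ
      have hρh : ρ h = 1 := by
        apply inclSU2_injective
        rw [map_one]
        apply eq_one_of_trace
        have := trace_eq_of_repClass_eq hρ h
        rw [hβh1, trace_one] at this
        exact this
      obtain ⟨h3, h4⟩ := B.finrank_H1C2 hρ1 hρh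
      exact ⟨B.inclH1_bijective hρ1 hρh, nonempty_linearEquiv h4⟩
    · have hγ' : IsIrred γ := by
        by_contra hcon
        exact hne (B.repClass_eq_of_hasFixedVector ((hs γ hγ).symm.trans (hs β hβC))
          (B.not_isIrred_iff.1 hcon) hfix)
      exact ⟨hγ', B.isSmoothPoint_of_sphere hC hclopen.2 hγ hγ' (hβx γ hγ) (hβy γ hγ) (hβz γ hγ)⟩
    · exact ⟨by rw [hβh γ hγ, ← hβh β hβC, hβh1],
        (hasThreeDistinctEigenvalues_iff_trace _).2 (hβx γ hγ),
        (hasThreeDistinctEigenvalues_iff_trace _).2 (hβy γ hγ),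
        (hasThreeDistinctEigenvalues_iff_trace _).2 (hβz γ hγ)⟩
  · left
    push Not at hred
    refine ⟨hC, fun γ hγ => ?_, α h, mem_center_of_smul (B.map_h_eq_smul hh), hβh⟩
    obtain ⟨h1, h2⟩ := B.isSmoothPoint_of_sphere hC hclopen.2 hγ (hred γ hγ) (hβx γ hγ) (hβy γ hγ)
      (hβz γ hγ)
    exact ⟨h1, hred γ hγ, (hasThreeDistinctEigenvalues_iff_trace _).2 (hβx γ hγ),
        (hasThreeDistinctEigenvalues_iff_trace _).2 (hβy γ hγ),
        (hasThreeDistinctEigenvalues_iff_trace _).2 (hβz γ hγ), h2⟩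

lemma exists_hasType (B : IsBrieskornGroup p q r a c x y z h) (α : π →* SU 3) :
    ∃ t, HasType x y z h (pathComponent (repClass α)) t := by
  by_cases ht : (α h : Mat).trace = -1
  · exact ⟨.Ib, B.isTypeIb_of_trace ht⟩
  by_cases h1 : α = 1
  · rw [h1]; exact ⟨.Ib, B.isTypeIb_one⟩
  by_cases hreg : ¬ HasDoubleRoot (α x : Mat).trace ∧ ¬ HasDoubleRoot (α y : Mat).trace ∧
      ¬ HasDoubleRoot (α z : Mat).trace
  · rcases B.isTypeII_of_regular ht hreg.1 hreg.2.1 hreg.2.2 with h2 | h2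
    exacts [⟨.IIa, h2⟩, ⟨.IIb, h2⟩]
  · have hα : IsIrred α := by
      by_contra hα
      exact hreg (B.of_hasFixedVector (B.not_isIrred_iff.1 hα) h1).2
    have htwo := fun h2 =>
      B.not_isIrred_iff.2 (B.hasFixedVector_of_common_eigenvector ht h2) hα
    refine ⟨.Ia, B.isTypeIa_of_double ht hα ?_⟩
    tauto

lemma hasType_unique (B : IsBrieskornGroup p q r a c x y z h) {C : Set (RepVariety π)}
    {t t' : ComponentType} (h1 : HasType x y z h C t) (h2 : HasType x y z h C t') : t = t' := by
  have hsing : ∀ ξ, C = {ξ} → ¬ IsTwoSphere C := by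
    rintro ξ rfl hC
    obtain ⟨η, hη, hne⟩ := hC.exists_ne ξ
    exact hne hη
  have e1 : IsTypeIa x y z h C → ¬ IsTwoSphere C := fun ⟨α, hα, _⟩ => hsing _ hα
  have e2 : IsTypeIb h C → ¬ IsTwoSphere C := fun ⟨β, hβ, _⟩ => hsing _ hβ
  have e3 : IsTypeIa x y z h C → ¬ IsTypeIb h C := by
    rintro ⟨α, hα, -, hirr, -⟩ ⟨β, hβ, -, hred, -⟩
    exact hred (B.isIrred_of_repClass_eq (Set.singleton_injective (hα.symm.trans hβ)) hirr)
  have e4 : IsTypeIIa x y z h C → ¬ IsTypeIIb x y z h C := by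
    rintro h1 ⟨-, ⟨β, hβ, hred, -⟩, -⟩
    exact hred (h1.2.1 β hβ).2.1
  cases t <;> cases t'
  exacts [rfl, absurd h2.1 (e1 h1), absurd h2 (e3 h1), absurd h2.1 (e1 h1),
    absurd h1.1 (e1 h2), rfl, absurd h1.1 (e2 h2), absurd h2 (e4 h1),
    absurd h1 (e3 h2), absurd h2.1 (e2 h1), rfl, absurd h2.1 (e2 h1),
    absurd h1.1 (e1 h2), absurd h1 (e4 h2), absurd h1.1 (e2 h2), rfl]

lemma isolated_reducible (B : IsBrieskornGroup p q r a c x y z h) (β : π →* SU 3) :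
    (IsOpen {repClass β} ∧ ¬ IsIrred β ∧ β h = 1) ↔ β = 1 := by
  constructor
  · rintro ⟨hopen, hred, hh⟩
    by_contra h1
    obtain ⟨-, hx, hy, hz⟩ := B.of_hasFixedVector (B.not_isIrred_iff.1 hred) h1
    obtain ⟨C, -, hmem, -, hC⟩ := B.exists_sphere (by rw [hh, trace_one]; norm_num) hx hy hz
    exact hC.not_isOpen_singleton hmem hopen
  · rintro rfl
    exact ⟨B.isClopen_singleton_one.2, B.not_isIrred_iff.2 hasFixedVector_one, rfl⟩

theorem componentClassification (B : IsBrieskornGroup p q r a c x y z h) :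
    ComponentClassification x y z h where
  exactly_one_type ξ := by
    obtain ⟨α, rfl⟩ := repClass_surjective ξ
    obtain ⟨t, ht⟩ := B.exists_hasType α
    exact ⟨t, ht, fun t' ht' => B.hasType_unique ht' ht⟩
  constant α β hj := by
    have hs := B.sameTraces_of_joined hj
    exact ⟨isConj_of_trace_eq hs.x, isConj_of_trace_eq hs.y, isConj_of_trace_eq hs.z,
      isConj_of_trace_eq hs.h⟩
  isolated_reducible := B.isolated_reducible

end IsBrieskornGroup

/-- The classification of the path components of `R(Σ(p,q,r), SU(3))`: it holds for the presented
group, and so for the fundamental group of the space `Σ(p,q,r)` with respect to the elements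
`x, y, z, h` of any presentation of it of this form. -/
theorem theorem2p6 (p q r : ℕ) (hp : 0 < p) (hq : 0 < q) (hr : 0 < r)
    (hpq : Nat.Coprime p q) (hpr : Nat.Coprime p r) (hqr : Nat.Coprime q r)
    (hpo : Odd p) (hqo : Odd q)
    (a c : ℤ) (hac : a * r * (p + q) + c * p * q = 1) :
    ComponentClassification
      (brieskornGen p q r a c .x) (brieskornGen p q r a c .y)
      (brieskornGen p q r a c .z) (brieskornGen p q r a c .h) ∧
    ∀ (s : BrieskornSphere p q r)
      (e : BrieskornGroup p q r a c ≃* FundamentalGroup (BrieskornSphere p q r) s),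
      ComponentClassification
        (e (brieskornGen p q r a c .x)) (e (brieskornGen p q r a c .y))
        (e (brieskornGen p q r a c .z)) (e (brieskornGen p q r a c .h)) := by
  have B := IsBrieskornGroup.brieskornGroup hp hq hr hpq hpr hqr hac
  exact ⟨B.componentClassification, fun s e => (B.map e).componentClassification⟩
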